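/- Let $R$ be a commutative ring and let $L$ be an oriented link in $S^3$ with components $K_1,\dots,K_m$ and with weights $w_1,\dots,w_m\in R$ such that $w_c-w_d$ is invertible whenever $c\ne d$. Let $D$ be a diagram of $L$ with crossings ordered $1,\dots,n$, with $n_+$ positive and $n_-$ negative ones. For $I\in\{0,1\}^n$ let $p(I)$ be the number of circles $x_1,\dots,x_{p(I)}$ of the resolution $I$ of $D$, put $V(I)=R[x_1,\dots,x_{p(I)}]/(x_1^2,\dots,x_{p(I)}^2)$ and $C(D)=\bigoplus_I V(I)$. For resolutions $I,J$ that differ in exactly one position, $\mathcal A(I,J):V(I)\to V(J)$ is the map induced by the saddle cobordism, for the Frobenius algebra $R[x]/(x^2)$ with $\Delta(1)=1\otimes x+x\otimes 1$ and $\Delta(x)=x\otimes x$. A sign assignment is a choice of $s(i)\in\{\pm1\}$ for each crossing such that, for every edge of the diagram from a crossing $i$ to a crossing $j$, $s(i)s(j)=-1$ if the edge is the upper strand at both ends or the lower strand at both ends, and $s(i)s(j)=1$ otherwise. Let $C(D,w)$ be $C(D)$ with $$d=\sum_{(I,J)}(-1)^{n(I,J)}\bigl(\mathcal A(I,J)+s(i)\,(w^i_{\mathrm{over}}-w^i_{\mathrm{under}})\,\mathcal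 A(J,I)\bigr),$$ where the sum runs over all pairs such that $J$ arises from $I$ by changing the $i$-th digit from $0$ to $1$, $n(I,J)=\#\{k<i: I(k)=1\}$, and $w^i_{\mathrm{over}}$, $w^i_{\mathrm{under}}$ are the weights of the components of the upper and lower strand at $i$. For a monomial $x\in V(I)$ of polynomial degree $e$ put $q(x)=|I|+n_+-2n_-+p(I)-2e$ and $g(x)=(q(x)-m)/2\in\mathbb Z$, and let $\mathcal F^pC$ be the span of the monomials with $g\le p$. With $Z_r^p=\{x\in\mathcal F^p: dx\in\mathcal F^{p-r}\}$ and $B_r^p=\{dy\in\mathcal F^p: y\in\mathcal F^{p+r}\}$, the pages of the associated spectral sequence are $E_r^p(L,w)=Z_r^p/(Z_{r-1}^{p-1}+B_{r-1}^p)$, with $d_r:E_r^p\to E_r^{p-r}$, $d_r[x]=[dx]$, for $r\ge1$. Write $E_k=E_\infty$ if $d_r=0$ for all $r\ge k$. Then, for every diagram $D$ of $L$ with an ordering of its crossings and every sign assignment $s$, one has $d^2=0$, and $E_k(L,w)=E_\infty(L,w)$ for all sufficiently large $k$. Let $b(L,w)$ be the largest $k\ge1$ with $E_k(L,w)\ne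 E_\infty(L,w)$, and $b(L,w)=0$ if there is no such $k$. Then $$b(L,w)\le \operatorname{sp}(L),$$ where the splitting number $\operatorname{sp}(L)$ is the minimum, over all diagrams of $L$, of the number of crossing changes between different components that produce a diagram of a completely split link (a link that has a diagram without crossings between different components). -/

import Mathlib

/-! ### Link diagrams

An oriented link diagram is recorded by its signed Gauss code.  Points are placed on the circles of
the link: every passage through a crossing is a point, and there may be further points away from
the crossings (so that a circle without crossings carries at least one point).  The arc `a` runs
from the previous point to a point which is denoted by `a` as well, and the following arc is
`next a`.  At the crossing `x` the upper strand comes in along `upper x` and leaves along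
`next (upper x)`; likewise for `lower x`. -/

/-- The signed Gauss code of an oriented link diagram, not necessarily planar. The crossings are
ordered, as elements of `Fin crossings`. -/
structure GaussDiagram where
  arcs : ℕ
  crossings : ℕ
  next : Equiv.Perm (Fin arcs)
  upper : Fin crossings → Fin arcs
  lower : Fin crossings → Fin arcs
  /-- `true` for a positive crossing, `false` for a negative one -/
  pos : Fin crossings → Bool
  passages_injective : Function.Injective (Sum.elim upper lower)

namespace GaussDiagram

/-- The point `a` is not a passage through a crossing. -/
def IsPlain (D : GaussDiagram) (a : Fin D.arcs) : Prop :=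
  ∀ x, D.upper x ≠ a ∧ D.lower x ≠ a

/-- The components of the link. -/
def Component (D : GaussDiagram) : Type :=
  Quot fun a b : Fin D.arcs => D.next a = b

/-- The component that contains an arc. -/
def comp (D : GaussDiagram) (a : Fin D.arcs) : D.Component := Quot.mk _ a

/-- A crossing between two different components of the link. -/
def IsMixed (D : GaussDiagram) (x : Fin D.crossings) : Prop :=
  D.comp (D.upper x) ≠ D.comp (D.lower x)

/-- The connected components of the underlying 4-valent graph of the diagram. -/
def ShadowComponent (D : GaussDiagram) : Type :=
  Quot fun a b : Fin D.arcs => D.next a = b ∨ ∃ x, D.upper x = a ∧ D.lower x = b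

/-- `(a, true)` is the arc `a` traversed forwards and `(a, false)` is `a` traversed backwards.
`D.FaceStep e f` says that `f` comes after `e` on the boundary of the region to the left of `e`,
that is, that one gets from `e` to `f` by turning left. At a positive crossing the lower strand
crosses the upper strand from right to left, at a negative crossing from left to right. -/
inductive FaceStep (D : GaussDiagram) : Fin D.arcs × Bool → Fin D.arcs × Bool → Prop
  | plain_fwd (a) (h : D.IsPlain a) : FaceStep D (a, true) (D.next a, true)
  | plain_bwd (a) (h : D.IsPlain a) : FaceStep D (D.next a, false) (a, false)
  | pos_upper_fwd (x) (h : D.pos x = true) :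
      FaceStep D (D.upper x, true) (D.next (D.lower x), true)
  | pos_lower_fwd (x) (h : D.pos x = true) :
      FaceStep D (D.lower x, true) (D.upper x, false)
  | pos_upper_bwd (x) (h : D.pos x = true) :
      FaceStep D (D.next (D.upper x), false) (D.lower x, false)
  | pos_lower_bwd (x) (h : D.pos x = true) :
      FaceStep D (D.next (D.lower x), false) (D.next (D.upper x), true)
  | neg_upper_fwd (x) (h : D.pos x = false) :
      FaceStep D (D.upper x, true) (D.lower x, false)
  | neg_lower_fwd (x) (h : D.pos x = false) :
      FaceStep D (D.lower x, true) (D.next (D.upper x), true)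
  | neg_upper_bwd (x) (h : D.pos x = false) :
      FaceStep D (D.next (D.upper x), false) (D.next (D.lower x), true)
  | neg_lower_bwd (x) (h : D.pos x = false) :
      FaceStep D (D.next (D.lower x), false) (D.upper x, false)

/-- The faces: boundary cycles of the regions, for each connected piece of the shadow separately. -/
def Face (D : GaussDiagram) : Type := Quot D.FaceStep

/-- The diagram is planar: every connected piece of its shadow lies on a sphere. There are
`arcs - crossings` vertices and `arcs` edges, so Euler's formula reads `F - crossings = 2 c`. The
position of the connected pieces relative to each other is not recorded: it does not affect the
link. -/
def IsPlanar (D : GaussDiagram) : Prop :=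
  Nat.card D.Face = D.crossings + 2 * Nat.card D.ShadowComponent

/-- Change the crossings in `S`: interchange upper and lower strand. -/
def change (D : GaussDiagram) (S : Finset (Fin D.crossings)) : GaussDiagram where
  arcs := D.arcs
  crossings := D.crossings
  next := D.next
  upper x := if x ∈ S then D.lower x else D.upper x
  lower x := if x ∈ S then D.upper x else D.lower x
  pos x := if x ∈ S then !D.pos x else D.pos x
  passages_injective := by
    have key : ∀ u v, Sum.elim D.upper D.lower u = Sum.elim D.upper D.lower v → u = v :=
      fun u v h => D.passages_injective h
    rintro (x | x) (y | y) h <;> simp only [Sum.elim_inl, Sum.elim_inr] at h <;>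
      split_ifs at h with h1 h2 h2
    · simpa using key (Sum.inr x) (Sum.inr y) h
    · simpa using key (Sum.inr x) (Sum.inl y) h
    · simpa using key (Sum.inl x) (Sum.inr y) h
    · simpa using key (Sum.inl x) (Sum.inl y) h
    · have := key (Sum.inr x) (Sum.inl y) h; simp at this
    · have := key (Sum.inr x) (Sum.inr y) h; simp only [Sum.inr.injEq] at this
      subst this; contradiction
    · have := key (Sum.inl x) (Sum.inl y) h; simp only [Sum.inl.injEq] at this
      subst this; contradiction
    · have := key (Sum.inl x) (Sum.inr y) h; simp at this
    · have := key (Sum.inl x) (Sum.inr y) h; simp at this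
    · have := key (Sum.inl x) (Sum.inl y) h; simp only [Sum.inl.injEq] at this
      subst this; contradiction
    · have := key (Sum.inr x) (Sum.inr y) h; simp only [Sum.inr.injEq] at this
      subst this; contradiction
    · have := key (Sum.inr x) (Sum.inl y) h; simp at this
    · simpa using key (Sum.inl x) (Sum.inl y) h
    · simpa using key (Sum.inl x) (Sum.inr y) h
    · simpa using key (Sum.inr x) (Sum.inl y) h
    · simpa using key (Sum.inr x) (Sum.inr y) h

theorem change_mem (D : GaussDiagram) (S : Finset (Fin D.crossings)) {x : Fin D.crossings}
    (hx : x ∈ S) : (D.change S).upper x = D.lower x ∧ (D.change S).lower x = D.upper x ∧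
      (D.change S).pos x = !D.pos x :=
  ⟨if_pos hx, if_pos hx, if_pos hx⟩

theorem change_notMem (D : GaussDiagram) (S : Finset (Fin D.crossings)) {x : Fin D.crossings}
    (hx : x ∉ S) : (D.change S).upper x = D.upper x ∧ (D.change S).lower x = D.lower x ∧
      (D.change S).pos x = D.pos x :=
  ⟨if_neg hx, if_neg hx, if_neg hx⟩

theorem isPlain_change (D : GaussDiagram) (S : Finset (Fin D.crossings)) (a : Fin D.arcs) :
    (D.change S).IsPlain a ↔ D.IsPlain a := by
  refine forall_congr' fun x => ?_
  by_cases hx : x ∈ S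
  · have k := D.change_mem S hx
    rw [k.1, k.2.1]; exact and_comm
  · have k := D.change_notMem S hx
    rw [k.1, k.2.1]; exact Iff.rfl

theorem faceStep_to_change (D : GaussDiagram) (S : Finset (Fin D.crossings))
    (e f : Fin D.arcs × Bool) (h : D.FaceStep e f) : (D.change S).FaceStep e f := by
  cases h with
  | plain_fwd a h => exact .plain_fwd (D := D.change S) a ((D.isPlain_change S a).2 h)
  | plain_bwd a h => exact .plain_bwd (D := D.change S) a ((D.isPlain_change S a).2 h)
  | pos_upper_fwd x h =>
    by_cases hx : x ∈ S
    · have k := D.change_mem S hx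
      have := FaceStep.neg_lower_fwd (D := D.change S) x (by rw [k.2.2, h]; rfl)
      rw [k.1, k.2.1] at this; exact this
    · have k := D.change_notMem S hx
      have := FaceStep.pos_upper_fwd (D := D.change S) x (by rw [k.2.2, h])
      rw [k.1, k.2.1] at this; exact this
  | pos_lower_fwd x h =>
    by_cases hx : x ∈ S
    · have k := D.change_mem S hx
      have := FaceStep.neg_upper_fwd (D := D.change S) x (by rw [k.2.2, h]; rfl)
      rw [k.1, k.2.1] at this; exact this
    · have k := D.change_notMem S hx
      have := FaceStep.pos_lower_fwd (D := D.change S) x (by rw [k.2.2, h])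
      rw [k.1, k.2.1] at this; exact this
  | pos_upper_bwd x h =>
    by_cases hx : x ∈ S
    · have k := D.change_mem S hx
      have := FaceStep.neg_lower_bwd (D := D.change S) x (by rw [k.2.2, h]; rfl)
      rw [k.1, k.2.1] at this; exact this
    · have k := D.change_notMem S hx
      have := FaceStep.pos_upper_bwd (D := D.change S) x (by rw [k.2.2, h])
      rw [k.1, k.2.1] at this; exact this
  | pos_lower_bwd x h =>
    by_cases hx : x ∈ S
    · have k := D.change_mem S hx
      have := FaceStep.neg_upper_bwd (D := D.change S) x (by rw [k.2.2, h]; rfl)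
      rw [k.1, k.2.1] at this; exact this
    · have k := D.change_notMem S hx
      have := FaceStep.pos_lower_bwd (D := D.change S) x (by rw [k.2.2, h])
      rw [k.1, k.2.1] at this; exact this
  | neg_upper_fwd x h =>
    by_cases hx : x ∈ S
    · have k := D.change_mem S hx
      have := FaceStep.pos_lower_fwd (D := D.change S) x (by rw [k.2.2, h]; rfl)
      rw [k.1, k.2.1] at this; exact this
    · have k := D.change_notMem S hx
      have := FaceStep.neg_upper_fwd (D := D.change S) x (by rw [k.2.2, h])
      rw [k.1, k.2.1] at this; exact this
  | neg_lower_fwd x h =>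
    by_cases hx : x ∈ S
    · have k := D.change_mem S hx
      have := FaceStep.pos_upper_fwd (D := D.change S) x (by rw [k.2.2, h]; rfl)
      rw [k.1, k.2.1] at this; exact this
    · have k := D.change_notMem S hx
      have := FaceStep.neg_lower_fwd (D := D.change S) x (by rw [k.2.2, h])
      rw [k.1, k.2.1] at this; exact this
  | neg_upper_bwd x h =>
    by_cases hx : x ∈ S
    · have k := D.change_mem S hx
      have := FaceStep.pos_lower_bwd (D := D.change S) x (by rw [k.2.2, h]; rfl)
      rw [k.1, k.2.1] at this; exact this
    · have k := D.change_notMem S hx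
      have := FaceStep.neg_upper_bwd (D := D.change S) x (by rw [k.2.2, h])
      rw [k.1, k.2.1] at this; exact this
  | neg_lower_bwd x h =>
    by_cases hx : x ∈ S
    · have k := D.change_mem S hx
      have := FaceStep.pos_upper_bwd (D := D.change S) x (by rw [k.2.2, h]; rfl)
      rw [k.1, k.2.1] at this; exact this
    · have k := D.change_notMem S hx
      have := FaceStep.neg_lower_bwd (D := D.change S) x (by rw [k.2.2, h])
      rw [k.1, k.2.1] at this; exact this

theorem faceStep_of_change (D : GaussDiagram) (S : Finset (Fin D.crossings))
    (e f : Fin (D.change S).arcs × Bool) (h : (D.change S).FaceStep e f) : D.FaceStep e f := by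
  cases h with
  | plain_fwd a h => exact .plain_fwd (D := D) a ((D.isPlain_change S a).1 h)
  | plain_bwd a h => exact .plain_bwd (D := D) a ((D.isPlain_change S a).1 h)
  | pos_upper_fwd x h =>
    by_cases hx : x ∈ S
    · have k := D.change_mem S hx
      rw [k.2.2] at h; rw [k.1, k.2.1]
      exact FaceStep.neg_lower_fwd (D := D) x (by simpa using h)
    · have k := D.change_notMem S hx
      rw [k.2.2] at h; rw [k.1, k.2.1]
      exact FaceStep.pos_upper_fwd (D := D) x h
  | pos_lower_fwd x h =>
    by_cases hx : x ∈ S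
    · have k := D.change_mem S hx
      rw [k.2.2] at h; rw [k.1, k.2.1]
      exact FaceStep.neg_upper_fwd (D := D) x (by simpa using h)
    · have k := D.change_notMem S hx
      rw [k.2.2] at h; rw [k.1, k.2.1]
      exact FaceStep.pos_lower_fwd (D := D) x h
  | pos_upper_bwd x h =>
    by_cases hx : x ∈ S
    · have k := D.change_mem S hx
      rw [k.2.2] at h; rw [k.1, k.2.1]
      exact FaceStep.neg_lower_bwd (D := D) x (by simpa using h)
    · have k := D.change_notMem S hx
      rw [k.2.2] at h; rw [k.1, k.2.1]
      exact FaceStep.pos_upper_bwd (D := D) x h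
  | pos_lower_bwd x h =>
    by_cases hx : x ∈ S
    · have k := D.change_mem S hx
      rw [k.2.2] at h; rw [k.1, k.2.1]
      exact FaceStep.neg_upper_bwd (D := D) x (by simpa using h)
    · have k := D.change_notMem S hx
      rw [k.2.2] at h; rw [k.1, k.2.1]
      exact FaceStep.pos_lower_bwd (D := D) x h
  | neg_upper_fwd x h =>
    by_cases hx : x ∈ S
    · have k := D.change_mem S hx
      rw [k.2.2] at h; rw [k.1, k.2.1]
      exact FaceStep.pos_lower_fwd (D := D) x (by simpa using h)
    · have k := D.change_notMem S hx
      rw [k.2.2] at h; rw [k.1, k.2.1]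
      exact FaceStep.neg_upper_fwd (D := D) x h
  | neg_lower_fwd x h =>
    by_cases hx : x ∈ S
    · have k := D.change_mem S hx
      rw [k.2.2] at h; rw [k.1, k.2.1]
      exact FaceStep.pos_upper_fwd (D := D) x (by simpa using h)
    · have k := D.change_notMem S hx
      rw [k.2.2] at h; rw [k.1, k.2.1]
      exact FaceStep.neg_lower_fwd (D := D) x h
  | neg_upper_bwd x h =>
    by_cases hx : x ∈ S
    · have k := D.change_mem S hx
      rw [k.2.2] at h; rw [k.1, k.2.1]
      exact FaceStep.pos_lower_bwd (D := D) x (by simpa using h)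
    · have k := D.change_notMem S hx
      rw [k.2.2] at h; rw [k.1, k.2.1]
      exact FaceStep.neg_upper_bwd (D := D) x h
  | neg_lower_bwd x h =>
    by_cases hx : x ∈ S
    · have k := D.change_mem S hx
      rw [k.2.2] at h; rw [k.1, k.2.1]
      exact FaceStep.pos_upper_bwd (D := D) x (by simpa using h)
    · have k := D.change_notMem S hx
      rw [k.2.2] at h; rw [k.1, k.2.1]
      exact FaceStep.neg_lower_bwd (D := D) x h

theorem shadow_change (D : GaussDiagram) (S : Finset (Fin D.crossings)) (a b : Fin D.arcs) :
    (Quot.mk _ a : (D.change S).ShadowComponent) = Quot.mk _ b ↔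
      (Quot.mk _ a : D.ShadowComponent) = Quot.mk _ b := by
  constructor
  · intro h
    have := congrArg (Quot.lift (fun c : Fin (D.change S).arcs => (Quot.mk _ c : D.ShadowComponent))
      (by
        rintro a b (h | ⟨x, rfl, rfl⟩)
        · exact Quot.sound (Or.inl h)
        · by_cases hx : x ∈ S
          · have k := D.change_mem S hx
            rw [k.1, k.2.1]
            have h' : (Quot.mk _ (D.upper x) : D.ShadowComponent) = Quot.mk _ (D.lower x) :=
              Quot.sound (Or.inr ⟨x, rfl, rfl⟩)
            exact h'.symm
          · have k := D.change_notMem S hx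
            rw [k.1, k.2.1]
            exact Quot.sound (Or.inr ⟨x, rfl, rfl⟩))) h
    exact this
  · intro h
    have := congrArg (Quot.lift (fun c : Fin D.arcs => (Quot.mk _ c : (D.change S).ShadowComponent))
      (by
        rintro a b (h | ⟨x, rfl, rfl⟩)
        · exact Quot.sound (Or.inl h)
        · by_cases hx : x ∈ S
          · have k := D.change_mem S hx
            rw [← k.1, ← k.2.1]
            have h' : (Quot.mk _ ((D.change S).upper x) : (D.change S).ShadowComponent) =
                Quot.mk _ ((D.change S).lower x) := Quot.sound (Or.inr ⟨x, rfl, rfl⟩)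
            exact h'.symm
          · have k := D.change_notMem S hx
            rw [← k.1, ← k.2.1]
            exact Quot.sound (Or.inr ⟨x, rfl, rfl⟩))) h
    exact this

theorem IsPlanar.change {D : GaussDiagram} (hD : D.IsPlanar) (S : Finset (Fin D.crossings)) :
    (D.change S).IsPlanar := by
  have hF : Nat.card (D.change S).Face = Nat.card D.Face :=
    Nat.card_congr (Quot.congrRight fun e f =>
      ⟨D.faceStep_of_change S e f, D.faceStep_to_change S e f⟩)
  have hS : Nat.card (D.change S).ShadowComponent = Nat.card D.ShadowComponent := by
    refine Nat.card_eq_of_bijective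
      (Quot.lift (fun c : Fin (D.change S).arcs => (Quot.mk _ c : D.ShadowComponent))
        fun a b h => (D.shadow_change S a b).1 (Quot.sound h)) ⟨?_, ?_⟩
    · rintro ⟨a⟩ ⟨b⟩ h
      exact (D.shadow_change S a b).2 h
    · rintro ⟨a⟩
      exact ⟨Quot.mk _ a, rfl⟩
  unfold IsPlanar at hD ⊢
  rw [hF, hS, hD]
  rfl

/-! ### Reidemeister moves -/

/-- `D'` is, up to relabelling, `D` with additional crossings indexed by `ι` (placed at points of
`D` which were not on a crossing before). -/
structure Extension (ι : Type) (D D' : GaussDiagram) where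
  arc : Fin D.arcs ≃ Fin D'.arcs
  cr : Fin D.crossings ⊕ ι ≃ Fin D'.crossings
  next_arc : ∀ a, D'.next (arc a) = arc (D.next a)
  upper_cr : ∀ x, D'.upper (cr (Sum.inl x)) = arc (D.upper x)
  lower_cr : ∀ x, D'.lower (cr (Sum.inl x)) = arc (D.lower x)
  pos_cr : ∀ x, D'.pos (cr (Sum.inl x)) = D.pos x

/-- `D'` is `D` with the arcs and the crossings relabelled. -/
def Relabel (D D' : GaussDiagram) : Prop := Nonempty (Extension Empty D D')

/-- `D'` is `D` with one more point, not on a crossing, in the interior of some arc `a`. -/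
def Subdivision (D D' : GaussDiagram) : Prop :=
  ∃ (arc : Option (Fin D.arcs) ≃ Fin D'.arcs) (cr : Fin D.crossings ≃ Fin D'.crossings)
    (a : Fin D.arcs),
    (∀ b, D'.next (arc b) = arc (Equiv.swap none (some a) (b.map D.next))) ∧
    ∀ x, D'.upper (cr x) = arc (some (D.upper x)) ∧ D'.lower (cr x) = arc (some (D.lower x)) ∧
      D'.pos (cr x) = D.pos x

/-- First Reidemeister move: `D'` is `D` with a kink. -/
def R1 (D D' : GaussDiagram) : Prop :=
  ∃ (f : Extension Unit D D') (p : Fin D.arcs),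
    let x := f.cr (Sum.inr ())
    (D'.upper x = f.arc p ∧ D'.lower x = f.arc (D.next p)) ∨
    (D'.lower x = f.arc p ∧ D'.upper x = f.arc (D.next p))

/-- Second Reidemeister move: in `D'` the strand at `p` has been pushed over the strand at `q`,
parallel or antiparallel to it. (For planar `D` and `D'` the two new crossings bound a bigon.) -/
def R2 (D D' : GaussDiagram) : Prop :=
  ∃ (f : Extension Bool D D') (p q : Fin D.arcs),
    let x := f.cr (Sum.inr false)
    let y := f.cr (Sum.inr true)
    D'.pos x ≠ D'.pos y ∧ D'.upper x = f.arc p ∧ D'.upper y = f.arc (D.next p) ∧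
    ((D'.lower x = f.arc q ∧ D'.lower y = f.arc (D.next q)) ∨
     (D'.lower y = f.arc q ∧ D'.lower x = f.arc (D.next q)))

/-- The arcs `a`, `b`, `c` bound a triangular face of the diagram. -/
def IsTriangle (D : GaussDiagram) (a b c : Fin D.arcs) : Prop :=
  ∃ i j k : Bool,
    (D.FaceStep (a, i) (b, j) ∧ D.FaceStep (b, j) (c, k) ∧ D.FaceStep (c, k) (a, i)) ∨
    (D.FaceStep (a, i) (c, k) ∧ D.FaceStep (c, k) (b, j) ∧ D.FaceStep (b, j) (a, i))

/-- Third Reidemeister move. The top, middle and bottom strand pass through the two points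
`t, next t`, through `m, next m` and through `b, next b`; the crossings are `x` (top over middle),
`y` (top over bottom) and `z` (middle over bottom), and the sides `next t`, `next m`, `next b` bound
a triangular face. The move reverses the order of the two crossings on each of the strands. -/
def R3 (D D' : GaussDiagram) : Prop :=
  ∃ (arc : Fin D.arcs ≃ Fin D'.arcs) (cr : Fin D.crossings ≃ Fin D'.crossings)
    (x y z : Fin D.crossings) (t m b : Fin D.arcs),
    x ≠ y ∧ x ≠ z ∧ y ≠ z ∧
    ({t, D.next t} : Set (Fin D.arcs)) = {D.upper x, D.upper y} ∧
    ({m, D.next m} : Set (Fin D.arcs)) = {D.lower x, D.upper z} ∧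
    ({b, D.next b} : Set (Fin D.arcs)) = {D.lower y, D.lower z} ∧
    D.IsTriangle (D.next t) (D.next m) (D.next b) ∧
    (∀ a, D'.next (arc a) = arc (D.next a)) ∧
    let τ : Equiv.Perm (Fin D.arcs) :=
      Equiv.swap t (D.next t) * Equiv.swap m (D.next m) * Equiv.swap b (D.next b)
    ∀ v, D'.upper (cr v) = arc (τ (D.upper v)) ∧ D'.lower (cr v) = arc (τ (D.lower v)) ∧
      D'.pos (cr v) = D.pos v

/-- An elementary step between diagrams of the same link. -/
def Move (D D' : GaussDiagram) : Prop :=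
  Relabel D D' ∨ Subdivision D D' ∨ R1 D D' ∨ R2 D D' ∨ R3 D D'

end GaussDiagram

/-- Planar oriented link diagrams. -/
structure LinkDiagram extends GaussDiagram where
  planar : toGaussDiagram.IsPlanar

/-- Oriented links (up to isotopy): planar diagrams modulo the equivalence relation generated by the
Reidemeister moves. -/
def Link : Type :=
  Quot fun D D' : LinkDiagram => D.toGaussDiagram.Move D'.toGaussDiagram

/-- The link that a diagram represents. -/
def LinkDiagram.link (D : LinkDiagram) : Link := Quot.mk _ D

/-- Change the crossings in `S`. -/
def LinkDiagram.change (D : LinkDiagram) (S : Finset (Fin D.crossings)) : LinkDiagram where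
  toGaussDiagram := D.toGaussDiagram.change S
  planar := D.planar.change S

/-- A completely split link: it has a diagram without crossings between different components. -/
def Link.IsCompletelySplit (L : Link) : Prop :=
  ∃ D : LinkDiagram, D.link = L ∧ ∀ x, ¬ D.IsMixed x

/-- The splitting number: the minimum, over all diagrams of the link, of the number of crossing
changes between different components that produce a completely split link. -/
noncomputable def Link.splittingNumber (L : Link) : ℕ∞ :=
  sInf {n | ∃ D : LinkDiagram, D.link = L ∧ ∃ S : Finset (Fin D.crossings),
    (∀ x ∈ S, D.IsMixed x) ∧ (D.change S).link.IsCompletelySplit ∧ n = (S.card : ℕ∞)}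

/-! ### The spectral sequence of a filtered complex -/

section SpectralSequence

variable {R M : Type*} [CommRing R] [AddCommGroup M] [Module R M]

/-- `Z_r^p`: the `x ∈ F^p` with `d x ∈ F^(p - r)`. -/
def approxCycles (d : M →ₗ[R] M) (F : ℤ → Submodule R M) (r p : ℤ) : Submodule R M :=
  F p ⊓ (F (p - r)).comap d

/-- `B_r^p`: the `d y ∈ F^p` with `y ∈ F^(p + r)`. -/
def earlyBoundaries (d : M →ₗ[R] M) (F : ℤ → Submodule R M) (r p : ℤ) : Submodule R M :=
  F p ⊓ (F (p + r)).map d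

/-- `Z_(r-1)^(p-1) + B_(r-1)^p`, so that the page of index `r` is
`E_r^p = Z_r^p / (Z_(r-1)^(p-1) + B_(r-1)^p)`. -/
def pageRelations (d : M →ₗ[R] M) (F : ℤ → Submodule R M) (r p : ℤ) : Submodule R M :=
  approxCycles d F (r - 1) (p - 1) ⊔ earlyBoundaries d F (r - 1) p

/-- The differential `d_r : E_r^p → E_r^(p-r)`, `[x] ↦ [d x]`, is zero for all `p`. -/
def PageDifferentialVanishes (d : M →ₗ[R] M) (F : ℤ → Submodule R M) (r : ℤ) : Prop :=
  ∀ p : ℤ, ∀ x ∈ approxCycles d F r p, d x ∈ pageRelations d F r (p - r)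

/-- The spectral sequence collapses on page `k`, that is, `d_r = 0` for all `r ≥ k`. As `E_(r+1)` is
the homology of `(E_r, d_r)`, this is what `E_k = E_∞` means. -/
def CollapsesOnPage (d : M →ₗ[R] M) (F : ℤ → Submodule R M) (k : ℕ) : Prop :=
  ∀ r : ℕ, k ≤ r → PageDifferentialVanishes d F r

end SpectralSequence

/-! ### The deformed Khovanov complex -/

/-- Structure constants of the multiplication of `R[x]/(x²)` in the basis `1` (`false`),
`x` (`true`): the coefficient at `c` of the product of `a` and `b`. -/
def mulCoeff (R : Type*) [CommRing R] : Bool → Bool → Bool → R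
  | false, false, false => 1
  | true, false, true => 1
  | false, true, true => 1
  | _, _, _ => 0

/-- Structure constants of the comultiplication `1 ↦ 1 ⊗ x + x ⊗ 1`, `x ↦ x ⊗ x`: the coefficient at
`b ⊗ c` of the coproduct of `a`. -/
def comulCoeff (R : Type*) [CommRing R] : Bool → Bool → Bool → R
  | false, false, true => 1
  | false, true, false => 1
  | true, true, true => 1
  | _, _, _ => 0

namespace GaussDiagram

/-- The arcs `a` and `b` are joined at a point in the resolution `I` (`false` is the 0-resolution,
`true` the 1-resolution). The 0-resolution of a positive crossing and the 1-resolution of a negative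
crossing are the oriented ones. -/
inductive Joined (D : GaussDiagram) (I : Fin D.crossings → Bool) :
    Fin D.arcs → Fin D.arcs → Prop
  | plain (a) (h : D.IsPlain a) : Joined D I a (D.next a)
  | oriented_upper (x) (h : I x ≠ D.pos x) : Joined D I (D.upper x) (D.next (D.lower x))
  | oriented_lower (x) (h : I x ≠ D.pos x) : Joined D I (D.lower x) (D.next (D.upper x))
  | unoriented_in (x) (h : I x = D.pos x) : Joined D I (D.upper x) (D.lower x)
  | unoriented_out (x) (h : I x = D.pos x) :
      Joined D I (D.next (D.upper x)) (D.next (D.lower x))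

/-- The circles of the resolution `I`. -/
def Circle (D : GaussDiagram) (I : Fin D.crossings → Bool) : Type := Quot (D.Joined I)

/-- The circle of the resolution `I` that contains the arc `a`. -/
def circle (D : GaussDiagram) (I : Fin D.crossings → Bool) (a : Fin D.arcs) : D.Circle I :=
  Quot.mk _ a

/-- The monomials, a basis of the complex: a resolution together with a set of its circles (those
which are factors of the monomial). -/
def Generator (D : GaussDiagram) : Type :=
  Σ I : Fin D.crossings → Bool, (D.Circle I → Bool)

/-- The label of the circle through the arc `a`: `true` for `x`, `false` for `1`. -/
def Generator.label {D : GaussDiagram} (γ : D.Generator) (a : Fin D.arcs) : Bool :=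
  γ.2 (D.circle γ.1 a)

instance (D : GaussDiagram) (I : Fin D.crossings → Bool) : Finite (D.Circle I) :=
  inferInstanceAs (Finite (Quot (D.Joined I)))

instance (D : GaussDiagram) : Finite D.Generator :=
  inferInstanceAs (Finite (Σ I : Fin D.crossings → Bool, (D.Circle I → Bool)))

noncomputable instance (D : GaussDiagram) : Fintype D.Generator := Fintype.ofFinite _

open Classical in
/-- Matrix entry from the monomial `γ` to the monomial `γ'` of the map induced by the saddle
cobordism at the crossing `x`, where the resolutions of `γ` and `γ'` differ exactly at `x`. The two
strands of a resolution near `x` are those of `upper x` and `next (upper x)`. If they lie on different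
circles, then these are merged, otherwise their circle is split. -/
noncomputable def saddleCoeff (R : Type*) [CommRing R] (D : GaussDiagram) (x : Fin D.crossings)
    (γ γ' : D.Generator) : R :=
  let o := D.upper x
  let o' := D.next (D.upper x)
  if ∀ a, D.circle γ.1 a ≠ D.circle γ.1 o → D.circle γ.1 a ≠ D.circle γ.1 o' →
      γ.label a = γ'.label a then
    if D.circle γ.1 o ≠ D.circle γ.1 o' then
      mulCoeff R (γ.label o) (γ.label o') (γ'.label o)
    else
      comulCoeff R (γ.label o) (γ'.label o) (γ'.label o')
  else 0

/-- The sign of an edge of the cube of resolutions in direction `x`. -/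
def edgeSign (D : GaussDiagram) (I : Fin D.crossings → Bool) (x : Fin D.crossings) : ℤˣ :=
  (-1) ^ (Finset.univ.filter fun k => k < x ∧ I k = true).card

open Classical in
/-- Matrix entry from `γ` to `γ'` of `d = d₀ + d₁`, for the component weights `w` and the sign
assignment `s`. -/
noncomputable def diffCoeff {R : Type*} [CommRing R] (D : GaussDiagram) (w : D.Component → R)
    (s : Fin D.crossings → ℤˣ) (γ γ' : D.Generator) : R :=
  (∑ x, if γ.1 x = false ∧ γ'.1 = Function.update γ.1 x true then
      (((D.edgeSign γ.1 x : ℤˣ) : ℤ) : R) * saddleCoeff R D x γ γ' else 0) +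
  ∑ x, if γ.1 x = true ∧ γ'.1 = Function.update γ.1 x false then
      (((D.edgeSign γ'.1 x * s x : ℤˣ) : ℤ) : R) *
        (w (D.comp (D.upper x)) - w (D.comp (D.lower x))) * saddleCoeff R D x γ γ' else 0

/-- The differential `d = d₀ + d₁` of the complex `C(D, w)`, the free module on the monomials. -/
noncomputable def diff {R : Type*} [CommRing R] (D : GaussDiagram) (w : D.Component → R)
    (s : Fin D.crossings → ℤˣ) : (D.Generator → R) →ₗ[R] (D.Generator → R) :=
  Matrix.mulVecLin (Matrix.of fun γ' γ => D.diffCoeff w s γ γ')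

/-- The points `a` and `b` on crossings are the ends of an edge of the shadow: following the link
from `a`, the next passage through a crossing is `b`. -/
def IsEdge (D : GaussDiagram) (a b : Fin D.arcs) : Prop :=
  ∃ k : ℕ, (D.next ^ (k + 1)) a = b ∧ ∀ j < k, D.IsPlain ((D.next ^ (j + 1)) a)

/-- Sign assignments: along an edge of the shadow whose two ends are both upper or both lower
strands the sign changes, along the other edges it does not. -/
def IsSignAssignment (D : GaussDiagram) (s : Fin D.crossings → ℤˣ) : Prop :=
  ∀ x y,
    (D.IsEdge (D.upper x) (D.upper y) → s x * s y = -1) ∧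
    (D.IsEdge (D.lower x) (D.lower y) → s x * s y = -1) ∧
    (D.IsEdge (D.upper x) (D.lower y) → s x * s y = 1) ∧
    (D.IsEdge (D.lower x) (D.upper y) → s x * s y = 1)

/-- The number of positive crossings. -/
def numPos (D : GaussDiagram) : ℤ := (Finset.univ.filter fun x => D.pos x = true).card

/-- The number of negative crossings. -/
def numNeg (D : GaussDiagram) : ℤ := (Finset.univ.filter fun x => D.pos x = false).card

/-- The homological grading `|I| - n₋`. -/
def homGrading (D : GaussDiagram) (γ : D.Generator) : ℤ :=
  (Finset.univ.filter fun x => γ.1 x = true).card - D.numNeg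

/-- The internal grading `deg - (number of circles) - writhe`, where each circle in the monomial has
degree `2`. -/
noncomputable def intGrading (D : GaussDiagram) (γ : D.Generator) : ℤ :=
  2 * (Nat.card {c : D.Circle γ.1 // γ.2 c = true} : ℤ) - (Nat.card (D.Circle γ.1) : ℤ) -
    (D.numPos - D.numNeg)

/-- The quantum grading. -/
noncomputable def qGrading (D : GaussDiagram) (γ : D.Generator) : ℤ :=
  D.homGrading γ - D.intGrading γ

/-- The filtration by the grading `g = (q - m) / 2`, where `m` is the number of components: `F^p` is
spanned by the monomials with `g ≤ p`, that is, with `q - m ≤ 2 p`. -/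
def gFiltration (R : Type*) [CommRing R] (D : GaussDiagram) (p : ℤ) :
    Submodule R (D.Generator → R) where
  carrier := {v | ∀ γ, 2 * p < D.qGrading γ - (Nat.card D.Component : ℤ) → v γ = 0}
  add_mem' := fun hu hv γ h => by simp [hu γ h, hv γ h]
  zero_mem' := fun _ _ => rfl
  smul_mem' := fun c v hv γ h => by simp [hv γ h]

/-- `b(L, w)`: the largest `k ≥ 1` with `E_k ≠ E_∞`, and `0` if there is none. -/
noncomputable def lastUnstablePage {R : Type*} [CommRing R] (D : GaussDiagram)
    (w : D.Component → R) (s : Fin D.crossings → ℤˣ) : ℕ∞ :=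
  ⨆ k ∈ {k : ℕ | 1 ≤ k ∧ ¬ CollapsesOnPage (D.diff w s) (D.gFiltration R) k}, (k : ℕ∞)

end GaussDiagram

/-! # The splitting number bounds the last page of the deformed Khovanov spectral sequence

**Strictness.** Let levels be quantum degrees. The differential is called strict up to `n`
(`StrictUpTo`) if every boundary of level at most `t` bounds a chain of level at most `t + 2 n`.
Then the differentials of the spectral sequence vanish from page `n + 1` on
(`collapsesOnPage_of_strictUpTo`), and for finitely many monomials some `n` always works
(`exists_strictUpTo`). So it has to be shown that the differential of `D` is strict up to the number
of crossing changes that lead to a completely split link.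

**Cubes of resolutions.** A diagram enters only through the equivalence relations "on the same
circle" on its arcs, one for each resolution, and through the arcs `o x` and `o' x` of the two
strands next to a crossing `x` (`ResCube`). The differential is then determined by a coefficient
`u x` for the reversed saddle at each crossing. It squares to zero if, in every resolution,
`∑ x, u x * (f (o x) + f (o' x)) = 0` for all `f` that are constant on circles (`ResCube.Flat`,
`ResCube.mat_mul_mat`). A sign assignment extends to a checkerboard coloring `τ` of the arcs
(`exists_coloring_of_isSignAssignment`), the coefficient `s x * (w over - w under)` is the sum of
`τ * w` over the two strands at `x`, and flatness is a telescoping sum along the link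
(`Code.IsColoring.flat`). A coloring also orients the circles of all resolutions, which is why
each change of a resolution merges two circles or splits one (`Code.IsColoring.surgery`).

**Invariance.** Cancelling pairs of monomials of equal level against each other preserves strictness
(`strictUpTo_iff_eliminated`). Small circles provide such pairs (`ResCube.Cancellation`): cancelling
them identifies the cube after a first or second Reidemeister move with the cube before it, and for
the third move it leaves isomorphic complexes on the two sides (`ResCube.IsSlide.strictUpTo_iff`).
To pass from one diagram to another, strictness is required for all colorings, weights and edge signs
at once (`Code.StrictFor`); a planar diagram does have a coloring, by Euler's formula and a
dimension count over `ZMod 2` (`colorable_of_isPlanar`). Hence strictness up to `n` depends only on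
the link (`strictFor_iff_of_link_eq`).

**Crossing changes.** The diagram with the crossings in `S` changed has the same resolutions, with
the digits in `S` toggled, and saddles and reversed saddles interchanged there. As the coefficients
`u x` for `x ∈ S` are units, the two differentials agree after rescaling the monomials by units. The
levels of corresponding monomials differ, up to a constant, by at most `#S` in either direction, so
that strictness up to `0` on one side gives strictness up to `#S` on the other
(`strictFor_of_change`). Finally, in a diagram without crossings between different components the
coefficients `u x` vanish, the differential preserves levels, and it is strict up to `0`
(`strictFor_zero`). -/

namespace LinkSplitting

/-! ### Filtered complexes with a basis -/

section Filtered

variable {R : Type*} [CommRing R]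

/-- The vectors supported on basis elements of level at most `t`. -/
def levelFiltration (R : Type*) [CommRing R] {G : Type*} (q : G → ℤ) (t : ℤ) :
    Submodule R (G → R) where
  carrier := {v | ∀ γ, t < q γ → v γ = 0}
  add_mem' := fun hu hv γ h => by simp [hu γ h, hv γ h]
  zero_mem' := fun _ _ => rfl
  smul_mem' := fun c v hv γ h => by simp [hv γ h]

theorem levelFiltration_mono {G : Type*} (q : G → ℤ) : Monotone (levelFiltration R q) :=
  fun _ _ h _ hv γ hγ => hv γ (lt_of_le_of_lt h hγ)

/-- Every boundary of level `t` bounds a chain of level at most `t + 2 n`. The factor `2` is there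
because levels are quantum degrees, twice the degrees of the filtration of the spectral
sequence. -/
def StrictUpTo {V : Type*} [AddCommGroup V] [Module R V] (d : V →ₗ[R] V) (F : ℤ → Submodule R V)
    (n : ℕ) : Prop :=
  ∀ x t, d x ∈ F t → ∃ y ∈ F (t + 2 * n), d y = d x

/-- If `d` is strict up to `n`, then a cycle on page `r > n` has the same boundary as a chain of
such low level that `d_r` vanishes. -/
theorem collapsesOnPage_of_strictUpTo {V : Type*} [AddCommGroup V] [Module R V]
    (d : V →ₗ[R] V) (F F' : ℤ → Submodule R V) (m : ℤ) (hF : Monotone F)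
    (hF' : ∀ p, F' p = F (2 * p + m)) (n k : ℕ) (hk : n + 1 ≤ k) (h : StrictUpTo d F n) :
    CollapsesOnPage d F' k := by
  intro r hr p x hx
  obtain ⟨hx1, hx2⟩ := hx
  have hx3 : d x ∈ F (2 * (p - r) + m) := by rw [← hF']; exact hx2
  obtain ⟨y, hy, hyx⟩ := h x _ hx3
  refine Submodule.mem_sup_right ⟨?_, y, ?_, hyx⟩
  · exact hx2
  · rw [hF']
    refine hF ?_ hy
    have : (n : ℤ) + 1 ≤ r := by exact_mod_cast hk.trans hr
    linarith

/-- With finitely many levels, every differential is strict up to some `n`. -/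
theorem exists_strictUpTo {G : Type*} [Finite G] (q : G → ℤ) (d : (G → R) →ₗ[R] (G → R)) :
    ∃ n, StrictUpTo d (levelFiltration R q) n := by
  obtain ⟨b, hb⟩ : ∃ b : ℕ, ∀ γ, |q γ| ≤ b := by
    have := (Set.finite_range fun γ => |q γ|).bddAbove
    obtain ⟨b, hb⟩ := this
    exact ⟨b.toNat, fun γ => (hb ⟨γ, rfl⟩).trans (Int.self_le_toNat b)⟩
  refine ⟨b, fun x t hx => ?_⟩
  by_cases ht : t < -b
  · refine ⟨0, zero_mem _, ?_⟩
    rw [map_zero]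
    funext γ
    refine (hx γ ?_).symm
    have := neg_abs_le (q γ)
    have := hb γ
    linarith
  · refine ⟨x, fun γ hγ => ?_, rfl⟩
    have := le_abs_self (q γ)
    have := hb γ
    push Not at ht
    linarith

/-- A bijection of bases which is compatible with the differentials up to units, and with the levels
up to a shift and a spread of `2 j`, weakens strictness by `j` at most. -/
theorem StrictUpTo.of_equiv {G G' : Type*} [Fintype G] [Fintype G'] {M : Matrix G G R}
    {M' : Matrix G' G' R} {q : G → ℤ} {q' : G' → ℤ} (e : G ≃ G') (c : G → Rˣ)
    (hM : ∀ γ γ', (c γ' : R) * M γ' γ = M' (e γ') (e γ) * c γ) (k : ℤ) (j : ℕ)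
    (h1 : ∀ γ, q γ + k ≤ q' (e γ)) (h2 : ∀ γ, q' (e γ) ≤ q γ + k + 2 * j) {n : ℕ}
    (h : StrictUpTo M'.mulVecLin (levelFiltration R q') n) :
    StrictUpTo M.mulVecLin (levelFiltration R q) (n + j) := by
  have key : ∀ (v : G → R) γ', M'.mulVecLin (fun g => c (e.symm g) * v (e.symm g)) (e γ') =
      c γ' * M.mulVecLin v γ' := by
    intro v γ'
    simp only [Matrix.mulVecLin_apply, Matrix.mulVec, dotProduct, Finset.mul_sum]
    rw [← e.sum_comp]
    refine Finset.sum_congr rfl fun γ _ => ?_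
    rw [e.symm_apply_apply, ← mul_assoc, ← mul_assoc, hM]
  intro x t hx
  obtain ⟨y, hy, hyx⟩ := h (fun g => c (e.symm g) * x (e.symm g)) (t + k + 2 * j) (by
    intro g hg
    obtain ⟨γ, rfl⟩ := e.surjective g
    rw [key, hx γ, mul_zero]
    have := h2 γ
    linarith)
  have hy' : y = fun g => (c (e.symm g) : R) * (fun γ => ↑(c γ)⁻¹ * y (e γ)) (e.symm g) := by
    funext g
    simp
  refine ⟨fun γ => ↑(c γ)⁻¹ * y (e γ), fun γ hγ => ?_, ?_⟩
  · have := h1 γ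
    push_cast at hγ
    simp only
    rw [hy (e γ) (by linarith), mul_zero]
  · funext γ
    have h3 := congrFun hyx (e γ)
    rw [hy', key (fun γ => ↑(c γ)⁻¹ * y (e γ)), key] at h3
    exact (c γ).isUnit.mul_left_cancel h3

/-- If the differential preserves the level, then it is strict. -/
theorem strictUpTo_zero_of_level_eq {G : Type*} [Fintype G] {M : Matrix G G R} {q : G → ℤ}
    (hM : ∀ γ γ', M γ' γ ≠ 0 → q γ' = q γ) :
    StrictUpTo M.mulVecLin (levelFiltration R q) 0 := by
  classical
  intro x t hx
  refine ⟨fun γ => if q γ ≤ t then x γ else 0, fun γ hγ => ?_, ?_⟩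
  · simp only [Nat.cast_zero, mul_zero, add_zero] at hγ
    simp [not_le.2 hγ]
  · funext γ'
    have expand : ∀ v : G → R, M.mulVecLin v γ' = ∑ γ, M γ' γ * v γ := fun v => rfl
    by_cases h : q γ' ≤ t
    · rw [expand, expand]
      refine Finset.sum_congr rfl fun γ _ => ?_
      by_cases h0 : M γ' γ = 0
      · simp [h0]
      · rw [if_pos (by rw [← hM _ _ h0]; exact h)]
    · rw [hx γ' (not_le.1 h), expand]
      refine Finset.sum_eq_zero fun γ _ => ?_
      by_cases h0 : M γ' γ = 0
      · simp [h0]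
      · rw [if_neg (by rw [← hM _ _ h0]; exact h), mul_zero]

end Filtered

/-! ### Gaussian elimination -/

section Elimination

variable {R V W : Type*} [CommRing R] [AddCommGroup V] [Module R V] [AddCommGroup W] [Module R W]

/-- Elimination along a contraction `h`: if `h d h = h` and `h² = 0`, then `1 - d h - h d` projects
the complex onto the subcomplex `ker h ∩ ker h d`. The latter is identified with a complement `W` of
the part of `V` on which `h` and `d` are mutually inverse, by `(1 - h d) E`. -/
theorem strictUpTo_iff_of_contraction (d h : V →ₗ[R] V) (E : W →ₗ[R] V) (ρ : V →ₗ[R] W)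
    (F : ℤ → Submodule R V) (F' : ℤ → Submodule R W) (hF : Monotone F)
    (dd : ∀ v, d (d v) = 0) (hdh : ∀ v, h (d (h v)) = h v) (hh : ∀ v, h (h v) = 0)
    (ρE : ∀ w, ρ (E w) = w) (hE : ∀ w, h (E w) = 0) (ρh : ∀ v, ρ (h v) = 0)
    (split : ∀ v, h v = 0 → ∃ v', v = E (ρ v) + h v')
    (Fd : ∀ t, ∀ v ∈ F t, d v ∈ F t) (Fh : ∀ t, ∀ v ∈ F t, h v ∈ F t)
    (FE : ∀ t, ∀ w ∈ F' t, E w ∈ F t) (Fρ : ∀ t, ∀ v ∈ F t, ρ v ∈ F' t) (n : ℕ) :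
    StrictUpTo d F n ↔ StrictUpTo (ρ ∘ₗ d ∘ₗ (LinearMap.id - h ∘ₗ d) ∘ₗ E) F' n := by
  have key : ∀ v, h v = 0 → h (d v) = 0 → v = E (ρ v) - h (d (E (ρ v))) := by
    intro v h1 h2
    obtain ⟨v', hv'⟩ := split v h1
    have h3 : h (d v) = h (d (E (ρ v))) + h (d (h v')) := by
      conv_lhs => rw [hv']
      simp
    rw [h2, hdh] at h3
    conv_lhs => rw [hv']
    rw [sub_eq_add_neg, eq_neg_of_add_eq_zero_right h3.symm]
  set d' := ρ ∘ₗ d ∘ₗ (LinearMap.id - h ∘ₗ d) ∘ₗ E with hd'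
  have d'_apply : ∀ w, d' w = ρ (d (E w - h (d (E w)))) := fun w => by simp [hd']
  have incl : ∀ w, d (E w - h (d (E w))) = E (d' w) - h (d (E (d' w))) := by
    intro w
    rw [d'_apply]
    refine key _ ?_ ?_
    · rw [map_sub, map_sub, hdh, sub_self]
    · rw [dd, map_zero]
  have proj : ∀ v, d' (ρ (v - d (h v))) = ρ (d v - d (h (d v))) := by
    intro v
    have h1 := key (v - d (h v) - h (d v)) (by simp [hdh, hh]) (by simp [hdh, dd])
    have h2 : ρ (v - d (h v) - h (d v)) = ρ (v - d (h v)) := by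
      rw [map_sub, ρh, sub_zero]
    rw [h2] at h1
    rw [d'_apply, ← h1]
    simp [dd]
  constructor
  · intro hs w t hw
    obtain ⟨y, hy, hyw⟩ := hs (E w - h (d (E w))) t (by
      rw [incl]
      exact sub_mem (FE _ _ hw) (Fh _ _ (Fd _ _ (FE _ _ hw))))
    refine ⟨ρ (y - d (h y)), Fρ _ _ (sub_mem hy (Fd _ _ (Fh _ _ hy))), ?_⟩
    rw [proj, hyw, incl]
    simp [map_sub, ρE, hE, hh, ρh]
  · intro hs x t hx
    have h1 := proj x
    obtain ⟨y, hy, hyw⟩ := hs (ρ (x - d (h x))) t (by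
      rw [proj]
      exact Fρ _ _ (sub_mem hx (Fd _ _ (Fh _ _ hx))))
    have hle : t ≤ t + 2 * (n : ℤ) := by linarith [(Nat.cast_nonneg n : (0:ℤ) ≤ n)]
    refine ⟨E y - h (d (E y)) + h (d x), ?_, ?_⟩
    · exact add_mem (sub_mem (FE _ _ hy) (Fh _ _ (Fd _ _ (FE _ _ hy)))) (hF hle (Fh _ _ hx))
    · rw [map_add, incl, hyw, h1]
      have h2 : ρ (d x - d (h (d x))) = ρ (d x - d (h (d x)) - h (d (d x))) := by simp [dd]
      rw [h2, ← key _ (by simp [hdh, dd]) (by simp [dd])]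
      simp [dd]

end Elimination

section MatrixElimination

variable {R : Type*} [CommRing R] {G ι : Type*} [Fintype G] [Fintype ι]

/-- The basis elements which are not cancelled. -/
def Rest (α β : ι → G) : Type _ := {γ : G // (∀ i, γ ≠ α i) ∧ ∀ i, γ ≠ β i}

noncomputable instance (α β : ι → G) : Fintype (Rest α β) := by
  classical
  exact inferInstanceAs (Fintype {γ : G // (∀ i, γ ≠ α i) ∧ ∀ i, γ ≠ β i})

/-- The differential on the remaining basis elements, after the basis elements `α i` and `β i` have
been cancelled against each other. -/
def eliminated (M : Matrix G G R) (α β : ι → G) (ε : ι → R) :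
    Matrix (Rest α β) (Rest α β) R :=
  Matrix.of fun γ' γ => M γ'.1 γ.1 - ∑ i, M γ'.1 (α i) * (ε i * M (β i) γ.1)

/-- Gaussian elimination: cancelling basis elements `α i` and `β i` of equal level, between which
the differential is diagonal with entries `±1`, preserves strictness. -/
theorem strictUpTo_iff_eliminated [DecidableEq ι] (M : Matrix G G R) (q : G → ℤ) (α β : ι → G)
    (ε : ι → R) (hα : Function.Injective α) (hβ : Function.Injective β) (hαβ : ∀ i j, α i ≠ β j)
    (hM : ∀ i j, M (β i) (α j) = if i = j then ε i else 0) (hε : ∀ i, ε i * ε i = 1)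
    (dd : M * M = 0) (hq : ∀ γ γ', M γ' γ ≠ 0 → q γ' ≤ q γ) (hqi : ∀ i, q (α i) = q (β i))
    (n : ℕ) :
    StrictUpTo M.mulVecLin (levelFiltration R q) n ↔
      StrictUpTo (eliminated M α β ε).mulVecLin
        (levelFiltration R fun γ : Rest α β => q γ.1) n := by
  classical
  let h : (G → R) →ₗ[R] (G → R) :=
    { toFun := fun v γ => ∑ i, if γ = α i then ε i * v (β i) else 0
      map_add' := fun u v => by
        funext γ
        simp only [Pi.add_apply, ← Finset.sum_add_distrib]
        refine Finset.sum_congr rfl fun i _ => ?_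
        split_ifs <;> ring
      map_smul' := fun c v => by
        funext γ
        simp only [Pi.smul_apply, smul_eq_mul, RingHom.id_apply, Finset.mul_sum]
        refine Finset.sum_congr rfl fun i _ => ?_
        split_ifs <;> ring }
  have h_apply : ∀ v γ, h v γ = ∑ i, if γ = α i then ε i * v (β i) else 0 := fun v γ => rfl
  have h_α : ∀ v i, h v (α i) = ε i * v (β i) := by
    intro v i
    rw [h_apply, Finset.sum_eq_single i]
    · simp
    · intro j _ hj
      rw [if_neg fun h' => hj (hα h').symm]
    · simp
  have h_other : ∀ v γ, (∀ i, γ ≠ α i) → h v γ = 0 := by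
    intro v γ hγ
    rw [h_apply]
    exact Finset.sum_eq_zero fun i _ => if_neg (hγ i)
  have d_apply : ∀ v γ', M.mulVecLin v γ' = ∑ γ, M γ' γ * v γ := fun v γ' => rfl
  have sum_h : ∀ (c : G → R) v, ∑ γ, c γ * h v γ = ∑ i, c (α i) * (ε i * v (β i)) := by
    intro c v
    simp only [h_apply, Finset.mul_sum]
    rw [Finset.sum_comm]
    refine Finset.sum_congr rfl fun i _ => ?_
    rw [Finset.sum_eq_single (α i)] <;> simp +contextual
  let E : (Rest α β → R) →ₗ[R] (G → R) :=
    { toFun := fun w γ => if hγ : (∀ i, γ ≠ α i) ∧ ∀ i, γ ≠ β i then w ⟨γ, hγ⟩ else 0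
      map_add' := fun u v => by funext γ; simp only [Pi.add_apply]; split_ifs <;> [rfl; simp]
      map_smul' := fun c v => by
        funext γ; simp only [Pi.smul_apply, RingHom.id_apply]; split_ifs <;> [rfl; simp] }
  have E_apply : ∀ w γ, E w γ =
      if hγ : (∀ i, γ ≠ α i) ∧ ∀ i, γ ≠ β i then w ⟨γ, hγ⟩ else 0 := fun w γ => rfl
  have E_α : ∀ w i, E w (α i) = 0 := fun w i => by
    rw [E_apply, dif_neg]; exact fun h' => h'.1 i rfl
  have E_β : ∀ w i, E w (β i) = 0 := fun w i => by
    rw [E_apply, dif_neg]; exact fun h' => h'.2 i rfl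
  let ρ : (G → R) →ₗ[R] (Rest α β → R) := LinearMap.funLeft R R Subtype.val
  have ρ_apply : ∀ v γ, ρ v γ = v γ.1 := fun v γ => rfl
  have sum_E : ∀ (c : G → R) w, ∑ γ, c γ * E w γ = ∑ γ : Rest α β, c γ.1 * w γ := by
    intro c w
    refine (Fintype.sum_of_injective (fun γ : Rest α β => γ.1) Subtype.val_injective _ _
      (fun γ hγ => ?_) fun γ => ?_).symm
    · rw [E_apply, dif_neg (fun h' => hγ ⟨⟨γ, h'⟩, rfl⟩), mul_zero]
    · rw [E_apply, dif_pos γ.2]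
      rfl
  have main := strictUpTo_iff_of_contraction M.mulVecLin h E ρ (levelFiltration R q)
    (levelFiltration R fun γ : Rest α β => q γ.1) (levelFiltration_mono q)
    (fun v => by
      rw [Matrix.mulVecLin_apply, Matrix.mulVecLin_apply, Matrix.mulVec_mulVec, dd,
        Matrix.zero_mulVec])
    (fun v => by
      funext γ
      by_cases hγ : ∃ i, γ = α i
      · obtain ⟨i, rfl⟩ := hγ
        rw [h_α, h_α, d_apply, sum_h]
        simp only [hM, ite_mul, zero_mul, Finset.sum_ite_eq, Finset.mem_univ, if_true]
        rw [← mul_assoc, ← mul_assoc, hε, one_mul]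
      · push Not at hγ
        rw [h_other _ _ hγ, h_other _ _ hγ])
    (fun v => by
      funext γ
      rw [h_apply]
      refine Finset.sum_eq_zero fun i _ => ?_
      rw [h_other v (β i) fun j hj => hαβ j i hj.symm, mul_zero, ite_self])
    (fun w => by
      funext γ
      rw [ρ_apply, E_apply, dif_pos γ.2]
      rfl)
    (fun w => by
      funext γ
      rw [h_apply]
      refine Finset.sum_eq_zero fun i _ => ?_
      rw [E_β, mul_zero, ite_self])
    (fun v => by
      funext γ
      exact h_other v γ.1 γ.2.1)
    (fun v hv => by
      refine ⟨fun γ => ∑ i, if γ = β i then ε i * v (α i) else 0, ?_⟩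
      funext γ
      rw [Pi.add_apply]
      by_cases hγ : ∃ i, γ = α i
      · obtain ⟨i, rfl⟩ := hγ
        rw [E_α, h_α, zero_add, Finset.sum_eq_single i]
        · rw [if_pos rfl, ← mul_assoc, hε, one_mul]
        · intro j _ hj
          rw [if_neg fun h' => hj (hβ h').symm]
        · simp
      · push Not at hγ
        rw [h_other _ _ hγ, add_zero]
        by_cases hγ' : ∃ i, γ = β i
        · obtain ⟨i, rfl⟩ := hγ'
          rw [E_β]
          have := congrFun hv (α i)
          rw [h_α] at this
          calc v (β i) = ε i * (ε i * v (β i)) := by rw [← mul_assoc, hε, one_mul]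
            _ = 0 := by rw [this]; simp
        · push Not at hγ'
          rw [E_apply, dif_pos ⟨hγ, hγ'⟩]
          rfl)
    (fun t v hv γ' hγ' => by
      rw [d_apply]
      refine Finset.sum_eq_zero fun γ _ => ?_
      by_cases h0 : M γ' γ = 0
      · rw [h0, zero_mul]
      · rw [hv γ (lt_of_lt_of_le hγ' (hq _ _ h0)), mul_zero])
    (fun t v hv γ hγ => by
      by_cases hγ' : ∃ i, γ = α i
      · obtain ⟨i, rfl⟩ := hγ'
        rw [h_α, hv (β i) (by rw [← hqi]; exact hγ), mul_zero]
      · push Not at hγ'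
        exact h_other _ _ hγ')
    (fun t w hw γ hγ => by
      rw [E_apply]
      split_ifs with h'
      · exact hw ⟨γ, h'⟩ hγ
      · rfl)
    (fun t v hv γ hγ => hv γ.1 hγ) n
  rw [main]
  have hd : ρ ∘ₗ M.mulVecLin ∘ₗ (LinearMap.id - h ∘ₗ M.mulVecLin) ∘ₗ E =
      (eliminated M α β ε).mulVecLin := by
    refine LinearMap.ext fun w => ?_
    funext γ'
    simp only [LinearMap.comp_apply, LinearMap.sub_apply, LinearMap.id_apply, map_sub, ρ_apply,
      Pi.sub_apply]
    rw [d_apply, d_apply, sum_E, sum_h]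
    simp only [d_apply, sum_E]
    rw [Matrix.mulVecLin_apply, Matrix.mulVec, dotProduct]
    simp only [eliminated, Matrix.of_apply, sub_mul, Finset.sum_sub_distrib]
    congr 1
    simp only [Finset.mul_sum, Finset.sum_mul]
    rw [Finset.sum_comm]
    refine Finset.sum_congr rfl fun γ _ => Finset.sum_congr rfl fun i _ => by ring
  rw [hd]

end MatrixElimination

end LinkSplitting

namespace LinkSplitting

/-! ### Signs on the edges of a cube -/

section Signs

variable {X : Type*} [DecidableEq X]

/-- Change the digit of `I` at `x`. -/
def flip (I : X → Bool) (x : X) : X → Bool := Function.update I x (!I x)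

@[simp] theorem flip_self (I : X → Bool) (x : X) : flip I x x = !I x := by simp [flip]

theorem flip_of_ne (I : X → Bool) {x y : X} (h : y ≠ x) : flip I x y = I y := by simp [flip, h]

@[simp] theorem flip_flip (I : X → Bool) (x : X) : flip (flip I x) x = I := by
  funext y
  by_cases h : y = x
  · subst h; simp
  · rw [flip_of_ne _ h, flip_of_ne _ h]

theorem flip_comm (I : X → Bool) (x y : X) : flip (flip I x) y = flip (flip I y) x := by
  by_cases hxy : x = y
  · subst hxy; rfl
  funext z
  by_cases hx : z = x
  · subst hx
    rw [flip_of_ne _ hxy, flip_self, flip_self, flip_of_ne _ hxy]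
  · by_cases hy : z = y
    · subst hy
      rw [flip_of_ne _ hx, flip_self, flip_self, flip_of_ne _ hx]
    · simp [flip_of_ne, hx, hy]

theorem flip_left_injective (I : X → Bool) {x y : X} (h : flip I x = flip I y) : x = y := by
  by_contra hxy
  have := congrFun h x
  rw [flip_self, flip_of_ne _ hxy] at this
  simp at this

theorem flip_eq_iff {I J : X → Bool} {x : X} : J = flip I x ↔ I = flip J x :=
  ⟨fun h => by rw [h, flip_flip], fun h => by rw [h, flip_flip]⟩

/-- Signs on the edges of the cube of resolutions for which every square anticommutes. The sign of
the edge in direction `x` through `I` is `e I x`. -/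
structure IsEdgeSign (e : (X → Bool) → X → ℤˣ) : Prop where
  symm : ∀ I x, e (flip I x) x = e I x
  square : ∀ I x y, x ≠ y → e I x * e (flip I x) y = -(e I y * e (flip I y) x)

/-- The cube is simply connected, so any two choices of signs differ by a rescaling of the
vertices. -/
theorem IsEdgeSign.exists_rescaling [Finite X] {e e' : (X → Bool) → X → ℤˣ} (he : IsEdgeSign e)
    (he' : IsEdgeSign e') :
    ∃ σ : (X → Bool) → ℤˣ, ∀ I x, σ (flip I x) * e I x = e' I x * σ I := by
  cases nonempty_fintype X
  suffices H : ∀ T : Finset X, ∃ σ : (X → Bool) → ℤˣ, ∀ I, ∀ x ∈ T,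
      σ (flip I x) = e' I x * e I x * σ I by
    obtain ⟨σ, hσ⟩ := H Finset.univ
    refine ⟨σ, fun I x => ?_⟩
    rw [hσ I x (Finset.mem_univ x), mul_assoc, mul_assoc, mul_comm (σ I), ← mul_assoc (e I x),
      Int.units_mul_self, one_mul]
  intro T
  induction T using Finset.induction_on with
  | empty => exact ⟨fun _ => 1, by simp⟩
  | insert z T hz ih =>
    obtain ⟨σ, hσ⟩ := ih
    refine ⟨fun I => if I z = true then e' I z * e I z * σ (flip I z) else σ I, fun I x hx => ?_⟩
    by_cases hxz : x = z
    · subst hxz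
      cases hI : I x
      · simp [hI, he.symm, he'.symm]
      · simp only [flip_self, hI, Bool.not_true, Bool.false_eq_true, if_false, if_true]
        rw [← mul_assoc]
        have : e' I x * e I x * (e' I x * e I x) = 1 := Int.units_mul_self _
        rw [this, one_mul]
    · have hxT : x ∈ T := (Finset.mem_insert.1 hx).resolve_left hxz
      have hzx : z ≠ x := fun h => hxz h.symm
      cases hI : I z
      · simp [flip_of_ne _ hzx, hI, hσ I x hxT]
      · simp only [flip_of_ne _ hzx, hI, if_true]
        rw [flip_comm, hσ _ x hxT]
        have h1 := he.square I x z hxz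
        have h2 := he'.square I x z hxz
        have h3 : e' I x * e' (flip I x) z * (e I x * e (flip I x) z) =
            e' I z * e' (flip I z) x * (e I z * e (flip I z) x) := by
          rw [h1, h2, neg_mul_neg]
        calc _ = (e' (flip I x) z * e (flip I x) z) * (e' (flip I z) x * e (flip I z) x) *
              σ (flip I z) := by ac_rfl
          _ = (e' I x * e I x * (e' I x * e I x)) * ((e' (flip I x) z * e (flip I x) z) *
              (e' (flip I z) x * e (flip I z) x)) * σ (flip I z) := by
            rw [Int.units_mul_self, one_mul]
          _ = (e' I x * e I x) * (e' I x * e' (flip I x) z * (e I x * e (flip I x) z)) *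
              (e' (flip I z) x * e (flip I z) x) * σ (flip I z) := by
            congr 1; ac_rfl
          _ = (e' I x * e I x) * (e' I z * e I z) * ((e' (flip I z) x * e (flip I z) x) *
              (e' (flip I z) x * e (flip I z) x)) * σ (flip I z) := by
            rw [h3]; congr 1; ac_rfl
          _ = _ := by rw [Int.units_mul_self, mul_one, mul_assoc]

end Signs

/-! ### Sums over equivalence classes -/

section ClassSum

variable {A B : Type*}

/-- The sum of `f` over a system of representatives. -/
noncomputable def classSum (s : Setoid A) (f : A → ℤ) : ℤ := ∑ᶠ c : Quotient s, f c.out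

theorem out_eq {s : Setoid A} {f : A → ℤ} (hf : ∀ a b, s a b → f a = f b) (a : A) :
    f (Quotient.mk s a).out = f a := hf _ _ (Quotient.mk_out a)

/-- A map `φ` under which the classes correspond bijectively, apart from one further class. -/
theorem classSum_of_extra [Finite A] [Finite B] {s : Setoid A} {s' : Setoid B} {f : A → ℤ}
    {f' : B → ℤ} (hf : ∀ a b, s a b → f a = f b) (hf' : ∀ a b, s' a b → f' a = f' b) (φ : A → B)
    (hφ : ∀ a b, s a b ↔ s' (φ a) (φ b)) (hff' : ∀ a, f a = f' (φ a)) (z : B)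
    (hz : ∀ a, ¬ s' (φ a) z) (surj : ∀ b, s' b z ∨ ∃ a, s' (φ a) b) :
    classSum s' f' = classSum s f + f' z := by
  classical
  have := Fintype.ofFinite (Quotient s)
  have := Fintype.ofFinite (Quotient s')
  rw [classSum, classSum, finsum_eq_sum_of_fintype, finsum_eq_sum_of_fintype,
    ← Finset.add_sum_erase _ _ (Finset.mem_univ (Quotient.mk s' z)), out_eq hf', add_comm]
  congr 1
  symm
  refine Finset.sum_bij (fun c _ => Quotient.map φ (fun a b h => (hφ a b).1 h) c) ?_ ?_ ?_ ?_
  · intro c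
    refine Quotient.inductionOn c fun a _ => ?_
    simp only [Finset.mem_erase, Finset.mem_univ, and_true]
    exact fun h => hz a (Quotient.exact h)
  · intro c _ c'
    refine Quotient.inductionOn₂ c c' fun a b _ h => ?_
    exact Quotient.sound ((hφ a b).2 (Quotient.exact h))
  · intro c
    refine Quotient.inductionOn c fun b hb => ?_
    simp only [Finset.mem_erase, Finset.mem_univ, and_true] at hb
    obtain h | ⟨a, ha⟩ := surj b
    · exact absurd (Quotient.sound h) hb
    · exact ⟨Quotient.mk s a, Finset.mem_univ _, Quotient.sound ha⟩
  · intro c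
    refine Quotient.inductionOn c fun a _ => ?_
    exact (out_eq hf a).trans ((hff' a).trans (out_eq hf' (φ a)).symm)

theorem classSum_congr [Finite A] [Finite B] {s : Setoid A} {s' : Setoid B} {f : A → ℤ}
    {f' : B → ℤ} (hf : ∀ a b, s a b → f a = f b) (hf' : ∀ a b, s' a b → f' a = f' b) (φ : A → B)
    (hφ : ∀ a b, s a b ↔ s' (φ a) (φ b)) (hff' : ∀ a, f a = f' (φ a))
    (surj : ∀ b, ∃ a, s' (φ a) b) : classSum s' f' = classSum s f := by
  classical
  have := Fintype.ofFinite (Quotient s)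
  have := Fintype.ofFinite (Quotient s')
  rw [classSum, classSum, finsum_eq_sum_of_fintype, finsum_eq_sum_of_fintype]
  symm
  refine Finset.sum_bij (fun c _ => Quotient.map φ (fun a b h => (hφ a b).1 h) c) ?_ ?_ ?_ ?_
  · intro c
    refine Quotient.inductionOn c fun a _ => ?_
    exact Finset.mem_univ _
  · intro c _ c'
    refine Quotient.inductionOn₂ c c' fun a b _ h => ?_
    exact Quotient.sound ((hφ a b).2 (Quotient.exact h))
  · intro c
    refine Quotient.inductionOn c fun b _ => ?_
    obtain ⟨a, ha⟩ := surj b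
    exact ⟨Quotient.mk s a, Finset.mem_univ _, Quotient.sound ha⟩
  · intro c
    refine Quotient.inductionOn c fun a _ => ?_
    exact (out_eq hf a).trans ((hff' a).trans (out_eq hf' (φ a)).symm)

/-- Merging the classes of `o` and `o'`. -/
theorem classSum_merge [Finite A] {s s' : Setoid A} {f f' : A → ℤ}
    (hf : ∀ a b, s a b → f a = f b) (hf' : ∀ a b, s' a b → f' a = f' b) {o o' : A}
    (ho : ¬ s o o') (hs : ∀ a b, s' a b ↔ s a b ∨ (s a o ∧ s b o') ∨ (s a o' ∧ s b o))
    (hff' : ∀ a, ¬ s a o → ¬ s a o' → f a = f' a) :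
    classSum s f = classSum s' f' - f' o + f o + f o' := by
  classical
  have := Fintype.ofFinite (Quotient s)
  have := Fintype.ofFinite (Quotient s')
  have hne : Quotient.mk s o' ≠ Quotient.mk s o := fun h => ho (s.symm (Quotient.exact h))
  rw [classSum, classSum, finsum_eq_sum_of_fintype, finsum_eq_sum_of_fintype,
    ← Finset.add_sum_erase _ _ (Finset.mem_univ (Quotient.mk s' o)),
    ← Finset.add_sum_erase _ _ (Finset.mem_univ (Quotient.mk s o)),
    ← Finset.add_sum_erase _ _ (Finset.mem_erase.2 ⟨hne, Finset.mem_univ _⟩),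
    out_eq hf, out_eq hf, out_eq hf']
  have key : ∑ c ∈ (Finset.univ.erase (Quotient.mk s o)).erase (Quotient.mk s o'), f c.out =
      ∑ c ∈ Finset.univ.erase (Quotient.mk s' o), f' c.out := by
    refine Finset.sum_bij
      (fun c _ => Quotient.map id (fun a b h => (hs a b).2 (Or.inl h)) c) ?_ ?_ ?_ ?_
    · intro c
      refine Quotient.inductionOn c fun a ha => ?_
      simp only [Finset.mem_erase, Finset.mem_univ, and_true] at ha ⊢
      intro h
      rcases (hs a o).1 (Quotient.exact h) with h | ⟨h, -⟩ | ⟨h, -⟩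
      · exact ha.2 (Quotient.sound h)
      · exact ha.2 (Quotient.sound h)
      · exact ha.1 (Quotient.sound h)
    · intro c hc c' hc' h
      revert hc hc' h
      refine Quotient.inductionOn₂ c c' fun a b ha hb h => ?_
      simp only [Finset.mem_erase, Finset.mem_univ, and_true] at ha
      rcases (hs a b).1 (Quotient.exact h) with h | ⟨h, -⟩ | ⟨h, -⟩
      · exact Quotient.sound h
      · exact absurd (Quotient.sound h) ha.2
      · exact absurd (Quotient.sound h) ha.1
    · intro c
      refine Quotient.inductionOn c fun b hb => ?_
      simp only [Finset.mem_erase, Finset.mem_univ, and_true] at hb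
      refine ⟨Quotient.mk s b, ?_, rfl⟩
      simp only [Finset.mem_erase, Finset.mem_univ, and_true]
      exact ⟨fun h => hb (Quotient.sound ((hs b o).2 (Or.inr (Or.inr ⟨Quotient.exact h, s.refl _⟩)))),
        fun h => hb (Quotient.sound ((hs b o).2 (Or.inl (Quotient.exact h))))⟩
    · intro c
      refine Quotient.inductionOn c fun a ha => ?_
      simp only [Finset.mem_erase, Finset.mem_univ, and_true] at ha
      refine (out_eq hf a).trans ((hff' a ?_ ?_).trans (out_eq hf' a).symm)
      · exact fun h => ha.2 (Quotient.sound h)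
      · exact fun h => ha.1 (Quotient.sound h)
  rw [key]
  ring

end ClassSum

/-! ### Cubes of resolutions -/

/-- What the Khovanov complex needs to know about a diagram: for every resolution `I` the relation
of lying on the same circle, and for every crossing `x` two arcs `o x`, `o' x`, one on each of the
two strands of any resolution near `x`. Changing the resolution at `x` merges the circles of `o x`
and `o' x` if they are different, and splits their circle otherwise. In particular, no circle is
turned into a single circle again. -/
structure ResCube (A X : Type*) [DecidableEq X] where
  rel : (X → Bool) → A → A → Prop
  equiv : ∀ I, Equivalence (rel I)
  o : X → A
  o' : X → A
  surgery : ∀ I x, rel I (o x) (o' x) ↔ ¬ rel (flip I x) (o x) (o' x)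
  rel_flip : ∀ I x a b, rel (flip I x) a b →
    rel I a b ∨ (rel I a (o x) ∧ rel I b (o' x)) ∨ (rel I a (o' x) ∧ rel I b (o x))

namespace ResCube

variable {A X : Type*} [DecidableEq X] (C : ResCube A X)

/-- The circles of a resolution, as a setoid on the arcs. -/
def setoid (I : X → Bool) : Setoid A := ⟨C.rel I, C.equiv I⟩

variable {C}

theorem refl (I : X → Bool) (a : A) : C.rel I a a := (C.equiv I).refl a

theorem symm {I : X → Bool} {a b : A} (h : C.rel I a b) : C.rel I b a := (C.equiv I).symm h

theorem trans {I : X → Bool} {a b c : A} (h : C.rel I a b) (h' : C.rel I b c) : C.rel I a c :=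
  (C.equiv I).trans h h'

theorem rel_comm {I : X → Bool} {a b : A} : C.rel I a b ↔ C.rel I b a := ⟨symm, symm⟩

/-- Flipping a crossing between two circles merges them. -/
theorem rel_flip_of_merge {I : X → Bool} {x : X} (h : ¬ C.rel I (C.o x) (C.o' x)) {a b : A} :
    C.rel (flip I x) a b ↔ C.rel I a b ∨ (C.rel I a (C.o x) ∧ C.rel I b (C.o' x)) ∨
      (C.rel I a (C.o' x) ∧ C.rel I b (C.o x)) := by
  refine ⟨C.rel_flip I x a b, ?_⟩
  have hJ : C.rel (flip I x) (C.o x) (C.o' x) := by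
    by_contra hJ
    exact h ((C.surgery I x).2 hJ)
  have le : ∀ a b, C.rel I a b → C.rel (flip I x) a b := by
    intro a b hab
    have := C.rel_flip (flip I x) x a b (by rwa [flip_flip])
    rcases this with h | ⟨h, h'⟩ | ⟨h, h'⟩
    · exact h
    · exact trans h (trans hJ (symm h'))
    · exact trans h (trans (symm hJ) (symm h'))
  rintro (h | ⟨h, h'⟩ | ⟨h, h'⟩)
  · exact le _ _ h
  · exact trans (le _ _ h) (trans hJ (symm (le _ _ h')))
  · exact trans (le _ _ h) (trans (symm hJ) (symm (le _ _ h')))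

/-- The circle split by flipping a crossing is the union of the two resulting circles. -/
theorem rel_of_split {I : X → Bool} {x : X} (h : C.rel I (C.o x) (C.o' x)) {a b : A} :
    C.rel I a b ↔ C.rel (flip I x) a b ∨
      (C.rel (flip I x) a (C.o x) ∧ C.rel (flip I x) b (C.o' x)) ∨
      (C.rel (flip I x) a (C.o' x) ∧ C.rel (flip I x) b (C.o x)) := by
  have := rel_flip_of_merge (C := C) (I := flip I x) (x := x) ((C.surgery I x).1 h) (a := a) (b := b)
  rwa [flip_flip] at this

theorem le_of_merge {I : X → Bool} {x : X} (h : ¬ C.rel I (C.o x) (C.o' x)) {a b : A}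
    (hab : C.rel I a b) : C.rel (flip I x) a b := (rel_flip_of_merge h).2 (Or.inl hab)

theorem le_of_split {I : X → Bool} {x : X} (h : C.rel I (C.o x) (C.o' x)) {a b : A}
    (hab : C.rel (flip I x) a b) : C.rel I a b := (rel_of_split h).2 (Or.inl hab)

theorem not_rel_flip {I : X → Bool} {x : X} (h : C.rel I (C.o x) (C.o' x)) :
    ¬ C.rel (flip I x) (C.o x) (C.o' x) := (C.surgery I x).1 h

theorem rel_flip_ends {I : X → Bool} {x : X} (h : ¬ C.rel I (C.o x) (C.o' x)) :
    C.rel (flip I x) (C.o x) (C.o' x) := by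
  by_contra hJ
  exact h ((C.surgery I x).2 hJ)

variable (C)

/-- Monomials: a resolution and a labelling of its circles (`true` for the factors), recorded as a
labelling of the arcs. -/
structure Gen where
  res : X → Bool
  label : A → Bool
  compat : ∀ a b, C.rel res a b → label a = label b

theorem Gen.label_eq {C : ResCube A X} (γ : C.Gen) {a b : A} (h : C.rel γ.res a b) :
    γ.label a = γ.label b := γ.compat a b h

theorem Gen.ext {C : ResCube A X} {γ δ : C.Gen} (h : γ.res = δ.res)
    (h' : ∀ a, γ.label a = δ.label a) : γ = δ := by
  obtain ⟨I, l, hl⟩ := γ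
  obtain ⟨J, m, hm⟩ := δ
  obtain rfl : I = J := h
  obtain rfl : l = m := funext h'
  rfl

instance [Finite A] [Finite X] : Finite C.Gen :=
  Finite.of_injective (fun γ : C.Gen => (γ.res, γ.label)) fun _ _ h =>
    Gen.ext (congrArg Prod.fst h) (congrFun (congrArg Prod.snd h))

noncomputable instance [Finite A] [Finite X] : Fintype C.Gen := Fintype.ofFinite _

/-- The saddle map at `x` from the resolution `I` has the coefficient `1` from the labelling `ℓ` to
the labelling `ℓ'`. All its other coefficients vanish. -/
def Saddle (I : X → Bool) (x : X) (ℓ ℓ' : A → Bool) : Prop :=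
  (∀ a, ¬ C.rel I a (C.o x) → ¬ C.rel I a (C.o' x) → ℓ a = ℓ' a) ∧
    (¬ C.rel I (C.o x) (C.o' x) →
      (ℓ (C.o x) && ℓ (C.o' x)) = false ∧ ℓ' (C.o x) = (ℓ (C.o x) || ℓ (C.o' x))) ∧
    (C.rel I (C.o x) (C.o' x) →
      (ℓ' (C.o x) || ℓ' (C.o' x)) = true ∧ ℓ (C.o x) = (ℓ' (C.o x) && ℓ' (C.o' x)))

/-- `+1` for the label `1`, `-1` for the label `x`. -/
def sgn (b : Bool) : ℤ := if b then -1 else 1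

/-- The weighted count of circles labelled `1` minus circles labelled `x`. -/
noncomputable def wt (η : A → ℤ) (γ : C.Gen) : ℤ :=
  classSum (C.setoid γ.res) fun a => η a * sgn (γ.label a)

theorem wt_eq_of_saddle [Finite A] (η : A → ℤ) (hη : ∀ I a b, C.rel I a b → η a = η b)
    {γ γ' : C.Gen} {x : X} (hx : γ'.res = flip γ.res x)
    (h : C.Saddle γ.res x γ.label γ'.label) :
    C.wt η γ' = C.wt η γ - η (C.o x) := by
  have hf : ∀ γ : C.Gen, ∀ a b, C.setoid γ.res a b →
      η a * sgn (γ.label a) = η b * sgn (γ.label b) := by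
    intro γ a b hab
    rw [hη _ a b hab, γ.label_eq hab]
  by_cases hI : C.rel γ.res (C.o x) (C.o' x)
  · have hI' : ¬ C.rel γ'.res (C.o x) (C.o' x) := by rw [hx]; exact not_rel_flip hI
    have h1 := classSum_merge (s := C.setoid γ'.res) (s' := C.setoid γ.res) (hf γ') (hf γ)
      (o := C.o x) (o' := C.o' x) hI' (fun a b => by
        have := rel_of_split (C := C) hI (a := a) (b := b)
        rw [← hx] at this
        exact this) (fun a h1 h2 => by
          have hle : ∀ b, C.rel γ.res a b → (C.rel γ'.res a b ∨ False) ∨ (C.rel γ'.res a (C.o x) ∨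
            C.rel γ'.res a (C.o' x)) := by
              intro b hb
              rw [rel_of_split hI, ← hx] at hb
              tauto
          rw [h.1 a (fun h' => ?_) (fun h' => ?_)]
          · rcases hle _ h' with (h' | h') | h' | h'
            exacts [h1 h', h', h1 h', h2 h']
          · rcases hle _ h' with (h' | h') | h' | h'
            exacts [h2 h', h', h1 h', h2 h'])
    rw [wt, wt, h1, ← hη _ _ _ hI]
    obtain ⟨h2, h3⟩ := h.2.2 hI
    rw [h3]
    cases hb : γ'.label (C.o x) <;> cases hb' : γ'.label (C.o' x) <;>
      simp [hb, hb', sgn] at h2 ⊢ <;> ring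
  · have h1 := classSum_merge (s := C.setoid γ.res) (s' := C.setoid γ'.res) (hf γ) (hf γ')
      (o := C.o x) (o' := C.o' x) hI (fun a b => by
        have := rel_flip_of_merge (C := C) hI (a := a) (b := b)
        rw [← hx] at this
        exact this) (fun a h1 h2 => by rw [h.1 a h1 h2])
    have hJ : C.rel γ'.res (C.o x) (C.o' x) := by rw [hx]; exact rel_flip_ends hI
    rw [wt, wt, h1, ← hη _ _ _ hJ]
    obtain ⟨h2, h3⟩ := h.2.1 hI
    rw [h3]
    cases hb : γ.label (C.o x) <;> cases hb' : γ.label (C.o' x) <;>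
      simp [hb, hb', sgn] at h2 ⊢

/-- The number of digits `1`. -/
def ones [Fintype X] (η : X → ℤ) (I : X → Bool) : ℤ := ∑ x, if I x then η x else 0

theorem ones_flip [Fintype X] (η : X → ℤ) (I : X → Bool) (x : X) :
    ones η (flip I x) = ones η I + if I x then - η x else η x := by
  rw [ones, ones, ← Finset.add_sum_erase _ _ (Finset.mem_univ x),
    ← Finset.add_sum_erase (a := x) _ (fun x => if I x then η x else 0) (Finset.mem_univ x)]
  have : ∑ y ∈ Finset.univ.erase x, (if flip I x y = true then η y else 0) =
      ∑ y ∈ Finset.univ.erase x, if I y = true then η y else 0 :=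
    Finset.sum_congr rfl fun y hy => by rw [flip_of_ne _ (Finset.ne_of_mem_erase hy)]
  rw [this, flip_self]
  cases I x
  · simp only [Bool.not_false, Bool.false_eq_true, if_true, if_false]
    ring
  · simp only [Bool.not_true, Bool.false_eq_true, if_true, if_false]
    ring

/-- The quantum degree, up to a constant. With weights `η`, the contribution of a part of the
diagram. -/
noncomputable def level [Fintype X] (η : A → ℤ) (γ : C.Gen) : ℤ :=
  ones (fun x => η (C.o x)) γ.res + C.wt η γ

theorem level_eq_of_saddle [Finite A] [Fintype X] (η : A → ℤ)
    (hη : ∀ I a b, C.rel I a b → η a = η b) {γ γ' : C.Gen} {x : X} (hx : γ'.res = flip γ.res x)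
    (h : C.Saddle γ.res x γ.label γ'.label) :
    C.level η γ' = C.level η γ - if γ.res x then 2 * η (C.o x) else 0 := by
  rw [level, level, C.wt_eq_of_saddle η hη hx h, hx, ones_flip]
  split_ifs
  · ring
  · ring

end ResCube

end LinkSplitting

namespace LinkSplitting

namespace ResCube

variable {A X R : Type*} [CommRing R]

/-! ### The deformed Khovanov complex of a cube of resolutions -/

/-- The coefficient of an edge of the cube in direction `x` whose end has the digit `b` at `x`: the
edges of `d₀` have coefficient `1`, those of `d₁` have coefficient `u x`. -/
def cf (u : X → R) (x : X) (b : Bool) : R := if b then 1 else u x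

theorem cf_mul_cf_not (u : X → R) (x : X) (b : Bool) : cf u x b * cf u x (!b) = u x := by
  cases b <;> simp [cf]

variable [DecidableEq X]

open Classical in
/-- The matrix of the differential with coefficients `u` and edge signs `e`. -/
noncomputable def mat [Fintype X] (C : ResCube A X) (u : X → R) (e : (X → Bool) → X → ℤˣ) :
    Matrix C.Gen C.Gen R :=
  Matrix.of fun γ' γ => ∑ x, if γ'.res = flip γ.res x ∧ C.Saddle γ.res x γ.label γ'.label then
    ((e γ.res x : ℤ) : R) * cf u x (γ'.res x) else 0

open Classical in
theorem mat_apply [Fintype X] (C : ResCube A X) (u : X → R) (e : (X → Bool) → X → ℤˣ)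
    (γ γ' : C.Gen) : C.mat u e γ' γ =
      ∑ x, if γ'.res = flip γ.res x ∧ C.Saddle γ.res x γ.label γ'.label then
        ((e γ.res x : ℤ) : R) * cf u x (γ'.res x) else 0 := rfl

open Classical in
theorem mat_apply_of_eq [Fintype X] (C : ResCube A X) (u : X → R) (e : (X → Bool) → X → ℤˣ)
    {γ γ' : C.Gen} {x : X} (h : γ'.res = flip γ.res x) :
    C.mat u e γ' γ = if C.Saddle γ.res x γ.label γ'.label then
      ((e γ.res x : ℤ) : R) * cf u x (γ'.res x) else 0 := by
  rw [mat_apply, Finset.sum_eq_single x]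
  · simp [h]
  · intro y _ hy
    rw [if_neg]
    rintro ⟨h', -⟩
    exact hy (flip_left_injective _ (h'.symm.trans h))
  · simp

theorem mat_apply_of_ne [Fintype X] (C : ResCube A X) (u : X → R) (e : (X → Bool) → X → ℤˣ)
    {γ γ' : C.Gen} (h : ∀ x, γ'.res ≠ flip γ.res x) : C.mat u e γ' γ = 0 := by
  classical
  rw [mat_apply]
  exact Finset.sum_eq_zero fun x _ => if_neg fun h' => h x h'.1

theorem exists_of_mat_ne_zero [Fintype X] {C : ResCube A X} {u : X → R}
    {e : (X → Bool) → X → ℤˣ} {γ γ' : C.Gen} (h : C.mat u e γ' γ ≠ 0) :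
    ∃ x, γ'.res = flip γ.res x ∧ C.Saddle γ.res x γ.label γ'.label ∧ cf u x (γ'.res x) ≠ 0 := by
  classical
  rw [mat_apply] at h
  obtain ⟨x, -, hx⟩ := Finset.exists_ne_zero_of_sum_ne_zero h
  have := ite_ne_right_iff.1 hx
  exact ⟨x, this.1.1, this.1.2, right_ne_zero_of_mul this.2⟩

theorem level_le_of_mat_ne_zero [Finite A] [Fintype X] {C : ResCube A X} {u : X → R}
    {e : (X → Bool) → X → ℤˣ} {γ γ' : C.Gen} (h : C.mat u e γ' γ ≠ 0) :
    C.level 1 γ' ≤ C.level 1 γ := by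
  obtain ⟨x, h1, h2, -⟩ := exists_of_mat_ne_zero h
  rw [C.level_eq_of_saddle 1 (fun _ _ _ _ => rfl) h1 h2]
  split_ifs <;> simp

/-- The condition on the coefficients under which `d₀ d₁ + d₁ d₀ = 0`. -/
def Flat (C : ResCube A X) [Fintype X] (u : X → R) : Prop :=
  ∀ (I : X → Bool) (f : A → R), (∀ a b, C.rel I a b → f a = f b) →
    ∑ x, u x * (f (C.o x) + f (C.o' x)) = 0

/-! ### The square of the differential

A chain is encoded by families `φ I` of functions on sets of arcs: `φ I S` is the coefficient of the
product of all circles in `∏ a ∈ S, a` times the `I`-part of the chain. In this encoding a split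
becomes the identity, a merge becomes multiplication by `o + o'`, and the arcs act by commuting
operators. -/

theorem classSum_one_of_merge (C : ResCube A X) [Finite A] {I : X → Bool} {x : X}
    (h : ¬ C.rel I (C.o x) (C.o' x)) :
    classSum (C.setoid I) 1 = classSum (C.setoid (flip I x)) 1 + 1 := by
  have := classSum_merge (s := C.setoid I) (s' := C.setoid (flip I x)) (f := 1) (f' := 1)
    (fun _ _ _ => rfl) (fun _ _ _ => rfl) h (fun a b => rel_flip_of_merge h) (fun _ _ _ => rfl)
  simpa using this

theorem classSum_one_of_split (C : ResCube A X) [Finite A] {I : X → Bool} {x : X}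
    (h : C.rel I (C.o x) (C.o' x)) :
    classSum (C.setoid (flip I x)) 1 = classSum (C.setoid I) 1 + 1 := by
  have := C.classSum_one_of_merge (I := flip I x) (x := x) (not_rel_flip h)
  rwa [flip_flip] at this

variable [DecidableEq A]

/-- The action of the arc `a`. -/
def mulArc (a : A) (φ : (A → Bool) → R) : (A → Bool) → R :=
  fun l => if l a then 0 else φ (Function.update l a true)

theorem mulArc_comm (a b : A) (φ : (A → Bool) → R) :
    mulArc a (mulArc b φ) = mulArc b (mulArc a φ) := by
  funext l
  by_cases hab : a = b
  · rw [hab]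
  · by_cases ha : l a = true <;> by_cases hb : l b = true <;>
      simp [mulArc, ha, hb, hab, Ne.symm hab, Function.update_comm hab]

theorem mulArc_add (a : A) (φ φ' : (A → Bool) → R) :
    mulArc a (φ + φ') = mulArc a φ + mulArc a φ' := by
  funext l; simp only [mulArc, Pi.add_apply]; split_ifs <;> simp

theorem mulArc_smul (a : A) (c : R) (φ : (A → Bool) → R) :
    mulArc a (c • φ) = c • mulArc a φ := by
  funext l; simp only [mulArc, Pi.smul_apply, smul_eq_mul]; split_ifs <;> simp

variable (C : ResCube A X)

open Classical in
/-- The saddle at `x` from the resolution `I` in the encoding by functions on sets of arcs. -/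
noncomputable def saddleOp (I : X → Bool) (x : X) (φ : (A → Bool) → R) : (A → Bool) → R :=
  if C.rel I (C.o x) (C.o' x) then φ else mulArc (C.o x) φ + mulArc (C.o' x) φ

theorem saddleOp_add (I : X → Bool) (x : X) (φ φ' : (A → Bool) → R) :
    C.saddleOp I x (φ + φ') = C.saddleOp I x φ + C.saddleOp I x φ' := by
  rw [saddleOp, saddleOp, saddleOp]
  split_ifs
  · rfl
  · rw [mulArc_add, mulArc_add]; abel

theorem saddleOp_smul (I : X → Bool) (x : X) (c : R) (φ : (A → Bool) → R) :
    C.saddleOp I x (c • φ) = c • C.saddleOp I x φ := by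
  rw [saddleOp, saddleOp]
  split_ifs
  · rfl
  · rw [mulArc_smul, mulArc_smul, smul_add]

theorem saddleOp_sum {ι : Type*} (s : Finset ι) (I : X → Bool) (x : X)
    (φ : ι → (A → Bool) → R) :
    C.saddleOp I x (∑ i ∈ s, φ i) = ∑ i ∈ s, C.saddleOp I x (φ i) := by
  let f : ((A → Bool) → R) →ₗ[R] ((A → Bool) → R) :=
    ⟨⟨C.saddleOp I x, C.saddleOp_add I x⟩, C.saddleOp_smul I x⟩
  exact map_sum f φ s

/-- Saddles at different crossings commute. -/
theorem saddleOp_comm [Finite A] (I : X → Bool) {x y : X} (φ : (A → Bool) → R)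
    (hφ : ∀ a b, C.rel I a b → mulArc a φ = mulArc b φ) :
    C.saddleOp (flip I x) y (C.saddleOp I x φ) = C.saddleOp (flip I y) x (C.saddleOp I y φ) := by
  have two : ∀ {a b a' b' : A}, (C.rel I a a' ∧ C.rel I b b') ∨ (C.rel I a b' ∧ C.rel I b a') →
      mulArc a φ + mulArc b φ = mulArc a' φ + mulArc b' φ := by
    rintro a b a' b' (⟨h, h'⟩ | ⟨h, h'⟩)
    · rw [hφ _ _ h, hφ _ _ h']
    · rw [hφ _ _ h, hφ _ _ h', add_comm]
  have hcomm := flip_comm I x y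
  have n1 := fun h => C.classSum_one_of_merge (I := I) (x := x) h
  have n2 := fun h => C.classSum_one_of_split (I := I) (x := x) h
  have n3 := fun h => C.classSum_one_of_merge (I := I) (x := y) h
  have n4 := fun h => C.classSum_one_of_split (I := I) (x := y) h
  have n5 := fun h => C.classSum_one_of_merge (I := flip I x) (x := y) h
  have n6 := fun h => C.classSum_one_of_split (I := flip I x) (x := y) h
  have n7 := fun h => C.classSum_one_of_merge (I := flip I y) (x := x) h
  have n8 := fun h => C.classSum_one_of_split (I := flip I y) (x := x) h
  rw [hcomm] at n5 n6
  by_cases hx : C.rel I (C.o x) (C.o' x) <;> by_cases hy : C.rel I (C.o y) (C.o' y)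
  · specialize n2 hx
    specialize n4 hy
    by_cases hxy : C.rel (flip I x) (C.o y) (C.o' y) <;>
      by_cases hyx : C.rel (flip I y) (C.o x) (C.o' x)
    · simp [saddleOp, hx, hy, hxy, hyx]
    · specialize n6 hxy
      specialize n7 hyx
      omega
    · specialize n5 hxy
      specialize n8 hyx
      omega
    · have h1 := (rel_of_split hx).1 hy
      simp only [saddleOp, hx, hy, hxy, hyx, if_true, if_false]
      refine two ?_
      have h2 : ∀ a, C.rel (flip I x) a (C.o x) → C.rel I a (C.o x) := fun a => le_of_split hx
      have h3 : ∀ a, C.rel (flip I x) a (C.o' x) → C.rel I a (C.o' x) := fun a => le_of_split hx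
      rcases h1 with h1 | ⟨h1, h1'⟩ | ⟨h1, h1'⟩
      · exact absurd h1 hxy
      · exact Or.inl ⟨h2 _ h1, h3 _ h1'⟩
      · exact Or.inr ⟨h3 _ h1, h2 _ h1'⟩
  · specialize n2 hx
    specialize n3 hy
    have hxy : ¬ C.rel (flip I x) (C.o y) (C.o' y) := by
      intro hxy
      specialize n6 hxy
      by_cases hyx : C.rel (flip I y) (C.o x) (C.o' x)
      · specialize n8 hyx; omega
      · specialize n7 hyx; omega
    specialize n5 hxy
    have hyx : C.rel (flip I y) (C.o x) (C.o' x) := by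
      by_contra hyx
      specialize n7 hyx; omega
    simp [saddleOp, hx, hy, hxy, hyx]
  · specialize n1 hx
    specialize n4 hy
    have hyx : ¬ C.rel (flip I y) (C.o x) (C.o' x) := by
      intro hyx
      specialize n8 hyx
      by_cases hxy : C.rel (flip I x) (C.o y) (C.o' y)
      · specialize n6 hxy; omega
      · specialize n5 hxy; omega
    specialize n7 hyx
    have hxy : C.rel (flip I x) (C.o y) (C.o' y) := by
      by_contra hxy
      specialize n5 hxy; omega
    simp [saddleOp, hx, hy, hxy, hyx]
  · specialize n1 hx
    specialize n3 hy
    by_cases hxy : C.rel (flip I x) (C.o y) (C.o' y) <;>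
      by_cases hyx : C.rel (flip I y) (C.o x) (C.o' x)
    · have h1 := (rel_flip_of_merge hx).1 hxy
      simp only [saddleOp, hx, hy, hxy, hyx, if_true, if_false]
      refine (two ?_).symm
      rcases h1 with h1 | ⟨h1, h1'⟩ | ⟨h1, h1'⟩
      · exact absurd h1 hy
      · exact Or.inl ⟨h1, h1'⟩
      · exact Or.inr ⟨h1, h1'⟩
    · specialize n6 hxy
      specialize n7 hyx
      omega
    · specialize n5 hxy
      specialize n8 hyx
      omega
    · simp only [saddleOp, hx, hy, hxy, hyx, if_false, mulArc_add]
      rw [mulArc_comm (C.o y) (C.o x), mulArc_comm (C.o y) (C.o' x),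
        mulArc_comm (C.o' y) (C.o x), mulArc_comm (C.o' y) (C.o' x)]
      abel

/-- The composition of the two saddles at a crossing. -/
theorem saddleOp_saddleOp_self (I : X → Bool) (x : X) (φ : (A → Bool) → R) :
    C.saddleOp (flip I x) x (C.saddleOp I x φ) = mulArc (C.o x) φ + mulArc (C.o' x) φ := by
  by_cases hx : C.rel I (C.o x) (C.o' x)
  · simp [saddleOp, hx, not_rel_flip hx]
  · simp [saddleOp, hx, rel_flip_ends hx]

/-- At most one arc of every circle belongs to `l`. -/
def Sparse (I : X → Bool) (l : A → Bool) : Prop :=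
  ∀ a b, l a = true → l b = true → C.rel I a b → a = b

open Classical in
/-- The monomial of the circles without an arc in `l`. -/
noncomputable def avoiding (I : X → Bool) (l : A → Bool) : C.Gen :=
  ⟨I, fun a => decide (¬ ∃ b, C.rel I a b ∧ l b = true), fun a b h => by
    have : ∀ c, C.rel I a c ↔ C.rel I b c := fun c => ⟨trans (symm h), trans h⟩
    simp [this]⟩

open Classical in
/-- The monomial of the circles without an arc in `l` and different from that of `o`. -/
noncomputable def avoiding' (I : X → Bool) (l : A → Bool) (o : A) : C.Gen :=
  ⟨I, fun a => decide ((¬ ∃ b, C.rel I a b ∧ l b = true) ∧ ¬ C.rel I a o), fun a b h => by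
    have : ∀ c, C.rel I a c ↔ C.rel I b c := fun c => ⟨trans (symm h), trans h⟩
    simp [this]⟩

open Classical in
/-- The encoding of chains by functions on sets of arcs. -/
noncomputable def encode (v : C.Gen → R) (I : X → Bool) (l : A → Bool) : R :=
  if C.Sparse I l then v (C.avoiding I l) else 0

theorem encode_injective {v : C.Gen → R} (h : C.encode v = 0) : v = 0 := by
  classical
  funext γ
  let l : A → Bool := fun a =>
    decide (γ.label a = false ∧ (Quotient.mk (C.setoid γ.res) a).out = a)
  have hs : C.Sparse γ.res l := by
    intro a b ha hb hab
    simp only [l, decide_eq_true_eq] at ha hb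
    have : Quotient.mk (C.setoid γ.res) a = Quotient.mk (C.setoid γ.res) b := Quotient.sound hab
    rw [← ha.2, ← hb.2, this]
  have hγ : C.avoiding γ.res l = γ := by
    refine Gen.ext rfl fun a => ?_
    have hout : C.rel γ.res a (Quotient.mk (C.setoid γ.res) a).out :=
      symm (Quotient.mk_out (s := C.setoid γ.res) a)
    cases hγa : γ.label a
    · simp only [avoiding, decide_eq_false_iff_not, not_not]
      refine ⟨_, hout, ?_⟩
      simp only [l, decide_eq_true_eq]
      refine ⟨by rw [← γ.label_eq hout, hγa], ?_⟩
      rw [Quotient.out_eq]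
    · simp only [avoiding, decide_eq_true_eq]
      rintro ⟨b, hb, hlb⟩
      simp only [l, decide_eq_true_eq] at hlb
      rw [← γ.label_eq hb, hγa] at hlb
      exact absurd hlb.1 (by simp)
  have := congrFun (congrFun h γ.res) l
  rw [encode, if_pos hs, hγ] at this
  exact this

open Classical in
theorem mulArc_encode (v : C.Gen → R) (I : X → Bool) (o : A) (l : A → Bool) :
    mulArc o (C.encode v I) l =
      if C.Sparse I l ∧ ¬ ∃ b, C.rel I o b ∧ l b = true then v (C.avoiding' I l o) else 0 := by
  rw [mulArc]
  by_cases ho : l o = true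
  · rw [if_pos ho, if_neg]
    exact fun h => h.2 ⟨o, refl _ _, ho⟩
  · rw [if_neg ho, encode]
    have h1 : C.Sparse I (Function.update l o true) ↔
        C.Sparse I l ∧ ¬ ∃ b, C.rel I o b ∧ l b = true := by
      constructor
      · intro hs
        refine ⟨fun a b ha hb hab => hs a b ?_ ?_ hab, ?_⟩
        · by_cases h : a = o <;> simp [h, ha]
        · by_cases h : b = o <;> simp [h, hb]
        · rintro ⟨b, hb, hlb⟩
          have hbo : b ≠ o := by rintro rfl; exact ho hlb
          exact hbo (hs b o (by simp [hbo, hlb]) (by simp) (symm hb))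
      · rintro ⟨hs, h⟩ a b ha hb hab
        by_cases hao : a = o <;> by_cases hbo : b = o
        · rw [hao, hbo]
        · subst hao
          rw [Function.update_of_ne hbo] at hb
          exact absurd ⟨b, hab, hb⟩ h
        · subst hbo
          rw [Function.update_of_ne hao] at ha
          exact absurd ⟨a, symm hab, ha⟩ h
        · rw [Function.update_of_ne hao] at ha
          rw [Function.update_of_ne hbo] at hb
          exact hs a b ha hb hab
    have h2 : C.avoiding I (Function.update l o true) = C.avoiding' I l o := by
      refine Gen.ext rfl fun a => ?_
      simp only [avoiding, avoiding', decide_eq_decide]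
      constructor
      · intro h
        refine ⟨fun ⟨b, hb, hlb⟩ => h ⟨b, hb, ?_⟩, fun hao => h ⟨o, hao, by simp⟩⟩
        by_cases h : b = o <;> simp [h, hlb]
      · rintro ⟨h, hao⟩ ⟨b, hb, hlb⟩
        by_cases hbo : b = o
        · exact hao (hbo ▸ hb)
        · rw [Function.update_of_ne hbo] at hlb
          exact h ⟨b, hb, hlb⟩
    simp only [h1, h2]

theorem mulArc_encode_eq (v : C.Gen → R) (I : X → Bool) {a b : A} (h : C.rel I a b) :
    mulArc a (C.encode v I) = mulArc b (C.encode v I) := by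
  classical
  funext l
  have h1 : ∀ c, C.rel I a c ↔ C.rel I b c := fun c => ⟨trans (symm h), trans h⟩
  have h2 : C.avoiding' I l a = C.avoiding' I l b := by
    refine Gen.ext rfl fun c => ?_
    simp only [avoiding', rel_comm (a := c), h1]
  rw [mulArc_encode, mulArc_encode, h2]
  simp only [h1]

open Classical in
/-- The saddle at `x`, applied to a chain. -/
noncomputable def saddleSum [Finite A] [Finite X] (x : X) (v : C.Gen → R) : C.Gen → R :=
  fun γ' => ∑ γ, if γ'.res = flip γ.res x ∧ C.Saddle γ.res x γ.label γ'.label then v γ else 0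

theorem encode_saddleSum_of_split [Finite A] [Finite X] (x : X) (v : C.Gen → R) (I : X → Bool)
    (hI : C.rel I (C.o x) (C.o' x)) :
    C.encode (C.saddleSum x v) (flip I x) = C.encode v I := by
  classical
  funext l
  have hI' := not_rel_flip hI
  have hrel := fun a b => rel_of_split (C := C) hI (a := a) (b := b)
  by_cases hJ : C.Sparse (flip I x) l
  swap
  · rw [encode, encode, if_neg hJ, if_neg]
    exact fun h => hJ fun a b ha hb hab => h a b ha hb (le_of_split hI hab)
  rw [encode, encode, if_pos hJ, saddleSum]
  have hoff : ∀ a, ¬ C.rel I a (C.o x) →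
      (C.avoiding (flip I x) l).label a = (C.avoiding I l).label a := by
    intro a ha
    simp only [avoiding, decide_eq_decide]
    have : ∀ b, C.rel I a b ↔ C.rel (flip I x) a b := by
      intro b
      rw [hrel]
      have h1 : ¬ C.rel (flip I x) a (C.o x) := fun h => ha (le_of_split hI h)
      have h2 : ¬ C.rel (flip I x) a (C.o' x) := fun h =>
        ha (trans (le_of_split hI h) (symm hI))
      tauto
    simp only [this]
  have hone : ∀ b, C.rel I (C.o x) b ↔
      C.rel (flip I x) (C.o x) b ∨ C.rel (flip I x) (C.o' x) b := by
    intro b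
    rw [hrel]
    have h1 : C.rel (flip I x) (C.o x) (C.o x) := refl _ _
    have h2 := rel_comm (C := C) (I := flip I x) (a := b) (b := C.o' x)
    have h3 : C.rel (flip I x) b (C.o x) ↔ C.rel (flip I x) (C.o x) b := rel_comm
    tauto
  have hon : ((C.avoiding (flip I x) l).label (C.o x) && (C.avoiding (flip I x) l).label (C.o' x)) =
      (C.avoiding I l).label (C.o x) := by
    simp only [avoiding, hone, or_and_right, exists_or, not_or, Bool.decide_and]
  by_cases hs : C.Sparse I l
  · rw [if_pos hs, Finset.sum_eq_single (C.avoiding I l)]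
    · rw [if_pos]
      refine ⟨rfl, fun a ha _ => (hoff a ha).symm, fun h => absurd hI h, fun _ => ⟨?_, hon.symm⟩⟩
      by_contra h
      simp only [avoiding, Bool.or_eq_true, decide_eq_true_eq, not_or, not_not] at h
      obtain ⟨⟨b, hb, hlb⟩, c, hc, hlc⟩ := h
      have : b = c := hs b c hlb hlc
        (trans (symm (le_of_split hI hb)) (trans hI (le_of_split hI hc)))
      subst this
      exact hI' (trans hb (symm hc))
    · intro γ _ hγ
      rw [if_neg]
      rintro ⟨h, h1, -, h2⟩
      have h' : γ.res = I := by
        have : flip I x = flip γ.res x := h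
        rw [← flip_flip γ.res x, ← this, flip_flip]
      rw [h'] at h1 h2
      refine hγ (Gen.ext h' fun a => ?_)
      by_cases ha : C.rel I a (C.o x)
      · rw [γ.label_eq (by rw [h']; exact ha), (h2 hI).2, hon]
        exact ((C.avoiding I l).label_eq ha).symm
      · rw [h1 a ha fun h => ha (trans h (symm hI)), hoff a ha]
    · simp
  · rw [if_neg hs]
    refine Finset.sum_eq_zero fun γ _ => if_neg ?_
    rintro ⟨h, -, -, h2⟩
    have h' : γ.res = I := by
      have : flip I x = flip γ.res x := h
      rw [← flip_flip γ.res x, ← this, flip_flip]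
    rw [h'] at h2
    refine hs fun a b ha hb hab => ?_
    rcases (hrel a b).1 hab with hab | ⟨h3, h4⟩ | ⟨h3, h4⟩
    · exact hJ a b ha hb hab
    · exfalso
      have := (h2 hI).1
      simp only [avoiding, Bool.or_eq_true, decide_eq_true_eq] at this
      rcases this with this | this
      · exact this ⟨a, symm h3, ha⟩
      · exact this ⟨b, symm h4, hb⟩
    · exfalso
      have := (h2 hI).1
      simp only [avoiding, Bool.or_eq_true, decide_eq_true_eq] at this
      rcases this with this | this
      · exact this ⟨b, symm h4, hb⟩
      · exact this ⟨a, symm h3, ha⟩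

theorem encode_saddleSum_of_merge [Finite A] [Finite X] (x : X) (v : C.Gen → R) (I : X → Bool)
    (hI : ¬ C.rel I (C.o x) (C.o' x)) :
    C.encode (C.saddleSum x v) (flip I x) =
      mulArc (C.o x) (C.encode v I) + mulArc (C.o' x) (C.encode v I) := by
  classical
  funext l
  rw [Pi.add_apply, mulArc_encode, mulArc_encode]
  have hrel := fun a b => rel_flip_of_merge (C := C) hI (a := a) (b := b)
  set P := ∃ b, C.rel I (C.o x) b ∧ l b = true with hP
  set P' := ∃ b, C.rel I (C.o' x) b ∧ l b = true with hP'
  have hsp : C.Sparse (flip I x) l ↔ C.Sparse I l ∧ ¬ (P ∧ P') := by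
    constructor
    · intro hs
      refine ⟨fun a b ha hb hab => hs a b ha hb (le_of_merge hI hab), ?_⟩
      rintro ⟨⟨a, ha, hla⟩, b, hb, hlb⟩
      have : a = b := hs a b hla hlb ((hrel a b).2 (Or.inr (Or.inl ⟨symm ha, symm hb⟩)))
      subst this
      exact hI (trans ha (symm hb))
    · rintro ⟨hs, hn⟩ a b ha hb hab
      rcases (hrel a b).1 hab with h | ⟨h, h'⟩ | ⟨h, h'⟩
      · exact hs a b ha hb h
      · exact absurd ⟨⟨a, symm h, ha⟩, b, symm h', hb⟩ hn
      · exact absurd ⟨⟨b, symm h', hb⟩, a, symm h, ha⟩ hn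
  by_cases hs : C.Sparse I l
  swap
  · rw [encode, if_neg fun h => hs (hsp.1 h).1, if_neg fun h => hs h.1, if_neg fun h => hs h.1,
      add_zero]
  by_cases hPP : P ∧ P'
  · rw [encode, if_neg fun h => (hsp.1 h).2 hPP, if_neg fun h => h.2 hPP.1,
      if_neg fun h => h.2 hPP.2, add_zero]
  rw [encode, if_pos (hsp.2 ⟨hs, hPP⟩), saddleSum]
  simp only [hs, true_and]
  have hoff : ∀ a, ¬ C.rel I a (C.o x) → ¬ C.rel I a (C.o' x) →
      ((C.avoiding (flip I x) l).label a = true ↔ ¬ ∃ b, C.rel I a b ∧ l b = true) := by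
    intro a h1 h2
    simp only [avoiding, decide_eq_true_eq]
    have : ∀ b, C.rel (flip I x) a b ↔ C.rel I a b := by
      intro b
      rw [hrel]
      tauto
    simp only [this]
  have hon : (C.avoiding (flip I x) l).label (C.o x) = true ↔ ¬ P ∧ ¬ P' := by
    have : ∀ b, C.rel (flip I x) (C.o x) b ↔ C.rel I (C.o x) b ∨ C.rel I (C.o' x) b := by
      intro b
      rw [hrel]
      refine or_congr Iff.rfl ⟨?_, fun h => Or.inl ⟨refl _ _, symm h⟩⟩
      rintro (⟨-, h⟩ | ⟨h, -⟩)
      · exact symm h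
      · exact absurd h hI
    simp only [avoiding, decide_eq_true_eq, this, or_and_right, exists_or, not_or, hP, hP']
  have hres : ∀ γ : C.Gen, (C.avoiding (flip I x) l).res = flip γ.res x ↔ γ.res = I := by
    intro γ
    constructor
    · intro h
      have : flip I x = flip γ.res x := h
      rw [← flip_flip γ.res x, ← this, flip_flip]
    · intro h
      rw [h]
      rfl
  have avo : ∀ o a, (C.avoiding' I l o).label a = true ↔
      (¬ ∃ b, C.rel I a b ∧ l b = true) ∧ ¬ C.rel I a o := fun o a => by simp [avoiding']
  -- the coefficient of `γ` is the sum of the coefficients on the other side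
  have main : ∀ γ : C.Gen, ((C.avoiding (flip I x) l).res = flip γ.res x ∧
      C.Saddle γ.res x γ.label (C.avoiding (flip I x) l).label) ↔
      (¬ P ∧ γ = C.avoiding' I l (C.o x)) ∨ (¬ P' ∧ γ = C.avoiding' I l (C.o' x)) := by
    intro γ
    rw [hres]
    constructor
    · rintro ⟨h, h1, h2, -⟩
      rw [h] at h1 h2
      obtain ⟨h3, h4⟩ := h2 hI
      have hγ : ∀ a, C.rel I a (C.o x) → γ.label a = γ.label (C.o x) :=
        fun a ha => γ.label_eq (by rw [h]; exact ha)
      have hγ' : ∀ a, C.rel I a (C.o' x) → γ.label a = γ.label (C.o' x) :=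
        fun a ha => γ.label_eq (by rw [h]; exact ha)
      have hPo : ∀ a, C.rel I a (C.o x) → ((∃ b, C.rel I a b ∧ l b = true) ↔ P) := by
        intro a ha
        have : ∀ b, C.rel I a b ↔ C.rel I (C.o x) b := fun b => ⟨trans (symm ha), trans ha⟩
        simp only [this, hP]
      have hPo' : ∀ a, C.rel I a (C.o' x) → ((∃ b, C.rel I a b ∧ l b = true) ↔ P') := by
        intro a ha
        have : ∀ b, C.rel I a b ↔ C.rel I (C.o' x) b := fun b => ⟨trans (symm ha), trans ha⟩
        simp only [this, hP']
      have hdisj : ∀ a, C.rel I a (C.o x) → ¬ C.rel I a (C.o' x) :=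
        fun a h h' => hI (trans (symm h) h')
      rw [Bool.eq_iff_iff, hon, Bool.or_eq_true] at h4
      by_cases hlo : γ.label (C.o x) = true
      · have hlo' : γ.label (C.o' x) = false := by simpa [hlo] using h3
        refine Or.inr ⟨(h4.2 (Or.inl hlo)).2, Gen.ext h fun a => ?_⟩
        rw [Bool.eq_iff_iff, avo]
        by_cases ha : C.rel I a (C.o x)
        · rw [hγ a ha, hPo a ha]
          simp [hlo, hdisj a ha, (h4.2 (Or.inl hlo)).1]
        · by_cases ha' : C.rel I a (C.o' x)
          · rw [hγ' a ha', hlo']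
            simp [ha']
          · rw [h1 a ha ha', hoff a ha ha']
            simp [ha']
      · by_cases hlo' : γ.label (C.o' x) = true
        · refine Or.inl ⟨(h4.2 (Or.inr hlo')).1, Gen.ext h fun a => ?_⟩
          rw [Bool.eq_iff_iff, avo]
          by_cases ha : C.rel I a (C.o x)
          · rw [hγ a ha]
            simp [hlo, ha]
          · by_cases ha' : C.rel I a (C.o' x)
            · rw [hγ' a ha', hlo', hPo' a ha']
              simp [ha, (h4.2 (Or.inr hlo')).2]
            · rw [h1 a ha ha', hoff a ha ha']
              simp [ha]
        · -- both labels are `1`, so exactly one of the two circles has an arc in `l`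
          simp only [hlo, hlo', Bool.false_eq_true, or_self, iff_false] at h4
          by_cases hPc : P
          · have hPc' : ¬ P' := fun h => hPP ⟨hPc, h⟩
            refine Or.inr ⟨hPc', Gen.ext h fun a => ?_⟩
            rw [Bool.eq_iff_iff, avo]
            by_cases ha : C.rel I a (C.o x)
            · rw [hγ a ha, hPo a ha]
              simp [hlo, hPc]
            · by_cases ha' : C.rel I a (C.o' x)
              · rw [hγ' a ha']
                simp [hlo', ha']
              · rw [h1 a ha ha', hoff a ha ha']
                simp [ha']
          · have hPc' : P' := by
              by_contra h
              exact h4 ⟨hPc, h⟩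
            refine Or.inl ⟨hPc, Gen.ext h fun a => ?_⟩
            rw [Bool.eq_iff_iff, avo]
            by_cases ha : C.rel I a (C.o x)
            · rw [hγ a ha]
              simp [hlo, ha]
            · by_cases ha' : C.rel I a (C.o' x)
              · rw [hγ' a ha', hPo' a ha']
                simp [hlo', hPc']
              · rw [h1 a ha ha', hoff a ha ha']
                simp [ha]
    · have ho : C.rel I (C.o x) (C.o x) := refl _ _
      have ho' : C.rel I (C.o' x) (C.o' x) := refl _ _
      have hI' : ¬ C.rel I (C.o' x) (C.o x) := fun h => hI (symm h)
      rintro (⟨hp, rfl⟩ | ⟨hp, rfl⟩)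
      · refine ⟨rfl, fun a ha ha' => ?_, fun _ => ⟨?_, ?_⟩, fun h => absurd h hI⟩
        · rw [Bool.eq_iff_iff, avo, hoff a ha ha']
          exact and_iff_left ha
        · rw [← Bool.not_eq_true, Bool.and_eq_true, avo]
          exact fun h => h.1.2 ho
        · rw [Bool.eq_iff_iff, Bool.or_eq_true, hon, avo, avo, ← hP, ← hP']
          simp [ho, hI', hp]
      · refine ⟨rfl, fun a ha ha' => ?_, fun _ => ⟨?_, ?_⟩, fun h => absurd h hI⟩
        · rw [Bool.eq_iff_iff, avo, hoff a ha ha']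
          exact and_iff_left ha'
        · rw [← Bool.not_eq_true, Bool.and_eq_true, avo, avo]
          exact fun h => h.2.2 ho'
        · rw [Bool.eq_iff_iff, Bool.or_eq_true, hon, avo, avo, ← hP, ← hP']
          simp [ho', hI, hp]
  have hne : ¬ P → C.avoiding' I l (C.o x) ≠ C.avoiding' I l (C.o' x) := by
    intro hp h
    have h1 := avo (C.o x) (C.o x)
    rw [h, avo] at h1
    exact (h1.1 ⟨hp, hI⟩).2 (refl _ _)
  have split : ∀ γ, (if (C.avoiding (flip I x) l).res = flip γ.res x ∧
      C.Saddle γ.res x γ.label (C.avoiding (flip I x) l).label then v γ else 0) =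
      (if γ = C.avoiding' I l (C.o x) then (if ¬ P then v γ else 0) else 0) +
      (if γ = C.avoiding' I l (C.o' x) then (if ¬ P' then v γ else 0) else 0) := by
    intro γ
    simp only [main γ]
    by_cases h1 : γ = C.avoiding' I l (C.o x) <;> by_cases h2 : γ = C.avoiding' I l (C.o' x)
    · by_cases hp : P
      · simp [h2, hp]
      · exact absurd (h1.symm.trans h2) (hne hp)
    · rw [if_pos h1, if_neg h2, add_zero]
      refine if_congr ?_ rfl rfl
      rw [or_iff_left fun h => h2 h.2]
      exact and_iff_left h1
    · rw [if_neg h1, if_pos h2, zero_add]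
      refine if_congr ?_ rfl rfl
      rw [or_iff_right fun h => h1 h.2]
      exact and_iff_left h2
    · simp [h1, h2]
  rw [Finset.sum_congr rfl fun γ _ => split γ, Finset.sum_add_distrib, Finset.sum_ite_eq',
    Finset.sum_ite_eq']
  simp

theorem encode_saddleSum [Finite A] [Finite X] (x : X) (v : C.Gen → R) (J : X → Bool) :
    C.encode (C.saddleSum x v) J = C.saddleOp (flip J x) x (C.encode v (flip J x)) := by
  conv_lhs => rw [← flip_flip J x]
  by_cases h : C.rel (flip J x) (C.o x) (C.o' x)
  · rw [C.encode_saddleSum_of_split x v _ h, saddleOp, if_pos h]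
  · rw [C.encode_saddleSum_of_merge x v _ h, saddleOp, if_neg h]

/-- In the encoding the differential is a sum of saddle operators, which are built from commuting
operators. -/
theorem encode_mulVec [Finite A] [Fintype X] {u : X → R} {e : (X → Bool) → X → ℤˣ}
    (he : IsEdgeSign e) (v : C.Gen → R) (J : X → Bool) :
    C.encode ((C.mat u e).mulVec v) J =
      ∑ x, (((e J x : ℤ) : R) * cf u x (J x)) •
        C.saddleOp (flip J x) x (C.encode v (flip J x)) := by
  classical
  have h1 : ∀ γ', ((C.mat u e).mulVec v) γ' =
      ∑ x, ((e γ'.res x : ℤ) : R) * cf u x (γ'.res x) * C.saddleSum x v γ' := by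
    intro γ'
    simp only [Matrix.mulVec, dotProduct, mat_apply, saddleSum, Finset.sum_mul, Finset.mul_sum]
    rw [Finset.sum_comm]
    refine Finset.sum_congr rfl fun x _ => Finset.sum_congr rfl fun γ _ => ?_
    by_cases h : γ'.res = flip γ.res x ∧ C.Saddle γ.res x γ.label γ'.label
    · rw [if_pos h, if_pos h, h.1, he.symm]
    · rw [if_neg h, if_neg h, zero_mul, mul_zero]
  funext l
  simp only [Finset.sum_apply, Pi.smul_apply, ← C.encode_saddleSum, smul_eq_mul]
  simp only [encode]
  split_ifs
  · rw [h1]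
    rfl
  · simp

/-- The differential squares to zero. -/
theorem mat_mul_mat [Finite A] [Fintype X] {u : X → R} {e : (X → Bool) → X → ℤˣ}
    (he : IsEdgeSign e) (hu : C.Flat u) : C.mat u e * C.mat u e = 0 := by
  classical
  suffices H : ∀ v, (C.mat u e).mulVec ((C.mat u e).mulVec v) = 0 by
    refine Matrix.ext_of_mulVec_single fun γ => ?_
    rw [← Matrix.mulVec_mulVec, H, Matrix.zero_mulVec]
  intro v
  refine C.encode_injective (funext fun K => ?_)
  rw [C.encode_mulVec he]
  simp only [C.encode_mulVec he, saddleOp_sum, saddleOp_smul, Finset.smul_sum, smul_smul]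
  rw [← Finset.sum_product']
  set t : X × X → (A → Bool) → R := fun p =>
    (((e K p.1 : ℤ) : R) * cf u p.1 (K p.1) *
      (((e (flip K p.1) p.2 : ℤ) : R) * cf u p.2 (flip K p.1 p.2))) •
    C.saddleOp (flip K p.1) p.1 (C.saddleOp (flip (flip K p.1) p.2) p.2
      (C.encode v (flip (flip K p.1) p.2))) with ht
  change ∑ p ∈ Finset.univ ×ˢ Finset.univ, t p = 0
  rw [Finset.univ_product_univ, ← Finset.sum_filter_add_sum_filter_not _ (fun p : X × X => p.1 = p.2)]
  have h1 : ∑ p : X × X with p.1 = p.2, t p = ∑ x, t (x, x) := by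
    refine Finset.sum_bij (fun p _ => p.1) (by simp) ?_ ?_ ?_
    · rintro ⟨a, b⟩ h ⟨c, d⟩ h' h''
      simp at h h' h''
      simp [← h, ← h', h'']
    · exact fun x _ => ⟨(x, x), by simp, rfl⟩
    · rintro ⟨a, b⟩ h
      simp at h
      simp [h]
  have h2 : ∑ x, t (x, x) = 0 := by
    funext l
    have h3 : ∀ x, t (x, x) l = u x * (mulArc (C.o x) (C.encode v K) l +
        mulArc (C.o' x) (C.encode v K) l) := by
      intro x
      simp only [ht, he.symm, flip_self]
      rw [flip_flip, saddleOp_saddleOp_self, mul_mul_mul_comm, cf_mul_cf_not]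
      have : ((e K x : ℤ) : R) * ((e K x : ℤ) : R) = 1 := by
        rw [← Int.cast_mul, ← Units.val_mul, Int.units_mul_self]
        simp
      rw [this, one_mul]
      rfl
    rw [Finset.sum_apply, Finset.sum_congr rfl fun x _ => h3 x]
    exact hu K (fun a => mulArc a (C.encode v K) l) fun a b hab => by
      rw [C.mulArc_encode_eq v K hab]
  have h4 : ∑ p : X × X with ¬ p.1 = p.2, t p = 0 := by
    refine Finset.sum_involution (fun p _ => p.swap) ?_ ?_ ?_ ?_
    · rintro ⟨y, x⟩ h
      simp only [Finset.mem_filter, Finset.mem_univ, true_and] at h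
      have hc := C.saddleOp_comm (flip (flip K y) x) (x := x) (y := y)
        (C.encode v (flip (flip K y) x)) fun a b hab => C.mulArc_encode_eq v _ hab
      simp only [ht, Prod.swap_prod_mk]
      rw [flip_flip] at hc
      rw [hc, flip_comm K y x, flip_flip, ← add_smul]
      convert zero_smul R _ using 2
      have hs := congrArg (fun z : ℤˣ => ((z : ℤ) : R)) (he.square K y x h)
      simp only [Units.val_mul, Units.val_neg, Int.cast_mul, Int.cast_neg] at hs
      rw [flip_of_ne _ h, flip_of_ne _ (Ne.symm h)]
      linear_combination (cf u y (K y) * cf u x (K x)) * hs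
    · rintro ⟨y, x⟩ h _ h'
      simp only [Finset.mem_filter, Finset.mem_univ, true_and] at h
      simp only [Prod.swap_prod_mk, Prod.mk.injEq] at h'
      exact h h'.1.symm
    · rintro ⟨y, x⟩ h
      simp only [Finset.mem_filter, Finset.mem_univ, true_and, Prod.swap_prod_mk] at h ⊢
      exact Ne.symm h
    · rintro ⟨y, x⟩ _
      rfl
  rw [h1, h2, h4, add_zero]

end ResCube

end LinkSplitting

namespace LinkSplitting

namespace ResCube

variable {A A' O X X' : Type*} [DecidableEq X] [DecidableEq X'] {C : ResCube A X}
  {C' : ResCube A' X'}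

/-! ### Saddles depend on the circles only -/

/-- Merge and split are dual to each other under the exchange of `1` and `x`. -/
theorem saddle_dual_of_merge {I : X → Bool} {x : X} (h : ¬ C.rel I (C.o x) (C.o' x))
    (ℓ ℓ' : A → Bool) :
    C.Saddle I x ℓ ℓ' ↔ C.Saddle (flip I x) x (fun a => !ℓ' a) (fun a => !ℓ a) := by
  have hJ := rel_flip_ends h
  have hoff : ∀ a, (¬ C.rel (flip I x) a (C.o x) ∧ ¬ C.rel (flip I x) a (C.o' x)) ↔
      (¬ C.rel I a (C.o x) ∧ ¬ C.rel I a (C.o' x)) := by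
    intro a
    constructor
    · exact fun h' => ⟨fun h1 => h'.1 (le_of_merge h h1), fun h1 => h'.2 (le_of_merge h h1)⟩
    · intro h'
      have : ¬ C.rel (flip I x) a (C.o x) := by
        rw [rel_flip_of_merge h]
        rintro (h1 | ⟨h1, -⟩ | ⟨h1, -⟩)
        exacts [h'.1 h1, h'.1 h1, h'.2 h1]
      exact ⟨this, fun h1 => this (trans h1 (symm hJ))⟩
  constructor
  · rintro ⟨h1, h2, -⟩
    refine ⟨fun a ha ha' => ?_, fun h' => absurd hJ h', fun _ => ?_⟩
    · have := (hoff a).1 ⟨ha, ha'⟩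
      exact congrArg not (h1 a this.1 this.2).symm
    · have h3 := h2 h
      refine ⟨?_, ?_⟩
      · rw [← Bool.not_and, h3.1]; rfl
      · simp only [h3.2, Bool.not_or]
  · rintro ⟨h1, -, h2⟩
    refine ⟨fun a ha ha' => ?_, fun _ => ?_, fun h' => absurd h' h⟩
    · have := (hoff a).2 ⟨ha, ha'⟩
      have := h1 a this.1 this.2
      exact (Bool.not_inj this).symm
    · have h3 := h2 hJ
      rw [← Bool.not_and, ← Bool.not_or] at h3
      exact ⟨by simpa only [Bool.not_eq_true'] using h3.1, Bool.not_inj h3.2⟩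

/-- Reversing a saddle amounts to interchanging the labels. -/
theorem saddle_dual (I : X → Bool) (x : X) (ℓ ℓ' : A → Bool) :
    C.Saddle I x ℓ ℓ' ↔ C.Saddle (flip I x) x (fun a => !ℓ' a) (fun a => !ℓ a) := by
  by_cases h : C.rel I (C.o x) (C.o' x)
  · have := saddle_dual_of_merge (not_rel_flip h) (fun a => !ℓ' a) (fun a => !ℓ a)
    simp only [flip_flip, Bool.not_not] at this
    exact this.symm
  · exact saddle_dual_of_merge h ℓ ℓ'

/-- The coefficient of a saddle, in terms of the relation of lying on the same circle before and
after. -/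
def PartitionSaddle (s s' : O → O → Prop) (m m' : O → Bool) : Prop :=
  ∃ o o', ((¬ s o o' ∧ s' o o') ∨ (s o o' ∧ ¬ s' o o')) ∧
    ∀ a, (¬ s a o → ¬ s a o' → m a = m' a) ∧
    (¬ s o o' → (m o && m o') = false ∧ m' o = (m o || m o')) ∧
    (s o o' → (m' o || m' o') = true ∧ m o = (m' o && m' o'))

/-- `Z` is a circle of the resolution `I`. -/
def IsCircle (C : ResCube A X) (I : X → Bool) (Z : A → Prop) : Prop :=
  ∀ a b, Z a → (C.rel I a b ↔ Z b)

theorem IsCircle.not_ends {I : X → Bool} {x : X} {Z : A → Prop} (hI : C.IsCircle I Z)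
    (hJ : C.IsCircle (flip I x) Z) {a b : A} (hab : C.rel I a b ↔ ¬ C.rel (flip I x) a b) :
    ¬ Z a := by
  intro ha
  rw [hI a b ha, hJ a b ha] at hab
  tauto

theorem saddle_iff_of_merge (f : O → A) (Z : A → Prop) {x : X} {γ γ' : C.Gen}
    (hx : γ'.res = flip γ.res x) (hI : ¬ C.rel γ.res (C.o x) (C.o' x))
    (hZ : C.IsCircle γ.res Z) (hZ' : C.IsCircle γ'.res Z)
    (cov : ∀ a, Z a ∨ ∃ b, C.rel γ.res a (f b)) (hl : ∀ a, Z a → γ.label a = γ'.label a) :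
    C.Saddle γ.res x γ.label γ'.label ↔
      ∃ o o', (¬ C.rel γ.res (f o) (f o') ∧ C.rel γ'.res (f o) (f o')) ∧
      (∀ a, ¬ C.rel γ.res (f a) (f o) → ¬ C.rel γ.res (f a) (f o') →
        γ.label (f a) = γ'.label (f a)) ∧
      (γ.label (f o) && γ.label (f o')) = false ∧
        γ'.label (f o) = (γ.label (f o) || γ.label (f o')) := by
  have hle : ∀ {a b}, C.rel γ.res a b → C.rel γ'.res a b := fun h => by
    rw [hx]; exact le_of_merge hI h
  have hJ : C.rel γ'.res (C.o x) (C.o' x) := by rw [hx]; exact rel_flip_ends hI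
  rw [hx] at hZ'
  have hz1 : ¬ Z (C.o x) := hZ.not_ends hZ' (C.surgery _ _)
  have hz2 : ¬ Z (C.o' x) := fun h => hI (symm ((hZ _ _ h).2 (by
    rw [← hZ' _ (C.o x) h, ← hx]; exact symm hJ)))
  constructor
  · rintro ⟨h1, h2, -⟩
    obtain ⟨b, hb⟩ := (cov (C.o x)).resolve_left hz1
    obtain ⟨b', hb'⟩ := (cov (C.o' x)).resolve_left hz2
    refine ⟨b, b', ⟨fun h => hI (trans hb (trans h (symm hb'))),
      trans (symm (hle hb)) (trans hJ (hle hb'))⟩, fun a h h' => ?_, ?_⟩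
    · exact h1 _ (fun h3 => h (trans h3 hb)) (fun h3 => h' (trans h3 hb'))
    · rw [← γ.label_eq hb, ← γ.label_eq hb', ← γ'.label_eq (hle hb)]
      exact h2 hI
  · rintro ⟨b, b', ⟨h1, h2⟩, h3, h4, h5⟩
    have ends : (C.rel γ.res (f b) (C.o x) ∧ C.rel γ.res (f b') (C.o' x)) ∨
        (C.rel γ.res (f b) (C.o' x) ∧ C.rel γ.res (f b') (C.o x)) := by
      rw [hx, rel_flip_of_merge hI] at h2
      exact h2.resolve_left h1
    have off : ∀ a, ¬ C.rel γ.res a (f b) → ¬ C.rel γ.res a (f b') → γ.label a = γ'.label a := by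
      intro a ha ha'
      rcases cov a with h | ⟨c, hc⟩
      · exact hl a h
      · rw [γ.label_eq hc, γ'.label_eq (hle hc)]
        exact h3 c (fun h => ha (trans hc h)) (fun h => ha' (trans hc h))
    refine ⟨fun a ha ha' => off a (fun h => ?_) (fun h => ?_), fun _ => ?_, fun h => absurd h hI⟩
    · rcases ends with e | e
      exacts [ha (trans h e.1), ha' (trans h e.1)]
    · rcases ends with e | e
      exacts [ha' (trans h e.2), ha (trans h e.2)]
    · rcases ends with e | e
      · rw [← γ.label_eq e.1, ← γ.label_eq e.2, ← γ'.label_eq (hle e.1)]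
        exact ⟨h4, h5⟩
      · rw [← γ.label_eq e.1, ← γ.label_eq e.2, ← γ'.label_eq (hle e.2), ← γ'.label_eq h2, h5,
          Bool.and_comm, Bool.or_comm]
        exact ⟨h4, rfl⟩

/-- The monomial with the opposite labels. -/
def Gen.neg (γ : C.Gen) : C.Gen := ⟨γ.res, fun a => !γ.label a, fun a b h => by rw [γ.label_eq h]⟩

/-- Saddles can be computed on any collection of arcs which meets all circles, except for circles
`Z` on which nothing happens. -/
theorem saddle_iff (f : O → A) (Z : A → Prop) {x : X} {γ γ' : C.Gen}
    (hx : γ'.res = flip γ.res x) (hZ : C.IsCircle γ.res Z) (hZ' : C.IsCircle γ'.res Z)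
    (cov : ∀ a, Z a ∨ ∃ b, C.rel γ.res a (f b)) (cov' : ∀ a, Z a ∨ ∃ b, C.rel γ'.res a (f b))
    (hl : ∀ a, Z a → γ.label a = γ'.label a) :
    C.Saddle γ.res x γ.label γ'.label ↔
      PartitionSaddle (fun a b => C.rel γ.res (f a) (f b)) (fun a b => C.rel γ'.res (f a) (f b))
        (fun a => γ.label (f a)) (fun a => γ'.label (f a)) := by
  by_cases hI : C.rel γ.res (C.o x) (C.o' x)
  · have hle : ∀ {a b}, C.rel γ'.res a b → C.rel γ.res a b := fun h => by
      rw [hx] at h; exact le_of_split hI h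
    have hI' : ¬ C.rel γ'.res (C.o x) (C.o' x) := by rw [hx]; exact not_rel_flip hI
    have hx' : γ.res = flip γ'.res x := by rw [hx, flip_flip]
    have key := saddle_iff_of_merge f Z (γ := γ'.neg) (γ' := γ.neg) hx' hI' hZ' hZ cov'
      (fun a ha => congrArg not (hl a ha).symm)
    rw [saddle_dual, ← hx]
    refine key.trans (exists_congr fun o => exists_congr fun o' => ?_)
    have hoff : (C.rel γ.res (f o) (f o') ∧ ¬ C.rel γ'.res (f o) (f o')) → ∀ a,
        (¬ C.rel γ'.res (f a) (f o) ∧ ¬ C.rel γ'.res (f a) (f o')) ↔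
        (¬ C.rel γ.res (f a) (f o) ∧ ¬ C.rel γ.res (f a) (f o')) := by
      rintro ⟨h1, h2⟩ a
      rw [rel_of_split hI, ← hx] at h1
      have h1 := h1.resolve_left h2
      rw [rel_of_split hI, rel_of_split hI, ← hx]
      have t : ∀ {b c}, C.rel γ'.res b c → (C.rel γ'.res (f a) b ↔ C.rel γ'.res (f a) c) :=
        fun h => ⟨fun h' => trans h' h, fun h' => trans h' (symm h)⟩
      rcases h1 with ⟨h3, h4⟩ | ⟨h3, h4⟩ <;> rw [t h3, t h4] <;> tauto
    constructor
    · rintro ⟨⟨h1, h2⟩, h3, h4, h5⟩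
      have h12 : C.rel γ.res (f o) (f o') ∧ ¬ C.rel γ'.res (f o) (f o') := ⟨h2, h1⟩
      refine ⟨Or.inr h12, fun a => ⟨fun ha ha' => ?_, fun h => absurd h2 h, fun _ => ?_⟩⟩
      · have := (hoff h12 a).2 ⟨ha, ha'⟩
        exact (Bool.not_inj (h3 a this.1 this.2)).symm
      · simp only [Gen.neg, ← Bool.not_and, ← Bool.not_or] at h4 h5
        exact ⟨by simpa only [Bool.not_eq_false'] using h4, Bool.not_inj h5⟩
    · rintro ⟨h1, h2⟩
      have h12 := h1.resolve_left fun h => h.1 (hle h.2)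
      refine ⟨⟨h12.2, h12.1⟩, fun a ha ha' => ?_, ?_, ?_⟩
      · have := (hoff h12 a).1 ⟨ha, ha'⟩
        exact congrArg not ((h2 a).1 this.1 this.2).symm
      · have := ((h2 o).2.2 h12.1).1
        simp only [Gen.neg, ← Bool.not_or]
        rw [this]; rfl
      · have := ((h2 o).2.2 h12.1).2
        simp only [Gen.neg, ← Bool.not_and]
        exact congrArg not this
  · have hle : ∀ {a b}, C.rel γ.res a b → C.rel γ'.res a b := fun h => by
      rw [hx]; exact le_of_merge hI h
    rw [saddle_iff_of_merge f Z hx hI hZ hZ' cov hl]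
    refine exists_congr fun o => exists_congr fun o' => ?_
    constructor
    · rintro ⟨h1, h3, h4⟩
      exact ⟨Or.inl h1, fun a => ⟨h3 a, fun _ => h4, fun h => absurd h h1.1⟩⟩
    · rintro ⟨h1, h2⟩
      have h1 := h1.resolve_right fun h => h.2 (hle h.1)
      exact ⟨h1, fun a => (h2 a).1, (h2 o).2.1 h1.1⟩

/-- The monomials `γ` and `δ` of two cubes look the same on the arcs `O`. -/
def Matches (f : O → A) (f' : O → A') (γ : C.Gen) (δ : C'.Gen) : Prop :=
  (∀ a b, C.rel γ.res (f a) (f b) ↔ C'.rel δ.res (f' a) (f' b)) ∧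
    ∀ a, γ.label (f a) = δ.label (f' a)

theorem saddle_congr {f : O → A} {f' : O → A'} {γ₁ γ₂ : C.Gen} {δ₁ δ₂ : C'.Gen} {x : X} {x' : X'}
    (m₁ : Matches f f' γ₁ δ₁) (m₂ : Matches f f' γ₂ δ₂) (hx : γ₂.res = flip γ₁.res x)
    (hx' : δ₂.res = flip δ₁.res x') (cov₁ : ∀ a, ∃ b, C.rel γ₁.res a (f b))
    (cov₂ : ∀ a, ∃ b, C.rel γ₂.res a (f b)) (Z : A' → Prop) (hZ₁ : C'.IsCircle δ₁.res Z)
    (hZ₂ : C'.IsCircle δ₂.res Z) (cov₁' : ∀ a, Z a ∨ ∃ b, C'.rel δ₁.res a (f' b))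
    (cov₂' : ∀ a, Z a ∨ ∃ b, C'.rel δ₂.res a (f' b))
    (hl : ∀ a, Z a → δ₁.label a = δ₂.label a) :
    C.Saddle γ₁.res x γ₁.label γ₂.label ↔ C'.Saddle δ₁.res x' δ₁.label δ₂.label := by
  rw [saddle_iff f (fun _ => False) hx (fun _ _ h => h.elim) (fun _ _ h => h.elim)
    (fun a => Or.inr (cov₁ a)) (fun a => Or.inr (cov₂ a)) (fun _ h => h.elim),
    saddle_iff f' Z hx' hZ₁ hZ₂ cov₁' cov₂' hl]
  simp only [m₁.1, m₁.2, m₂.1, m₂.2]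

theorem Gen.ext_of_cover {f : O → A} {Z : A → Prop} {γ δ : C.Gen} (h : γ.res = δ.res)
    (cov : ∀ a, Z a ∨ ∃ b, C.rel γ.res a (f b)) (hf : ∀ a, γ.label (f a) = δ.label (f a))
    (hZ : ∀ a, Z a → γ.label a = δ.label a) : γ = δ := by
  refine Gen.ext h fun a => ?_
  rcases cov a with ha | ⟨b, hb⟩
  · exact hZ a ha
  · rw [γ.label_eq hb, δ.label_eq (by rw [← h]; exact hb), hf]

theorem exists_gen (f : O → A) {Z : A → Prop} {I : X → Bool} (hZ : C.IsCircle I Z)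
    (cov : ∀ a, Z a ∨ ∃ b, C.rel I a (f b)) (hfZ : ∀ a, ¬ Z (f a)) (m : O → Bool)
    (hm : ∀ a b, C.rel I (f a) (f b) → m a = m b) (z : Bool) :
    ∃ γ : C.Gen, γ.res = I ∧ (∀ a, γ.label (f a) = m a) ∧ ∀ a, Z a → γ.label a = z := by
  classical
  let ℓ : A → Bool := fun a => if h : Z a then z else m ((cov a).resolve_left h).choose
  have hℓ : ∀ a b, C.rel I a (f b) → ℓ a = m b := by
    intro a b hab
    have h : ¬ Z a := fun h => hfZ b ((hZ a _ h).1 hab)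
    simp only [ℓ, dif_neg h]
    exact hm _ _ (trans (symm ((cov a).resolve_left h).choose_spec) hab)
  refine ⟨⟨I, ℓ, fun a b hab => ?_⟩, rfl, fun a => hℓ _ _ (refl _ _), fun a ha => by
    simp only [ℓ, dif_pos ha]⟩
  rcases cov a with h | ⟨c, hc⟩
  · have h' := (hZ a b h).1 hab
    simp only [ℓ, dif_pos h, dif_pos h']
  · rw [hℓ a c hc, hℓ b c (trans (symm hab) hc)]

/-- Matching monomials have the same weight, up to the contribution of an additional circle. -/
theorem wt_of_matches [Finite A] [Finite A'] {f' : A → A'} {γ : C.Gen} {δ : C'.Gen}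
    (m : Matches id f' γ δ) {η : A → ℤ} {η' : A' → ℤ} (hη : ∀ a b, C.rel γ.res a b → η a = η b)
    (hη' : ∀ a b, C'.rel δ.res a b → η' a = η' b) (hηη' : ∀ a, η a = η' (f' a))
    (cov : ∀ a, ∃ b, C'.rel δ.res (f' b) a) : C'.wt η' δ = C.wt η γ := by
  refine classSum_congr (s := C.setoid γ.res) (s' := C'.setoid δ.res) (fun a b h => ?_)
    (fun a b h => ?_) f' m.1 (fun a => ?_) cov
  · rw [hη a b h, γ.label_eq h]
  · rw [hη' a b h, δ.label_eq h]
  · rw [hηη', ← m.2]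
    rfl

/-! ### Small circles -/

/-- Exactly one of the two strands at the crossing `v` belongs to `Z`. -/
def EndIn (C : ResCube A X) (Z : A → Prop) (v : X) : Prop :=
  (Z (C.o v) ∧ ¬ Z (C.o' v)) ∨ (¬ Z (C.o v) ∧ Z (C.o' v))

open Classical in
/-- The strand at `v` that does not belong to `Z`. -/
noncomputable def outerEnd (C : ResCube A X) (Z : A → Prop) (v : X) : A :=
  if Z (C.o v) then C.o' v else C.o v

theorem EndIn.not_outerEnd {Z : A → Prop} {v : X} (h : C.EndIn Z v) : ¬ Z (C.outerEnd Z v) := by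
  rw [outerEnd]
  rcases h with h | h
  · rw [if_pos h.1]; exact h.2
  · rw [if_neg h.1]; exact h.1

theorem EndIn.not_rel {Z : A → Prop} {v : X} (h : C.EndIn Z v) {I : X → Bool}
    (hZ : C.IsCircle I Z) : ¬ C.rel I (C.o v) (C.o' v) := by
  intro h'
  rcases h with h | h
  · exact h.2 ((hZ _ _ h.1).1 h')
  · exact h.1 ((hZ _ _ h.2).1 (symm h'))

/-- Changing the resolution at `v` merges the circle `Z` into that of the outer strand. -/
theorem EndIn.rel_flip {Z : A → Prop} {v : X} (h : C.EndIn Z v) {I : X → Bool}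
    (hZ : C.IsCircle I Z) (a b : A) : C.rel (flip I v) a b ↔
      C.rel I a b ∨ (Z a ∧ C.rel I b (C.outerEnd Z v)) ∨ (C.rel I a (C.outerEnd Z v) ∧ Z b) := by
  have hz : ∀ {z}, Z z → ∀ a, C.rel I a z ↔ Z a := fun h1 a => by rw [rel_comm, hZ _ _ h1]
  rw [rel_flip_of_merge (h.not_rel hZ), outerEnd]
  rcases h with h | h
  · rw [if_pos h.1, hz h.1, hz h.1]
  · rw [if_neg h.1, hz h.2, hz h.2]
    tauto

theorem EndIn.rel_flip_of_not {Z : A → Prop} {v : X} (h : C.EndIn Z v) {I : X → Bool}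
    (hZ : C.IsCircle I Z) {a b : A} (ha : ¬ Z a) (hb : ¬ Z b) :
    C.rel (flip I v) a b ↔ C.rel I a b := by
  rw [h.rel_flip hZ]
  tauto

theorem EndIn.rel_flip_outerEnd {Z : A → Prop} {v : X} (h : C.EndIn Z v) {I : X → Bool}
    (hZ : C.IsCircle I Z) {a : A} (ha : Z a) : C.rel (flip I v) a (C.outerEnd Z v) :=
  (h.rel_flip hZ _ _).2 (Or.inr (Or.inl ⟨ha, refl _ _⟩))

open Classical in
/-- The labelling after the circle `Z` has been merged into that of the outer strand at `v`, which
keeps its label. -/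
noncomputable def absorb (C : ResCube A X) (Z : A → Prop) (v : X) (γ : C.Gen) : C.Gen :=
  if h : C.EndIn Z v ∧ C.IsCircle γ.res Z then
    ⟨flip γ.res v, fun a => if Z a then γ.label (C.outerEnd Z v) else γ.label a, by
      intro a b hab
      rw [h.1.rel_flip h.2] at hab
      rcases hab with hab | ⟨ha, hb⟩ | ⟨ha, hb⟩
      · by_cases ha : Z a
        · rw [if_pos ha, if_pos ((h.2 a b ha).1 hab)]
        · have hb : ¬ Z b := fun hb => ha ((h.2 b a hb).1 (symm hab))
          rw [if_neg ha, if_neg hb, γ.label_eq hab]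
      · have hb' : ¬ Z b := fun hb' => h.1.not_outerEnd ((h.2 _ _ hb').1 hb)
        rw [if_pos ha, if_neg hb', γ.label_eq hb]
      · have ha' : ¬ Z a := fun ha' => h.1.not_outerEnd ((h.2 _ _ ha').1 ha)
        rw [if_pos hb, if_neg ha', γ.label_eq ha]⟩
  else γ

section Absorb

variable {Z : A → Prop} {v : X} {γ : C.Gen}

theorem absorb_res (h : C.EndIn Z v) (hZ : C.IsCircle γ.res Z) :
    (C.absorb Z v γ).res = flip γ.res v := by
  rw [absorb, dif_pos ⟨h, hZ⟩]

theorem absorb_label (h : C.EndIn Z v) (hZ : C.IsCircle γ.res Z) {a : A} (ha : ¬ Z a) :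
    (C.absorb Z v γ).label a = γ.label a := by
  rw [absorb, dif_pos ⟨h, hZ⟩]
  exact if_neg ha

theorem eq_absorb (h : C.EndIn Z v) (hZ : C.IsCircle γ.res Z) {δ : C.Gen}
    (hδ : δ.res = flip γ.res v) (hl : ∀ a, ¬ Z a → δ.label a = γ.label a) :
    δ = C.absorb Z v γ := by
  refine Gen.ext (hδ.trans (absorb_res h hZ).symm) fun a => ?_
  by_cases ha : Z a
  · have hr := h.rel_flip_outerEnd hZ ha
    rw [δ.label_eq (by rw [hδ]; exact hr),
      (C.absorb Z v γ).label_eq (by rw [absorb_res h hZ]; exact hr), hl _ h.not_outerEnd,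
      absorb_label h hZ h.not_outerEnd]
  · rw [hl a ha, absorb_label h hZ ha]

theorem absorb_injective (h : C.EndIn Z v) (hZ : C.IsCircle γ.res Z) {γ' : C.Gen}
    (hZ' : C.IsCircle γ'.res Z) (he : C.absorb Z v γ = C.absorb Z v γ')
    (hl : ∀ a, Z a → γ.label a = γ'.label a) : γ = γ' := by
  have hres : γ.res = γ'.res := by
    have := congrArg Gen.res he
    rw [absorb_res h hZ, absorb_res h hZ'] at this
    rw [← flip_flip γ.res v, this, flip_flip]
  refine Gen.ext hres fun a => ?_
  by_cases ha : Z a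
  · exact hl a ha
  · rw [← absorb_label h hZ ha, he, absorb_label h hZ' ha]

theorem exists_absorb (h : C.EndIn Z v) {δ : C.Gen} (hZ : C.IsCircle (flip δ.res v) Z) (z : Bool) :
    ∃ γ : C.Gen, γ.res = flip δ.res v ∧ (∀ a, Z a → γ.label a = z) ∧ C.absorb Z v γ = δ := by
  classical
  have hle : ∀ a b, C.rel (flip δ.res v) a b → C.rel δ.res a b := by
    intro a b hab
    have := le_of_merge (h.not_rel hZ) hab
    rwa [flip_flip] at this
  let γ : C.Gen := ⟨flip δ.res v, fun a => if Z a then z else δ.label a, fun a b hab => by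
    by_cases ha : Z a
    · rw [if_pos ha, if_pos ((hZ a b ha).1 hab)]
    · have hb : ¬ Z b := fun hb => ha ((hZ b a hb).1 (symm hab))
      rw [if_neg ha, if_neg hb, δ.label_eq (hle _ _ hab)]⟩
  refine ⟨γ, rfl, fun a ha => if_pos ha, ?_⟩
  exact (eq_absorb (γ := γ) h hZ (flip_flip _ _).symm fun a ha => (if_neg ha).symm).symm

/-- A small circle labelled `1` is merged without any change of labels. -/
theorem saddle_absorb_iff (h : C.EndIn Z v) (hZ : C.IsCircle γ.res Z)
    (hl : ∀ a, Z a → γ.label a = false) {δ : C.Gen} (hδ : δ.res = flip γ.res v) :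
    C.Saddle γ.res v γ.label δ.label ↔ δ = C.absorb Z v γ := by
  have hI := h.not_rel hZ
  have hz : ∀ {z}, Z z → ∀ a, C.rel γ.res a z ↔ Z a :=
    fun h1 a => by rw [rel_comm, hZ _ _ h1]
  have hend : (γ.label (C.o v) && γ.label (C.o' v)) = false ∧
      (γ.label (C.o v) || γ.label (C.o' v)) = γ.label (C.outerEnd Z v) := by
    rw [outerEnd]
    rcases h with h | h
    · rw [if_pos h.1, hl _ h.1]; simp
    · rw [if_neg h.1, hl _ h.2]; simp
  have hoff : ∀ a, (¬ C.rel γ.res a (C.o v) ∧ ¬ C.rel γ.res a (C.o' v)) ↔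
      (¬ Z a ∧ ¬ C.rel γ.res a (C.outerEnd Z v)) := by
    intro a
    rw [outerEnd]
    rcases h with h | h
    · rw [if_pos h.1, hz h.1]
    · rw [if_neg h.1, hz h.2]; tauto
  have hJ : C.rel δ.res (C.o v) (C.outerEnd Z v) := by
    rw [hδ, outerEnd]
    split_ifs
    · exact rel_flip_ends hI
    · exact refl _ _
  constructor
  · rintro ⟨h1, h2, -⟩
    refine eq_absorb h hZ hδ fun a ha => ?_
    by_cases ha' : C.rel γ.res a (C.outerEnd Z v)
    · rw [γ.label_eq ha', δ.label_eq (by rw [hδ]; exact le_of_merge hI ha'), ← δ.label_eq hJ,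
        (h2 hI).2, hend.2]
    · have := (hoff a).2 ⟨ha, ha'⟩
      exact (h1 a this.1 this.2).symm
  · rintro rfl
    refine ⟨fun a ha ha' => ?_, fun _ => ⟨hend.1, ?_⟩, fun h' => absurd h' hI⟩
    · exact (absorb_label h hZ ((hoff a).1 ⟨ha, ha'⟩).1).symm
    · rw [hend.2, Gen.label_eq _ hJ, absorb_label h hZ h.not_outerEnd]

/-- A small circle labelled `x` is split off without any change of labels. -/
theorem saddle_absorb_iff' (h : C.EndIn Z v) (hZ : C.IsCircle γ.res Z)
    (hl : ∀ a, Z a → γ.label a = true) {δ : C.Gen} (hδ : γ.res = flip δ.res v) :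
    C.Saddle δ.res v δ.label γ.label ↔ δ = C.absorb Z v γ := by
  have hδ' : δ.res = flip γ.res v := by rw [hδ, flip_flip]
  rw [saddle_dual, ← hδ]
  have := saddle_absorb_iff (γ := γ.neg) (δ := δ.neg) h hZ (fun a ha => by simp [Gen.neg, hl a ha])
    hδ'
  refine this.trans ⟨fun he => eq_absorb h hZ hδ' fun a ha => ?_, fun he => ?_⟩
  · have h1 := congrArg (fun γ => γ.label a) he
    rw [absorb_label h (γ := γ.neg) hZ ha] at h1
    exact Bool.not_inj h1
  · refine eq_absorb (γ := γ.neg) (δ := δ.neg) h hZ hδ' fun a ha => ?_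
    simp only [Gen.neg]
    rw [he, absorb_label h hZ ha]

/-- A circle which is present before and after keeps its label. -/
theorem label_eq_of_saddle {x : X} {γ' : C.Gen} (hx : γ'.res = flip γ.res x)
    (hZ : C.IsCircle γ.res Z) (hZ' : C.IsCircle γ'.res Z)
    (hs : C.Saddle γ.res x γ.label γ'.label) {a : A} (ha : Z a) : γ.label a = γ'.label a := by
  rw [hx] at hZ'
  have h1 := hZ.not_ends hZ' (C.surgery γ.res x)
  have h2 : ¬ Z (C.o' x) := hZ.not_ends hZ' (b := C.o x) (by
    rw [rel_comm, C.surgery, rel_comm (I := flip γ.res x)])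
  exact hs.1 a (fun h => h1 ((hZ _ _ ha).1 h)) (fun h => h2 ((hZ _ _ ha).1 h))

end Absorb

end ResCube

end LinkSplitting

namespace LinkSplitting

namespace ResCube

variable {A X R : Type*} [DecidableEq X] [CommRing R]

/-! ### Cancelling small circles -/

/-- A family of resolutions `Q` with a common circle `Z`. Those of their monomials in which `Z` is
labelled `x` are the results of splitting off `Z` at the crossing `l`, and those in which `Z` is
labelled `1` become results of merging `Z` at the crossing `h`. `T` says for which of the two
labels the monomials are to be cancelled. -/
structure Cancellation (C : ResCube A X) where
  Q : (X → Bool) → Prop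
  Z : A → Prop
  z : A
  mem_z : Z z
  T : Bool → Prop
  l : X
  h : X
  circle : ∀ I, Q I → C.IsCircle I Z
  split : T true → C.EndIn Z l ∧ ∀ I, Q I → I l = true
  merge : T false → C.EndIn Z h ∧ ∀ I, Q I → I h = false

namespace Cancellation

variable {C : ResCube A X} (K : C.Cancellation)

/-- The monomials with a small circle that are cancelled. -/
def Index : Type _ := {γ : C.Gen // K.Q γ.res ∧ K.T (γ.label K.z)}

noncomputable instance [Finite A] [Finite X] : Fintype K.Index := by
  classical
  exact inferInstanceAs (Fintype {γ : C.Gen // K.Q γ.res ∧ K.T (γ.label K.z)})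

/-- The source of the cancelled arrow. -/
noncomputable def src (i : K.Index) : C.Gen :=
  if i.1.label K.z then C.absorb K.Z K.l i.1 else i.1

/-- The target of the cancelled arrow. -/
noncomputable def tgt (i : K.Index) : C.Gen :=
  if i.1.label K.z then i.1 else C.absorb K.Z K.h i.1

/-- The sign of the cancelled arrow. -/
def sign (e : (X → Bool) → X → ℤˣ) (i : K.Index) : ℤˣ :=
  if i.1.label K.z then e i.1.res K.l else e i.1.res K.h

variable {K}

theorem label_eq {γ : C.Gen} (hQ : K.Q γ.res) {a : A} (ha : K.Z a) :
    γ.label a = γ.label K.z := γ.label_eq ((K.circle _ hQ _ _ ha).2 K.mem_z)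

theorem src_res_l {i : K.Index} (hi : i.1.label K.z = true) :
    (K.src i).res = flip i.1.res K.l ∧ (K.src i).res K.l = false := by
  have ht : K.T true := hi ▸ i.2.2
  have := absorb_res (K.split ht).1 (K.circle _ i.2.1)
  rw [src, if_pos hi, this, flip_self, (K.split ht).2 _ i.2.1]
  exact ⟨rfl, rfl⟩

theorem tgt_res_h {i : K.Index} (hi : i.1.label K.z = false) :
    (K.tgt i).res = flip i.1.res K.h ∧ (K.tgt i).res K.h = true := by
  have ht : K.T false := hi ▸ i.2.2
  have := absorb_res (K.merge ht).1 (K.circle _ i.2.1)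
  rw [tgt, hi, if_neg (by simp), this, flip_self, (K.merge ht).2 _ i.2.1]
  exact ⟨rfl, rfl⟩

theorem l_ne_h (ht : K.T true) (hf : K.T false) {I : X → Bool} (hI : K.Q I) : K.l ≠ K.h := by
  intro h
  have h1 := (K.split ht).2 I hI
  have h2 := (K.merge hf).2 I hI
  rw [h, h2] at h1
  simp at h1

theorem src_eq_of_false {i : K.Index} (hi : i.1.label K.z = false) : K.src i = i.1 := by
  rw [src, hi, if_neg (by simp)]

theorem tgt_eq_of_true {i : K.Index} (hi : i.1.label K.z = true) : K.tgt i = i.1 := by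
  rw [tgt, if_pos hi]

theorem src_eq_of_true {i : K.Index} (hi : i.1.label K.z = true) :
    K.src i = C.absorb K.Z K.l i.1 := by
  rw [src, if_pos hi]

theorem tgt_eq_of_false {i : K.Index} (hi : i.1.label K.z = false) :
    K.tgt i = C.absorb K.Z K.h i.1 := by
  rw [tgt, hi, if_neg (by simp)]

theorem sign_eq_of_true {e : (X → Bool) → X → ℤˣ} {i : K.Index} (hi : i.1.label K.z = true) :
    K.sign e i = e i.1.res K.l := by
  rw [sign, if_pos hi]

theorem sign_eq_of_false {e : (X → Bool) → X → ℤˣ} {i : K.Index} (hi : i.1.label K.z = false) :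
    K.sign e i = e i.1.res K.h := by
  rw [sign, hi, if_neg (by simp)]

theorem index_eq_of_absorb {i j : K.Index} {v : X} (h : C.EndIn K.Z v)
    (hij : i.1.label K.z = j.1.label K.z) (he : C.absorb K.Z v i.1 = C.absorb K.Z v j.1) :
    i = j :=
  Subtype.ext (absorb_injective h (K.circle _ i.2.1) (K.circle _ j.2.1) he fun a ha => by
    rw [label_eq i.2.1 ha, label_eq j.2.1 ha, hij])

theorem src_injective : Function.Injective K.src := by
  intro i j hij
  cases hi : i.1.label K.z <;> cases hj : j.1.label K.z
  · rw [src_eq_of_false hi, src_eq_of_false hj] at hij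
    exact Subtype.ext hij
  · have h1 := (src_res_l hj).2
    rw [← hij, src_eq_of_false hi, (K.split (hj ▸ j.2.2)).2 _ i.2.1] at h1
    simp at h1
  · have h1 := (src_res_l hi).2
    rw [hij, src_eq_of_false hj, (K.split (hi ▸ i.2.2)).2 _ j.2.1] at h1
    simp at h1
  · refine index_eq_of_absorb (K.split (hi ▸ i.2.2)).1 (hi.trans hj.symm) ?_
    rwa [src, src, if_pos hi, if_pos hj] at hij

theorem tgt_injective : Function.Injective K.tgt := by
  intro i j hij
  cases hi : i.1.label K.z <;> cases hj : j.1.label K.z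
  · refine index_eq_of_absorb (K.merge (hi ▸ i.2.2)).1 (hi.trans hj.symm) ?_
    rwa [tgt, tgt, hi, hj, if_neg (by simp), if_neg (by simp)] at hij
  · have h1 := (tgt_res_h hi).2
    rw [hij, tgt_eq_of_true hj, (K.merge (hi ▸ i.2.2)).2 _ j.2.1] at h1
    simp at h1
  · have h1 := (tgt_res_h hj).2
    rw [← hij, tgt_eq_of_true hi, (K.merge (hj ▸ j.2.2)).2 _ i.2.1] at h1
    simp at h1
  · rw [tgt_eq_of_true hi, tgt_eq_of_true hj] at hij
    exact Subtype.ext hij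

/-- The digits of the source at `h` and of the target at `l`. -/
theorem src_res_h {i : K.Index} (hf : K.T false) : (K.src i).res K.h = false := by
  cases hi : i.1.label K.z
  · rw [src_eq_of_false hi, (K.merge hf).2 _ i.2.1]
  · rw [(src_res_l hi).1, flip_of_ne _ (l_ne_h (hi ▸ i.2.2) hf i.2.1).symm,
      (K.merge hf).2 _ i.2.1]

theorem tgt_res_l {i : K.Index} (ht : K.T true) : (K.tgt i).res K.l = true := by
  cases hi : i.1.label K.z
  · rw [(tgt_res_h hi).1, flip_of_ne _ (l_ne_h ht (hi ▸ i.2.2) i.2.1), (K.split ht).2 _ i.2.1]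
  · rw [tgt_eq_of_true hi, (K.split ht).2 _ i.2.1]

theorem src_ne_tgt (i j : K.Index) : K.src i ≠ K.tgt j := by
  intro hij
  cases hj : j.1.label K.z
  · have h1 := (tgt_res_h hj).2
    rw [← hij, src_res_h (hj ▸ j.2.2)] at h1
    simp at h1
  · cases hi : i.1.label K.z
    · rw [src_eq_of_false hi, tgt_eq_of_true hj] at hij
      rw [hij, hj] at hi
      simp at hi
    · have h1 := (src_res_l hi).2
      rw [hij, tgt_res_l (hi ▸ i.2.2)] at h1
      simp at h1

theorem mat_tgt_src [Fintype X] [DecidableEq K.Index] {u : X → R} {e : (X → Bool) → X → ℤˣ}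
    (he : IsEdgeSign e) (i j : K.Index) :
    C.mat u e (K.tgt i) (K.src j) = if i = j then ((K.sign e i : ℤ) : R) else 0 := by
  classical
  cases hi : i.1.label K.z <;> cases hj : j.1.label K.z
  · have hf : K.T false := hi ▸ i.2.2
    by_cases hx : (K.tgt i).res = flip (K.src j).res K.h
    · rw [mat_apply_of_eq _ _ _ hx]
      have hij : i.1.res = j.1.res := by
        rw [(tgt_res_h hi).1, src_eq_of_false hj] at hx
        rw [← flip_flip i.1.res K.h, hx, flip_flip]
      have hb := (tgt_res_h hi).2
      rw [src_eq_of_false hj] at hx ⊢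
      rw [saddle_absorb_iff (K.merge hf).1 (K.circle _ j.2.1)
        (fun a ha => by rw [label_eq j.2.1 ha, hj]) hx, sign_eq_of_false hi, hij, hb, cf,
        if_pos rfl, mul_one]
      refine if_congr ?_ rfl rfl
      rw [tgt_eq_of_false hi]
      exact ⟨index_eq_of_absorb (K.merge hf).1 (hi.trans hj.symm), fun h => by rw [h]⟩
    · rw [if_neg, mat_apply_of_ne]
      · intro x hx'
        have h1 := (tgt_res_h hi).2
        have h2 := src_res_h (i := j) hf
        by_cases hxh : x = K.h
        · exact hx (hxh ▸ hx')
        · rw [hx', flip_of_ne _ (Ne.symm hxh), h2] at h1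
          simp at h1
      · rintro rfl
        exact hx (by rw [(tgt_res_h hi).1, src_eq_of_false hi])
  · rw [if_neg (by rintro rfl; simp [hi] at hj), mat_apply_of_ne]
    intro x hx
    have hlh := l_ne_h (hj ▸ j.2.2) (hi ▸ i.2.2) i.2.1
    have h1 := (tgt_res_h hi).2
    have h2 := src_res_h (i := j) (hi ▸ i.2.2)
    have h3 := tgt_res_l (i := i) (hj ▸ j.2.2)
    have h4 := (src_res_l hj).2
    by_cases hxh : K.h = x
    · rw [hx, flip_of_ne _ (hxh ▸ hlh), h4] at h3
      simp at h3
    · rw [hx, flip_of_ne _ hxh, h2] at h1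
      simp at h1
  · rw [if_neg (by rintro rfl; simp [hi] at hj)]
    by_contra h0
    obtain ⟨x, hx, hs, -⟩ := exists_of_mat_ne_zero h0
    rw [src_eq_of_false hj, tgt_eq_of_true hi] at hx hs
    have := label_eq_of_saddle hx (K.circle _ j.2.1) (K.circle _ i.2.1) hs K.mem_z
    rw [hi, hj] at this
    simp at this
  · have ht : K.T true := hi ▸ i.2.2
    by_cases hx : (K.tgt i).res = flip (K.src j).res K.l
    · rw [mat_apply_of_eq _ _ _ hx]
      have hij : j.1.res = i.1.res := by
        rw [(src_res_l hj).1, flip_flip, tgt_eq_of_true hi] at hx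
        exact hx.symm
      have hb := tgt_res_l (i := i) ht
      have hsgn : e (K.src j).res K.l = e i.1.res K.l := by rw [(src_res_l hj).1, he.symm, hij]
      rw [tgt_eq_of_true hi] at hx hb ⊢
      rw [saddle_absorb_iff' (K.split ht).1 (K.circle _ i.2.1)
        (fun a ha => by rw [label_eq i.2.1 ha, hi]) hx, sign_eq_of_true hi, hsgn, hb, cf,
        if_pos rfl, mul_one]
      refine if_congr ?_ rfl rfl
      rw [src_eq_of_true hj]
      exact ⟨fun h => index_eq_of_absorb (K.split ht).1 (hi.trans hj.symm) h.symm,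
        fun h => by rw [h]⟩
    · rw [if_neg, mat_apply_of_ne]
      · intro x hx'
        have h1 := tgt_res_l (i := i) ht
        have h2 := (src_res_l hj).2
        by_cases hxh : x = K.l
        · exact hx (hxh ▸ hx')
        · rw [hx', flip_of_ne _ (Ne.symm hxh), h2] at h1
          simp at h1
      · rintro rfl
        exact hx (by rw [(src_res_l hi).1, flip_flip, tgt_eq_of_true hi])

theorem level_src [Finite A] [Fintype X] (i : K.Index) :
    C.level 1 (K.src i) = C.level 1 (K.tgt i) := by
  cases hi : i.1.label K.z
  · have hf : K.T false := hi ▸ i.2.2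
    have hs := (saddle_absorb_iff (K.merge hf).1 (K.circle _ i.2.1)
        (fun a ha => by rw [label_eq i.2.1 ha, hi]) (absorb_res (K.merge hf).1
          (K.circle _ i.2.1))).2 rfl
    have := C.level_eq_of_saddle 1 (fun _ _ _ _ => rfl)
      (absorb_res (K.merge hf).1 (K.circle _ i.2.1)) hs
    rw [src_eq_of_false hi, tgt, hi, if_neg (by simp), this, (K.merge hf).2 _ i.2.1]
    simp
  · have ht : K.T true := hi ▸ i.2.2
    have hr := absorb_res (K.split ht).1 (K.circle _ i.2.1)
    have hr' : i.1.res = flip (C.absorb K.Z K.l i.1).res K.l := by rw [hr, flip_flip]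
    have hs := (saddle_absorb_iff' (K.split ht).1 (K.circle _ i.2.1)
        (fun a ha => by rw [label_eq i.2.1 ha, hi]) hr').2 rfl
    have := C.level_eq_of_saddle 1 (fun _ _ _ _ => rfl) hr' hs
    rw [tgt_eq_of_true hi, src, if_pos hi, this, hr, flip_self, (K.split ht).2 _ i.2.1]
    simp

variable (K)

/-- The monomials that survive the cancellation. -/
def Survives (γ : C.Gen) : Prop :=
  ¬ (K.Q γ.res ∧ K.T (γ.label K.z)) ∧ ¬ (K.T true ∧ K.Q (flip γ.res K.l)) ∧
    ¬ (K.T false ∧ K.Q (flip γ.res K.h))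

variable {K}

theorem survives_iff {γ : C.Gen} :
    K.Survives γ ↔ (∀ i, γ ≠ K.src i) ∧ ∀ i, γ ≠ K.tgt i := by
  constructor
  · rintro ⟨h1, h2, h3⟩
    refine ⟨fun i hi => ?_, fun i hi => ?_⟩ <;> cases hl : i.1.label K.z
    · rw [src_eq_of_false hl] at hi
      exact h1 (hi ▸ i.2)
    · exact h2 ⟨hl ▸ i.2.2, by rw [hi, (src_res_l hl).1, flip_flip]; exact i.2.1⟩
    · exact h3 ⟨hl ▸ i.2.2, by rw [hi, (tgt_res_h hl).1, flip_flip]; exact i.2.1⟩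
    · rw [tgt_eq_of_true hl] at hi
      exact h1 (hi ▸ i.2)
  · rintro ⟨h1, h2⟩
    refine ⟨fun h => ?_, fun h => ?_, fun h => ?_⟩
    · cases hl : γ.label K.z
      · exact h1 ⟨γ, h⟩ (src_eq_of_false (i := ⟨γ, h⟩) hl).symm
      · exact h2 ⟨γ, h⟩ (tgt_eq_of_true (i := ⟨γ, h⟩) hl).symm
    · obtain ⟨δ, hδ, hl, rfl⟩ := exists_absorb (K.split h.1).1 (K.circle _ h.2) true
      have hz := hl _ K.mem_z
      exact h1 ⟨δ, hδ ▸ h.2, hz ▸ h.1⟩ (src_eq_of_true (i := ⟨δ, hδ ▸ h.2, hz ▸ h.1⟩) hz).symm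
    · obtain ⟨δ, hδ, hl, rfl⟩ := exists_absorb (K.merge h.1).1 (K.circle _ h.2) false
      have hz := hl _ K.mem_z
      exact h2 ⟨δ, hδ ▸ h.2, hz ▸ h.1⟩ (tgt_eq_of_false (i := ⟨δ, hδ ▸ h.2, hz ▸ h.1⟩) hz).symm

variable (K)

/-- The pairs of monomials which differ by a small circle have equal levels and can be cancelled. -/
theorem strictUpTo_iff [Finite A] [Fintype X] {u : X → R} {e : (X → Bool) → X → ℤˣ}
    (he : IsEdgeSign e) (hu : C.Flat u) (n : ℕ) :
    StrictUpTo (C.mat u e).mulVecLin (levelFiltration R (C.level 1)) n ↔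
      StrictUpTo (eliminated (C.mat u e) K.src K.tgt fun i => ((K.sign e i : ℤ) : R)).mulVecLin
        (levelFiltration R fun γ : Rest K.src K.tgt => C.level 1 γ.1) n := by
  classical
  refine strictUpTo_iff_eliminated _ _ _ _ _ src_injective tgt_injective src_ne_tgt
    (fun i j => mat_tgt_src he i j) (fun i => ?_) (C.mat_mul_mat he hu)
    (fun γ γ' h => level_le_of_mat_ne_zero h) level_src n
  rw [← Int.cast_mul, ← Units.val_mul, Int.units_mul_self]
  simp

end Cancellation

end ResCube

end LinkSplitting

namespace LinkSplitting

section Transfer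

variable {R : Type*} [CommRing R]

/-- A sign as a unit of `R`. -/
def signUnit (R : Type*) [CommRing R] (s : ℤˣ) : Rˣ := Units.map (Int.castRingHom R).toMonoidHom s

@[simp] theorem coe_signUnit (s : ℤˣ) : (signUnit R s : R) = ((s : ℤ) : R) := rfl

theorem strictUpTo_iff_of_equiv {G G' : Type*} [Fintype G] [Fintype G'] {M : Matrix G G R}
    {M' : Matrix G' G' R} {q : G → ℤ} {q' : G' → ℤ} (e : G ≃ G') (c : G → Rˣ)
    (hM : ∀ γ γ', (c γ' : R) * M γ' γ = M' (e γ') (e γ) * c γ) (k : ℤ)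
    (hq : ∀ γ, q' (e γ) = q γ + k) (n : ℕ) :
    StrictUpTo M.mulVecLin (levelFiltration R q) n ↔
      StrictUpTo M'.mulVecLin (levelFiltration R q') n := by
  constructor
  · intro h
    refine StrictUpTo.of_equiv e.symm (fun γ => (c (e.symm γ))⁻¹) (fun γ γ' => ?_) (-k) 0
      (fun γ => ?_) (fun γ => ?_) h
    · have := hM (e.symm γ) (e.symm γ')
      rw [e.apply_symm_apply, e.apply_symm_apply] at this
      rw [Units.inv_mul_eq_iff_eq_mul, ← mul_assoc, this, mul_assoc, Units.mul_inv, mul_one]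
    · have := hq (e.symm γ)
      rw [e.apply_symm_apply] at this
      linarith
    · have := hq (e.symm γ)
      rw [e.apply_symm_apply] at this
      push_cast
      linarith
  · intro h
    exact StrictUpTo.of_equiv e c hM k 0 (fun γ => (hq γ).ge) (fun γ => by
      rw [hq]; push_cast; linarith) h

namespace ResCube

variable {A A' X X' : Type*} [DecidableEq X] [DecidableEq X'] [Finite A] [Finite A'] [Fintype X]
  [Fintype X'] {C : ResCube A X} {C' : ResCube A' X'}

/-- Comparison of a cube `C` with a face of the cube `C'`, in the resolutions of which there is at
most one additional circle `Z`: the monomials of the face in which `Z` has the label `z` form the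
complex of `C`, up to signs and a shift of the level. -/
theorem strictUpTo_iff_of_face {G : Type*} [Fintype G] {ψ : G → C'.Gen}
    (hψ : Function.Injective ψ) {j : X → X'} {ext : (X → Bool) → X' → Bool}
    (hext : ∀ I x, ext I (j x) = I x) (hflip : ∀ I x, ext (flip I x) = flip (ext I) (j x))
    {φ : A → A'} {Z : A' → Prop} {z : Bool}
    (range : ∀ δ, (∃ g, ψ g = δ) ↔ (∃ I, δ.res = ext I) ∧ ∀ a, Z a → δ.label a = z)
    (hrel : ∀ I a b, C.rel I a b ↔ C'.rel (ext I) (φ a) (φ b))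
    (hZ : ∀ I, C'.IsCircle (ext I) Z) (hφZ : ∀ a, ¬ Z (φ a))
    (cov : ∀ I b, Z b ∨ ∃ a, C'.rel (ext I) b (φ a)) {u : X → R} {u' : X' → R}
    (hu : ∀ x, u' (j x) = u x) {e : (X → Bool) → X → ℤˣ} {e' : (X' → Bool) → X' → ℤˣ}
    (he : IsEdgeSign e) (he' : IsEdgeSign e') (k : ℤ)
    (hlevel : ∀ (γ : C.Gen) (δ : C'.Gen), δ.res = ext γ.res →
      (∀ a, δ.label (φ a) = γ.label a) → (∀ a, Z a → δ.label a = z) →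
      C'.level 1 δ = C.level 1 γ + k)
    {N : Matrix G G R} (hN : ∀ g g', N g' g = C'.mat u' e' (ψ g') (ψ g)) (n : ℕ) :
    StrictUpTo N.mulVecLin (levelFiltration R fun g => C'.level 1 (ψ g)) n ↔
      StrictUpTo (C.mat u e).mulVecLin (levelFiltration R (C.level 1)) n := by
  classical
  have inj : Function.Injective j := by
    intro x y hxy
    have := hext (flip (fun _ => false) x) y
    rw [← hxy, hext, flip_self] at this
    by_contra h
    rw [flip_of_ne _ (Ne.symm h)] at this
    simp at this
  have hg : ∀ g, (ψ g).res = ext ((ψ g).res ∘ j) ∧ ∀ a, Z a → (ψ g).label a = z := by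
    intro g
    obtain ⟨⟨I, hI⟩, h⟩ := (range (ψ g)).1 ⟨g, rfl⟩
    refine ⟨?_, h⟩
    have : (ψ g).res ∘ j = I := by
      funext x
      rw [hI, Function.comp, hext]
    rw [this, hI]
  let Φ : G → C.Gen := fun g => ⟨(ψ g).res ∘ j, (ψ g).label ∘ φ, fun a b h => (ψ g).label_eq (by
    rw [(hg g).1]
    exact (hrel _ _ _).1 h)⟩
  have res_eq : ∀ g, (ψ g).res = ext (Φ g).res := fun g => (hg g).1
  have cov_g : ∀ g b, Z b ∨ ∃ a, C'.rel (ψ g).res b (φ a) := fun g b => by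
    rw [res_eq]; exact cov _ b
  have hΦ : Function.Bijective Φ := by
    constructor
    · intro g g' h
      have h1 : (ψ g).res = (ψ g').res := by rw [res_eq, res_eq, h]
      refine hψ (Gen.ext_of_cover h1 (cov_g g) (fun a => ?_) fun a ha => ?_)
      · exact congrFun (congrArg Gen.label h) a
      · rw [(hg g).2 a ha, (hg g').2 a ha]
    · intro γ
      obtain ⟨δ, h1, h2, h3⟩ := exists_gen (C := C') φ (hZ γ.res) (cov γ.res) hφZ γ.label
        (fun a b h => γ.label_eq ((hrel _ _ _).2 h)) z
      obtain ⟨g, rfl⟩ := (range δ).2 ⟨⟨_, h1⟩, h3⟩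
      refine ⟨g, Gen.ext ?_ h2⟩
      funext x
      change (ψ g).res (j x) = _
      rw [h1, hext]
  have he'' : IsEdgeSign fun I x => e' (ext I) (j x) :=
    ⟨fun I x => by rw [hflip, he'.symm], fun I x y hxy => by
      rw [hflip, hflip]
      exact he'.square _ _ _ fun h => hxy (inj h)⟩
  obtain ⟨σ, hσ⟩ := he''.exists_rescaling he
  have match_g : ∀ g, Matches id φ (Φ g) (ψ g) := fun g =>
    ⟨fun a b => by rw [res_eq]; exact hrel _ _ _, fun a => rfl⟩
  refine strictUpTo_iff_of_equiv (Equiv.ofBijective Φ hΦ) (fun g => signUnit R (σ (Φ g).res))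
    (fun g g' => ?_) (-k) (fun g => ?_) n
  · simp only [Equiv.ofBijective_apply, coe_signUnit, hN]
    by_cases h : ∃ x, (Φ g').res = flip (Φ g).res x
    · obtain ⟨x, hx⟩ := h
      have hx' : (ψ g').res = flip (ψ g).res (j x) := by
        rw [res_eq, res_eq, hx, hflip]
      rw [mat_apply_of_eq _ _ _ hx, mat_apply_of_eq _ _ _ hx']
      have hs : C.Saddle (Φ g).res x (Φ g).label (Φ g').label ↔
          C'.Saddle (ψ g).res (j x) (ψ g).label (ψ g').label :=
        saddle_congr (match_g g) (match_g g') hx hx' (fun a => ⟨a, refl _ _⟩)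
          (fun a => ⟨a, refl _ _⟩) Z (by rw [res_eq]; exact hZ _) (by rw [res_eq]; exact hZ _)
          (cov_g g) (cov_g g') fun a ha => by rw [(hg g).2 a ha, (hg g').2 a ha]
      by_cases hsad : C.Saddle (Φ g).res x (Φ g).label (Φ g').label
      · rw [if_pos hsad, if_pos (hs.1 hsad)]
        have h1 := congrArg (fun s : ℤˣ => ((s : ℤ) : R)) (hσ (Φ g).res x)
        simp only [Units.val_mul, Int.cast_mul, ← hx, ← res_eq] at h1
        have h2 : cf u' (j x) ((ψ g').res (j x)) = cf u x ((Φ g').res x) := by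
          rw [res_eq g', hext, cf, cf, hu]
        rw [h2]
        linear_combination (cf u x ((Φ g').res x)) * h1
      · rw [if_neg hsad, if_neg fun h' => hsad (hs.2 h'), mul_zero, zero_mul]
    · push Not at h
      rw [mat_apply_of_ne _ _ _ h, mat_apply_of_ne, mul_zero, zero_mul]
      intro x' hx'
      by_cases hj : ∃ x, j x = x'
      · obtain ⟨x, rfl⟩ := hj
        refine h x ?_
        funext y
        have : (Φ g').res y = (ψ g').res (j y) := rfl
        rw [this, hx', res_eq, ← hflip, hext]
      · have : (Φ g').res = (Φ g).res := by
          funext y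
          have : (Φ g').res y = (ψ g').res (j y) := rfl
          rw [this, hx', flip_of_ne _ (fun h => hj ⟨y, h⟩)]
          rfl
        rw [res_eq g', this, ← res_eq] at hx'
        have := congrFun hx' x'
        simp at this
  · rw [Equiv.ofBijective_apply, hlevel (Φ g) (ψ g) (res_eq g) (fun a => rfl) (hg g).2]
    ring

/-- Cubes which differ by the names of the crossings, and by arcs that do not give new circles. -/
theorem strictUpTo_iff_of_iso (j : X ≃ X') {φ : A → A'}
    (hrel : ∀ I a b, C.rel I a b ↔ C'.rel (I ∘ j.symm) (φ a) (φ b))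
    (cov : ∀ I b, ∃ a, C'.rel (I ∘ j.symm) b (φ a)) {u : X → R} {u' : X' → R}
    (hu : ∀ x, u' (j x) = u x) {e : (X → Bool) → X → ℤˣ} {e' : (X' → Bool) → X' → ℤˣ}
    (he : IsEdgeSign e) (he' : IsEdgeSign e') (n : ℕ) :
    StrictUpTo (C'.mat u' e').mulVecLin (levelFiltration R (C'.level 1)) n ↔
      StrictUpTo (C.mat u e).mulVecLin (levelFiltration R (C.level 1)) n := by
  refine strictUpTo_iff_of_face (ψ := id) Function.injective_id (j := j)
    (ext := fun I => I ∘ j.symm) (fun I x => by simp) (fun I x => ?_) (φ := φ)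
    (Z := fun _ => False) (z := false) (fun δ => ?_) hrel (fun _ _ _ h => h.elim) (fun _ h => h)
    (fun I b => Or.inr (cov I b)) hu he he' 0 (fun γ δ h1 h2 _ => ?_) (fun _ _ => rfl) n
  · funext y
    obtain ⟨y, rfl⟩ := j.surjective y
    simp only [Function.comp, j.symm_apply_apply]
    by_cases h : y = x
    · subst h; simp
    · rw [flip_of_ne _ h, flip_of_ne _ (j.injective.ne h), Function.comp, j.symm_apply_apply]
  · simp only [id, exists_eq, false_imp_iff, implies_true, and_true, true_iff]
    exact ⟨δ.res ∘ j, by funext y; simp⟩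
  · have h3 : Matches id φ γ δ := ⟨fun a b => by rw [h1]; exact hrel _ _ _, fun a => (h2 a).symm⟩
    have h4 : C'.wt 1 δ = C.wt 1 γ := wt_of_matches h3 (fun _ _ _ => rfl) (fun _ _ _ => rfl)
      (fun _ => rfl) fun a => by
        obtain ⟨b, hb⟩ := cov γ.res a
        exact ⟨b, by rw [h1]; exact symm hb⟩
    rw [level, level, h4, add_zero]
    congr 1
    rw [ones, ones, h1, ← j.sum_comp]
    simp

/-- The choice of signs does not matter. -/
theorem strictUpTo_iff_of_edgeSign {u : X → R} {e e' : (X → Bool) → X → ℤˣ}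
    (he : IsEdgeSign e) (he' : IsEdgeSign e') (n : ℕ) :
    StrictUpTo (C.mat u e').mulVecLin (levelFiltration R (C.level 1)) n ↔
      StrictUpTo (C.mat u e).mulVecLin (levelFiltration R (C.level 1)) n :=
  strictUpTo_iff_of_iso (Equiv.refl X) (φ := id) (fun _ _ _ => Iff.rfl)
    (fun _ b => ⟨b, refl _ _⟩) (fun _ => rfl) he he' n

end ResCube

end Transfer

end LinkSplitting

namespace LinkSplitting

namespace ResCube

/-! ### The first and the second Reidemeister move for cubes -/

section

variable {A A' X ι R : Type*} [CommRing R]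

theorem elim_flip [DecidableEq X] [DecidableEq ι] (I : X → Bool) (b : ι → Bool) (x : X) :
    (Sum.elim (flip I x) b : X ⊕ ι → Bool) = flip (Sum.elim I b) (Sum.inl x) := by
  funext y
  rcases y with y | y
  · by_cases h : y = x
    · subst h; simp
    · rw [flip_of_ne _ (by simpa using h)]
      simp [flip_of_ne, h]
  · rw [flip_of_ne _ (by simp)]
    rfl

theorem exists_eq_elim_iff {J : X ⊕ ι → Bool} {b : ι → Bool} :
    (∃ I, J = Sum.elim I b) ↔ ∀ i, J (Sum.inr i) = b i := by
  constructor
  · rintro ⟨I, rfl⟩ i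
    rfl
  · intro h
    refine ⟨J ∘ Sum.inl, ?_⟩
    funext x
    rcases x with x | x
    · rfl
    · exact h x

theorem ones_elim [Fintype X] [Fintype ι] (I : X → Bool) (b : ι → Bool) :
    ones 1 (Sum.elim I b : X ⊕ ι → Bool) = ones 1 I + ones 1 b := by
  rw [ones, Fintype.sum_sum_type]
  rfl

variable [DecidableEq X] [DecidableEq ι] [Finite A] [Finite A'] [Fintype X] [Fintype ι]
  {C : ResCube A X} {C' : ResCube A' (X ⊕ ι)}

/-- A cancellation after which only one face of the cube is left. -/
theorem Cancellation.strictUpTo_iff_of_face (K : C'.Cancellation) {b : ι → Bool} {φ : A → A'}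
    {Z : A' → Prop} {z : Bool}
    (hK : ∀ δ, K.Survives δ ↔ (∃ I, δ.res = Sum.elim I b) ∧ ∀ a, Z a → δ.label a = z)
    (hrel : ∀ I a a', C.rel I a a' ↔ C'.rel (Sum.elim I b) (φ a) (φ a'))
    (hZ : ∀ I, C'.IsCircle (Sum.elim I b) Z) (hφZ : ∀ a, ¬ Z (φ a))
    (cov : ∀ I a', Z a' ∨ ∃ a, C'.rel (Sum.elim I b) a' (φ a)) {u : X → R} {u' : X ⊕ ι → R}
    (hu : ∀ x, u' (Sum.inl x) = u x) {e : (X → Bool) → X → ℤˣ}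
    {e' : (X ⊕ ι → Bool) → X ⊕ ι → ℤˣ} (he : IsEdgeSign e) (he' : IsEdgeSign e')
    (hu' : C'.Flat u') (k : ℤ)
    (hwt : ∀ (γ : C.Gen) (δ : C'.Gen), δ.res = Sum.elim γ.res b →
      (∀ a, δ.label (φ a) = γ.label a) → (∀ a, Z a → δ.label a = z) →
      C'.wt 1 δ = C.wt 1 γ + k)
    (hcorr : ∀ γ γ' i, K.Survives γ → K.Survives γ' →
      C'.mat u' e' γ' (K.src i) = 0 ∨ C'.mat u' e' (K.tgt i) γ = 0) (n : ℕ) :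
    StrictUpTo (C'.mat u' e').mulVecLin (levelFiltration R (C'.level 1)) n ↔
      StrictUpTo (C.mat u e).mulVecLin (levelFiltration R (C.level 1)) n := by
  classical
  rw [K.strictUpTo_iff he' hu']
  refine ResCube.strictUpTo_iff_of_face (ψ := Subtype.val) Subtype.val_injective
    (fun I x => Sum.elim_inl I b x) (fun I x => elim_flip I b x) (fun δ => ?_) hrel hZ hφZ cov hu
    (z := z) he he' (ones 1 b + k) (fun γ δ h1 h2 h3 => ?_) (fun g g' => ?_) n
  · rw [← hK, K.survives_iff]
    exact ⟨fun ⟨g, hg⟩ => hg ▸ g.2, fun h => ⟨⟨δ, h⟩, rfl⟩⟩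
  · rw [level, level, hwt γ δ h1 h2 h3, h1]
    have := ones_elim γ.res b
    simp only [Pi.one_apply] at this ⊢
    change ones 1 _ + _ = ones 1 _ + _ + _
    rw [this]
    ring
  · refine sub_eq_self.2 ?_
    refine Finset.sum_eq_zero fun i _ => ?_
    rcases hcorr g.1 g'.1 i (K.survives_iff.2 g.2) (K.survives_iff.2 g'.2) with h | h <;> rw [h] <;>
      simp

theorem strictUpTo_iff_of_kink {C' : ResCube A' (X ⊕ Unit)} {b : Bool} {φ : A → A'}
    {Z : A' → Prop} {z : A'} (hz : Z z) (hend : C'.EndIn Z (Sum.inr ()))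
    (hrel : ∀ I a a', C.rel I a a' ↔ C'.rel (Sum.elim I fun _ => b) (φ a) (φ a'))
    (hZ : ∀ I, C'.IsCircle (Sum.elim I fun _ => b) Z) (hφZ : ∀ a, ¬ Z (φ a))
    (cov : ∀ I a', Z a' ∨ ∃ a, C'.rel (Sum.elim I fun _ => b) a' (φ a)) {u : X → R}
    {u' : X ⊕ Unit → R} (hu : ∀ x, u' (Sum.inl x) = u x) {e : (X → Bool) → X → ℤˣ}
    {e' : (X ⊕ Unit → Bool) → X ⊕ Unit → ℤˣ} (he : IsEdgeSign e) (he' : IsEdgeSign e')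
    (hu' : C'.Flat u') (n : ℕ) :
    StrictUpTo (C'.mat u' e').mulVecLin (levelFiltration R (C'.level 1)) n ↔
      StrictUpTo (C.mat u e).mulVecLin (levelFiltration R (C.level 1)) n := by
  have hQ : ∀ {J : X ⊕ Unit → Bool}, J (Sum.inr ()) = b → C'.IsCircle J Z := fun {J} h => by
    obtain ⟨I, rfl⟩ := exists_eq_elim_iff (b := fun _ => b).2 fun _ => h
    exact hZ I
  let K : C'.Cancellation :=
    { Q := fun J => J (Sum.inr ()) = b
      Z := Z
      z := z
      mem_z := hz
      T := fun t => t = b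
      l := Sum.inr ()
      h := Sum.inr ()
      circle := fun J h => hQ h
      split := fun h => ⟨hend, fun J hJ => hJ.trans h.symm⟩
      merge := fun h => ⟨hend, fun J hJ => hJ.trans h.symm⟩ }
  have surv : ∀ δ : C'.Gen, K.Survives δ ↔ δ.res (Sum.inr ()) = b ∧ δ.label z = !b := by
    intro δ
    simp only [Cancellation.Survives, K, flip_self]
    cases b <;> cases δ.res (Sum.inr ()) <;> cases δ.label z <;> simp
  refine K.strictUpTo_iff_of_face (b := fun _ => b) (z := !b) (fun δ => ?_) hrel hZ hφZ cov hu he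
    he' hu' (sgn !b) (fun γ δ h1 h2 h3 => ?_) (fun γ γ' i h h' => ?_) n
  · rw [surv, exists_eq_elim_iff]
    constructor
    · rintro ⟨h1, h2⟩
      exact ⟨fun _ => h1, fun a ha => by rw [← h2, δ.label_eq ((hQ h1 a z ha).2 hz)]⟩
    · rintro ⟨h1, h2⟩
      exact ⟨h1 (), h2 _ hz⟩
  · have hc := hZ γ.res
    rw [← h1] at hc
    have := classSum_of_extra (s := C.setoid γ.res) (s' := C'.setoid δ.res)
      (f := fun a => (1 : A → ℤ) a * sgn (γ.label a)) (f' := fun a => (1 : A' → ℤ) a * sgn (δ.label a))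
      (fun a a' h => by simp only [Pi.one_apply, γ.label_eq h])
      (fun a a' h => by simp only [Pi.one_apply, δ.label_eq h]) φ
      (fun a a' => by
        change C.rel _ _ _ ↔ C'.rel _ _ _
        rw [h1]
        exact hrel _ _ _) (fun a => by simp only [Pi.one_apply, h2]) z
      (fun a h => hφZ a ((hc _ _ hz).1 (symm h))) (fun a' => by
        rcases cov γ.res a' with h | ⟨a, ha⟩
        · exact Or.inl ((hc _ _ h).2 hz)
        · exact Or.inr ⟨a, by
            change C'.rel _ _ _
            rw [h1]
            exact symm ha⟩)
    rw [wt, wt, this, h3 z hz]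
    simp
  · obtain ⟨h1, h2⟩ := (surv _).1 h
    obtain ⟨h3, h4⟩ := (surv _).1 h'
    have hi : i.1.label z = b := i.2.2
    have hiQ : i.1.res (Sum.inr ()) = b := i.2.1
    by_contra h0
    push Not at h0
    cases hb : b
    · obtain ⟨x, hx, hs, -⟩ := exists_of_mat_ne_zero h0.1
      rw [Cancellation.src_eq_of_false (hi.trans hb)] at hx hs
      have := label_eq_of_saddle hx (hQ hiQ) (hQ h3) hs hz
      rw [hi, h4] at this
      simp at this
    · obtain ⟨x, hx, hs, -⟩ := exists_of_mat_ne_zero h0.2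
      rw [Cancellation.tgt_eq_of_true (hi.trans hb)] at hx hs
      have := label_eq_of_saddle hx (hQ h1) (hQ hiQ) hs hz
      rw [hi, h2] at this
      simp at this

/-- The two new crossings are `b` and `!b`. The small circle `Z` appears in the resolutions in which
`b` has the digit `1` and `!b` has the digit `0`, and the resolutions with the opposite digits
survive. -/
theorem strictUpTo_iff_of_bigon {C' : ResCube A' (X ⊕ Bool)} {b : Bool} {φ : A → A'}
    {Z : A' → Prop} {z : A'} (hz : Z z) (hend : ∀ i, C'.EndIn Z (Sum.inr i))
    (hZ : ∀ I, C'.IsCircle (Sum.elim I fun i => i == b) Z)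
    (hrel : ∀ I a a', C.rel I a a' ↔ C'.rel (Sum.elim I fun i => i != b) (φ a) (φ a'))
    (cov : ∀ I a', ∃ a, C'.rel (Sum.elim I fun i => i != b) a' (φ a)) {u : X → R}
    {u' : X ⊕ Bool → R} (hu : ∀ x, u' (Sum.inl x) = u x) {e : (X → Bool) → X → ℤˣ}
    {e' : (X ⊕ Bool → Bool) → X ⊕ Bool → ℤˣ} (he : IsEdgeSign e) (he' : IsEdgeSign e')
    (hu' : C'.Flat u') (n : ℕ) :
    StrictUpTo (C'.mat u' e').mulVecLin (levelFiltration R (C'.level 1)) n ↔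
      StrictUpTo (C.mat u e).mulVecLin (levelFiltration R (C.level 1)) n := by
  have hne : (Sum.inr b : X ⊕ Bool) ≠ Sum.inr !b := by simp
  let K : C'.Cancellation :=
    { Q := fun J => J (Sum.inr b) = true ∧ J (Sum.inr !b) = false
      Z := Z
      z := z
      mem_z := hz
      T := fun _ => True
      l := Sum.inr b
      h := Sum.inr !b
      circle := fun J h => by
        obtain ⟨I, rfl⟩ := exists_eq_elim_iff (b := fun i => i == b).2 fun i => by
          by_cases h' : i = b
          · subst h'; simpa using h.1
          · have : i = !b := by cases i <;> cases b <;> simp_all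
            subst this
            simpa using h.2
        exact hZ I
      split := fun _ => ⟨hend _, fun J hJ => hJ.1⟩
      merge := fun _ => ⟨hend _, fun J hJ => hJ.2⟩ }
  have surv : ∀ δ : C'.Gen, K.Survives δ ↔
      δ.res (Sum.inr b) = false ∧ δ.res (Sum.inr !b) = true := by
    intro δ
    simp only [Cancellation.Survives, K, flip_self, flip_of_ne _ hne, flip_of_ne _ hne.symm]
    cases δ.res (Sum.inr b) <;> cases δ.res (Sum.inr !b) <;> simp
  refine K.strictUpTo_iff_of_face (b := fun i => i != b) (Z := fun _ => False) (z := false)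
    (fun δ => ?_) hrel (fun _ _ _ h => h.elim) (fun _ h => h) (fun I a' => Or.inr (cov I a')) hu he
    he' hu' 0 (fun γ δ h1 h2 h3 => ?_) (fun γ γ' i h h' => ?_) n
  · rw [surv, exists_eq_elim_iff]
    simp only [false_imp_iff, implies_true, and_true]
    constructor
    · rintro ⟨h1, h2⟩ i
      by_cases h : i = b
      · subst h; simpa using h1
      · have : i = !b := by cases i <;> cases b <;> simp_all
        subst this
        simpa using h2
    · intro h
      exact ⟨by simpa using h b, by simpa using h !b⟩
  · rw [add_zero]
    exact wt_of_matches (f' := φ) ⟨fun a a' => by rw [h1]; exact hrel _ _ _, fun a => (h2 a).symm⟩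
      (fun _ _ _ => rfl) (fun _ _ _ => rfl) (fun _ => rfl) fun a' => by
        obtain ⟨a, ha⟩ := cov γ.res a'
        exact ⟨a, by rw [h1]; exact symm ha⟩
  · obtain ⟨h1, h2⟩ := (surv _).1 h
    obtain ⟨h3, h4⟩ := (surv _).1 h'
    have two : ∀ {δ δ' : C'.Gen}, δ'.res (Sum.inr b) ≠ δ.res (Sum.inr b) →
        δ'.res (Sum.inr !b) ≠ δ.res (Sum.inr !b) → C'.mat u' e' δ' δ = 0 := by
      intro δ δ' h h'
      refine mat_apply_of_ne _ _ _ fun x hx => ?_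
      by_cases hxb : x = Sum.inr b
      · refine h' ?_
        rw [hx, flip_of_ne _ (hxb ▸ hne.symm)]
      · exact h (by rw [hx, flip_of_ne _ (Ne.symm hxb)])
    have hiQ : i.1.res (Sum.inr b) = true ∧ i.1.res (Sum.inr !b) = false := i.2.1
    cases hi : i.1.label K.z
    · left
      rw [Cancellation.src_eq_of_false hi]
      exact two (by rw [h3, hiQ.1]; simp) (by rw [h4, hiQ.2]; simp)
    · right
      rw [Cancellation.tgt_eq_of_true hi]
      exact two (by rw [h1, hiQ.1]; simp) (by rw [h2, hiQ.2]; simp)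

end

end ResCube

end LinkSplitting

namespace LinkSplitting

theorem flip_apply {X : Type*} [DecidableEq X] (I : X → Bool) (x y : X) :
    flip I x y = if y = x then !I y else I y := by
  split_ifs with h
  · rw [h, flip_self]
  · exact flip_of_ne _ h

theorem flip_comp_equiv {X Y : Type*} [DecidableEq X] [DecidableEq Y] (I : X → Bool) (σ : Y ≃ X)
    (y : Y) : flip I (σ y) ∘ σ = flip (I ∘ σ) y := by
  funext w
  simp [flip_apply]

namespace ResCube

/-! ### The third Reidemeister move for cubes -/

variable {A X R : Type*} [CommRing R] [DecidableEq X]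

/-- The triangle of a third Reidemeister move: in the resolutions with the digits `1`, `0`, `c` at
`l`, `h`, `k`, its three sides form a small circle `Z`. -/
structure IsTriangle (C : ResCube A X) (l h k : X) (c : Bool) (Z : A → Prop) (z : A) : Prop where
  l_ne_h : l ≠ h
  l_ne_k : l ≠ k
  h_ne_k : h ≠ k
  mem_z : Z z
  circle : ∀ I, I l = true → I h = false → I k = c → C.IsCircle I Z
  endIn_l : C.EndIn Z l
  endIn_h : C.EndIn Z h
  endIn_k : C.EndIn Z k
  cov : ∀ I, ¬ (I l = true ∧ I h = false ∧ I k = c) → ∀ a, ∃ b : {b // ¬ Z b}, C.rel I a b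

namespace IsTriangle

variable {C : ResCube A X} {l h k : X} {c : Bool} {Z : A → Prop} {z : A}

/-- The cancellation of all monomials of the resolutions with a small triangular circle. -/
def cancellation (T : C.IsTriangle l h k c Z z) : C.Cancellation where
  Q J := J l = true ∧ J h = false ∧ J k = c
  Z := Z
  z := z
  mem_z := T.mem_z
  T _ := True
  l := l
  h := h
  circle J hJ := T.circle J hJ.1 hJ.2.1 hJ.2.2
  split _ := ⟨T.endIn_l, fun _ hJ => hJ.1⟩
  merge _ := ⟨T.endIn_h, fun _ hJ => hJ.2.1⟩

/-- The resolutions that survive. -/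
theorem survives_iff (T : C.IsTriangle l h k c Z z) {γ : C.Gen} : T.cancellation.Survives γ ↔
    γ.res k = (!c) ∨ γ.res k = c ∧ γ.res l = false ∧ γ.res h = true := by
  simp only [Cancellation.Survives, cancellation, flip_apply, T.l_ne_h, T.l_ne_h.symm,
    T.l_ne_k.symm, T.h_ne_k.symm, if_true, if_false]
  cases γ.res l <;> cases γ.res h <;> cases γ.res k <;> cases c <;> simp

/-- The saddle relation on the arcs outside of the triangle. -/
def Outer (Z : A → Prop) (γ γ' : C.Gen) : Prop :=
  PartitionSaddle (fun a b : {b // ¬ Z b} => C.rel γ.res a b) (fun a b => C.rel γ'.res a b)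
    (fun a => γ.label a) (fun a => γ'.label a)

theorem outer_congr_left {ν γ γ' : C.Gen}
    (h1 : ∀ a b, ¬ Z a → ¬ Z b → (C.rel ν.res a b ↔ C.rel γ.res a b))
    (h2 : ∀ a, ¬ Z a → ν.label a = γ.label a) : Outer Z ν γ' ↔ Outer Z γ γ' := by
  have e1 : (fun a b : {b // ¬ Z b} => C.rel ν.res a b) = fun a b : {b // ¬ Z b} => C.rel γ.res a b := by
    funext a b; exact propext (h1 a b a.2 b.2)
  have e2 : (fun a : {b // ¬ Z b} => ν.label a) = fun a : {b // ¬ Z b} => γ.label a := by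
    funext a; exact h2 a a.2
  rw [Outer, Outer, e1, e2]

theorem outer_congr_right {ν γ γ' : C.Gen}
    (h1 : ∀ a b, ¬ Z a → ¬ Z b → (C.rel ν.res a b ↔ C.rel γ'.res a b))
    (h2 : ∀ a, ¬ Z a → ν.label a = γ'.label a) : Outer Z γ ν ↔ Outer Z γ γ' := by
  have e1 : (fun a b : {b // ¬ Z b} => C.rel ν.res a b) = fun a b : {b // ¬ Z b} => C.rel γ'.res a b := by
    funext a b; exact propext (h1 a b a.2 b.2)
  have e2 : (fun a : {b // ¬ Z b} => ν.label a) = fun a : {b // ¬ Z b} => γ'.label a := by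
    funext a; exact h2 a a.2
  rw [Outer, Outer, e1, e2]

theorem saddle_iff_outer (T : C.IsTriangle l h k c Z z) {γ γ' : C.Gen} {x : X}
    (hx : γ'.res = flip γ.res x) (hγ : ¬ (γ.res l = true ∧ γ.res h = false ∧ γ.res k = c))
    (hγ' : ¬ (γ'.res l = true ∧ γ'.res h = false ∧ γ'.res k = c)) :
    C.Saddle γ.res x γ.label γ'.label ↔ Outer Z γ γ' :=
  saddle_iff Subtype.val (fun _ => False) hx (fun _ _ h => h.elim) (fun _ _ h => h.elim)
    (fun a => Or.inr (T.cov _ hγ a)) (fun a => Or.inr (T.cov _ hγ' a)) fun _ h => h.elim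

open Classical in
theorem mat_eq (T : C.IsTriangle l h k c Z z) [Fintype X] {u : X → R}
    {e : (X → Bool) → X → ℤˣ} {γ γ' : C.Gen} {x : X}
    (hx : γ'.res = flip γ.res x) (hγ : ¬ (γ.res l = true ∧ γ.res h = false ∧ γ.res k = c))
    (hγ' : ¬ (γ'.res l = true ∧ γ'.res h = false ∧ γ'.res k = c)) :
    C.mat u e γ' γ = if Outer Z γ γ' then ((e γ.res x : ℤ) : R) * cf u x (γ'.res x) else 0 := by
  rw [mat_apply_of_eq _ _ _ hx]
  exact if_congr (T.saddle_iff_outer hx hγ hγ') rfl rfl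

variable [Finite A] [Fintype X]

/-- The correction term of the differential after the cancellation. -/
noncomputable def corr (T : C.IsTriangle l h k c Z z) (u : X → R) (e : (X → Bool) → X → ℤˣ)
    (γ' γ : C.Gen) : R :=
  ∑ i, C.mat u e γ' (T.cancellation.src i) *
    (((T.cancellation.sign e i : ℤ) : R) * C.mat u e (T.cancellation.tgt i) γ)

/-- The corrections for a resolution that is obtained by opening the triangle at `k`. -/
theorem corr_of_source (T : C.IsTriangle l h k c Z z) (u : X → R) {e : (X → Bool) → X → ℤˣ}
    (he : IsEdgeSign e) {P : X → Bool} (hl : P l = true) (hh : P h = false) (hk : P k = c)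
    {γ : C.Gen} (hγ : γ.res = flip P k) :
    ∃ ν : C.Gen, ν.res = flip P l ∧ (∀ a, ¬ Z a → ν.label a = γ.label a) ∧
      ∀ γ', T.corr u e γ' γ =
        C.mat u e γ' ν * (((e P l : ℤ) : R) * (((e P k : ℤ) : R) * cf u k c)) := by
  classical
  set K := T.cancellation with hK
  have hP : flip γ.res k = P := by rw [hγ, flip_flip]
  have hPZ : C.IsCircle P Z := T.circle P hl hh hk
  obtain ⟨γ₀, h1, h2, h3⟩ := exists_absorb T.endIn_k (by rw [hP]; exact hPZ) true
  rw [hP] at h1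
  let i₀ : K.Index := ⟨γ₀, by rw [h1]; exact ⟨hl, hh, hk⟩, trivial⟩
  have hi₀ : i₀.1.label K.z = true := h2 z T.mem_z
  have hν := Cancellation.src_eq_of_true hi₀
  have hZ₀ : C.IsCircle γ₀.res Z := by rw [h1]; exact hPZ
  refine ⟨K.src i₀, ?_, fun a ha => ?_, fun γ' => ?_⟩
  · rw [(Cancellation.src_res_l hi₀).1]
    exact congrArg (flip · l) h1
  · have := absorb_label T.endIn_l hZ₀ ha
    rw [← h3, absorb_label T.endIn_k hZ₀ ha, hν]
    exact this
  · rw [corr, Finset.sum_eq_single i₀]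
    · rw [Cancellation.sign_eq_of_true hi₀, Cancellation.tgt_eq_of_true hi₀]
      have hx : γ₀.res = flip γ.res k := by rw [h1, hP]
      have hs := (saddle_absorb_iff' T.endIn_k hZ₀ h2 hx).2 h3.symm
      change C.mat u e γ' (K.src i₀) * (((e γ₀.res l : ℤ) : R) * C.mat u e γ₀ γ) = _
      rw [mat_apply_of_eq _ _ _ hx, if_pos hs, h1, hγ, he.symm, hk]
    · intro i _ hi
      by_contra h0
      have h0 := right_ne_zero_of_mul (right_ne_zero_of_mul h0)
      obtain ⟨x, hx, hs, -⟩ := exists_of_mat_ne_zero h0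
      obtain ⟨hil, hih, hik⟩ : i.1.res l = true ∧ i.1.res h = false ∧ i.1.res k = c := i.2.1
      cases hl' : i.1.label K.z
      · rw [(Cancellation.tgt_res_h hl').1] at hx
        change flip i.1.res h = _ at hx
        have e1 := congrFun hx k
        have e2 := congrFun hx h
        rw [flip_of_ne _ T.h_ne_k.symm, hik] at e1
        rw [flip_self, hih] at e2
        by_cases hxk : x = k
        · rw [hxk, flip_of_ne _ T.h_ne_k, hγ, flip_of_ne _ T.h_ne_k, hh] at e2
          simp at e2
        · rw [flip_of_ne _ (Ne.symm hxk), hγ, flip_self, hk] at e1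
          simp at e1
      · rw [Cancellation.tgt_eq_of_true hl'] at hx hs
        have hxk : x = k := by
          by_contra hxk
          have e1 := congrFun hx k
          rw [flip_of_ne _ (Ne.symm hxk), hik, hγ, flip_self, hk] at e1
          simp at e1
        subst hxk
        refine hi (Cancellation.index_eq_of_absorb T.endIn_k (hl'.trans hi₀.symm) ?_)
        have hZi : C.IsCircle i.1.res Z := T.circle _ hil hih hik
        have := (saddle_absorb_iff' T.endIn_k hZi
          (fun a ha => (Cancellation.label_eq i.2.1 ha).trans hl') hx).1 hs
        exact this.symm.trans h3.symm
    · simp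

theorem corr_of_target (T : C.IsTriangle l h k c Z z) (u : X → R) {e : (X → Bool) → X → ℤˣ}
    {P : X → Bool} (hl : P l = true) (hh : P h = false) (hk : P k = c)
    {γ' : C.Gen} (hγ' : γ'.res = flip P k) :
    ∃ ν : C.Gen, ν.res = flip P h ∧ (∀ a, ¬ Z a → ν.label a = γ'.label a) ∧
      ∀ γ, T.corr u e γ' γ =
        (((e P k : ℤ) : R) * cf u k (!c)) * (((e P h : ℤ) : R) * C.mat u e ν γ) := by
  classical
  set K := T.cancellation with hK
  have hP : flip γ'.res k = P := by rw [hγ', flip_flip]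
  have hPZ : C.IsCircle P Z := T.circle P hl hh hk
  obtain ⟨γ₀, h1, h2, h3⟩ := exists_absorb T.endIn_k (by rw [hP]; exact hPZ) false
  rw [hP] at h1
  let i₀ : K.Index := ⟨γ₀, by rw [h1]; exact ⟨hl, hh, hk⟩, trivial⟩
  have hi₀ : i₀.1.label K.z = false := h2 z T.mem_z
  have hν := Cancellation.tgt_eq_of_false hi₀
  have hZ₀ : C.IsCircle γ₀.res Z := by rw [h1]; exact hPZ
  refine ⟨K.tgt i₀, ?_, fun a ha => ?_, fun γ => ?_⟩
  · rw [(Cancellation.tgt_res_h hi₀).1]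
    exact congrArg (flip · h) h1
  · have := absorb_label T.endIn_h hZ₀ ha
    rw [← h3, absorb_label T.endIn_k hZ₀ ha, hν]
    exact this
  · rw [corr, Finset.sum_eq_single i₀]
    · rw [Cancellation.sign_eq_of_false hi₀, Cancellation.src_eq_of_false hi₀]
      have hx : γ'.res = flip γ₀.res k := by rw [h1, hγ']
      have hs := (saddle_absorb_iff T.endIn_k hZ₀ h2 hx).2 h3.symm
      change C.mat u e γ' γ₀ * (((e γ₀.res h : ℤ) : R) * C.mat u e (K.tgt i₀) γ) = _
      rw [mat_apply_of_eq _ _ _ hx, if_pos hs, h1, hγ', flip_self, hk]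
    · intro i _ hi
      by_contra h0
      have h0 := left_ne_zero_of_mul h0
      obtain ⟨x, hx, hs, -⟩ := exists_of_mat_ne_zero h0
      obtain ⟨hil, hih, hik⟩ : i.1.res l = true ∧ i.1.res h = false ∧ i.1.res k = c := i.2.1
      cases hl' : i.1.label K.z
      · rw [Cancellation.src_eq_of_false hl'] at hx hs
        have hxk : x = k := by
          by_contra hxk
          have e1 := congrFun hx k
          rw [flip_of_ne _ (Ne.symm hxk), hik, hγ', flip_self, hk] at e1
          simp at e1
        subst hxk
        refine hi (Cancellation.index_eq_of_absorb T.endIn_k (hl'.trans hi₀.symm) ?_)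
        have hZi : C.IsCircle i.1.res Z := T.circle _ hil hih hik
        have := (saddle_absorb_iff T.endIn_k hZi
          (fun a ha => (Cancellation.label_eq i.2.1 ha).trans hl') hx).1 hs
        exact this.symm.trans h3.symm
      · rw [(Cancellation.src_res_l hl').1] at hx
        change _ = flip (flip i.1.res l) x at hx
        have e1 := congrFun hx k
        have e2 := congrFun hx l
        rw [hγ', flip_self, hk] at e1
        rw [hγ', flip_of_ne _ T.l_ne_k, hl] at e2
        by_cases hxk : x = k
        · rw [hxk, flip_of_ne _ T.l_ne_k, flip_self, hil] at e2
          simp at e2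
        · rw [flip_of_ne _ (Ne.symm hxk), flip_of_ne _ T.l_ne_k.symm, hik] at e1
          simp at e1
    · simp

theorem corr_eq_zero (T : C.IsTriangle l h k c Z z) (u : X → R) {e : (X → Bool) → X → ℤˣ}
    {γ γ' : C.Gen} (hγ : T.cancellation.Survives γ) (hγ' : T.cancellation.Survives γ')
    (h1 : ¬ (γ.res l = true ∧ γ.res h = false)) (h2 : ¬ (γ'.res l = true ∧ γ'.res h = false)) :
    T.corr u e γ' γ = 0 := by
  refine Finset.sum_eq_zero fun i _ => ?_
  obtain ⟨hil, hih, hik⟩ : i.1.res l = true ∧ i.1.res h = false ∧ i.1.res k = c := i.2.1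
  have key : ∀ {δ : C.Gen}, T.cancellation.Survives δ → ∀ x, δ.res = flip i.1.res x →
      δ.res l = true ∧ δ.res h = false := by
    intro δ hδ x hx
    rw [T.survives_iff] at hδ
    have e1 : x = l ∨ x = h ∨ x = k ∨ (x ≠ l ∧ x ≠ h ∧ x ≠ k) := by tauto
    rcases e1 with rfl | rfl | rfl | ⟨e1, e2, e3⟩
    · simp [hx, flip_apply, hil, hih, hik, T.l_ne_h.symm, T.l_ne_k.symm] at hδ
    · simp [hx, flip_apply, hil, hih, hik, T.l_ne_h, T.h_ne_k.symm] at hδ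
    · simp [hx, flip_apply, hil, hih, T.l_ne_k, T.h_ne_k]
    · simp [hx, flip_apply, hil, hih, e1.symm, e2.symm]
  by_contra h0
  cases hl' : i.1.label T.cancellation.z
  · obtain ⟨x, hx, -⟩ := exists_of_mat_ne_zero (left_ne_zero_of_mul h0)
    rw [Cancellation.src_eq_of_false hl'] at hx
    exact h2 (key hγ' x hx)
  · obtain ⟨x, hx, -⟩ := exists_of_mat_ne_zero (right_ne_zero_of_mul (right_ne_zero_of_mul h0))
    rw [Cancellation.tgt_eq_of_true hl'] at hx
    exact h1 (key hγ x (by rw [hx, flip_flip]))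

end IsTriangle

end ResCube

end LinkSplitting

namespace LinkSplitting

section

variable {X R : Type*} [DecidableEq X] [CommRing R]

theorem cast_mul_self (s : ℤˣ) : ((s : ℤ) : R) * ((s : ℤ) : R) = 1 := by
  rw [← Int.cast_mul, ← Units.val_mul, Int.units_mul_self]
  simp

theorem IsEdgeSign.cast_square {e : (X → Bool) → X → ℤˣ} (he : IsEdgeSign e) (I : X → Bool)
    {x y : X} (h : x ≠ y) : ((e I x : ℤ) : R) * ((e (flip I x) y : ℤ) : R) =
      -(((e I y : ℤ) : R) * ((e (flip I y) x : ℤ) : R)) := by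
  have := congrArg (fun s : ℤˣ => ((s : ℤ) : R)) (he.square I x y h)
  simpa using this

end

namespace ResCube

variable {A X R : Type*} [CommRing R] [DecidableEq X]

/-- Matching monomials have the same weight. -/
theorem wt_eq_of_matches {O A' X' : Type*} [DecidableEq X'] [Finite A] [Finite A'] [Finite O]
    {C : ResCube A X} {C' : ResCube A' X'} {f : O → A} {f' : O → A'} {γ : C.Gen} {δ : C'.Gen}
    (m : Matches f f' γ δ) (cov : ∀ a, ∃ b, C.rel γ.res a (f b))
    (cov' : ∀ a, ∃ b, C'.rel δ.res a (f' b)) : C'.wt 1 δ = C.wt 1 γ := by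
  have h1 : ∀ a b, (C.setoid γ.res).comap f a b → sgn (γ.label (f a)) = sgn (γ.label (f b)) :=
    fun a b h => by rw [γ.label_eq h]
  have e1 := classSum_congr (s := (C.setoid γ.res).comap f) (s' := C.setoid γ.res)
    (f := fun a => sgn (γ.label (f a))) (f' := fun a => (1 : A → ℤ) a * sgn (γ.label a)) h1
    (fun a b h => by rw [γ.label_eq h]; rfl) f (fun a b => Iff.rfl) (fun a => by simp)
    fun b => (cov b).imp fun _ h => symm h
  have e2 := classSum_congr (s := (C.setoid γ.res).comap f) (s' := C'.setoid δ.res)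
    (f := fun a => sgn (γ.label (f a))) (f' := fun a => (1 : A' → ℤ) a * sgn (δ.label a)) h1
    (fun a b h => by rw [δ.label_eq h]; rfl) f' (fun a b => m.1 a b) (fun a => by simp [m.2])
    fun b => (cov' b).imp fun _ h => symm h
  rw [wt, wt, e1, e2]

/-- The correspondence between the surviving resolutions before and after sliding a strand over the
crossing of a triangle: outside the triangle, the resolutions with digits `a`, `b`, `!c` at `l`, `h`,
`k` look like the ones with digits `b`, `a`, `!c` after the move. -/
def slide (l h k : X) (c : Bool) (I : X → Bool) : X → Bool :=
  if I k = c then I else I ∘ Equiv.swap l h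

/-- The resolutions that survive the cancellation of the triangle. -/
def Live (l h k : X) (c : Bool) (I : X → Bool) : Prop :=
  I k = (!c) ∨ I k = c ∧ I l = false ∧ I h = true

/-- Two cubes of resolutions with weights and signs that are related by a third Reidemeister
move. -/
structure IsSlide (C C' : ResCube A X) (l h k : X) (c : Bool) (Z : A → Prop) (z : A) (u u' : X → R)
    (e e' : (X → Bool) → X → ℤˣ) : Prop where
  T : C.IsTriangle l h k c Z z
  T' : C'.IsTriangle l h k c Z z
  rel : ∀ I, Live l h k c I → ∀ a b, ¬ Z a → ¬ Z b →
    (C.rel I a b ↔ C'.rel (slide l h k c I) a b)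
  sum : u l + u h + u k = 0
  u_l : u' l = -u l
  u_h : u' h = -u h
  u_k : u' k = -u k
  u_of_ne : ∀ x, x ≠ l → x ≠ h → x ≠ k → u' x = u x
  he : IsEdgeSign e
  e_eq : ∀ I x, e' I x = e (I ∘ Equiv.swap l h) (Equiv.swap l h x)

namespace IsSlide

variable {C C' : ResCube A X} {l h k : X} {c : Bool} {Z : A → Prop} {z : A} {u u' : X → R}
  {e e' : (X → Bool) → X → ℤˣ}

theorem comp_swap_swap (I : X → Bool) : (I ∘ Equiv.swap l h) ∘ Equiv.swap l h = I := by
  funext x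
  simp

theorem slide_k (hlk : l ≠ k) (hhk : h ≠ k) (I : X → Bool) : slide l h k c I k = I k := by
  rw [slide]
  split_ifs
  · rfl
  · rw [Function.comp, Equiv.swap_apply_of_ne_of_ne hlk.symm hhk.symm]

theorem slide_slide (hlk : l ≠ k) (hhk : h ≠ k) (I : X → Bool) :
    slide l h k c (slide l h k c I) = I := by
  by_cases hI : I k = c
  · have : slide l h k c I = I := if_pos hI
    rw [this, this]
  · have h1 : slide l h k c I = I ∘ Equiv.swap l h := if_neg hI
    have h2 := slide_k (c := c) hlk hhk I
    have h3 : slide l h k c (slide l h k c I) = slide l h k c I ∘ Equiv.swap l h :=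
      if_neg (by rwa [h2])
    rw [h3, h1, comp_swap_swap]

theorem live_slide (hlk : l ≠ k) (hhk : h ≠ k) {I : X → Bool} (hI : Live l h k c I) :
    Live l h k c (slide l h k c I) := by
  rcases hI with hI | hI
  · exact Or.inl (by rw [slide_k hlk hhk, hI])
  · rw [slide, if_pos hI.1]
    exact Or.inr hI

theorem edgeSign_swap (he : IsEdgeSign e)
    (e_eq : ∀ I x, e' I x = e (I ∘ Equiv.swap l h) (Equiv.swap l h x)) : IsEdgeSign e' := by
  have hf : ∀ I x, flip I x ∘ Equiv.swap l h =
      flip (I ∘ Equiv.swap l h) (Equiv.swap l h x) := by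
    intro I x
    have := flip_comp_equiv I (Equiv.swap l h) (Equiv.swap l h x)
    rwa [Equiv.swap_apply_self] at this
  constructor
  · intro I x
    rw [e_eq, e_eq, hf, he.symm]
  · intro I x y hxy
    rw [e_eq, e_eq, e_eq, e_eq, hf, hf]
    exact he.square _ _ _ ((Equiv.swap l h).injective.ne hxy)

protected theorem symm (S : IsSlide C C' l h k c Z z u u' e e') :
    IsSlide C' C l h k c Z z u' u e' e where
  T := S.T'
  T' := S.T
  rel I hI a b ha hb := by
    have := S.rel _ (live_slide S.T.l_ne_k S.T.h_ne_k hI) a b ha hb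
    rw [slide_slide S.T.l_ne_k S.T.h_ne_k] at this
    exact this.symm
  sum := by rw [S.u_l, S.u_h, S.u_k]; linear_combination -S.sum
  u_l := by rw [S.u_l, neg_neg]
  u_h := by rw [S.u_h, neg_neg]
  u_k := by rw [S.u_k, neg_neg]
  u_of_ne x h1 h2 h3 := (S.u_of_ne x h1 h2 h3).symm
  he := edgeSign_swap S.he S.e_eq
  e_eq I x := by rw [S.e_eq, comp_swap_swap, Equiv.swap_apply_self]

/-- The rescaling of the surviving monomials, given by their resolution. -/
def scale (l h k : X) (c : Bool) (e : (X → Bool) → X → ℤˣ) (I : X → Bool) : ℤˣ :=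
  if I k = c then (if c then -1 else 1) * (e (flip I h) l * e (flip I h) h) else 1

theorem scale_slide (S : IsSlide C C' l h k c Z z u u' e e') {I : X → Bool}
    (hI : Live l h k c I) : scale l h k c e' (slide l h k c I) = scale l h k c e I := by
  rw [scale, scale, slide_k S.T.l_ne_k S.T.h_ne_k]
  split_ifs with h1 h2
  all_goals try rfl
  all_goals
    obtain ⟨-, h3, h4⟩ := hI.resolve_left (by rw [h1]; simp)
    have h5 : flip I h ∘ Equiv.swap l h = flip I h := by
      funext x
      simp only [Function.comp, flip_apply, Equiv.swap_apply_def]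
      have := S.T.l_ne_h
      split_ifs <;> simp_all
    rw [slide, if_pos h1, S.e_eq, S.e_eq, h5, Equiv.swap_apply_left, Equiv.swap_apply_right,
      mul_comm (e (flip I h) h)]

/-- The pairs of resolutions between which the cancellation of the triangle creates a correction
of the differential. -/
def Special (l h k : X) (c : Bool) (J J' : X → Bool) : Prop :=
  ∃ P : X → Bool, P l = true ∧ P h = false ∧ P k = c ∧
    ((J = flip P k ∧ (J' = flip (flip P l) k ∨ J' = flip (flip P l) h)) ∨
      (J' = flip P k ∧ (J = flip (flip P h) k ∨ J = flip (flip P l) h)))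

theorem live_iff (T : C.IsTriangle l h k c Z z) {γ : C.Gen} :
    T.cancellation.Survives γ ↔ Live l h k c γ.res := T.survives_iff

variable [Finite A] [Fintype X]

theorem corr_eq_zero_of_not_special (T : C.IsTriangle l h k c Z z) (he : IsEdgeSign e)
    {γ γ' : C.Gen} (hγ : Live l h k c γ.res) (hγ' : Live l h k c γ'.res)
    (hs : ¬ Special l h k c γ.res γ'.res) : T.corr u e γ' γ = 0 := by
  have corner : ∀ {I : X → Bool}, Live l h k c I → I l = true → I h = false →
      ∃ P : X → Bool, P l = true ∧ P h = false ∧ P k = c ∧ I = flip P k := by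
    intro I hI h1 h2
    have h3 := hI.resolve_right (by simp [h1])
    exact ⟨flip I k, by rw [flip_of_ne _ T.l_ne_k, h1], by rw [flip_of_ne _ T.h_ne_k, h2],
      by rw [flip_self, h3, Bool.not_not], (flip_flip _ _).symm⟩
  by_cases h1 : γ.res l = true ∧ γ.res h = false
  · obtain ⟨P, hl, hh, hk, hP⟩ := corner hγ h1.1 h1.2
    obtain ⟨ν, hν, -, hc⟩ := T.corr_of_source u he hl hh hk hP
    rw [hc, mat_apply_of_ne, zero_mul]
    intro x hx
    rw [hν] at hx
    have e1 : x = l ∨ x = h ∨ x = k ∨ (x ≠ l ∧ x ≠ h ∧ x ≠ k) := by tauto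
    rcases e1 with rfl | rfl | rfl | ⟨e1, e2, e3⟩
    · rw [flip_flip] at hx
      rw [hx] at hγ'
      rcases hγ' with h4 | h4
      · rw [hk] at h4; simp at h4
      · rw [hl] at h4; simp at h4
    · exact hs ⟨P, hl, hh, hk, Or.inl ⟨hP, Or.inr hx⟩⟩
    · exact hs ⟨P, hl, hh, hk, Or.inl ⟨hP, Or.inl hx⟩⟩
    · simp [Live, hx, flip_apply, hl, hh, hk, e1.symm, e2.symm, e3.symm, T.l_ne_h.symm,
        T.l_ne_k.symm] at hγ'
  · by_cases h2 : γ'.res l = true ∧ γ'.res h = false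
    · obtain ⟨P, hl, hh, hk, hP⟩ := corner hγ' h2.1 h2.2
      obtain ⟨ν, hν, -, hc⟩ := T.corr_of_target u (e := e) hl hh hk hP
      rw [hc, mat_apply_of_ne, mul_zero, mul_zero]
      intro x hx
      rw [hν, flip_eq_iff] at hx
      have e1 : x = l ∨ x = h ∨ x = k ∨ (x ≠ l ∧ x ≠ h ∧ x ≠ k) := by tauto
      rcases e1 with rfl | rfl | rfl | ⟨e1, e2, e3⟩
      · exact hs ⟨P, hl, hh, hk, Or.inr ⟨hP, Or.inr (by rw [hx, flip_comm])⟩⟩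
      · rw [flip_flip] at hx
        rw [hx] at hγ
        rcases hγ with h4 | h4
        · rw [hk] at h4; simp at h4
        · rw [hl] at h4; simp at h4
      · exact hs ⟨P, hl, hh, hk, Or.inr ⟨hP, Or.inl hx⟩⟩
      · simp [Live, hx, flip_apply, hl, hh, hk, e1.symm, e2.symm, e3.symm, T.l_ne_h,
          T.h_ne_k.symm] at hγ
    · exact T.corr_eq_zero u ((live_iff T).2 hγ) ((live_iff T).2 hγ') h1 h2

end IsSlide

end ResCube

end LinkSplitting

namespace LinkSplitting

set_option linter.unusedSectionVars false

namespace ResCube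

namespace IsSlide

open IsTriangle

variable {A X R : Type*} [CommRing R] [DecidableEq X] {C C' : ResCube A X} {l h k : X} {c : Bool}
  {Z : A → Prop} {z : A} {u u' : X → R} {e e' : (X → Bool) → X → ℤˣ} [Finite A] [Fintype X]

theorem not_corner_of_live {I : X → Bool} (hI : Live l h k c I) :
    ¬ (I l = true ∧ I h = false ∧ I k = c) := by
  rintro ⟨h1, h2, h3⟩
  rcases hI with h | h
  · rw [h3] at h; simp at h
  · rw [h1] at h; simp at h

section Corrections

variable (T : C.IsTriangle l h k c Z z) (he : IsEdgeSign e) {P : X → Bool} (hl : P l = true)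
  (hh : P h = false) (hk : P k = c) {γ γ' : C.Gen}

include T he hl hh hk

theorem rel_outer {v v' : X} (hv : C.EndIn Z v) (hv' : C.EndIn Z v') {a b : A} (ha : ¬ Z a)
    (hb : ¬ Z b) : C.rel (flip P v) a b ↔ C.rel (flip P v') a b := by
  have hZ := T.circle P hl hh hk
  rw [hv.rel_flip_of_not hZ ha hb, hv'.rel_flip_of_not hZ ha hb]

theorem live_flip_k : Live l h k c (flip P k) := Or.inl (by rw [flip_self, hk])

theorem live_flip_flip_k {v : X} (hv : v ≠ k) : Live l h k c (flip (flip P v) k) :=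
  Or.inl (by rw [flip_self, flip_of_ne _ hv.symm, hk])

theorem live_E : Live l h k c (flip (flip P l) h) := Or.inr (by
  simp [flip_apply, hl, hh, hk, T.l_ne_h, T.l_ne_h.symm, T.l_ne_k.symm, T.h_ne_k.symm])

open Classical in
/-- Elimination changes the coefficient in direction `l` next to the corner `P` from `u l` to
`u l + u k`. -/
theorem diff_split (hγ : γ.res = flip P k) (hγ' : γ'.res = flip (flip P l) k) :
    C.mat u e γ' γ - T.corr u e γ' γ =
      if Outer Z γ γ' then ((e (flip P k) l : ℤ) : R) * (u l + u k) else 0 := by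
  obtain ⟨ν, hν, hl', hc⟩ := T.corr_of_source u he hl hh hk hγ
  have n1 := not_corner_of_live (live_flip_k T he hl hh hk)
  have n2 := not_corner_of_live (live_flip_flip_k T he hl hh hk T.l_ne_k)
  have n3 : ¬ (flip P l l = true ∧ flip P l h = false ∧ flip P l k = c) := by simp [hl]
  rw [hc, T.mat_eq (x := l) (by rw [hγ', hγ, flip_comm]) (by rwa [hγ]) (by rwa [hγ']),
    T.mat_eq (x := k) (by rw [hγ', hν]) (by rwa [hν]) (by rwa [hγ']),
    outer_congr_left (ν := ν) (γ := γ) (fun a b ha hb => by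
      rw [hν, hγ]; exact rel_outer T he hl hh hk T.endIn_l T.endIn_k ha hb) hl']
  have b1 : γ'.res l = false := by simp [hγ', flip_apply, hl, T.l_ne_k]
  have b2 : γ'.res k = !c := by simp [hγ', flip_apply, hk, T.l_ne_k.symm]
  have sq := he.cast_square (R := R) P T.l_ne_k
  have s1 := cast_mul_self (R := R) (e P k)
  have hcf := cf_mul_cf_not u k c
  rw [b1, b2, hγ, hν]
  split_ifs
  · have : cf u l false = u l := by simp [cf]
    rw [this]
    linear_combination (-((e P k : ℤ) : R) * u k) * sq + (((e (flip P k) l : ℤ) : R) * u k) * s1 -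
      (((e (flip P l) k : ℤ) : R) * ((e P l : ℤ) : R) * ((e P k : ℤ) : R)) * hcf
  · ring

open Classical in
/-- Elimination creates an entry between resolutions next to `P` that differ at all three
crossings. -/
theorem diff_to_E (hγ : γ.res = flip P k) (hγ' : γ'.res = flip (flip P l) h) :
    C.mat u e γ' γ - T.corr u e γ' γ = if Outer Z γ γ' then
      -(((e (flip P l) h : ℤ) : R) * ((e P l : ℤ) : R) * ((e P k : ℤ) : R) * cf u k c) else 0 := by
  obtain ⟨ν, hν, hl', hc⟩ := T.corr_of_source u he hl hh hk hγ
  have n2 := not_corner_of_live (live_E T he hl hh hk)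
  have n3 : ¬ (flip P l l = true ∧ flip P l h = false ∧ flip P l k = c) := by simp [hl]
  rw [hc, mat_apply_of_ne, T.mat_eq (x := h) (by rw [hγ', hν]) (by rwa [hν]) (by rwa [hγ']),
    outer_congr_left (ν := ν) (γ := γ) (fun a b ha hb => by
      rw [hν, hγ]; exact rel_outer T he hl hh hk T.endIn_l T.endIn_k ha hb) hl']
  · have b1 : γ'.res h = true := by simp [hγ', flip_apply, hh, T.l_ne_h.symm]
    rw [b1, hν]
    split_ifs
    · simp only [cf, if_true]; ring
    · ring
  · intro x hx
    rw [hγ, hγ'] at hx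
    by_cases hxl : x = l
    · have := congrFun hx h
      simp [flip_apply, hxl, hh, T.l_ne_h.symm, T.h_ne_k] at this
    · have := congrFun hx l
      simp [flip_apply, Ne.symm hxl, hl, T.l_ne_h, T.l_ne_k] at this

open Classical in
/-- Elimination changes the coefficient in direction `h` next to the corner `P` from `u h` to
`u h + u k`. -/
theorem diff_merge (hγ : γ.res = flip (flip P h) k) (hγ' : γ'.res = flip P k) :
    C.mat u e γ' γ - T.corr u e γ' γ =
      if Outer Z γ γ' then ((e (flip P k) h : ℤ) : R) * (u h + u k) else 0 := by
  obtain ⟨ν, hν, hl', hc⟩ := T.corr_of_target u (e := e) hl hh hk hγ'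
  have n1 := not_corner_of_live (live_flip_k T he hl hh hk)
  have n2 := not_corner_of_live (live_flip_flip_k T he hl hh hk T.h_ne_k)
  have n3 : ¬ (flip P h l = true ∧ flip P h h = false ∧ flip P h k = c) := by simp [hh]
  rw [hc, T.mat_eq (x := h) (by rw [hγ', hγ, flip_comm (flip P h), flip_flip]) (by rwa [hγ])
      (by rwa [hγ']),
    T.mat_eq (x := k) (by rw [hγ, hν, flip_flip]) (by rwa [hγ]) (by rwa [hν]),
    outer_congr_right (ν := ν) (γ' := γ') (fun a b ha hb => by
      rw [hν, hγ']; exact rel_outer T he hl hh hk T.endIn_h T.endIn_k ha hb) hl']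
  have b1 : γ'.res h = false := by simp [hγ', flip_apply, hh, T.h_ne_k]
  have b2 : ν.res k = c := by simp [hν, flip_apply, hk, T.h_ne_k.symm]
  have sq := he.cast_square (R := R) P T.h_ne_k
  have s1 := cast_mul_self (R := R) (e P k)
  have hcf := cf_mul_cf_not u k c
  have e1 : e (flip (flip P h) k) h = e (flip P k) h := by
    rw [flip_comm, he.symm]
  rw [b1, b2, hγ, e1, he.symm]
  split_ifs
  · have : cf u h false = u h := by simp [cf]
    rw [this]
    linear_combination (-((e P k : ℤ) : R) * u k) * sq + (((e (flip P k) h : ℤ) : R) * u k) * s1 -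
      (((e (flip P h) k : ℤ) : R) * ((e P h : ℤ) : R) * ((e P k : ℤ) : R)) * hcf
  · ring

open Classical in
/-- The entry in the direction opposite to that of `diff_to_E`. -/
theorem diff_from_E (hγ : γ.res = flip (flip P l) h) (hγ' : γ'.res = flip P k) :
    C.mat u e γ' γ - T.corr u e γ' γ = if Outer Z γ γ' then
      -(((e (flip P h) l : ℤ) : R) * ((e P h : ℤ) : R) * ((e P k : ℤ) : R) * cf u k (!c))
        else 0 := by
  obtain ⟨ν, hν, hl', hc⟩ := T.corr_of_target u (e := e) hl hh hk hγ'
  have n2 := not_corner_of_live (live_E T he hl hh hk)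
  have n3 : ¬ (flip P h l = true ∧ flip P h h = false ∧ flip P h k = c) := by simp [hh]
  rw [hc, mat_apply_of_ne, T.mat_eq (x := l) (by rw [hγ, hν, flip_comm (flip P l), flip_flip])
      (by rwa [hγ]) (by rwa [hν]),
    outer_congr_right (ν := ν) (γ' := γ') (fun a b ha hb => by
      rw [hν, hγ']; exact rel_outer T he hl hh hk T.endIn_h T.endIn_k ha hb) hl']
  · have b1 : ν.res l = true := by simp [hν, flip_apply, hl, T.l_ne_h]
    rw [b1, hγ, flip_comm, he.symm]
    split_ifs
    · simp only [cf, if_true]; ring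
    · ring
  · intro x hx
    rw [hγ, hγ'] at hx
    by_cases hxl : x = l
    · have := congrFun hx h
      simp [flip_apply, hxl, hh, T.l_ne_h.symm, T.h_ne_k] at this
    · have := congrFun hx l
      simp [flip_apply, Ne.symm hxl, hl, T.l_ne_h, T.l_ne_k] at this

end Corrections

/-- Surviving monomials that correspond to each other. -/
structure Corresponds (S : IsSlide C C' l h k c Z z u u' e e') (γ : C.Gen) (δ : C'.Gen) :
    Prop where
  live : Live l h k c γ.res
  res : δ.res = slide l h k c γ.res
  label : ∀ a, ¬ Z a → δ.label a = γ.label a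

variable {S : IsSlide C C' l h k c Z z u u' e e'} {γ γ' : C.Gen} {δ δ' : C'.Gen}

theorem Corresponds.live' (m : Corresponds S γ δ) : Live l h k c δ.res := by
  rw [m.res]
  exact live_slide S.T.l_ne_k S.T.h_ne_k m.live

protected theorem Corresponds.symm (m : Corresponds S γ δ) : Corresponds S.symm δ γ where
  live := m.live'
  res := by rw [m.res, slide_slide S.T.l_ne_k S.T.h_ne_k]
  label a ha := (m.label a ha).symm

theorem Corresponds.outer_iff (m : Corresponds S γ δ) (m' : Corresponds S γ' δ') :
    Outer Z δ δ' ↔ Outer Z γ γ' := by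
  have e1 : ∀ {γ : C.Gen} {δ : C'.Gen}, Corresponds S γ δ →
      (fun a b : {b // ¬ Z b} => C'.rel δ.res a b) = fun a b : {b // ¬ Z b} => C.rel γ.res a b := by
    intro γ δ m
    funext a b
    rw [m.res]
    exact propext (S.rel _ m.live a b a.2 b.2).symm
  have e2 : ∀ {γ : C.Gen} {δ : C'.Gen}, Corresponds S γ δ →
      (fun a : {b // ¬ Z b} => δ.label a) = fun a : {b // ¬ Z b} => γ.label a := by
    intro γ δ m
    funext a
    exact m.label a a.2
  rw [Outer, Outer, e1 m, e1 m', e2 m, e2 m']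

theorem corner_comp_swap {P : X → Bool} (hl : P l = true) (hh : P h = false) :
    P ∘ Equiv.swap l h = flip (flip P l) h ∧ flip (flip P l) h ∘ Equiv.swap l h = P := by
  have : P ∘ Equiv.swap l h = flip (flip P l) h := by
    funext x
    simp only [Function.comp, flip_apply, Equiv.swap_apply_def]
    split_ifs <;> simp_all
  exact ⟨this, by rw [← this, comp_swap_swap]⟩

theorem flip_comp_swap (I : X → Bool) (x : X) : flip I x ∘ Equiv.swap l h =
    flip (I ∘ Equiv.swap l h) (Equiv.swap l h x) := by
  have := flip_comp_equiv I (Equiv.swap l h) (Equiv.swap l h x)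
  rwa [Equiv.swap_apply_self] at this

theorem cf_neg (c : Bool) (hu : u' k = -u k) :
    cf u' k c = -((((if c then -1 else 1 : ℤˣ) : ℤ) : R) * cf u k c) ∧
      cf u' k (!c) = (((if c then -1 else 1 : ℤˣ) : ℤ) : R) * cf u k (!c) := by
  cases c <;> simp [cf, hu]

/-- The differentials of corresponding special pairs: a correction on one side corresponds to an edge
of the cube on the other side. -/
theorem diff_eq_of_special (m : Corresponds S γ δ) (m' : Corresponds S γ' δ')
    (hs : Special l h k c γ.res γ'.res) :
    ((scale l h k c e γ'.res : ℤ) : R) * (C.mat u e γ' γ - S.T.corr u e γ' γ) =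
      (C'.mat u' e' δ' δ - S.T'.corr u' e' δ' δ) * ((scale l h k c e γ.res : ℤ) : R) := by
  classical
  have T := S.T
  have he := S.he
  obtain ⟨P, hl, hh, hk, hs⟩ := hs
  have hlk := T.l_ne_k
  have hhk := T.h_ne_k
  have hlh := T.l_ne_h
  obtain ⟨sw1, sw2⟩ := corner_comp_swap hl hh
  have hck : (!c) ≠ c := by simp
  have swk : Equiv.swap l h k = k := Equiv.swap_apply_of_ne_of_ne hlk.symm hhk.symm
  have sl_k : slide l h k c (flip P k) = flip (flip (flip P l) h) k := by
    rw [slide, if_neg (by rw [flip_self, hk]; exact hck), flip_comp_swap, sw1, swk]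
  have sl_l : slide l h k c (flip (flip P l) k) = flip (flip P l) k := by
    rw [slide, if_neg (by rw [flip_self, flip_of_ne _ hlk.symm, hk]; exact hck), flip_comp_swap,
      flip_comp_swap, sw1, swk, Equiv.swap_apply_left, flip_flip]
  have sl_h : slide l h k c (flip (flip P h) k) = flip (flip P h) k := by
    rw [slide, if_neg (by rw [flip_self, flip_of_ne _ hhk.symm, hk]; exact hck), flip_comp_swap,
      flip_comp_swap, sw1, swk, Equiv.swap_apply_right, flip_comm P, flip_flip]
  have sl_E : slide l h k c (flip (flip P l) h) = flip (flip P l) h := by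
    rw [slide, if_pos (by rw [flip_of_ne _ hhk.symm, flip_of_ne _ hlk.symm, hk])]
  have sc_1 : ∀ v, v ≠ k → scale l h k c e (flip (flip P v) k) = 1 := fun v hv => by
    rw [scale, if_neg (by rw [flip_self, flip_of_ne _ hv.symm, hk]; exact hck)]
  have sc_k : scale l h k c e (flip P k) = 1 := by
    rw [scale, if_neg (by rw [flip_self, hk]; exact hck)]
  have sc_E : scale l h k c e (flip (flip P l) h) =
      (if c then -1 else 1) * (e P l * e (flip P l) h) := by
    rw [scale, if_pos (by rw [flip_of_ne _ hhk.symm, flip_of_ne _ hlk.symm, hk]), flip_flip,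
      he.symm]
  have dead : ∀ δ : C'.Gen, δ.res l = false ∨ δ.res h = true →
      ¬ (δ.res l = true ∧ δ.res h = false) := by
    rintro δ h1 ⟨h2, h3⟩
    rw [h2, h3] at h1
    simp at h1
  have lk : flip (flip (flip P l) h) k l = false ∧ flip (flip P l) h l = false ∧
      flip (flip P l) k l = false := by
    simp [flip_apply, hl, hlh, hlk]
  have corr0 : (δ.res l = false ∨ δ.res h = true) → (δ'.res l = false ∨ δ'.res h = true) →
      S.T'.corr u' e' δ' δ = 0 := fun h1 h2 => S.T'.corr_eq_zero u' ((live_iff _).2 m.live')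
        ((live_iff _).2 m'.live') (dead _ h1) (dead _ h2)
  have nc := not_corner_of_live m.live'
  have nc' := not_corner_of_live m'.live'
  have ek : e' (flip (flip P l) h) k = e P k := by rw [S.e_eq, sw2, swk]
  rcases hs with ⟨hγ, hγ' | hγ'⟩ | ⟨hγ', hγ | hγ⟩
  · have hδ := m.res
    rw [hγ, sl_k] at hδ
    have hδ' := m'.res
    rw [hγ', sl_l] at hδ'
    rw [diff_split T he hl hh hk hγ hγ', corr0 (Or.inl (by rw [hδ]; exact lk.1))
      (Or.inl (by rw [hδ']; exact lk.2.2)), sub_zero, S.T'.mat_eq (x := h)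
      (by rw [hδ, hδ', flip_comm _ k h, flip_flip]) nc nc', m.outer_iff m', hγ, hγ', sc_k,
      sc_1 _ hlk]
    have b : δ'.res h = false := by simp [hδ', flip_apply, hh, hlh.symm, hhk]
    have es : e' δ.res h = e (flip P k) l := by
      rw [hδ, S.e_eq, flip_comp_swap, sw2, swk, Equiv.swap_apply_right]
    rw [b, es]
    have h3 := S.u_h
    have h4 := S.sum
    split_ifs
    · simp only [cf, Bool.false_eq_true, if_false]
      rw [h3]
      push_cast
      linear_combination ((e (flip P k) l : ℤ) : R) * h4
    · simp
  · have hδ := m.res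
    rw [hγ, sl_k] at hδ
    have hδ' := m'.res
    rw [hγ', sl_E] at hδ'
    rw [diff_to_E T he hl hh hk hγ hγ', corr0 (Or.inl (by rw [hδ]; exact lk.1))
      (Or.inl (by rw [hδ']; exact lk.2.1)), sub_zero, S.T'.mat_eq (x := k)
      (by rw [hδ, hδ', flip_flip]) nc nc', m.outer_iff m', hγ, hγ', sc_k, sc_E]
    have b : δ'.res k = c := by simp [hδ', flip_apply, hk, hlk.symm, hhk.symm]
    have hc := (cf_neg (k := k) c S.u_k).1
    rw [b, hδ, (edgeSign_swap he S.e_eq).symm, ek, hc]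
    have s1 := cast_mul_self (R := R) (e P l)
    have s2 := cast_mul_self (R := R) (e (flip P l) h)
    simp only [Units.val_mul, Int.cast_mul, Units.val_one, Int.cast_one, mul_one]
    generalize (((if c = true then -1 else 1 : ℤˣ) : ℤ) : R) = ς
    split_ifs
    · linear_combination (-ς * ((e P k : ℤ) : R) * cf u k c * ((e (flip P l) h : ℤ) : R) *
        ((e (flip P l) h : ℤ) : R)) * s1 - (ς * ((e P k : ℤ) : R) * cf u k c) * s2
    · ring
  · have hδ := m.res
    rw [hγ, sl_h] at hδ
    have hδ' := m'.res
    rw [hγ', sl_k] at hδ'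
    have hb : δ.res h = true := by simp [hδ, flip_apply, hh, hhk]
    rw [diff_merge T he hl hh hk hγ hγ', corr0 (Or.inr hb)
      (Or.inl (by rw [hδ']; exact lk.1)), sub_zero, S.T'.mat_eq (x := l)
      (by rw [hδ, hδ', flip_comm _ k l, flip_comm _ h l]) nc nc', m.outer_iff m', hγ, hγ', sc_k,
      sc_1 _ hhk]
    have b : δ'.res l = false := by rw [hδ']; exact lk.1
    have es : e' δ.res l = e (flip P k) h := by
      rw [hδ, S.e_eq, flip_comp_swap, flip_comp_swap, sw1, swk, Equiv.swap_apply_left,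
        Equiv.swap_apply_right, flip_comm P l h, flip_flip, flip_comm, he.symm]
    rw [b, es]
    have h3 := S.u_l
    have h4 := S.sum
    split_ifs
    · simp only [cf, Bool.false_eq_true, if_false]
      rw [h3]
      push_cast
      linear_combination ((e (flip P k) h : ℤ) : R) * h4
    · simp
  · have hδ := m.res
    rw [hγ, sl_E] at hδ
    have hδ' := m'.res
    rw [hγ', sl_k] at hδ'
    rw [diff_from_E T he hl hh hk hγ hγ', corr0 (Or.inl (by rw [hδ]; exact lk.2.1))
      (Or.inl (by rw [hδ']; exact lk.1)), sub_zero, S.T'.mat_eq (x := k)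
      (by rw [hδ, hδ']) nc nc', m.outer_iff m', hγ, hγ', sc_k, sc_E]
    have b : δ'.res k = !c := by simp [hδ', flip_apply, hk, hlk.symm, hhk.symm]
    have hc := (cf_neg (k := k) c S.u_k).2
    rw [b, hδ, ek, hc]
    have s1 := cast_mul_self (R := R) (if c then -1 else 1)
    have sq := he.cast_square (R := R) P T.l_ne_h
    simp only [Units.val_mul, Int.cast_mul, Units.val_one, Int.cast_one, one_mul]
    generalize (((if c = true then -1 else 1 : ℤˣ) : ℤ) : R) = ς at s1 ⊢
    split_ifs
    · linear_combination (-((e P k : ℤ) : R) * cf u k (!c)) * sq - ((e P k : ℤ) : R) *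
        cf u k (!c) * ((e P l : ℤ) : R) * ((e (flip P l) h : ℤ) : R) * s1
    · ring

end IsSlide

end ResCube

end LinkSplitting

namespace LinkSplitting

set_option linter.unusedSectionVars false

namespace ResCube

namespace IsSlide

open IsTriangle

variable {A X R : Type*} [CommRing R] [DecidableEq X] {C C' : ResCube A X} {l h k : X} {c : Bool}
  {Z : A → Prop} {z : A} {u u' : X → R} {e e' : (X → Bool) → X → ℤˣ} [Finite A] [Fintype X]
  {S : IsSlide C C' l h k c Z z u u' e e'} {γ γ' : C.Gen} {δ δ' : C'.Gen}

/-- On resolutions that differ at a crossing away from the triangle the rescaling accounts for the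
different signs of the edges. -/
theorem scale_flip (he : IsEdgeSign e) {I : X → Bool}
    (hI : I k = c) (hIl : I l = false) (hIh : I h = true) {x : X} (h1 : x ≠ l) (h2 : x ≠ h)
    (h3 : x ≠ k) : scale l h k c e (flip I x) * e I x =
      e (I ∘ Equiv.swap l h) x * scale l h k c e I := by
  set P₀ := flip I h with hP₀
  have hI' : flip P₀ h = I := flip_flip _ _
  have hP : I ∘ Equiv.swap l h = flip P₀ l := by
    funext y
    simp only [hP₀, Function.comp, flip_apply, Equiv.swap_apply_def]
    split_ifs <;> simp_all
  have e1 : flip (flip I x) h = flip P₀ x := flip_comm I x h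
  have e2 : e I x = e (flip P₀ h) x := by rw [hI']
  rw [scale, scale, if_pos hI, if_pos (by rw [flip_of_ne _ h3.symm, hI]), e1, e2, hP, ← hP₀]
  have q1 := he.square P₀ x l h1
  have q2 := he.square P₀ x h h2
  rw [← mul_right_inj (e P₀ x), ← mul_right_inj (e P₀ x)]
  calc _ = (if c = true then -1 else 1) * (e P₀ x * e (flip P₀ x) l) *
        (e P₀ x * e (flip P₀ x) h) * e (flip P₀ h) x := by ac_rfl
    _ = (if c = true then -1 else 1) * (e P₀ l * e (flip P₀ l) x) * (e P₀ h * e (flip P₀ h) x) *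
        e (flip P₀ h) x := by rw [q1, q2]; simp
    _ = (if c = true then -1 else 1) * e P₀ l * e (flip P₀ l) x * e P₀ h *
        (e (flip P₀ h) x * e (flip P₀ h) x) := by ac_rfl
    _ = (e P₀ x * e P₀ x) * ((if c = true then -1 else 1) * e P₀ l * e (flip P₀ l) x * e P₀ h) := by
      rw [Int.units_mul_self, Int.units_mul_self, one_mul, mul_one]
    _ = _ := by ac_rfl

/-- Edges of the cube for which neither side has a correction. -/
theorem edge_of_not_special (S : IsSlide C C' l h k c Z z u u' e e') {J : X → Bool} {x : X}
    (hJ : Live l h k c J) (hJ' : Live l h k c (flip J x)) (h1 : ¬ Special l h k c J (flip J x))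
    (h2 : ¬ Special l h k c (slide l h k c J) (slide l h k c (flip J x))) :
    slide l h k c (flip J x) = flip (slide l h k c J) (Equiv.swap l h x) ∧
      ((scale l h k c e (flip J x) : ℤ) : R) * (((e J x : ℤ) : R) * cf u x (!J x)) =
        (((e' (slide l h k c J) (Equiv.swap l h x) : ℤ) : R) *
          cf u' (Equiv.swap l h x) (!J x)) * ((scale l h k c e J : ℤ) : R) := by
  have hlk := S.T.l_ne_k
  have hhk := S.T.h_ne_k
  have hlh := S.T.l_ne_h
  have hck : (!c) ≠ c := by simp
  have e1 : x = k ∨ x = l ∨ x = h ∨ (x ≠ l ∧ x ≠ h ∧ x ≠ k) := by tauto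
  rcases hJ with hJk | ⟨hJk, hJl, hJh⟩
  · have sl : slide l h k c J = J ∘ Equiv.swap l h := if_neg (by rw [hJk]; exact hck)
    have sc : scale l h k c e J = 1 := if_neg (by rw [hJk]; exact hck)
    have main : x ≠ k → (cf u x (!J x) = cf u' (Equiv.swap l h x) (!J x)) →
        slide l h k c (flip J x) = flip (slide l h k c J) (Equiv.swap l h x) ∧
      ((scale l h k c e (flip J x) : ℤ) : R) * (((e J x : ℤ) : R) * cf u x (!J x)) =
        (((e' (slide l h k c J) (Equiv.swap l h x) : ℤ) : R) *
          cf u' (Equiv.swap l h x) (!J x)) * ((scale l h k c e J : ℤ) : R) := by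
      intro hx hcf
      have hk' : flip J x k ≠ c := by rw [flip_of_ne _ hx.symm, hJk]; exact hck
      refine ⟨?_, ?_⟩
      · rw [sl, slide, if_neg hk', flip_comp_swap]
      · rw [sc, scale, if_neg hk', sl, S.e_eq, comp_swap_swap, Equiv.swap_apply_self, hcf]
        ring
    rcases e1 with rfl | rfl | rfl | ⟨n1, n2, n3⟩
    · exfalso
      have hJ' := hJ'.resolve_left (by rw [flip_self, hJk]; simp)
      rw [flip_of_ne _ hlk, flip_of_ne _ hhk] at hJ'
      refine h2 ⟨flip (J ∘ Equiv.swap l h) x, ?_, ?_, ?_, Or.inl ⟨?_, Or.inr ?_⟩⟩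
      · simp [flip_apply, hlk, hJ'.2.2]
      · simp [flip_apply, hhk, hJ'.2.1]
      · rw [flip_self, Function.comp, Equiv.swap_apply_of_ne_of_ne hlk.symm hhk.symm, hJk,
          Bool.not_not]
      · rw [flip_flip, sl]
      · rw [slide, if_pos hJ'.1]
        have := (corner_comp_swap (l := l) (h := h) (P := J ∘ Equiv.swap l h)
          (by simp [hJ'.2.2]) (by simp [hJ'.2.1])).1
        rw [comp_swap_swap] at this
        rw [flip_comm _ x l, flip_comm _ x h, ← this]
    · refine main hlk ?_
      have : J x = false := by
        by_contra hJl
        rw [Bool.not_eq_false] at hJl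
        cases hJh : J h
        · refine h1 ⟨flip J k, by rw [flip_of_ne _ hlk, hJl], by rw [flip_of_ne _ hhk, hJh],
            by rw [flip_self, hJk, Bool.not_not], Or.inl ⟨(flip_flip _ _).symm, Or.inl ?_⟩⟩
          rw [flip_comm _ k, flip_flip]
        · have hk' : flip J x k ≠ c := by rw [flip_of_ne _ hlk.symm, hJk]; exact hck
          have sl' : slide x h k c (flip J x) = flip (J ∘ Equiv.swap x h) h := by
            rw [slide, if_neg hk', flip_comp_swap, Equiv.swap_apply_left]
          refine h2 ⟨flip (flip (J ∘ Equiv.swap x h) h) k, ?_, ?_, ?_,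
            Or.inr ⟨by rw [flip_flip, sl'], Or.inl ?_⟩⟩
          · simp [flip_apply, hlk, hlh, hJh]
          · simp [flip_apply, hhk, hJl]
          · rw [flip_self, flip_of_ne _ hhk.symm, Function.comp,
              Equiv.swap_apply_of_ne_of_ne hlk.symm hhk.symm, hJk, Bool.not_not]
          · rw [sl, flip_comm _ h k, flip_flip, flip_flip]
      simp [this, cf]
    · refine main hhk ?_
      have : J x = false := by
        by_contra hJh
        rw [Bool.not_eq_false] at hJh
        cases hJl : J l
        · have hk' : flip J x k ≠ c := by rw [flip_of_ne _ hhk.symm, hJk]; exact hck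
          have sl' : slide l x k c (flip J x) = flip (J ∘ Equiv.swap l x) l := by
            rw [slide, if_neg hk', flip_comp_swap, Equiv.swap_apply_right]
          refine h2 ⟨flip (J ∘ Equiv.swap l x) k, ?_, ?_, ?_,
            Or.inl ⟨by rw [flip_flip, sl], Or.inl ?_⟩⟩
          · simp [flip_apply, hlk, hJh]
          · simp [flip_apply, hhk, hJl]
          · rw [flip_self, Function.comp,
              Equiv.swap_apply_of_ne_of_ne hlk.symm hhk.symm, hJk, Bool.not_not]
          · rw [sl', flip_comm _ k l, flip_flip]
        · refine h1 ⟨flip (flip J x) k, by simp [flip_apply, hlk, hlh, hJl],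
            by simp [flip_apply, hhk, hJh],
            by rw [flip_self, flip_of_ne _ hhk.symm, hJk, Bool.not_not],
            Or.inr ⟨(flip_flip _ _).symm, Or.inl ?_⟩⟩
          rw [flip_comm _ x k, flip_flip, flip_flip]
      simp [this, cf]
    · refine main n3 ?_
      rw [Equiv.swap_apply_of_ne_of_ne n1 n2, cf, cf, S.u_of_ne x n1 n2 n3]
  · have sl : slide l h k c J = J := if_pos hJk
    rcases e1 with rfl | rfl | rfl | ⟨n1, n2, n3⟩
    · exfalso
      have sl' : slide l h x c (flip J x) = flip (J ∘ Equiv.swap l h) x := by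
        rw [slide, if_neg (by rw [flip_self, hJk]; simp), flip_comp_swap,
          Equiv.swap_apply_of_ne_of_ne hlk.symm hhk.symm]
      refine h2 ⟨J ∘ Equiv.swap l h, by simp [hJh], by simp [hJl],
        by rw [Function.comp, Equiv.swap_apply_of_ne_of_ne hlk.symm hhk.symm, hJk],
        Or.inr ⟨sl', Or.inr ?_⟩⟩
      have := (corner_comp_swap (l := l) (h := h) (P := J ∘ Equiv.swap l h)
        (by simp [hJh]) (by simp [hJl])).1
      rw [comp_swap_swap] at this
      rw [sl, ← this]
    · exfalso
      have := hJ'.resolve_left (by rw [flip_of_ne _ hlk.symm, hJk]; exact hck.symm)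
      rw [flip_self, hJl] at this
      simp at this
    · exfalso
      have := hJ'.resolve_left (by rw [flip_of_ne _ hhk.symm, hJk]; exact hck.symm)
      rw [flip_self, hJh] at this
      simp at this
    · have hk' : flip J x k = c := by rw [flip_of_ne _ n3.symm, hJk]
      rw [Equiv.swap_apply_of_ne_of_ne n1 n2, sl, slide, if_pos hk']
      refine ⟨rfl, ?_⟩
      have h5 := congrArg (fun s : ℤˣ => ((s : ℤ) : R))
        (scale_flip S.he hJk hJl hJh n1 n2 n3)
      simp only [Units.val_mul, Int.cast_mul] at h5
      rw [S.e_eq, Equiv.swap_apply_of_ne_of_ne n1 n2]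
      have : cf u' x (!J x) = cf u x (!J x) := by rw [cf, cf, S.u_of_ne x n1 n2 n3]
      rw [this]
      linear_combination (cf u x (!J x)) * h5

theorem mat_eq_of_not_special (m : Corresponds S γ δ) (m' : Corresponds S γ' δ')
    (h1 : ¬ Special l h k c γ.res γ'.res) (h2 : ¬ Special l h k c δ.res δ'.res) {x : X}
    (hx : γ'.res = flip γ.res x) : (∃ y, δ'.res = flip δ.res y) ∧
    ((scale l h k c e γ'.res : ℤ) : R) * C.mat u e γ' γ =
      C'.mat u' e' δ' δ * ((scale l h k c e γ.res : ℤ) : R) := by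
  classical
  rw [m.res, m'.res, hx] at h2
  rw [hx] at h1
  obtain ⟨e1, e2⟩ := edge_of_not_special S m.live (hx ▸ m'.live) h1 h2
  have hy : δ'.res = flip δ.res (Equiv.swap l h x) := by rw [m.res, m'.res, hx, e1]
  refine ⟨⟨_, hy⟩, ?_⟩
  rw [S.T.mat_eq hx (not_corner_of_live m.live) (not_corner_of_live m'.live),
    S.T'.mat_eq hy (not_corner_of_live m.live') (not_corner_of_live m'.live'), m.outer_iff m']
  have b1 : γ'.res x = !γ.res x := by rw [hx, flip_self]
  have b2 : δ'.res (Equiv.swap l h x) = !δ.res (Equiv.swap l h x) := by rw [hy, flip_self]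
  split_ifs
  · rw [b1, b2, m.res, hx, e2]
    congr 3
    by_cases hk : x = k
    · rw [hk, Equiv.swap_apply_of_ne_of_ne S.T.l_ne_k.symm S.T.h_ne_k.symm,
        slide_k S.T.l_ne_k S.T.h_ne_k]
    · by_cases hJ : γ.res k = c
      · have e3 : slide l h k c γ.res = γ.res := if_pos hJ
        have hJ' := m'.live.resolve_left (by rw [hx, flip_of_ne _ (Ne.symm hk), hJ]; simp)
        have hJ := m.live.resolve_left (by rw [hJ]; simp)
        have n1 : x ≠ l := by
          rintro rfl
          rw [b1, hJ.2.1] at hJ'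
          simp at hJ'
        have n2 : x ≠ h := by
          rintro rfl
          rw [b1, hJ.2.2] at hJ'
          simp at hJ'
        rw [e3, Equiv.swap_apply_of_ne_of_ne n1 n2]
      · rw [slide, if_neg hJ, Function.comp, Equiv.swap_apply_self]
  · simp

/-- After cancelling the triangle on both sides, the differentials agree up to signs. -/
theorem diff_eq (m : Corresponds S γ δ) (m' : Corresponds S γ' δ') :
    ((scale l h k c e γ'.res : ℤ) : R) * (C.mat u e γ' γ - S.T.corr u e γ' γ) =
      (C'.mat u' e' δ' δ - S.T'.corr u' e' δ' δ) * ((scale l h k c e γ.res : ℤ) : R) := by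
  by_cases h1 : Special l h k c γ.res γ'.res
  · exact diff_eq_of_special m m' h1
  have hsc : ∀ {γ : C.Gen} {δ : C'.Gen}, Corresponds S γ δ →
      scale l h k c e' δ.res = scale l h k c e γ.res := fun m => by
    rw [m.res, S.scale_slide m.live]
  by_cases h2 : Special l h k c δ.res δ'.res
  · have := diff_eq_of_special m.symm m'.symm h2
    rw [hsc m, hsc m'] at this
    have s1 := cast_mul_self (R := R) (scale l h k c e γ.res)
    have s2 := cast_mul_self (R := R) (scale l h k c e γ'.res)
    linear_combination
      (-((scale l h k c e γ.res : ℤ) : R) * ((scale l h k c e γ'.res : ℤ) : R)) * this +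
      (((scale l h k c e γ.res : ℤ) : R) * (C'.mat u' e' δ' δ - S.T'.corr u' e' δ' δ)) * s2 -
      (((scale l h k c e γ'.res : ℤ) : R) * (C.mat u e γ' γ - S.T.corr u e γ' γ)) * s1
  rw [corr_eq_zero_of_not_special S.T S.he m.live m'.live h1,
    corr_eq_zero_of_not_special S.T' S.symm.he m.live' m'.live' h2, sub_zero, sub_zero]
  by_cases hx : ∃ x, γ'.res = flip γ.res x
  · obtain ⟨x, hx⟩ := hx
    exact (mat_eq_of_not_special m m' h1 h2 hx).2
  · have hy : ¬ ∃ y, δ'.res = flip δ.res y := fun ⟨y, hy⟩ =>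
      hx (mat_eq_of_not_special (R := R) (S := S.symm) m.symm m'.symm h2 h1 hy).1
    rw [mat_apply_of_ne _ _ _ fun x h => hx ⟨x, h⟩, mat_apply_of_ne _ _ _ fun x h => hy ⟨x, h⟩]
    simp

theorem exists_corresponds (S : IsSlide C C' l h k c Z z u u' e e') (γ : C.Gen)
    (hγ : Live l h k c γ.res) : ∃ δ : C'.Gen, Corresponds S γ δ := by
  have hl := live_slide S.T.l_ne_k S.T.h_ne_k hγ
  obtain ⟨δ, h1, h2, -⟩ := exists_gen (C := C') (Subtype.val : {b // ¬ Z b} → A)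
    (Z := fun _ => False) (I := slide l h k c γ.res) (fun _ _ h => h.elim)
    (fun a => Or.inr (S.T'.cov _ (not_corner_of_live hl) a)) (fun _ h => h)
    (fun a => γ.label a) (fun a b hab => γ.label_eq ((S.rel _ hγ a b a.2 b.2).2 hab)) false
  exact ⟨δ, hγ, h1, fun a ha => h2 ⟨a, ha⟩⟩

theorem Corresponds.eq_of_left (m : Corresponds S γ δ) (m' : Corresponds S γ δ') : δ = δ' :=
  Gen.ext_of_cover (m.res.trans m'.res.symm) (f := (Subtype.val : {b // ¬ Z b} → A))
    (Z := fun _ => False) (fun a => Or.inr (S.T'.cov _ (not_corner_of_live m.live') a))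
    (fun a => (m.label a a.2).trans (m'.label a a.2).symm) fun _ h => h.elim

theorem Corresponds.level_eq (m : Corresponds S γ δ) : C'.level 1 δ = C.level 1 γ := by
  have h1 : C'.wt 1 δ = C.wt 1 γ := wt_eq_of_matches
    (f := (Subtype.val : {b // ¬ Z b} → A)) (f' := (Subtype.val : {b // ¬ Z b} → A))
    ⟨fun a b => by rw [m.res]; exact S.rel _ m.live a b a.2 b.2, fun a => (m.label a a.2).symm⟩
    (S.T.cov _ (not_corner_of_live m.live)) (S.T'.cov _ (not_corner_of_live m.live'))
  rw [level, level, h1, m.res]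
  congr 1
  rw [slide]
  split_ifs
  · rfl
  · rw [ones, ones, ← Equiv.sum_comp (Equiv.swap l h)]
    simp

/-- After cancellation of the triangular circles, the two sides of a third Reidemeister move have
isomorphic complexes: the monomials with the same values outside of the triangle correspond to each
other, up to sign. -/
theorem strictUpTo_iff (S : IsSlide C C' l h k c Z z u u' e e') (hu : C.Flat u) (hu' : C'.Flat u')
    (n : ℕ) : StrictUpTo (C.mat u e).mulVecLin (levelFiltration R (C.level 1)) n ↔
      StrictUpTo (C'.mat u' e').mulVecLin (levelFiltration R (C'.level 1)) n := by
  rw [S.T.cancellation.strictUpTo_iff S.he hu, S.T'.cancellation.strictUpTo_iff S.symm.he hu']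
  have live : ∀ γ : Rest S.T.cancellation.src S.T.cancellation.tgt, Live l h k c γ.1.res :=
    fun γ => (live_iff S.T).1 (Cancellation.survives_iff.2 γ.2)
  have rest : ∀ δ : C'.Gen, Live l h k c δ.res →
      (∀ i, δ ≠ S.T'.cancellation.src i) ∧ ∀ i, δ ≠ S.T'.cancellation.tgt i :=
    fun δ h => Cancellation.survives_iff.1 ((live_iff S.T').2 h)
  choose Φ hΦ using fun γ : Rest S.T.cancellation.src S.T.cancellation.tgt =>
    exists_corresponds S γ.1 (live γ)
  let Ψ : Rest S.T.cancellation.src S.T.cancellation.tgt →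
      Rest S.T'.cancellation.src S.T'.cancellation.tgt := fun γ => ⟨Φ γ, rest _ (hΦ γ).live'⟩
  have hΨ : Function.Bijective Ψ := by
    constructor
    · intro γ γ' h
      have h1 := hΦ γ
      have h2 : Φ γ = Φ γ' := congrArg Subtype.val h
      rw [h2] at h1
      exact Subtype.ext (Corresponds.eq_of_left h1.symm (hΦ γ').symm)
    · intro δ
      have hδ := (live_iff S.T').1 (Cancellation.survives_iff.2 δ.2)
      obtain ⟨γ, hγ⟩ := exists_corresponds S.symm δ.1 hδ
      have hr : (∀ i, γ ≠ S.T.cancellation.src i) ∧ ∀ i, γ ≠ S.T.cancellation.tgt i :=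
        Cancellation.survives_iff.1 ((live_iff S.T).2 hγ.live')
      exact ⟨⟨γ, hr⟩, Subtype.ext (Corresponds.eq_of_left (hΦ ⟨γ, hr⟩) hγ.symm)⟩
  refine strictUpTo_iff_of_equiv (Equiv.ofBijective Ψ hΨ)
    (fun γ => signUnit R (scale l h k c e γ.1.res)) (fun γ γ' => ?_) 0 (fun γ => ?_) n
  · exact diff_eq (hΦ γ) (hΦ γ')
  · rw [add_zero]
    exact (hΦ γ).level_eq

end IsSlide

end ResCube

end LinkSplitting

namespace LinkSplitting

/-! ### Cycles of a permutation and transpositions -/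

/-- Multiplication by a transposition splits the common cycle of two points or merges their cycles. -/
theorem sameCycle_mul_swap_iff {α : Type*} [Finite α] [DecidableEq α] (σ : Equiv.Perm α) {a b : α}
    (hab : a ≠ b) : (σ * Equiv.swap a b).SameCycle a b ↔ ¬ σ.SameCycle a b := by
  classical
  set σ' := σ * Equiv.swap a b with hσ'
  have ha : σ' a = σ b := by simp [hσ']
  have hb : σ' b = σ a := by simp [hσ']
  have hne : ∀ c, c ≠ a → c ≠ b → σ' c = σ c := fun c h h' => by
    simp [hσ', Equiv.swap_apply_of_ne_of_ne h h']
  constructor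
  · intro h' h
    have hex : ∃ m, (σ ^ m) a = b := h.exists_nat_pow_eq
    set m := Nat.find hex with hm
    have hmb : (σ ^ m) a = b := Nat.find_spec hex
    have hmin : ∀ i < m, (σ ^ i) a ≠ b := fun i hi => Nat.find_min hex hi
    have hm0 : 0 < m := by
      rcases Nat.eq_zero_or_pos m with h0 | h0
      · rw [h0] at hmb; exact absurd hmb hab
      · exact h0
    have hmina : ∀ i, 0 < i → i < m → (σ ^ i) a ≠ a := by
      intro i h0 hi hia
      refine hmin (m - i) (by omega) ?_
      rw [← hmb]
      conv_rhs => rw [show m = m - i + i by omega, pow_add, Equiv.Perm.mul_apply, hia]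
    have key : ∀ i, 0 < i → i ≤ m → (σ' ^ i) b = (σ ^ i) a := by
      intro i
      induction i with
      | zero => intro h; exact absurd h (lt_irrefl _)
      | succ i ih =>
        intro _ hi
        rcases Nat.eq_zero_or_pos i with h0 | h0
        · subst h0; simpa using hb
        · rw [pow_succ', Equiv.Perm.mul_apply, ih h0 (by omega), hne _ (hmina i h0 (by omega))
            (hmin i (by omega)), pow_succ', Equiv.Perm.mul_apply]
    obtain ⟨n, hn⟩ := h'.symm.exists_nat_pow_eq
    have hper : Function.IsPeriodicPt σ' m b := by
      rw [Function.IsPeriodicPt, Function.IsFixedPt, ← Equiv.Perm.coe_pow, key m hm0 le_rfl, hmb]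
    have hn' : (σ' ^ (n % m)) b = a := by
      rw [Equiv.Perm.coe_pow, hper.iterate_mod_apply, ← Equiv.Perm.coe_pow, hn]
    rcases Nat.eq_zero_or_pos (n % m) with h0 | h0
    · rw [h0] at hn'; exact hab hn'.symm
    · have hlt := Nat.mod_lt n hm0
      rw [key _ h0 hlt.le] at hn'
      exact hmina _ h0 hlt hn'
  · intro h
    have hex : ∃ m, 0 < m ∧ (σ ^ m) b = b := ⟨orderOf σ, orderOf_pos σ, by rw [pow_orderOf_eq_one]; rfl⟩
    set m := Nat.find hex with hm
    obtain ⟨hm0, hmb⟩ : 0 < m ∧ (σ ^ m) b = b := Nat.find_spec hex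
    have hmin : ∀ i, 0 < i → i < m → (σ ^ i) b ≠ b := fun i h0 hi hib =>
      Nat.find_min hex hi ⟨h0, hib⟩
    have hmina : ∀ i, (σ ^ i) b ≠ a := fun i hi => h (Equiv.Perm.SameCycle.symm ⟨i, by simpa using hi⟩)
    have key : ∀ i, 0 < i → i ≤ m → (σ' ^ i) a = (σ ^ i) b := by
      intro i
      induction i with
      | zero => intro h; exact absurd h (lt_irrefl _)
      | succ i ih =>
        intro _ hi
        rcases Nat.eq_zero_or_pos i with h0 | h0
        · subst h0; simpa using ha
        · rw [pow_succ', Equiv.Perm.mul_apply, ih h0 (by omega), hne _ (hmina i)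
            (hmin i h0 (by omega)), pow_succ', Equiv.Perm.mul_apply]
    exact ⟨m, by rw [zpow_natCast, key m hm0 le_rfl, hmb]⟩

theorem neg_one_ne_one : (-1 : ℤˣ) ≠ 1 := by decide

/-! ### Signed Gauss codes -/

/-- A signed Gauss code, as in `GaussDiagram`, with arcs and crossings in arbitrary types. -/
structure Code (A X : Type*) where
  next : Equiv.Perm A
  upper : X → A
  lower : X → A
  pos : X → Bool
  inj : Function.Injective (Sum.elim upper lower)

namespace Code

variable {A X : Type*} (C : Code A X)

theorem upper_inj {x y : X} : C.upper x = C.upper y ↔ x = y :=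
  ⟨fun h => Sum.inl_injective (C.inj (a₁ := Sum.inl x) (a₂ := Sum.inl y) h), fun h => h ▸ rfl⟩

theorem lower_inj {x y : X} : C.lower x = C.lower y ↔ x = y :=
  ⟨fun h => Sum.inr_injective (C.inj (a₁ := Sum.inr x) (a₂ := Sum.inr y) h), fun h => h ▸ rfl⟩

theorem upper_ne_lower (x y : X) : C.upper x ≠ C.lower y := fun h => by
  have := C.inj (a₁ := Sum.inl x) (a₂ := Sum.inr y) h
  simp at this

/-- The point `a` is not a passage through a crossing. -/
def Plain (a : A) : Prop := ∀ x, C.upper x ≠ a ∧ C.lower x ≠ a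

theorem plain_or (a : A) : C.Plain a ∨ (∃ x, a = C.upper x) ∨ ∃ x, a = C.lower x := by
  by_cases h : C.Plain a
  · exact Or.inl h
  · rw [Plain] at h
    push Not at h
    obtain ⟨x, hx⟩ := h
    by_cases h' : C.upper x = a
    · exact Or.inr (Or.inl ⟨x, h'.symm⟩)
    · exact Or.inr (Or.inr ⟨x, (hx h').symm⟩)

open Classical in
/-- The other passage through the crossing at the point `a`, or `a` itself if there is no
crossing. -/
noncomputable def opp (a : A) : A :=
  if h : ∃ x, C.upper x = a then C.lower h.choose
  else if h : ∃ x, C.lower x = a then C.upper h.choose else a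

@[simp] theorem opp_upper (x : X) : C.opp (C.upper x) = C.lower x := by
  have h : ∃ y, C.upper y = C.upper x := ⟨x, rfl⟩
  rw [opp, dif_pos h, (C.upper_inj).1 h.choose_spec]

@[simp] theorem opp_lower (x : X) : C.opp (C.lower x) = C.upper x := by
  have h : ∃ y, C.lower y = C.lower x := ⟨x, rfl⟩
  rw [opp, dif_neg (by rintro ⟨y, hy⟩; exact C.upper_ne_lower _ _ hy), dif_pos h,
    (C.lower_inj).1 h.choose_spec]

theorem opp_plain {a : A} (h : C.Plain a) : C.opp a = a := by
  rw [opp, dif_neg (by rintro ⟨y, hy⟩; exact (h y).1 hy), dif_neg (by rintro ⟨y, hy⟩; exact (h y).2 hy)]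

@[simp] theorem opp_opp (a : A) : C.opp (C.opp a) = a := by
  rcases C.plain_or a with h | ⟨x, rfl⟩ | ⟨x, rfl⟩
  · rw [C.opp_plain h, C.opp_plain h]
  · simp
  · simp

/-- The crossing at the point `a` has the unoriented resolution. -/
def Turned (I : X → Bool) (a : A) : Prop :=
  ∃ x, (C.upper x = a ∨ C.lower x = a) ∧ I x = C.pos x

theorem turned_upper {I : X → Bool} {x : X} : C.Turned I (C.upper x) ↔ I x = C.pos x := by
  constructor
  · rintro ⟨y, h | h, hy⟩
    · rwa [← C.upper_inj.1 h]
    · exact absurd h.symm (C.upper_ne_lower _ _)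
  · exact fun h => ⟨x, Or.inl rfl, h⟩

theorem turned_lower {I : X → Bool} {x : X} : C.Turned I (C.lower x) ↔ I x = C.pos x := by
  constructor
  · rintro ⟨y, h | h, hy⟩
    · exact absurd h (C.upper_ne_lower _ _)
    · rwa [← C.lower_inj.1 h]
  · exact fun h => ⟨x, Or.inr rfl, h⟩

theorem not_turned_plain {I : X → Bool} {a : A} (h : C.Plain a) : ¬ C.Turned I a := by
  rintro ⟨x, h' | h', -⟩
  · exact (h x).1 h'
  · exact (h x).2 h'

theorem turned_opp {I : X → Bool} {a : A} : C.Turned I (C.opp a) ↔ C.Turned I a := by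
  rcases C.plain_or a with h | ⟨x, rfl⟩ | ⟨x, rfl⟩
  · rw [C.opp_plain h]
  · rw [opp_upper, turned_lower, turned_upper]
  · rw [opp_lower, turned_lower, turned_upper]

/-- Two arcs are joined at a point in the resolution `I`. -/
inductive Joined (I : X → Bool) : A → A → Prop
  | straight (a) (h : ¬ C.Turned I a) : Joined I a (C.next (C.opp a))
  | turned_in (a) (h : C.Turned I a) : Joined I a (C.opp a)
  | turned_out (a) (h : C.Turned I a) : Joined I (C.next a) (C.next (C.opp a))

/-- Two arcs lie on the same circle of the resolution `I`. -/
def rel (I : X → Bool) : A → A → Prop := Relation.EqvGen (C.Joined I)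

theorem rel_equivalence (I : X → Bool) : Equivalence (C.rel I) := Relation.EqvGen.is_equivalence _

variable {C}

theorem rel_straight {I : X → Bool} {a : A} (h : ¬ C.Turned I a) :
    C.rel I a (C.next (C.opp a)) := .rel _ _ (.straight a h)

theorem rel_in {I : X → Bool} {a : A} (h : C.Turned I a) : C.rel I a (C.opp a) :=
  .rel _ _ (.turned_in a h)

theorem rel_out {I : X → Bool} {a : A} (h : C.Turned I a) :
    C.rel I (C.next a) (C.next (C.opp a)) := .rel _ _ (.turned_out a h)

theorem rel_plain {I : X → Bool} {a : A} (h : C.Plain a) : C.rel I a (C.next a) := by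
  have := rel_straight (C.not_turned_plain h (I := I))
  rwa [C.opp_plain h] at this

theorem rel_le {I : X → Bool} {S : A → A → Prop} (hS : Equivalence S)
    (h : ∀ a b, C.Joined I a b → S a b) {a b : A} (hab : C.rel I a b) : S a b := by
  induction hab with
  | rel a b h' => exact h a b h'
  | refl a => exact hS.refl a
  | symm a b _ ih => exact hS.symm ih
  | trans a b c _ _ ih ih' => exact hS.trans ih ih'

variable (C)

/-- A checkerboard orientation of the arcs, relative to the orientation of the link: it is reversed
at each passage through a crossing, and at each crossing the two arcs of one strand point towards
the crossing and those of the other strand away from it. -/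
structure IsColoring (τ : A → ℤˣ) : Prop where
  plain : ∀ a, C.Plain a → τ (C.next a) = τ a
  upper : ∀ x, τ (C.next (C.upper x)) = -τ (C.upper x)
  lower : ∀ x, τ (C.next (C.lower x)) = -τ (C.lower x)
  lower_eq : ∀ x, τ (C.lower x) = -τ (C.upper x)

variable {C}

namespace IsColoring

variable {τ : A → ℤˣ}

theorem opp_eq (hτ : C.IsColoring τ) {a : A} (h : ¬ C.Plain a) : τ (C.opp a) = -τ a := by
  rcases C.plain_or a with h' | ⟨x, rfl⟩ | ⟨x, rfl⟩
  · exact absurd h' h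
  · rw [opp_upper, hτ.lower_eq]
  · rw [opp_lower, hτ.lower_eq, neg_neg]

theorem next_eq (hτ : C.IsColoring τ) {a : A} (h : ¬ C.Plain a) : τ (C.next a) = -τ a := by
  rcases C.plain_or a with h' | ⟨x, rfl⟩ | ⟨x, rfl⟩
  · exact absurd h' h
  · exact hτ.upper x
  · exact hτ.lower x

theorem next_opp (hτ : C.IsColoring τ) (a : A) : τ (C.next (C.opp a)) = τ a := by
  by_cases h : C.Plain a
  · rw [C.opp_plain h, hτ.plain a h]
  · have h' : ¬ C.Plain (C.opp a) := fun h' => by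
      rw [← C.opp_opp a, C.opp_plain h'] at h
      exact h h'
    rw [hτ.next_eq h', hτ.opp_eq h, neg_neg]

protected theorem neg (hτ : C.IsColoring τ) : C.IsColoring fun a => -τ a :=
  ⟨fun a h => by rw [hτ.plain a h], fun x => by rw [hτ.upper], fun x => by rw [hτ.lower],
    fun x => by rw [hτ.lower_eq]⟩

end IsColoring

open Classical in
/-- The arc after `a` on its circle of the resolution `I`, with respect to the orientation `τ`. -/
noncomputable def succ (C : Code A X) (τ : A → ℤˣ) (I : X → Bool) (a : A) : A :=
  if τ a = 1 then if C.Turned I a then C.opp a else C.next (C.opp a)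
  else if C.Turned I (C.next.symm a) then C.next (C.opp (C.next.symm a))
    else C.opp (C.next.symm a)

theorem not_plain_of_turned {I : X → Bool} {a : A} (h : C.Turned I a) : ¬ C.Plain a :=
  fun h' => C.not_turned_plain h' h

theorem IsColoring.succ_succ {τ : A → ℤˣ} (hτ : C.IsColoring τ) (I : X → Bool) (a : A) :
    C.succ (fun a => -τ a) I (C.succ τ I a) = a := by
  have h1 := neg_one_ne_one
  rcases Int.units_eq_one_or (τ a) with ha | ha
  · rw [succ.eq_1 C τ, if_pos ha]
    split_ifs with h
    · rw [succ, hτ.opp_eq (not_plain_of_turned h), neg_neg, if_pos ha, if_pos (C.turned_opp.2 h),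
        opp_opp]
    · rw [succ, hτ.next_opp, ha, if_neg h1, Equiv.symm_apply_apply, if_neg (C.turned_opp.not.2 h),
        opp_opp]
  · rw [succ.eq_1 C τ, if_neg (by rw [ha]; exact h1)]
    obtain ⟨b, rfl⟩ := C.next.surjective a
    rw [Equiv.symm_apply_apply]
    split_ifs with h
    · rw [succ, hτ.next_opp]
      rw [hτ.next_eq (not_plain_of_turned h), neg_inj] at ha
      rw [ha, if_neg h1, Equiv.symm_apply_apply, if_pos (C.turned_opp.2 h), opp_opp]
    · have : -τ (C.opp b) = 1 := by
        rw [← hτ.next_opp (C.opp b), opp_opp, ha, neg_neg]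
      rw [succ, if_pos this, if_neg (C.turned_opp.not.2 h), opp_opp]

/-- The permutation of the arcs whose cycles are the oriented circles of the resolution `I`. -/
noncomputable def IsColoring.perm {τ : A → ℤˣ} (hτ : C.IsColoring τ) (I : X → Bool) :
    Equiv.Perm A where
  toFun := C.succ τ I
  invFun := C.succ (fun a => -τ a) I
  left_inv a := hτ.succ_succ I a
  right_inv a := by
    have := hτ.neg.succ_succ I a
    simpa using this

theorem IsColoring.perm_apply {τ : A → ℤˣ} (hτ : C.IsColoring τ) (I : X → Bool) (a : A) :
    hτ.perm I a = C.succ τ I a := rfl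

theorem rel_succ (τ : A → ℤˣ) (I : X → Bool) (a : A) : C.rel I a (C.succ τ I a) := by
  have E := C.rel_equivalence I
  rw [succ]
  obtain ⟨b, rfl⟩ := C.next.surjective a
  rw [Equiv.symm_apply_apply]
  split_ifs with h1 h2 h2
  · exact rel_in h2
  · exact rel_straight h2
  · exact rel_out h2
  · have := rel_straight (C.turned_opp.not.2 h2)
    rw [opp_opp] at this
    exact E.symm this

/-- The coloring orients every circle: start forwards on arcs of color `1`, backwards on the others. -/
theorem IsColoring.rel_iff_sameCycle [Finite A] {τ : A → ℤˣ} (hτ : C.IsColoring τ) (I : X → Bool)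
    (a b : A) : C.rel I a b ↔ (hτ.perm I).SameCycle a b := by
  have E := C.rel_equivalence I
  constructor
  · refine rel_le (Equiv.Perm.SameCycle.equivalence _) fun a b h => ?_
    have one : ∀ c, (hτ.perm I).SameCycle c (C.succ τ I c) := fun c =>
      ⟨1, by rw [zpow_one]; rfl⟩
    cases h with
    | straight _ h =>
      rcases Int.units_eq_one_or (τ a) with ha | ha
      · have := one a
        rwa [succ, if_pos ha, if_neg h] at this
      · have := one (C.next (C.opp a))
        rw [succ, hτ.next_opp, ha, if_neg (by decide), Equiv.symm_apply_apply,
          if_neg (C.turned_opp.not.2 h), opp_opp] at this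
        exact this.symm
    | turned_in _ h =>
      rcases Int.units_eq_one_or (τ a) with ha | ha
      · have := one a
        rwa [succ, if_pos ha, if_pos h] at this
      · have := one (C.opp a)
        rw [succ, hτ.opp_eq (not_plain_of_turned h), ha, neg_neg, if_pos rfl,
          if_pos (C.turned_opp.2 h), opp_opp] at this
        exact this.symm
    | turned_out a h =>
      rcases Int.units_eq_one_or (τ a) with ha | ha
      · have := one (C.next a)
        rwa [succ, hτ.next_eq (not_plain_of_turned h), ha, if_neg (by decide),
          Equiv.symm_apply_apply, if_pos h] at this
      · have := one (C.next (C.opp a))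
        rw [succ, hτ.next_opp, ha, if_neg (by decide), Equiv.symm_apply_apply,
          if_pos (C.turned_opp.2 h), opp_opp] at this
        exact this.symm
  · intro h
    obtain ⟨n, rfl⟩ := h.exists_nat_pow_eq
    induction n with
    | zero => exact E.refl _
    | succ n ih =>
      refine E.trans (ih ⟨n, by simp⟩) ?_
      rw [pow_succ', Equiv.Perm.mul_apply]
      exact rel_succ τ I _

variable [DecidableEq X]

theorem turned_flip_of_ne {I : X → Bool} {x : X} {a : A} (h1 : C.upper x ≠ a) (h2 : C.lower x ≠ a) :
    C.Turned (flip I x) a ↔ C.Turned I a := by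
  refine exists_congr fun y => and_congr_right fun hy => ?_
  have : y ≠ x := by
    rintro rfl
    rcases hy with hy | hy
    exacts [h1 hy, h2 hy]
  rw [flip_of_ne _ this]

theorem turned_flip_upper {I : X → Bool} {x : X} :
    C.Turned (flip I x) (C.upper x) ↔ ¬ C.Turned I (C.upper x) := by
  rw [turned_upper, turned_upper, flip_self]
  cases I x <;> cases C.pos x <;> simp

theorem turned_flip_lower {I : X → Bool} {x : X} :
    C.Turned (flip I x) (C.lower x) ↔ ¬ C.Turned I (C.lower x) := by
  rw [turned_lower, turned_lower, flip_self]
  cases I x <;> cases C.pos x <;> simp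

/-- The change of the resolution at a crossing is a transposition of the two arcs that point towards
the crossing. -/
theorem IsColoring.perm_flip [DecidableEq A] {τ : A → ℤˣ} (hτ : C.IsColoring τ) (I : X → Bool)
    {x : X} {p : A} (hp : p = C.upper x ∨ p = C.lower x) (hp1 : τ p = 1) :
    hτ.perm (flip I x) = hτ.perm I * Equiv.swap p (C.next p) := by
  classical
  have hnp : ¬ C.Plain p := by
    rintro h
    rcases hp with rfl | rfl
    exacts [(h x).1 rfl, (h x).2 rfl]
  have hq : τ (C.next p) = -1 := by rw [hτ.next_eq hnp, hp1]
  have hturn : C.Turned (flip I x) p ↔ ¬ C.Turned I p := by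
    rcases hp with rfl | rfl
    exacts [turned_flip_upper, turned_flip_lower]
  have hopp : C.opp p = C.upper x ∨ C.opp p = C.lower x := by
    rcases hp with rfl | rfl
    · exact Or.inr (C.opp_upper x)
    · exact Or.inl (C.opp_lower x)
  have other : ∀ b, b ≠ p → τ b = 1 ∨ (τ (C.next b) = -1) →
      (C.Turned (flip I x) b ↔ C.Turned I b) := by
    intro b hb h
    have hb' : b ≠ C.opp p := by
      rintro rfl
      have e1 := hτ.opp_eq hnp
      rw [hp1] at e1
      have e2 := hτ.next_opp p
      rw [e1, e2, hp1] at h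
      revert h; decide
    refine turned_flip_of_ne ?_ ?_
    · rintro rfl
      rcases hp with rfl | rfl
      · exact hb rfl
      · exact hb' (C.opp_lower x).symm
    · rintro rfl
      rcases hp with rfl | rfl
      · exact hb' (C.opp_upper x).symm
      · exact hb rfl
  ext a
  rw [Equiv.Perm.mul_apply]
  by_cases hap : a = p
  · subst hap
    rw [Equiv.swap_apply_left, perm_apply, perm_apply, succ, succ, if_pos hp1, hq,
      if_neg neg_one_ne_one, Equiv.symm_apply_apply]
    by_cases h : C.Turned I a
    · rw [if_pos h, if_neg (fun h' => hturn.1 h' h)]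
    · rw [if_neg h, if_pos (hturn.2 h)]
  by_cases haq : a = C.next p
  · subst haq
    rw [Equiv.swap_apply_right, perm_apply, perm_apply, succ, succ, if_pos hp1, hq,
      if_neg neg_one_ne_one, Equiv.symm_apply_apply]
    by_cases h : C.Turned I p
    · rw [if_pos h, if_neg (fun h' => hturn.1 h' h)]
    · rw [if_neg h, if_pos (hturn.2 h)]
  rw [Equiv.swap_apply_of_ne_of_ne hap haq, perm_apply, perm_apply, succ, succ]
  rcases Int.units_eq_one_or (τ a) with ha | ha
  · rw [if_pos ha, if_pos ha]
    exact if_congr (other a hap (Or.inl ha)) rfl rfl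
  · rw [ha, if_neg neg_one_ne_one, if_neg neg_one_ne_one]
    obtain ⟨b, rfl⟩ := C.next.surjective a
    rw [Equiv.symm_apply_apply]
    have hb : b ≠ p := fun h => haq (by rw [h])
    exact if_congr (other b hb (Or.inr ha)) rfl rfl

end Code

end LinkSplitting

namespace LinkSplitting

namespace Code

variable {A X : Type*} [DecidableEq X] {C : Code A X}

/-! ### The cube of resolutions of a colored code -/

theorem rel_ends {I : X → Bool} {x : X} :
    C.rel I (C.upper x) (C.next (C.upper x)) ↔ C.rel I (C.lower x) (C.next (C.lower x)) := by
  have E := C.rel_equivalence I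
  by_cases h : C.Turned I (C.upper x)
  · have h1 := rel_in h
    have h2 := rel_out h
    rw [opp_upper] at h1 h2
    exact ⟨fun h => E.trans (E.symm h1) (E.trans h h2),
      fun h => E.trans h1 (E.trans h (E.symm h2))⟩
  · have h1 := rel_straight h
    have h2 := rel_straight (C.turned_opp.not.2 h)
    rw [opp_opp, opp_upper] at h2
    rw [opp_upper] at h1
    exact ⟨fun h => E.trans h2 (E.trans (E.symm h) h1),
      fun h => E.trans h1 (E.trans (E.symm h) h2)⟩

/-- Changing a resolution at one crossing multiplies the permutation of the arcs by a transposition,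
hence it merges two circles or splits one; it never reconnects a circle to a single circle. -/
theorem IsColoring.surgery [Finite A] {τ : A → ℤˣ} (hτ : C.IsColoring τ) (I : X → Bool) (x : X) :
    C.rel I (C.upper x) (C.next (C.upper x)) ↔
      ¬ C.rel (flip I x) (C.upper x) (C.next (C.upper x)) := by
  classical
  have key : ∀ p, (p = C.upper x ∨ p = C.lower x) → τ p = 1 →
      (C.rel I p (C.next p) ↔ ¬ C.rel (flip I x) p (C.next p)) := by
    intro p hp hp1
    have hne : p ≠ C.next p := by
      intro h
      have h1 : τ (C.next p) = -τ p := by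
        rcases hp with rfl | rfl
        exacts [hτ.upper x, hτ.lower x]
      rw [← h, hp1] at h1
      exact neg_one_ne_one h1.symm
    rw [hτ.rel_iff_sameCycle, hτ.rel_iff_sameCycle, hτ.perm_flip I hp hp1,
      sameCycle_mul_swap_iff _ hne, not_not]
  rcases Int.units_eq_one_or (τ (C.upper x)) with h | h
  · exact key _ (Or.inl rfl) h
  · rw [rel_ends, rel_ends]
    exact key _ (Or.inr rfl) (by rw [hτ.lower_eq, h, neg_neg])

theorem rel_flip (I : X → Bool) (x : X) (a b : A) (h : C.rel (flip I x) a b) :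
    C.rel I a b ∨ (C.rel I a (C.upper x) ∧ C.rel I b (C.next (C.upper x))) ∨
      (C.rel I a (C.next (C.upper x)) ∧ C.rel I b (C.upper x)) := by
  have E := C.rel_equivalence I
  set o := C.upper x
  set o' := C.next (C.upper x)
  have hS : Equivalence fun a b => C.rel I a b ∨ (C.rel I a o ∧ C.rel I b o') ∨
      (C.rel I a o' ∧ C.rel I b o) := by
    refine ⟨fun a => Or.inl (E.refl a), ?_, ?_⟩
    · rintro a b (h | h | h)
      exacts [Or.inl (E.symm h), Or.inr (Or.inr ⟨h.2, h.1⟩), Or.inr (Or.inl ⟨h.2, h.1⟩)]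
    · rintro a b c (h | h | h) (h' | h' | h')
      · exact Or.inl (E.trans h h')
      · exact Or.inr (Or.inl ⟨E.trans h h'.1, h'.2⟩)
      · exact Or.inr (Or.inr ⟨E.trans h h'.1, h'.2⟩)
      · exact Or.inr (Or.inl ⟨h.1, E.trans (E.symm h') h.2⟩)
      · exact Or.inl (E.trans h.1 (E.trans (E.symm h'.1) (E.trans h.2 (E.symm h'.2))))
      · exact Or.inl (E.trans h.1 (E.symm h'.2))
      · exact Or.inr (Or.inr ⟨h.1, E.trans (E.symm h') h.2⟩)
      · exact Or.inl (E.trans h.1 (E.symm h'.2))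
      · exact Or.inl (E.trans h.1 (E.trans (E.symm h'.1) (E.trans h.2 (E.symm h'.2))))
  have ends : ∀ p, p = C.upper x ∨ p = C.lower x → C.Turned I p ∧
      ((C.rel I p o ∧ C.rel I (C.opp p) o ∧ C.rel I (C.next p) o' ∧
        C.rel I (C.next (C.opp p)) o')) ∨ ¬ C.Turned I p ∧
      ((C.rel I p o ∧ C.rel I (C.next (C.opp p)) o ∧ C.rel I (C.opp p) o' ∧
        C.rel I (C.next p) o') ∨ (C.rel I p o' ∧ C.rel I (C.next (C.opp p)) o' ∧
        C.rel I (C.opp p) o ∧ C.rel I (C.next p) o)) := by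
    intro p hp
    by_cases h : C.Turned I (C.upper x)
    · have h1 := rel_in h
      have h2 := rel_out h
      rw [opp_upper] at h1 h2
      left
      rcases hp with rfl | rfl
      · rw [opp_upper]
        exact ⟨h, E.refl _, E.symm h1, E.refl _, E.symm h2⟩
      · rw [opp_lower]
        exact ⟨by rwa [turned_lower, ← turned_upper], E.symm h1, E.refl _, E.symm h2, E.refl _⟩
    · have h1 := rel_straight h
      have h2 := rel_straight (C.turned_opp.not.2 h)
      rw [opp_opp, opp_upper] at h2
      rw [opp_upper] at h1
      right
      rcases hp with rfl | rfl
      · rw [opp_upper]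
        exact ⟨h, Or.inl ⟨E.refl _, E.symm h1, h2, E.refl _⟩⟩
      · rw [opp_lower]
        exact ⟨by rwa [turned_lower, ← turned_upper], Or.inr ⟨h2, E.refl _, E.refl _, E.symm h1⟩⟩
  refine rel_le hS (fun a b hab => ?_) h
  have turn : ∀ c, (c ≠ C.upper x ∧ c ≠ C.lower x) ∨ (c = C.upper x ∨ c = C.lower x) :=
    fun c => by tauto
  have flipT : ∀ c, (c = C.upper x ∨ c = C.lower x) →
      (C.Turned (flip I x) c ↔ ¬ C.Turned I c) := by
    rintro c (rfl | rfl)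
    exacts [turned_flip_upper, turned_flip_lower]
  cases hab with
  | straight _ h =>
    rcases turn a with h' | h'
    · rw [turned_flip_of_ne h'.1.symm h'.2.symm] at h
      exact Or.inl (rel_straight h)
    · rw [flipT a h', not_not] at h
      have := (ends a h').resolve_right fun h' => h'.1 h
      exact Or.inr (Or.inl ⟨this.2.1, this.2.2.2.2⟩)
  | turned_in _ h =>
    rcases turn a with h' | h'
    · rw [turned_flip_of_ne h'.1.symm h'.2.symm] at h
      exact Or.inl (rel_in h)
    · rw [flipT a h'] at h
      have := (ends a h').resolve_left fun h' => h h'.1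
      rcases this.2 with h | h
      · exact Or.inr (Or.inl ⟨h.1, h.2.2.1⟩)
      · exact Or.inr (Or.inr ⟨h.1, h.2.2.1⟩)
  | turned_out c h =>
    rcases turn c with h' | h'
    · rw [turned_flip_of_ne h'.1.symm h'.2.symm] at h
      exact Or.inl (rel_out h)
    · rw [flipT c h'] at h
      have := (ends c h').resolve_left fun h' => h h'.1
      rcases this.2 with h | h
      · exact Or.inr (Or.inr ⟨h.2.2.2, h.2.1⟩)
      · exact Or.inr (Or.inl ⟨h.2.2.2, h.2.1⟩)

variable [Finite A]

variable (C) in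
/-- The code has a checkerboard coloring. -/
def Colorable : Prop := ∃ τ, C.IsColoring τ

variable (C) in
/-- The cube of resolutions. -/
def cube (h : C.Colorable) : ResCube A X where
  rel := C.rel
  equiv := C.rel_equivalence
  o := C.upper
  o' x := C.next (C.upper x)
  surgery := h.choose_spec.surgery
  rel_flip := C.rel_flip

variable {R : Type*} [CommRing R]

variable (C) in
/-- The coefficient of the reversed saddle at a crossing, for the coloring `τ` and the weights `ω` of
the arcs: up to sign, this is the difference of the weights of the two strands. -/
def weight (τ : A → ℤˣ) (ω : A → R) (x : X) : R :=
  ((τ (C.upper x) : ℤ) : R) * ω (C.upper x) + ((τ (C.lower x) : ℤ) : R) * ω (C.lower x)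

/-- The sum telescopes along the link, as the color changes at every passage through a crossing. -/
theorem IsColoring.flat [Fintype X] {τ : A → ℤˣ} (hτ : C.IsColoring τ) {ω : A → R}
    (hω : ∀ a, ω (C.next a) = ω a) (h : C.Colorable) : (C.cube h).Flat (C.weight τ ω) := by
  classical
  intro I f hf
  cases nonempty_fintype A
  change ∀ a b, C.rel I a b → f a = f b at hf
  change ∑ x, C.weight τ ω x * (f (C.upper x) + f (C.next (C.upper x))) = 0
  let F : A → R := fun a => ((τ a : ℤ) : R) * ω a * f a
  have h0 : ∑ a, (F a - F (C.next a)) = 0 := by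
    rw [Finset.sum_sub_distrib, Equiv.sum_comp C.next F, sub_self]
  have h1 : ∀ s : X ⊕ X, F (Sum.elim C.upper C.lower s) - F (C.next (Sum.elim C.upper C.lower s)) =
      ((τ (Sum.elim C.upper C.lower s) : ℤ) : R) * ω (Sum.elim C.upper C.lower s) *
        (f (Sum.elim C.upper C.lower s) + f (C.next (Sum.elim C.upper C.lower s))) := by
    intro s
    have : τ (C.next (Sum.elim C.upper C.lower s)) = -τ (Sum.elim C.upper C.lower s) := by
      rcases s with s | s
      exacts [hτ.upper s, hτ.lower s]
    simp only [F, this, hω]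
    push_cast
    ring
  rw [← Fintype.sum_of_injective (Sum.elim C.upper C.lower) C.inj
    (fun s => ((τ (Sum.elim C.upper C.lower s) : ℤ) : R) * ω (Sum.elim C.upper C.lower s) *
        (f (Sum.elim C.upper C.lower s) + f (C.next (Sum.elim C.upper C.lower s))))
    (fun a => F a - F (C.next a)) (fun a ha => by
      have hp : C.Plain a := fun x => ⟨fun h => ha ⟨Sum.inl x, h⟩, fun h => ha ⟨Sum.inr x, h⟩⟩
      simp only [F, hτ.plain a hp, hω, hf _ _ (rel_plain hp), sub_self]) (fun s => (h1 s).symm),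
    Fintype.sum_sum_type] at h0
  simp only [Sum.elim_inl, Sum.elim_inr] at h0
  rw [← h0, ← Finset.sum_add_distrib]
  refine Finset.sum_congr rfl fun x _ => ?_
  have h2 : f (C.lower x) + f (C.next (C.lower x)) = f (C.upper x) + f (C.next (C.upper x)) := by
    by_cases h : C.Turned I (C.upper x)
    · have e1 := hf _ _ (rel_in h)
      have e2 := hf _ _ (rel_out h)
      rw [opp_upper] at e1 e2
      rw [e1, e2]
    · have e1 := hf _ _ (rel_straight h)
      have e2 := hf _ _ (rel_straight (C.turned_opp.not.2 h))
      rw [opp_opp, opp_upper] at e2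
      rw [opp_upper] at e1
      rw [e1, e2, add_comm]
  rw [h2, weight]
  ring

variable (C) in
/-- The differential of the deformed complex is strict up to `n`. -/
def Strict [Fintype X] (h : C.Colorable) (u : X → R) (e : (X → Bool) → X → ℤˣ) (n : ℕ) : Prop :=
  StrictUpTo ((C.cube h).mat u e).mulVecLin (levelFiltration R ((C.cube h).level 1)) n

/-- `-1` to the integral part of half of `t`. -/
def halfSign (t : ℤ) : ℤˣ := (-1) ^ (t / 2)

theorem halfSign_sub_two (t : ℤ) : halfSign (t - 2) = -halfSign t := by
  have : (t - 2) / 2 = t / 2 - 1 := by omega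
  rw [halfSign, halfSign, this, zpow_sub_one]
  simp

/-- The choice of the coloring does not matter. -/
theorem strict_iff_of_coloring [Fintype X] {τ τ' : A → ℤˣ} (hτ : C.IsColoring τ)
    (hτ' : C.IsColoring τ') (ω : A → R) (h : C.Colorable) (e : (X → Bool) → X → ℤˣ) (n : ℕ) :
    C.Strict h (C.weight τ ω) e n ↔ C.Strict h (C.weight τ' ω) e n := by
  classical
  set η : A → ℤ := fun a => if τ a = τ' a then 0 else 1 with hη
  have hη_rel : ∀ I a b, (C.cube h).rel I a b → η a = η b := by
    intro I a b hab
    have key : ∀ {a b}, (τ a = τ' a ↔ τ b = τ' b) → η a = η b := fun h => if_congr h rfl rfl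
    refine rel_le (S := fun a b => η a = η b) ⟨fun _ => rfl, Eq.symm, Eq.trans⟩
      (fun a b hab => ?_) hab
    cases hab with
    | straight _ h => exact key (by rw [hτ.next_opp, hτ'.next_opp])
    | turned_in _ h =>
      refine key ?_
      rw [hτ.opp_eq (not_plain_of_turned h), hτ'.opp_eq (not_plain_of_turned h), neg_inj]
    | turned_out a h =>
      refine key ?_
      rw [hτ.next_opp, hτ'.next_opp, hτ.next_eq (not_plain_of_turned h),
        hτ'.next_eq (not_plain_of_turned h), neg_inj]
  refine strictUpTo_iff_of_equiv (Equiv.refl _)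
    (fun γ => signUnit R (halfSign ((C.cube h).level η γ))) (fun γ γ' => ?_) 0
    (fun γ => by simp) n
  simp only [Equiv.refl_apply, coe_signUnit]
  by_cases hx : ∃ x, γ'.res = flip γ.res x
  · obtain ⟨x, hx⟩ := hx
    rw [ResCube.mat_apply_of_eq _ _ _ hx, ResCube.mat_apply_of_eq _ _ _ hx]
    split_ifs with hs
    · rw [(C.cube h).level_eq_of_saddle η hη_rel hx hs]
      have hb : γ'.res x = !γ.res x := by rw [hx, flip_self]
      cases hg : γ.res x
      · rw [hb, hg]
        simp [ResCube.cf, mul_comm]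
      · rw [hb, hg]
        simp only [if_true, ResCube.cf, Bool.not_true, Bool.false_eq_true, if_false]
        have ho : (C.cube h).o x = C.upper x := rfl
        rw [ho]
        by_cases hτx : τ (C.upper x) = τ' (C.upper x)
        · have h1 : η (C.upper x) = 0 := if_pos hτx
          rw [h1, weight, weight, hτ.lower_eq, hτ'.lower_eq, hτx]
          simp only [mul_zero, sub_zero]
          ring
        · have h1 : η (C.upper x) = 1 := if_neg hτx
          have h2 : τ (C.upper x) = -τ' (C.upper x) := by
            rcases Int.units_eq_one_or (τ (C.upper x)) with h | h <;>
            rcases Int.units_eq_one_or (τ' (C.upper x)) with h' | h' <;> rw [h, h'] at hτx ⊢ <;>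
            simp at hτx ⊢
          rw [h1, weight, weight, hτ.lower_eq, hτ'.lower_eq, h2, mul_one, halfSign_sub_two]
          push_cast
          ring
    · simp
  · push Not at hx
    rw [ResCube.mat_apply_of_ne _ _ _ hx, ResCube.mat_apply_of_ne _ _ _ hx]
    simp

/-- Without crossings between strands of different weight the differential preserves the level. -/
theorem strict_zero [Fintype X] (h : C.Colorable) {u : X → R} (hu : ∀ x, u x = 0)
    (e : (X → Bool) → X → ℤˣ) : C.Strict h u e 0 := by
  refine strictUpTo_zero_of_level_eq fun γ γ' h0 => ?_
  obtain ⟨x, hx, hs, hcf⟩ := ResCube.exists_of_mat_ne_zero h0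
  rw [(C.cube h).level_eq_of_saddle 1 (fun _ _ _ _ => rfl) hx hs, if_neg, sub_zero]
  intro hg
  rw [hx, flip_self, hg] at hcf
  simp [ResCube.cf, hu] at hcf

/-- `C'` is `C` with the crossings in `S` changed. -/
structure IsChange (C C' : Code A X) (S : Finset X) : Prop where
  next : C'.next = C.next
  mem : ∀ x ∈ S, C'.upper x = C.lower x ∧ C'.lower x = C.upper x ∧ C'.pos x = !C.pos x
  notMem : ∀ x, x ∉ S → C'.upper x = C.upper x ∧ C'.lower x = C.lower x ∧ C'.pos x = C.pos x

namespace IsChange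

variable {C' : Code A X} {S : Finset X}

theorem upper_or (h : IsChange C C' S) (x : X) : (C'.upper x = C.lower x ∧ C'.lower x = C.upper x) ∨
    (C'.upper x = C.upper x ∧ C'.lower x = C.lower x) := by
  by_cases hx : x ∈ S
  · exact Or.inl ⟨(h.mem x hx).1, (h.mem x hx).2.1⟩
  · exact Or.inr ⟨(h.notMem x hx).1, (h.notMem x hx).2.1⟩

theorem plain_iff (h : IsChange C C' S) {a : A} : C'.Plain a ↔ C.Plain a := by
  refine forall_congr' fun x => ?_
  rcases h.upper_or x with h | h <;> rw [h.1, h.2]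
  exact and_comm

theorem opp_eq (h : IsChange C C' S) (a : A) : C'.opp a = C.opp a := by
  rcases C.plain_or a with h' | ⟨x, rfl⟩ | ⟨x, rfl⟩
  · rw [C.opp_plain h', C'.opp_plain (h.plain_iff.2 h')]
  · rw [opp_upper]
    rcases h.upper_or x with h | h
    · rw [← h.2, opp_lower, h.1]
    · rw [← h.1, opp_upper, h.2]
  · rw [opp_lower]
    rcases h.upper_or x with h | h
    · rw [← h.1, opp_upper, h.2]
    · rw [← h.2, opp_lower, h.1]

theorem isColoring (h : IsChange C C' S) {τ : A → ℤˣ} (hτ : C.IsColoring τ) : C'.IsColoring τ := by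
  refine ⟨fun a ha => ?_, fun x => ?_, fun x => ?_, fun x => ?_⟩
  · rw [h.next, hτ.plain a (h.plain_iff.1 ha)]
  · rw [h.next]
    rcases h.upper_or x with h | h <;> rw [h.1]
    exacts [hτ.lower x, hτ.upper x]
  · rw [h.next]
    rcases h.upper_or x with h | h <;> rw [h.2]
    exacts [hτ.upper x, hτ.lower x]
  · rcases h.upper_or x with h | h <;> rw [h.1, h.2, hτ.lower_eq]
    rw [neg_neg]

/-- Change the digits in `S`. -/
def toggle (S : Finset X) (I : X → Bool) : X → Bool := fun x => if x ∈ S then !I x else I x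

theorem toggle_toggle (S : Finset X) (I : X → Bool) : toggle S (toggle S I) = I := by
  funext x
  simp only [toggle]
  split_ifs <;> simp

theorem toggle_flip (S : Finset X) (I : X → Bool) (x : X) :
    toggle S (flip I x) = flip (toggle S I) x := by
  funext y
  simp only [toggle, flip_apply]
  split_ifs <;> simp

theorem turned_iff (h : IsChange C C' S) (I : X → Bool) (a : A) :
    C'.Turned (toggle S I) a ↔ C.Turned I a := by
  refine exists_congr fun x => ?_
  by_cases hx : x ∈ S
  · rw [(h.mem x hx).1, (h.mem x hx).2.1, (h.mem x hx).2.2, toggle, if_pos hx, or_comm]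
    simp
  · rw [(h.notMem x hx).1, (h.notMem x hx).2.1, (h.notMem x hx).2.2, toggle, if_neg hx]

theorem joined_iff (h : IsChange C C' S) (I : X → Bool) (a b : A) :
    C'.Joined (toggle S I) a b ↔ C.Joined I a b := by
  constructor
  · intro h'
    cases h' with
    | straight _ h' => rw [h.opp_eq, h.next]; exact .straight _ ((h.turned_iff I a).not.1 h')
    | turned_in _ h' => rw [h.opp_eq]; exact .turned_in _ ((h.turned_iff I a).1 h')
    | turned_out c h' => rw [h.opp_eq, h.next]; exact .turned_out _ ((h.turned_iff I c).1 h')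
  · intro h'
    cases h' with
    | straight _ h' =>
      rw [← h.opp_eq, ← h.next]; exact .straight _ ((h.turned_iff I a).not.2 h')
    | turned_in _ h' => rw [← h.opp_eq]; exact .turned_in _ ((h.turned_iff I a).2 h')
    | turned_out c h' =>
      rw [← h.opp_eq, ← h.next]; exact .turned_out _ ((h.turned_iff I c).2 h')

theorem rel_eq (h : IsChange C C' S) (I : X → Bool) : C'.rel (toggle S I) = C.rel I := by
  have : C'.Joined (toggle S I) = C.Joined I := by
    funext a b
    exact propext (h.joined_iff I a b)
  rw [rel, rel, this]

theorem weight_eq (h : IsChange C C' S) (τ : A → ℤˣ) (ω : A → R) :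
    C'.weight τ ω = C.weight τ ω := by
  funext x
  rw [weight, weight]
  rcases h.upper_or x with h | h <;> rw [h.1, h.2]
  ring

/-- Changing crossings whose coefficients are units weakens strictness by their number at most: the
monomial `γ` is multiplied by the coefficients of those changed crossings at which its resolution has
the digit `1`. -/
theorem strict [Fintype X] (hS : IsChange C C' S) (h : C.Colorable) (h' : C'.Colorable) {u : X → R}
    (hu : ∀ x ∈ S, IsUnit (u x)) {e e' : (X → Bool) → X → ℤˣ} (he : IsEdgeSign e)
    (he' : IsEdgeSign e') {n : ℕ} (hs : C'.Strict h' u e' n) : C.Strict h u e (n + S.card) := by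
  classical
  have he'' : IsEdgeSign fun I x => e' (toggle S I) x :=
    ⟨fun I x => by rw [toggle_flip, he'.symm], fun I x y hxy => by
      rw [toggle_flip, toggle_flip, he'.square _ _ _ hxy]⟩
  obtain ⟨σ, hσ⟩ := he.exists_rescaling he''
  let ν : X → Rˣ := fun x => if hx : x ∈ S then (hu x hx).unit else 1
  have hν : ∀ x ∈ S, (ν x : R) = u x := fun x hx => by simp [ν, dif_pos hx]
  let m : (X → Bool) → Rˣ := fun I => ∏ x ∈ S, if I x then ν x else 1
  have hm : ∀ I x, I x = false → x ∈ S → m (flip I x) = ν x * m I := by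
    intro I x hI hx
    simp only [m]
    rw [← Finset.mul_prod_erase S _ hx, ← Finset.mul_prod_erase S (fun x => if I x = true then ν x
      else 1) hx, flip_self, hI]
    simp only [Bool.not_false, if_true, Bool.false_eq_true, if_false, one_mul]
    congr 1
    exact Finset.prod_congr rfl fun y hy => by rw [flip_of_ne _ (Finset.ne_of_mem_erase hy)]
  have hm' : ∀ I x, x ∉ S → m (flip I x) = m I := fun I x hx =>
    Finset.prod_congr rfl fun y hy => by
      rw [flip_of_ne]
      rintro rfl
      exact hx hy
  let Φ : (C.cube h).Gen ≃ (C'.cube h').Gen :=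
    { toFun := fun γ => ⟨toggle S γ.res, γ.label, fun a b hab => γ.compat a b (by
        change C'.rel _ a b at hab
        rw [hS.rel_eq] at hab
        exact hab)⟩
      invFun := fun δ => ⟨toggle S δ.res, δ.label, fun a b hab => δ.compat a b (by
        change C.rel _ a b at hab
        rw [← hS.rel_eq, toggle_toggle] at hab
        exact hab)⟩
      left_inv := fun γ => ResCube.Gen.ext (toggle_toggle _ _) fun _ => rfl
      right_inv := fun δ => ResCube.Gen.ext (toggle_toggle _ _) fun _ => rfl }
  have res : ∀ γ, (Φ γ).res = toggle S γ.res := fun γ => rfl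
  have hmatch : ∀ γ, ResCube.Matches (C := C.cube h) (C' := C'.cube h') id id γ (Φ γ) := fun γ =>
    ⟨fun a b => by
      change C.rel _ a b ↔ C'.rel (toggle S γ.res) a b
      rw [hS.rel_eq], fun a => rfl⟩
  have hwt : ∀ γ, (C'.cube h').wt 1 (Φ γ) = (C.cube h).wt 1 γ := fun γ =>
    ResCube.wt_eq_of_matches (hmatch γ) (fun a => ⟨a, ResCube.refl _ _⟩)
      (fun a => ⟨a, ResCube.refl _ _⟩)
  have hones : ∀ I : X → Bool, ResCube.ones 1 I + -(S.card : ℤ) ≤ ResCube.ones 1 (toggle S I) ∧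
      ResCube.ones 1 (toggle S I) ≤ ResCube.ones 1 I + -(S.card : ℤ) + 2 * S.card := by
    intro I
    have h1 : (S.card : ℤ) = ∑ x, if x ∈ S then 1 else 0 := by simp
    constructor
    · rw [h1, ← sub_eq_add_neg, sub_le_iff_le_add, ResCube.ones, ResCube.ones,
        ← Finset.sum_add_distrib]
      refine Finset.sum_le_sum fun x _ => ?_
      simp only [toggle]
      split_ifs <;> simp_all
    · have : ResCube.ones 1 (toggle S I) ≤ ResCube.ones 1 I + S.card := by
        rw [h1, ResCube.ones, ResCube.ones, ← Finset.sum_add_distrib]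
        refine Finset.sum_le_sum fun x _ => ?_
        simp only [toggle]
        split_ifs <;> simp_all
      linarith
  refine StrictUpTo.of_equiv Φ (fun γ => signUnit R (σ γ.res) * m γ.res) (fun γ γ' => ?_)
    (-(S.card : ℤ)) S.card (fun γ => ?_) (fun γ => ?_) hs
  · simp only [Units.val_mul, coe_signUnit]
    by_cases hx : ∃ x, γ'.res = flip γ.res x
    · obtain ⟨x, hx⟩ := hx
      have hx' : (Φ γ').res = flip (Φ γ).res x := by rw [res, res, hx, toggle_flip]
      rw [ResCube.mat_apply_of_eq _ _ _ hx, ResCube.mat_apply_of_eq _ _ _ hx']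
      have hsad := ResCube.saddle_congr (hmatch γ) (hmatch γ') hx hx'
        (fun a => ⟨a, ResCube.refl _ _⟩) (fun a => ⟨a, ResCube.refl _ _⟩) (fun _ => False)
        (fun _ _ h => h.elim) (fun _ _ h => h.elim) (fun a => Or.inr ⟨a, ResCube.refl _ _⟩)
        (fun a => Or.inr ⟨a, ResCube.refl _ _⟩) (fun _ h => h.elim)
      have hs1 := congrArg (fun s : ℤˣ => ((s : ℤ) : R)) (hσ γ.res x)
      simp only [Units.val_mul, Int.cast_mul, ← hx, ← res] at hs1
      have hcf : (m γ'.res : R) * ResCube.cf u x (γ'.res x) =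
          ResCube.cf u x ((Φ γ').res x) * m γ.res := by
        rw [res, toggle]
        by_cases hxS : x ∈ S
        · rw [if_pos hxS]
          cases hg : γ.res x
          · rw [hx, hm _ _ hg hxS, flip_self, hg]
            simp [ResCube.cf, hν x hxS]
          · have h2 : m γ.res = ν x * m γ'.res := by
              rw [← hm _ _ (by rw [hx, flip_self, hg]; rfl) hxS, hx, flip_flip]
            rw [h2, hx, flip_self, hg]
            simp [ResCube.cf, hν x hxS, mul_comm]
        · rw [if_neg hxS, hx, hm' _ _ hxS, mul_comm]
      by_cases hsd : (C.cube h).Saddle γ.res x γ.label γ'.label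
      · rw [if_pos hsd, if_pos (hsad.1 hsd)]
        linear_combination (((e γ.res x : ℤ) : R) * ((σ γ'.res : ℤ) : R)) * hcf +
          (ResCube.cf u x ((Φ γ').res x) * (m γ.res : R)) * hs1
      · rw [if_neg hsd, if_neg fun h => hsd (hsad.2 h), mul_zero, zero_mul]
    · have hy : ¬ ∃ x, (Φ γ').res = flip (Φ γ).res x := by
        rintro ⟨x, h⟩
        refine hx ⟨x, ?_⟩
        rw [res, res, ← toggle_flip] at h
        rw [← toggle_toggle S γ'.res, h, toggle_toggle]
      rw [ResCube.mat_apply_of_ne _ _ _ fun x h => hx ⟨x, h⟩,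
        ResCube.mat_apply_of_ne _ _ _ fun x h => hy ⟨x, h⟩, mul_zero, zero_mul]
  · rw [ResCube.level, ResCube.level, hwt]
    have := (hones γ.res).1
    change ResCube.ones 1 _ + _ + _ ≤ ResCube.ones 1 _ + _
    rw [res]
    linarith
  · rw [ResCube.level, ResCube.level, hwt]
    have := (hones γ.res).2
    change ResCube.ones 1 _ + _ ≤ ResCube.ones 1 _ + _ + _ + _
    rw [res]
    linarith

end IsChange

end Code

end LinkSplitting

namespace LinkSplitting

namespace Code

variable {A X Q : Type*} {C : Code A X}

/-! ### Functions that are constant on the circles of a resolution -/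

variable (C) in
/-- `f` takes the same value on arcs that are joined in the resolution `I`. -/
def Respects (I : X → Bool) (f : A → Q) : Prop := ∀ a b, C.Joined I a b → f a = f b

variable (C) in
/-- `f` takes the same value on arcs that are joined at the crossing `x` in the resolution `I`. -/
def RespectsAt (I : X → Bool) (f : A → Q) (x : X) : Prop :=
  (I x = C.pos x → f (C.upper x) = f (C.lower x) ∧
    f (C.next (C.upper x)) = f (C.next (C.lower x))) ∧
  (I x ≠ C.pos x → f (C.upper x) = f (C.next (C.lower x)) ∧
    f (C.lower x) = f (C.next (C.upper x)))

variable (C) in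
/-- The circle of the resolution `I` that contains an arc. -/
def circ (I : X → Bool) (a : A) : Quot (C.Joined I) := Quot.mk _ a

theorem circ_eq_iff {I : X → Bool} {a b : A} : C.circ I a = C.circ I b ↔ C.rel I a b := Quot.eq

theorem respects_circ (I : X → Bool) : C.Respects I (C.circ I) := fun _ _ h => Quot.sound h

theorem Respects.eq_of_rel {I : X → Bool} {f : A → Q} (hf : C.Respects I f) {a b : A}
    (h : C.rel I a b) : f a = f b :=
  rel_le (S := fun a b => f a = f b) ⟨fun _ => rfl, Eq.symm, Eq.trans⟩ hf h

theorem Respects.plain {I : X → Bool} {f : A → Q} (hf : C.Respects I f) {a : A} (h : C.Plain a) :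
    f a = f (C.next a) := hf.eq_of_rel (rel_plain h)

theorem Respects.at {I : X → Bool} {f : A → Q} (hf : C.Respects I f) (x : X) :
    C.RespectsAt I f x := by
  constructor
  · intro h
    have h1 := hf.eq_of_rel (rel_in (C.turned_upper.2 h))
    have h2 := hf.eq_of_rel (rel_out (C.turned_upper.2 h))
    rw [opp_upper] at h1 h2
    exact ⟨h1, h2⟩
  · intro h
    have h1 := hf.eq_of_rel (rel_straight (C.turned_upper.not.2 h))
    have h2 := hf.eq_of_rel (rel_straight (C.turned_lower.not.2 h))
    rw [opp_upper] at h1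
    rw [opp_lower] at h2
    exact ⟨h1, h2⟩

theorem respects_of_at {I : X → Bool} {f : A → Q} (hp : ∀ a, C.Plain a → f a = f (C.next a))
    (hx : ∀ x, C.RespectsAt I f x) : C.Respects I f := by
  intro a b h
  cases h with
  | straight _ h =>
    rcases C.plain_or a with h' | ⟨x, rfl⟩ | ⟨x, rfl⟩
    · rw [C.opp_plain h']; exact hp a h'
    · rw [opp_upper]; exact ((hx x).2 (C.turned_upper.not.1 h)).1
    · rw [opp_lower]; exact ((hx x).2 (C.turned_lower.not.1 h)).2
  | turned_in _ h =>
    obtain ⟨x, rfl | rfl, h⟩ := h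
    · rw [opp_upper]; exact ((hx x).1 h).1
    · rw [opp_lower]; exact ((hx x).1 h).1.symm
  | turned_out c h =>
    obtain ⟨x, rfl | rfl, h⟩ := h
    · rw [opp_upper]; exact ((hx x).1 h).2
    · rw [opp_lower]; exact ((hx x).1 h).2.symm

variable (C) in
/-- The arc after (`true`) or before (`false`) the point `a`. -/
def stub (a : A) (d : Bool) : A := if d then C.next a else a

variable (C) in
/-- At the crossing `x`, the arcs `i`, `o` are the two ends of one strand, `i'`, `o'` those of the
other one, and the resolution with the digit `κ` joins `i` with `i'` and `o` with `o'`. -/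
def Corner (x : X) (κ : Bool) (i i' o o' : A) : Prop :=
  ∃ (a b : A) (d d' : Bool), ((a = C.upper x ∧ b = C.lower x) ∨ (a = C.lower x ∧ b = C.upper x)) ∧
    (d' = d ↔ κ = C.pos x) ∧ i = C.stub a d ∧ i' = C.stub b d' ∧ o = C.stub a (!d) ∧
    o' = C.stub b (!d')

theorem Corner.respectsAt_iff {x : X} {κ : Bool} {i i' o o' : A} (h : C.Corner x κ i i' o o')
    {I : X → Bool} {f : A → Q} : C.RespectsAt I f x ↔
      (I x = κ → f i = f i' ∧ f o = f o') ∧ (I x ≠ κ → f i = f o' ∧ f o = f i') := by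
  obtain ⟨a, b, d, d', hab, hd, rfl, rfl, rfl, rfl⟩ := h
  rw [RespectsAt]
  rcases hab with ⟨rfl, rfl⟩ | ⟨rfl, rfl⟩ <;>
  revert hd <;> cases d <;> cases d' <;> cases κ <;> cases C.pos x <;> cases I x <;>
  simp [stub] <;> grind

theorem Corner.end_iff {x : X} {κ : Bool} {i i' o o' : A} (h : C.Corner x κ i i' o o')
    {Z : A → Prop} (hi : Z i) (hi' : Z i') (ho : ¬ Z o) (ho' : ¬ Z o') :
    (Z (C.upper x) ∧ ¬ Z (C.next (C.upper x))) ∨ (¬ Z (C.upper x) ∧ Z (C.next (C.upper x))) := by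
  obtain ⟨a, b, d, d', hab, hd, rfl, rfl, rfl, rfl⟩ := h
  rcases hab with ⟨rfl, rfl⟩ | ⟨rfl, rfl⟩ <;>
  cases d <;> cases d' <;> simp_all [stub]

/-! ### Additional crossings -/

/-- `C'` is `C` with additional crossings, indexed by `ι`, at points which are plain in `C`. -/
structure IsExtension {ι : Type*} (C : Code A X) (C' : Code A (X ⊕ ι)) : Prop where
  next : C'.next = C.next
  upper : ∀ x, C'.upper (Sum.inl x) = C.upper x
  lower : ∀ x, C'.lower (Sum.inl x) = C.lower x
  pos : ∀ x, C'.pos (Sum.inl x) = C.pos x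

namespace IsExtension

variable {ι : Type*} {C' : Code A (X ⊕ ι)} (E : IsExtension C C')
include E

theorem plain_iff {a : A} : C'.Plain a ↔
    C.Plain a ∧ ∀ i, C'.upper (Sum.inr i) ≠ a ∧ C'.lower (Sum.inr i) ≠ a := by
  rw [Plain, Sum.forall, Plain]
  simp only [E.upper, E.lower]

theorem respectsAt_iff {I : X → Bool} {J : ι → Bool} {f : A → Q} {x : X} :
    C'.RespectsAt (Sum.elim I J) f (Sum.inl x) ↔ C.RespectsAt I f x := by
  simp only [RespectsAt, E.upper, E.lower, E.pos, E.next, Sum.elim_inl]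

theorem respectsAt_congr {N : A → Prop}
    (hN : ∀ a, N a ∨ N (C.next a) → ∃ i, a = C'.upper (Sum.inr i) ∨ a = C'.lower (Sum.inr i))
    {I : X → Bool} {f g : A → Q} (hfg : ∀ a, ¬ N a → g a = f a) {x : X}
    (hf : C.RespectsAt I f x) : C.RespectsAt I g x := by
  have h1 : ∀ a, (a = C.upper x ∨ a = C.lower x) → g a = f a ∧ g (C.next a) = f (C.next a) := by
    intro a ha
    by_contra hc
    have : ∃ i, a = C'.upper (Sum.inr i) ∨ a = C'.lower (Sum.inr i) := by
      apply hN
      by_contra h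
      push Not at h
      exact hc ⟨hfg _ h.1, hfg _ h.2⟩
    obtain ⟨i, hi⟩ := this
    rw [← E.upper, ← E.lower] at ha
    rcases ha with ha | ha <;> rcases hi with hi | hi <;> rw [ha] at hi
    · exact absurd (C'.upper_inj.1 hi) (by simp)
    · exact C'.upper_ne_lower _ _ hi
    · exact C'.upper_ne_lower _ _ hi.symm
    · exact absurd (C'.lower_inj.1 hi) (by simp)
  have hu := h1 _ (Or.inl rfl)
  have hl := h1 _ (Or.inr rfl)
  rw [RespectsAt, hu.1, hu.2, hl.1, hl.2]
  exact hf

/-- A function that is constant on the circles before crossings are added may be changed on a set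
`N` of arcs at the new crossings. -/
theorem respects {N : A → Prop}
    (hN : ∀ a, N a ∨ N (C.next a) → ∃ i, a = C'.upper (Sum.inr i) ∨ a = C'.lower (Sum.inr i))
    {I : X → Bool} {J : ι → Bool} {f g : A → Q} (hfg : ∀ a, ¬ N a → g a = f a)
    (hf : C.Respects I f) (hg : ∀ i, C'.RespectsAt (Sum.elim I J) g (Sum.inr i)) :
    C'.Respects (Sum.elim I J) g := by
  refine respects_of_at (fun a ha => ?_) fun x => ?_
  · rw [E.plain_iff] at ha
    have hNa : ¬ (N a ∨ N (C.next a)) := fun h => by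
      obtain ⟨i, hi | hi⟩ := hN a h
      exacts [(ha.2 i).1 hi.symm, (ha.2 i).2 hi.symm]
    push Not at hNa
    rw [E.next, hfg _ hNa.1, hfg _ hNa.2, hf.plain ha.1]
  · rcases x with x | i
    · exact E.respectsAt_iff.2 (E.respectsAt_congr hN hfg (hf.at x))
    · exact hg i

/-- A function that is constant on the circles after crossings have been added may be changed on a
set `N` of arcs at the new crossings. -/
theorem respects_of {N : A → Prop}
    (hN : ∀ a, N a ∨ N (C.next a) → ∃ i, a = C'.upper (Sum.inr i) ∨ a = C'.lower (Sum.inr i))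
    {I : X → Bool} {J : ι → Bool} {f g : A → Q} (hfg : ∀ a, ¬ N a → g a = f a)
    (hf : C'.Respects (Sum.elim I J) f)
    (hg : ∀ i, g (C'.upper (Sum.inr i)) = g (C.next (C'.upper (Sum.inr i))) ∧
      g (C'.lower (Sum.inr i)) = g (C.next (C'.lower (Sum.inr i)))) :
    C.Respects I g := by
  refine respects_of_at (fun a ha => ?_) fun x =>
    E.respectsAt_congr hN hfg (E.respectsAt_iff.1 (hf.at (Sum.inl x)))
  by_cases h : ∃ i, a = C'.upper (Sum.inr i) ∨ a = C'.lower (Sum.inr i)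
  · obtain ⟨i, rfl | rfl⟩ := h
    exacts [(hg i).1, (hg i).2]
  · have hNa : ¬ (N a ∨ N (C.next a)) := fun h' => h (hN a h')
    push Not at hNa
    have ha' : C'.Plain a := E.plain_iff.2 ⟨ha, fun i =>
      ⟨fun h' => h ⟨i, Or.inl h'.symm⟩, fun h' => h ⟨i, Or.inr h'.symm⟩⟩⟩
    rw [hfg _ hNa.1, hfg _ hNa.2, hf.plain ha', E.next]

open Classical in
/-- If the new passages come in consecutive pairs, with the arcs in `N` between the two points of a
pair, then a coloring of the larger code gives one of the smaller code. -/
theorem exists_coloring {N : A → Prop} (hNN : ∀ a, N (C.next a) → ¬ N a)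
    (hN : ∀ a, N a ∨ N (C.next a) ↔ ∃ i, a = C'.upper (Sum.inr i) ∨ a = C'.lower (Sum.inr i))
    {τ' : A → ℤˣ} (hτ' : C'.IsColoring τ') {R : Type*} [CommRing R] (ω : A → R) :
    ∃ τ, C.IsColoring τ ∧ ∀ x, C'.weight τ' ω (Sum.inl x) = C.weight τ ω x := by
  have hnew : ∀ a, N a ∨ N (C.next a) → ¬ C'.Plain a := by
    intro a ha hp
    obtain ⟨i, hi | hi⟩ := (hN a).1 ha
    exacts [(hp _).1 hi.symm, (hp _).2 hi.symm]
  have hold : ∀ x a, (a = C.upper x ∨ a = C.lower x) → ¬ N a ∧ ¬ N (C.next a) := by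
    intro x a ha
    rw [← not_or, hN]
    rintro ⟨i, hi⟩
    rw [← E.upper, ← E.lower] at ha
    rcases ha with ha | ha <;> rcases hi with hi | hi <;> rw [ha] at hi
    · exact absurd (C'.upper_inj.1 hi) (by simp)
    · exact C'.upper_ne_lower _ _ hi
    · exact C'.upper_ne_lower _ _ hi.symm
    · exact absurd (C'.lower_inj.1 hi) (by simp)
  let τ : A → ℤˣ := fun a => if N a then τ' (C.next.symm a) else τ' a
  have hτ : ∀ a, ¬ N a → τ a = τ' a := fun a h => if_neg h
  have hτN : ∀ a, N (C.next a) → τ (C.next a) = τ' a := fun a h => by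
    simp only [τ, if_pos h, Equiv.symm_apply_apply]
  refine ⟨τ, ⟨fun a ha => ?_, fun x => ?_, fun x => ?_, fun x => ?_⟩, fun x => ?_⟩
  · by_cases h1 : N (C.next a)
    · rw [hτN a h1, hτ a (hNN a h1)]
    · rw [hτ _ h1]
      by_cases h2 : N a
      · obtain ⟨b, rfl⟩ := C.next.surjective a
        rw [hτN b h2, ← E.next, hτ'.next_eq (by rw [E.next]; exact hnew _ (Or.inl h2)), E.next,
          ← E.next, hτ'.next_eq (hnew _ (Or.inr h2)), neg_neg]
      · rw [hτ _ h2, ← E.next]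
        refine hτ'.plain a (E.plain_iff.2 ⟨ha, fun i => ?_⟩)
        have := (hN a).not.1 (by tauto)
        push Not at this
        exact ⟨(this i).1.symm, (this i).2.symm⟩
  · have := hold x _ (Or.inl rfl)
    rw [hτ _ this.1, hτ _ this.2, ← E.upper, ← E.next, hτ'.upper]
  · have := hold x _ (Or.inr rfl)
    rw [hτ _ this.1, hτ _ this.2, ← E.lower, ← E.next, hτ'.lower]
  · rw [hτ _ (hold x _ (Or.inl rfl)).1, hτ _ (hold x _ (Or.inr rfl)).1, ← E.lower, ← E.upper,
      hτ'.lower_eq]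
  · rw [weight, weight, E.upper, E.lower, hτ _ (hold x _ (Or.inl rfl)).1,
      hτ _ (hold x _ (Or.inr rfl)).1]

end IsExtension

end Code

end LinkSplitting

namespace LinkSplitting

namespace Code

variable {A X R : Type*} [Finite A] [Fintype X] [DecidableEq X] [CommRing R]

/-! ### The first two Reidemeister moves for codes -/

/-- Invariance under the first Reidemeister move. -/
theorem IsExtension.strict_iff_of_kink {C : Code A X} {C' : Code A (X ⊕ Unit)}
    (E : IsExtension C C') {p : A}
    (hp : (C'.upper (Sum.inr ()) = p ∧ C'.lower (Sum.inr ()) = C.next p) ∨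
      (C'.lower (Sum.inr ()) = p ∧ C'.upper (Sum.inr ()) = C.next p))
    (h : C.Colorable) (h' : C'.Colorable) {τ τ' : A → ℤˣ} (hτ : C.IsColoring τ)
    (hτ' : C'.IsColoring τ') {ω : A → R} (hω : ∀ a, ω (C.next a) = ω a)
    {e : (X → Bool) → X → ℤˣ} {e' : (X ⊕ Unit → Bool) → X ⊕ Unit → ℤˣ} (he : IsEdgeSign e)
    (he' : IsEdgeSign e') (n : ℕ) :
    C'.Strict h' (C'.weight τ' ω) e' n ↔ C.Strict h (C.weight τ ω) e n := by
  classical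
  set b : Bool := !C'.pos (Sum.inr ()) with hb
  set q := C.next p with hq
  have hpq : p ≠ q := by
    have := C'.upper_ne_lower (Sum.inr ()) (Sum.inr ())
    rcases hp with ⟨h1, h2⟩ | ⟨h1, h2⟩ <;> rw [h1, h2] at this
    exacts [this, this.symm]
  have hqq : C.next q ≠ q := fun h => hpq (C.next.injective (by rw [h, hq]))
  have hcorner : C'.Corner (Sum.inr ()) b q q p (C.next q) :=
    ⟨p, q, true, false, by simpa [eq_comm] using hp, by simp [hb], by simp [stub, E.next, hq],
      rfl, rfl, by simp [stub, E.next]⟩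
  have hN : ∀ a, a = q ∨ C.next a = q ↔ ∃ i, a = C'.upper (Sum.inr i) ∨ a = C'.lower (Sum.inr i) := by
    intro a
    rw [hq, C.next.injective.eq_iff, ← hq]
    constructor
    · rintro h
      refine ⟨(), ?_⟩
      rcases hp with ⟨h1, h2⟩ | ⟨h1, h2⟩ <;> rw [h1, h2] <;> tauto
    · rintro ⟨i, h⟩
      rcases hp with ⟨h1, h2⟩ | ⟨h1, h2⟩ <;> rw [h1, h2] at h <;> tauto
  obtain ⟨τ₁, hτ₁, hw⟩ := E.exists_coloring (N := fun a => a = q)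
    (fun a h h' => hqq (by rw [← h', h, h'])) hN hτ' ω
  rw [strict_iff_of_coloring hτ hτ₁ ω h e n]
  let φ : A → A := fun a => if a = q then p else a
  have hφ : ∀ a, a ≠ q → φ a = a := fun a h => if_neg h
  have hφq : φ q = p := if_pos rfl
  have hφZ : ∀ a, ¬ φ a = q := fun a => by
    by_cases h : a = q
    · rw [h, hφq]; exact hpq
    · rwa [hφ a h]
  have bit : ∀ I : X → Bool, (Sum.elim I fun _ : Unit => b) (Sum.inr ()) = b := fun I => rfl
  have hup : ∀ {Q : Type _} {g : A → Q}, g p = g q → g q = g (C.next q) →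
      ∀ i : Unit, g (C'.upper (Sum.inr i)) = g (C.next (C'.upper (Sum.inr i))) ∧
      g (C'.lower (Sum.inr i)) = g (C.next (C'.lower (Sum.inr i))) := by
    intro Q g h1 h2 i
    rcases hp with ⟨h3, h4⟩ | ⟨h3, h4⟩ <;> rw [h3, h4, ← hq]
    exacts [⟨h1, h2⟩, ⟨h2, h1⟩]
  have hCpq : ∀ I, C.circ I p = C.circ I q ∧ C.circ I q = C.circ I (C.next q) := by
    intro I
    have hpl : ∀ a, (a = q ∨ C.next a = q) → C.Plain a := by
      intro a ha x
      obtain ⟨i, hi⟩ := (hN a).1 ha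
      rw [← E.upper, ← E.lower]
      rcases hi with rfl | rfl
      · exact ⟨fun h => by simpa using C'.upper_inj.1 h, fun h => C'.upper_ne_lower _ _ h.symm⟩
      · exact ⟨C'.upper_ne_lower _ _, fun h => by simpa using C'.lower_inj.1 h⟩
    exact ⟨circ_eq_iff.2 (rel_plain (hpl p (Or.inr rfl))),
      circ_eq_iff.2 (rel_plain (hpl q (Or.inl rfl)))⟩
  have hback : ∀ I a a', C'.rel (Sum.elim I fun _ => b) a a' → C.rel I a a' := by
    intro I a a' h
    have := E.respects (N := fun a => a = q) (J := fun _ => b) (fun a => (hN a).1)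
      (fun _ _ => rfl) (respects_circ I) (fun i => hcorner.respectsAt_iff.2
        ⟨fun _ => ⟨rfl, (hCpq I).1.trans (hCpq I).2⟩, fun h => absurd (bit I) h⟩)
    exact circ_eq_iff.1 (this.eq_of_rel h)
  refine ResCube.strictUpTo_iff_of_kink (C := C.cube h) (C' := C'.cube h') (b := b) (φ := φ)
    (Z := fun a => a = q) rfl ?_ (fun I a a' => ⟨fun h => ?_, fun h => ?_⟩) (fun I a a' ha => ?_)
    hφZ (fun I a => ?_) hw he he' (hτ'.flat (fun a => by rw [E.next, hω]) h') n
  · exact hcorner.end_iff (Z := fun a => a = q) rfl rfl hpq hqq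
  · have hc := (hcorner.respectsAt_iff.1 ((respects_circ (C := C')
      (Sum.elim I fun _ => b)).at (Sum.inr ()))).1 (bit I)
    have := E.respects_of (N := fun a => a = q) (J := fun _ => b)
      (g := fun a => C'.circ (Sum.elim I fun _ => b) (φ a)) (fun a => (hN a).1)
      (fun a h => by rw [hφ a h]) (respects_circ (Sum.elim I fun _ => b))
      (hup (g := fun a => C'.circ (Sum.elim I fun _ => b) (φ a)) (by simp only [hφq, hφ _ hpq])
        (by simp only [hφq, hφ _ hqq, hc.2]))
    exact circ_eq_iff.1 (this.eq_of_rel h)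
  · have key : ∀ a, C.circ I (φ a) = C.circ I a := fun a => by
      by_cases h : a = q
      · rw [h, hφq, (hCpq I).1]
      · rw [hφ a h]
    have := hback I _ _ h
    exact circ_eq_iff.1 (by rw [← key a, ← key a', circ_eq_iff.2 this])
  · have hr : C'.Respects (Sum.elim I fun _ => b) (fun a => a = q) :=
      E.respects (N := fun a => a = q) (f := fun _ => False) (fun a => (hN a).1)
        (fun a h => by simp [h]) (fun _ _ _ => rfl) (fun i => hcorner.respectsAt_iff.2
          ⟨fun _ => ⟨rfl, by simp [hpq, hqq]⟩, fun h => absurd (bit I) h⟩)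
    constructor
    · intro h
      have := hr.eq_of_rel h
      simpa [ha] using this
    · rintro rfl
      rw [ha]
      exact (C'.rel_equivalence _).refl _
  · by_cases h : a = q
    · exact Or.inl h
    · exact Or.inr ⟨a, by rw [hφ a h]; exact (C'.rel_equivalence _).refl _⟩

/-- Invariance under the second Reidemeister move. The arcs `r`, `s` are the two sides of the new
bigon. -/
theorem IsExtension.strict_iff_of_bigon {C : Code A X} {C' : Code A (X ⊕ Bool)}
    (E : IsExtension C C') {p q o o' : A} {κ : Bool}
    (hN : ∀ a, (a = C.next p ∨ a = C.next q) ∨ (a = p ∨ a = q) ↔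
      ∃ i, a = C'.upper (Sum.inr i) ∨ a = C'.lower (Sum.inr i))
    (hpp : p ≠ C.next p) (hpq : p ≠ C.next q) (hqp : q ≠ C.next p) (hqq : q ≠ C.next q)
    (hne : p ≠ q)
    (hx : C'.Corner (Sum.inr false) κ (C.next p) (C.next q) p o)
    (hy : C'.Corner (Sum.inr true) (!κ) (C.next p) (C.next q) (C.next (C.next p)) o')
    (ho : (o = q ∧ o' = C.next (C.next q)) ∨ (o' = q ∧ o = C.next (C.next q)))
    (h : C.Colorable) (h' : C'.Colorable) {τ τ' : A → ℤˣ} (hτ : C.IsColoring τ)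
    (hτ' : C'.IsColoring τ') {ω : A → R} (hω : ∀ a, ω (C.next a) = ω a)
    {e : (X → Bool) → X → ℤˣ} {e' : (X ⊕ Bool → Bool) → X ⊕ Bool → ℤˣ} (he : IsEdgeSign e)
    (he' : IsEdgeSign e') (n : ℕ) :
    C'.Strict h' (C'.weight τ' ω) e' n ↔ C.Strict h (C.weight τ ω) e n := by
  classical
  set N : A → Prop := fun a => a = C.next p ∨ a = C.next q with hNdef
  have hN' : ∀ a, N a ∨ N (C.next a) ↔
      ∃ i, a = C'.upper (Sum.inr i) ∨ a = C'.lower (Sum.inr i) := fun a => by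
    rw [← hN a, hNdef]
    simp only [C.next.injective.eq_iff]
  have hNN : ∀ a, N (C.next a) → ¬ N a := by
    rintro a h
    simp only [hNdef, C.next.injective.eq_iff] at h ⊢
    rcases h with rfl | rfl <;> tauto
  have hpn : ∀ a, (N a ∨ N (C.next a)) → C.Plain a := by
    intro a ha x
    obtain ⟨i, hi⟩ := (hN' a).1 ha
    rw [← E.upper, ← E.lower]
    rcases hi with rfl | rfl
    · exact ⟨fun h => by simpa using C'.upper_inj.1 h, fun h => C'.upper_ne_lower _ _ h.symm⟩
    · exact ⟨C'.upper_ne_lower _ _, fun h => by simpa using C'.lower_inj.1 h⟩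
  obtain ⟨τ₁, hτ₁, hw⟩ := E.exists_coloring hNN hN' hτ' ω
  rw [strict_iff_of_coloring hτ hτ₁ ω h e n]
  have hNp : ¬ N p := by simp [hNdef, hpp, hpq]
  have hNq : ¬ N q := by simp [hNdef, hqp, hqq]
  have hNpp : ¬ N (C.next (C.next p)) := fun h => hNN _ h (Or.inl rfl)
  have hNqq : ¬ N (C.next (C.next q)) := fun h => hNN _ h (Or.inr rfl)
  have hNo : ¬ N o ∧ ¬ N o' := by
    rcases ho with ⟨rfl, rfl⟩ | ⟨rfl, rfl⟩
    exacts [⟨hNq, hNqq⟩, ⟨hNqq, hNq⟩]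
  let φ : A → A := fun a => if a = C.next p then p else if a = C.next q then q else a
  have hφ : ∀ a, ¬ N a → φ a = a := fun a h => by
    simp only [hNdef, not_or] at h
    simp only [φ, if_neg h.1, if_neg h.2]
  have hφp : φ (C.next p) = p := if_pos rfl
  have hφq : φ (C.next q) = q := by
    simp only [φ, if_neg (C.next.injective.ne hne.symm), if_pos]
  have hφN : ∀ a, ¬ N (φ a) := fun a => by
    by_cases h : N a
    · rcases h with rfl | rfl
      · rwa [hφp]
      · rwa [hφq]
    · rwa [hφ a h]
  set b := !κ with hb
  -- in the resolution of the two crossings that separates the strands, both sides of the bigon are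
  -- joined to the other strand
  have hjoin : ∀ I, let g := C'.circ (Sum.elim I fun i => i != b)
      (g (C.next p) = g o ∧ g p = g (C.next q)) ∧
      (g (C.next p) = g o' ∧ g (C.next (C.next p)) = g (C.next q)) := by
    intro I g
    refine ⟨(hx.respectsAt_iff.1 ((respects_circ _).at _)).2 ?_,
      (hy.respectsAt_iff.1 ((respects_circ _).at _)).2 ?_⟩
    · rw [hb]; simp
    · rw [hb]; simp
  have hC : ∀ I, (C.circ I p = C.circ I (C.next p) ∧
      C.circ I (C.next p) = C.circ I (C.next (C.next p))) ∧ (C.circ I q = C.circ I (C.next q) ∧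
      C.circ I (C.next q) = C.circ I (C.next (C.next q))) := fun I =>
    have r := respects_circ (C := C) I
    ⟨⟨r.plain (hpn p (Or.inr (Or.inl rfl))), r.plain (hpn _ (Or.inl (Or.inl rfl)))⟩,
      r.plain (hpn q (Or.inr (Or.inr rfl))), r.plain (hpn _ (Or.inl (Or.inr rfl)))⟩
  refine ResCube.strictUpTo_iff_of_bigon (C := C.cube h) (C' := C'.cube h') (b := b) (φ := φ)
    (Z := N) (Or.inl rfl) ?_ (fun I a a' ha => ?_) (fun I a a' => ⟨fun h => ?_, fun h => ?_⟩)
    (fun I a => ?_) hw he he' (hτ'.flat (fun a => by rw [E.next, hω]) h') n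
  · rintro (_ | _)
    · exact hx.end_iff (Z := N) (Or.inl rfl) (Or.inr rfl) hNp hNo.1
    · exact hy.end_iff (Z := N) (Or.inl rfl) (Or.inr rfl) hNpp hNo.2
  · have hr : C'.Respects (Sum.elim I fun i => i == b) N := by
      refine E.respects (N := N) (f := fun _ => False) (fun a => (hN' a).1)
        (fun a h => by simp [h]) (fun _ _ _ => rfl) ?_
      have e1 : N (C.next p) = N (C.next q) := propext ⟨fun _ => Or.inr rfl, fun _ => Or.inl rfl⟩
      rintro (_ | _)
      · exact hx.respectsAt_iff.2 ⟨fun _ => ⟨e1, by simp [hNp, hNo.1]⟩,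
          fun h => absurd (by rw [hb]; simp) h⟩
      · exact hy.respectsAt_iff.2 ⟨fun _ => ⟨e1, by simp [hNpp, hNo.2]⟩,
          fun h => absurd (by rw [hb]; simp) h⟩
    have hpq' : C'.rel (Sum.elim I fun i => i == b) (C.next p) (C.next q) :=
      circ_eq_iff.1 ((hx.respectsAt_iff.1 ((respects_circ _).at _)).1 (by rw [hb]; simp)).1
    have E' := C'.rel_equivalence (Sum.elim I fun i => i == b)
    constructor
    · intro h
      have := hr.eq_of_rel h
      rwa [← this]
    · intro h
      rcases ha with rfl | rfl <;> rcases h with rfl | rfl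
      exacts [E'.refl _, hpq', E'.symm hpq', E'.refl _]
  · obtain ⟨⟨h1, h2⟩, h3, h4⟩ := hjoin I
    refine circ_eq_iff.1 (Respects.eq_of_rel (C := C) (I := I)
      (f := fun a => C'.circ (Sum.elim I fun i => i != b) (φ a)) ?_ h)
    refine E.respects_of (N := N) (J := fun i => i != b) (fun a => (hN' a).1)
      (fun a h => by rw [hφ a h]) (respects_circ (Sum.elim I fun i => i != b)) fun i => ?_
    have hall : ∀ a, ((a = C.next p ∨ a = C.next q) ∨ (a = p ∨ a = q)) →
        C'.circ (Sum.elim I fun i => i != b) (φ a) =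
          C'.circ (Sum.elim I fun i => i != b) (φ (C.next a)) := by
      rintro a ((rfl | rfl) | (rfl | rfl))
      · rw [hφp, hφ _ hNpp, h2, h4]
      · rw [hφq, hφ _ hNqq]
        rcases ho with ⟨rfl, rfl⟩ | ⟨rfl, rfl⟩
        · rw [← h1, h3]
        · rw [← h3, h1]
      · rw [hφp, hφ _ hNp]
      · rw [hφq, hφ _ hNq]
    exact ⟨hall _ ((hN _).2 ⟨i, Or.inl rfl⟩), hall _ ((hN _).2 ⟨i, Or.inr rfl⟩)⟩
  · obtain ⟨⟨h1, h2⟩, h3, h4⟩ := hC I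
    have key : ∀ a, C.circ I (φ a) = C.circ I a := fun a => by
      by_cases h : N a
      · rcases h with rfl | rfl
        · rw [hφp, h1]
        · rw [hφq, h3]
      · rw [hφ a h]
    let g : A → Quot (C.Joined I) := fun a => if a = C.next p then C.circ I q else
      if a = C.next q then C.circ I p else C.circ I a
    have hg : ∀ a, ¬ N a → g a = C.circ I a := fun a h => by
      simp only [hNdef, not_or] at h
      simp only [g, if_neg h.1, if_neg h.2]
    have hgp : g (C.next p) = C.circ I q := if_pos rfl
    have hgq : g (C.next q) = C.circ I p := by
      simp only [g, if_neg (C.next.injective.ne hne.symm), if_pos]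
    have hgo : g o = C.circ I q ∧ g o' = C.circ I q := by
      rw [hg _ hNo.1, hg _ hNo.2]
      rcases ho with ⟨rfl, rfl⟩ | ⟨rfl, rfl⟩
      exacts [⟨rfl, (h3.trans h4).symm⟩, ⟨(h3.trans h4).symm, rfl⟩]
    have hr : C'.Respects (Sum.elim I fun i => i != b) g := by
      refine E.respects (N := N) (fun a => (hN' a).1) hg (respects_circ I) ?_
      rintro (_ | _)
      · exact hx.respectsAt_iff.2 ⟨fun h => absurd h (by rw [hb]; simp),
          fun _ => ⟨by rw [hgp, hgo.1], by rw [hgq, hg _ hNp]⟩⟩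
      · exact hy.respectsAt_iff.2 ⟨fun h => absurd h (by rw [hb]; simp),
          fun _ => ⟨by rw [hgp, hgo.2], by rw [hgq, hg _ hNpp, ← h2, h1]⟩⟩
    refine circ_eq_iff.1 ?_
    have := hr.eq_of_rel h
    rwa [hg _ (hφN a), hg _ (hφN a'), key, key] at this
  · obtain ⟨⟨h1, h2⟩, h3, h4⟩ := hjoin I
    have E' := C'.rel_equivalence (Sum.elim I fun i => i != b)
    by_cases h : N a
    · rcases h with rfl | rfl
      · refine ⟨o, circ_eq_iff.1 ?_⟩
        rw [hφ _ hNo.1, h1]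
      · refine ⟨p, circ_eq_iff.1 ?_⟩
        rw [hφ _ hNp, h2]
    · exact ⟨a, by rw [hφ a h]; exact E'.refl _⟩

end Code

end LinkSplitting

namespace LinkSplitting

namespace Code

variable {A X : Type*}

/-! ### The third Reidemeister move for codes -/

theorem Corner.symm {C : Code A X} {x : X} {κ : Bool} {i i' o o' : A} (h : C.Corner x κ i i' o o') :
    C.Corner x κ i' i o' o := by
  obtain ⟨a, b, d, d', hab, hd, rfl, rfl, rfl, rfl⟩ := h
  exact ⟨b, a, d', d, by tauto, by rw [← hd, eq_comm], rfl, rfl, rfl, rfl⟩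

/-- The strands of a triangle outside of it are connected in the same way before and after the move:
if values on the outer arcs extend to the sides of the triangle after the move, then they do so
before the move. -/
theorem exists_inner_values {Q : Type*} {c bl bh bk bl' bh' : Bool}
    (live : bk = (!c) ∨ bk = c ∧ bl = false ∧ bh = true) (hs : bk = c → bl' = bl ∧ bh' = bh)
    (hs' : bk ≠ c → bl' = bh ∧ bh' = bl) {i₁ i₂ i₃ o₁l o₂l o₁h o₃h o₂k o₃k : Q}
    (hl : (bl' = true → i₁ = i₂ ∧ o₁h = o₂k) ∧ (bl' ≠ true → i₁ = o₂k ∧ o₁h = i₂))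
    (hh : (bh' = false → i₁ = i₃ ∧ o₁l = o₃k) ∧ (bh' ≠ false → i₁ = o₃k ∧ o₁l = i₃))
    (hk : (bk = c → i₂ = i₃ ∧ o₂l = o₃h) ∧ (bk ≠ c → i₂ = o₃h ∧ o₂l = i₃)) :
    ∃ v₁ v₂ v₃ : Q,
      ((bl = true → v₁ = v₂ ∧ o₁l = o₂l) ∧ (bl ≠ true → v₁ = o₂l ∧ o₁l = v₂)) ∧
      ((bh = false → v₁ = v₃ ∧ o₁h = o₃h) ∧ (bh ≠ false → v₁ = o₃h ∧ o₁h = v₃)) ∧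
      ((bk = c → v₂ = v₃ ∧ o₂k = o₃k) ∧ (bk ≠ c → v₂ = o₃k ∧ o₂k = v₃)) := by
  by_cases hc : bk = c
  · obtain ⟨rfl, rfl⟩ := hs hc
    obtain ⟨-, rfl, rfl⟩ := live.resolve_left (by rw [hc]; simp)
    refine ⟨o₂l, o₁l, o₁l, ?_⟩
    grind
  · obtain ⟨rfl, rfl⟩ := hs' hc
    cases bl' <;> cases bh'
    · refine ⟨o₂l, o₁l, o₂l, ?_⟩
      grind
    · refine ⟨o₂k, o₂k, o₂k, ?_⟩
      grind
    · refine ⟨o₂l, o₁l, o₁h, ?_⟩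
      grind
    · refine ⟨o₃h, o₃h, o₁h, ?_⟩
      grind

/-- The crossings `l`, `h`, `k` of `C` are the vertices of a triangle with the sides `i₁`, `i₂`, `i₃`,
which form a circle in the resolutions with the digits `1`, `0`, `c`. The other arcs at these
crossings are `o₁l`, `o₂l` and so on, with the index of the strand first. -/
structure IsTriangleAt (C : Code A X) (l h k : X) (c : Bool)
    (i₁ i₂ i₃ o₁l o₂l o₁h o₃h o₂k o₃k : A) : Prop where
  l_ne_h : l ≠ h
  l_ne_k : l ≠ k
  h_ne_k : h ≠ k
  corner_l : C.Corner l true i₁ i₂ o₁l o₂l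
  corner_h : C.Corner h false i₁ i₃ o₁h o₃h
  corner_k : C.Corner k c i₂ i₃ o₂k o₃k
  inner₁₂ : i₁ ≠ i₂
  inner₁₃ : i₁ ≠ i₃
  inner₂₃ : i₂ ≠ i₃
  outer : ∀ a, (a = o₁l ∨ a = o₂l ∨ a = o₁h ∨ a = o₃h ∨ a = o₂k ∨ a = o₃k) →
    a ≠ i₁ ∧ a ≠ i₂ ∧ a ≠ i₃
  near : ∀ a, ((a = i₁ ∨ a = i₂ ∨ a = i₃) ∨ (C.next a = i₁ ∨ C.next a = i₂ ∨ C.next a = i₃)) →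
    ∃ x, (x = l ∨ x = h ∨ x = k) ∧ (a = C.upper x ∨ a = C.lower x)

namespace IsTriangleAt

variable {C C' : Code A X} {l h k : X} {c : Bool} {i₁ i₂ i₃ o₁l o₂l o₁h o₃h o₂k o₃k : A}

section

variable (T : C.IsTriangleAt l h k c i₁ i₂ i₃ o₁l o₂l o₁h o₃h o₂k o₃k)
include T

theorem away_of_plain {a : A} (ha : C.Plain a) : (a ≠ i₁ ∧ a ≠ i₂ ∧ a ≠ i₃) ∧
    (C.next a ≠ i₁ ∧ C.next a ≠ i₂ ∧ C.next a ≠ i₃) := by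
  by_contra hc
  obtain ⟨x, -, hx⟩ := T.near a (by tauto)
  rcases hx with rfl | rfl
  exacts [(ha x).1 rfl, (ha x).2 rfl]

theorem away_of_ne {x : X} (hx : ¬ (x = l ∨ x = h ∨ x = k)) {a : A}
    (ha : a = C.upper x ∨ a = C.lower x) : (a ≠ i₁ ∧ a ≠ i₂ ∧ a ≠ i₃) ∧
    (C.next a ≠ i₁ ∧ C.next a ≠ i₂ ∧ C.next a ≠ i₃) := by
  by_contra hc
  obtain ⟨y, hy, hay⟩ := T.near a (by tauto)
  have hxy : x ≠ y := fun h => hx (h ▸ hy)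
  rcases ha with rfl | rfl <;> rcases hay with h | h
  exacts [hxy (C.upper_inj.1 h), C.upper_ne_lower _ _ h, C.upper_ne_lower _ _ h.symm,
    hxy (C.lower_inj.1 h)]

open Classical in
/-- A function that is constant on circles away from the triangle may be changed on the sides of
the triangle. -/
theorem respects {Q : Type*} {I : X → Bool} {f g : A → Q}
    (hfg : ∀ a, a ≠ i₁ → a ≠ i₂ → a ≠ i₃ → g a = f a)
    (hp : ∀ a, C.Plain a → f a = f (C.next a))
    (hx : ∀ x, ¬ (x = l ∨ x = h ∨ x = k) → C.RespectsAt I f x)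
    (hT : ∀ x, (x = l ∨ x = h ∨ x = k) → C.RespectsAt I g x) : C.Respects I g := by
  refine respects_of_at (fun a ha => ?_) fun x => ?_
  · obtain ⟨⟨h1, h2, h3⟩, h4, h5, h6⟩ := T.away_of_plain ha
    rw [hfg _ h1 h2 h3, hfg _ h4 h5 h6, hp a ha]
  · by_cases hxl : x = l ∨ x = h ∨ x = k
    · exact hT x hxl
    · obtain ⟨⟨h1, h2, h3⟩, h4, h5, h6⟩ := T.away_of_ne hxl (Or.inl rfl)
      obtain ⟨⟨h1', h2', h3'⟩, h4', h5', h6'⟩ := T.away_of_ne hxl (Or.inr rfl)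
      rw [RespectsAt, hfg _ h1 h2 h3, hfg _ h4 h5 h6, hfg _ h1' h2' h3', hfg _ h4' h5' h6']
      exact hx x hxl

theorem circ_eq (I : X → Bool) : let g := C.circ I
    ((I l = true → g i₁ = g i₂ ∧ g o₁l = g o₂l) ∧ (I l ≠ true → g i₁ = g o₂l ∧ g o₁l = g i₂)) ∧
    ((I h = false → g i₁ = g i₃ ∧ g o₁h = g o₃h) ∧
      (I h ≠ false → g i₁ = g o₃h ∧ g o₁h = g i₃)) ∧
    ((I k = c → g i₂ = g i₃ ∧ g o₂k = g o₃k) ∧ (I k ≠ c → g i₂ = g o₃k ∧ g o₂k = g i₃)) :=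
  ⟨T.corner_l.respectsAt_iff.1 ((respects_circ I).at l),
    T.corner_h.respectsAt_iff.1 ((respects_circ I).at h),
    T.corner_k.respectsAt_iff.1 ((respects_circ I).at k)⟩

variable [DecidableEq X]

theorem isTriangle [Finite A] (hC : C.Colorable) :
    (C.cube hC).IsTriangle l h k c (fun a => a = i₁ ∨ a = i₂ ∨ a = i₃) i₁ := by
  have out : ∀ a, (a = o₁l ∨ a = o₂l ∨ a = o₁h ∨ a = o₃h ∨ a = o₂k ∨ a = o₃k) →
      ¬ (a = i₁ ∨ a = i₂ ∨ a = i₃) := fun a ha => by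
    have := T.outer a ha
    tauto
  refine ⟨T.l_ne_h, T.l_ne_k, T.h_ne_k, Or.inl rfl, fun I hl hh hk a b ha => ?_, ?_, ?_, ?_,
    fun I hI a => ?_⟩
  · obtain ⟨h1, h2, h3⟩ := T.circ_eq I
    have h1 := h1.1 hl
    have h2 := h2.1 hh
    constructor
    · intro hab
      have hr : C.Respects I fun a => (a = i₁ ∨ a = i₂ ∨ a = i₃) := by
        refine T.respects (f := fun _ => False) (fun a h1 h2 h3 => by simp [h1, h2, h3])
          (fun _ _ => rfl) (fun _ _ => ⟨fun _ => ⟨rfl, rfl⟩, fun _ => ⟨rfl, rfl⟩⟩) ?_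
        have hin : ∀ a b, (a = i₁ ∨ a = i₂ ∨ a = i₃) → (b = i₁ ∨ b = i₂ ∨ b = i₃) →
            (a = i₁ ∨ a = i₂ ∨ a = i₃) = (b = i₁ ∨ b = i₂ ∨ b = i₃) := fun a b ha hb =>
          propext ⟨fun _ => hb, fun _ => ha⟩
        have hout : ∀ a b, (a = o₁l ∨ a = o₂l ∨ a = o₁h ∨ a = o₃h ∨ a = o₂k ∨ a = o₃k) →
            (b = o₁l ∨ b = o₂l ∨ b = o₁h ∨ b = o₃h ∨ b = o₂k ∨ b = o₃k) →
            (a = i₁ ∨ a = i₂ ∨ a = i₃) = (b = i₁ ∨ b = i₂ ∨ b = i₃) := fun a b ha hb =>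
          propext ⟨fun h => absurd h (out a ha), fun h => absurd h (out b hb)⟩
        rintro x (rfl | rfl | rfl)
        · exact T.corner_l.respectsAt_iff.2 ⟨fun _ => ⟨hin _ _ (by simp) (by simp),
            hout _ _ (by simp) (by simp)⟩, fun h => absurd hl h⟩
        · exact T.corner_h.respectsAt_iff.2 ⟨fun _ => ⟨hin _ _ (by simp) (by simp),
            hout _ _ (by simp) (by simp)⟩, fun h => absurd hh h⟩
        · exact T.corner_k.respectsAt_iff.2 ⟨fun _ => ⟨hin _ _ (by simp) (by simp),
            hout _ _ (by simp) (by simp)⟩, fun h => absurd hk h⟩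
      have := hr.eq_of_rel hab
      rwa [← this]
    · intro hb
      have key : ∀ a, (a = i₁ ∨ a = i₂ ∨ a = i₃) → C.circ I a = C.circ I i₁ := by
        rintro a (rfl | rfl | rfl)
        exacts [rfl, h1.1.symm, h2.1.symm]
      exact circ_eq_iff.1 ((key a ha).trans (key b hb).symm)
  · exact T.corner_l.end_iff (Z := fun a => a = i₁ ∨ a = i₂ ∨ a = i₃) (by simp) (by simp)
      (out _ (by simp)) (out _ (by simp))
  · exact T.corner_h.end_iff (Z := fun a => a = i₁ ∨ a = i₂ ∨ a = i₃) (by simp) (by simp)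
      (out _ (by simp)) (out _ (by simp))
  · exact T.corner_k.end_iff (Z := fun a => a = i₁ ∨ a = i₂ ∨ a = i₃) (by simp) (by simp)
      (out _ (by simp)) (out _ (by simp))
  · obtain ⟨h1, h2, h3⟩ := T.circ_eq I
    suffices h : ∃ b, ¬ (b = i₁ ∨ b = i₂ ∨ b = i₃) ∧ C.circ I a = C.circ I b by
      obtain ⟨b, hb, hab⟩ := h
      exact ⟨⟨b, hb⟩, circ_eq_iff.1 hab⟩
    have c1 : ∃ b, ¬ (b = i₁ ∨ b = i₂ ∨ b = i₃) ∧ C.circ I i₁ = C.circ I b := by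
      by_cases hl : I l = true
      · by_cases hh : I h = false
        · exact ⟨o₃k, out _ (by simp), by
            rw [(h1.1 hl).1, (h3.2 fun hk => hI ⟨hl, hh, hk⟩).1]⟩
        · exact ⟨o₃h, out _ (by simp), (h2.2 hh).1⟩
      · exact ⟨o₂l, out _ (by simp), (h1.2 hl).1⟩
    by_cases ha : a = i₁ ∨ a = i₂ ∨ a = i₃
    · rcases ha with rfl | rfl | rfl
      · exact c1
      · by_cases hl : I l = true
        · rwa [← (h1.1 hl).1]
        · exact ⟨o₁l, out _ (by simp), (h1.2 hl).2.symm⟩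
      · by_cases hh : I h = false
        · rwa [← (h2.1 hh).1]
        · exact ⟨o₁h, out _ (by simp), (h2.2 hh).2.symm⟩
    · exact ⟨a, ha, rfl⟩

open Classical in
/-- Away from the triangle the circles are the same before and after the move. -/
theorem rel_slide (T' : C'.IsTriangleAt l h k c i₁ i₂ i₃ o₁h o₂k o₁l o₃k o₂l o₃h)
    (hnext : C'.next = C.next) (hplain : ∀ a, C.Plain a → C'.Plain a)
    (hx : ∀ x, ¬ (x = l ∨ x = h ∨ x = k) →
      C'.upper x = C.upper x ∧ C'.lower x = C.lower x ∧ C'.pos x = C.pos x)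
    {I : X → Bool} (hI : ResCube.Live l h k c I) {a b : A} (ha : ¬ (a = i₁ ∨ a = i₂ ∨ a = i₃))
    (hb : ¬ (b = i₁ ∨ b = i₂ ∨ b = i₃)) (hab : C.rel I a b) :
    C'.rel (ResCube.slide l h k c I) a b := by
  set I' := ResCube.slide l h k c I with hI'
  have hIk : I' k = I k := ResCube.IsSlide.slide_k T.l_ne_k T.h_ne_k I
  obtain ⟨h1, h2, h3⟩ := T'.circ_eq I'
  rw [hIk] at h3
  obtain ⟨v₁, v₂, v₃, hl, hh, hk⟩ := exists_inner_values hI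
    (fun hc => by rw [hI', ResCube.slide, if_pos hc]; exact ⟨rfl, rfl⟩)
    (fun hc => by rw [hI', ResCube.slide, if_neg hc]; simp) h1 h2 h3
  let g : A → Quot (C'.Joined I') := fun a => if a = i₁ then v₁ else if a = i₂ then v₂ else
    if a = i₃ then v₃ else C'.circ I' a
  have g1 : g i₁ = v₁ := if_pos rfl
  have g2 : g i₂ = v₂ := by simp only [g, if_neg T.inner₁₂.symm, if_pos]
  have g3 : g i₃ = v₃ := by
    simp only [g, if_neg T.inner₁₃.symm, if_neg T.inner₂₃.symm, if_pos]
  have g0 : ∀ a, a ≠ i₁ → a ≠ i₂ → a ≠ i₃ → g a = C'.circ I' a := fun a h1 h2 h3 => by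
    simp only [g, if_neg h1, if_neg h2, if_neg h3]
  have go : ∀ a, (a = o₁l ∨ a = o₂l ∨ a = o₁h ∨ a = o₃h ∨ a = o₂k ∨ a = o₃k) →
      g a = C'.circ I' a := fun a ha => by
    obtain ⟨h1, h2, h3⟩ := T.outer a ha
    exact g0 a h1 h2 h3
  have hr : C.Respects I g := by
    refine T.respects g0 (fun a ha => ?_) (fun x hxl => ?_) ?_
    · rw [← hnext]; exact (respects_circ I').plain (hplain a ha)
    · have := (respects_circ (C := C') I').at x
      obtain ⟨e1, e2, e3⟩ := hx x hxl
      have e4 : I' x = I x := by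
        rw [hI', ResCube.slide]
        split_ifs
        · rfl
        · exact congrArg I (Equiv.swap_apply_of_ne_of_ne (fun h => hxl (Or.inl h))
            fun h => hxl (Or.inr (Or.inl h)))
      rwa [RespectsAt, e1, e2, e3, e4, hnext] at this
    · rintro x (rfl | rfl | rfl)
      · rw [T.corner_l.respectsAt_iff, g1, g2, go _ (by simp), go o₂l (by simp)]
        exact hl
      · rw [T.corner_h.respectsAt_iff, g1, g3, go _ (by simp), go o₃h (by simp)]
        exact hh
      · rw [T.corner_k.respectsAt_iff, g2, g3, go _ (by simp), go o₃k (by simp)]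
        exact hk
  have := hr.eq_of_rel hab
  push Not at ha hb
  rw [g0 a ha.1 ha.2.1 ha.2.2, g0 b hb.1 hb.2.1 hb.2.2] at this
  exact circ_eq_iff.1 this

end

section

variable [DecidableEq X] [Finite A] [Fintype X] {R : Type*} [CommRing R]

/-- Invariance under the third Reidemeister move. -/
theorem strict_iff (T : C.IsTriangleAt l h k c i₁ i₂ i₃ o₁l o₂l o₁h o₃h o₂k o₃k)
    (T' : C'.IsTriangleAt l h k c i₁ i₂ i₃ o₁h o₂k o₁l o₃k o₂l o₃h)
    (hnext : C'.next = C.next) (hplain : ∀ a, C.Plain a ↔ C'.Plain a)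
    (hx : ∀ x, ¬ (x = l ∨ x = h ∨ x = k) →
      C'.upper x = C.upper x ∧ C'.lower x = C.lower x ∧ C'.pos x = C.pos x)
    (hC : C.Colorable) (hC' : C'.Colorable) {τ : A → ℤˣ} (hτ : C.IsColoring τ)
    (hτ' : C'.IsColoring τ) {ω : A → R} (hω : ∀ a, ω (C.next a) = ω a)
    (hsum : C.weight τ ω l + C.weight τ ω h + C.weight τ ω k = 0)
    (hneg : ∀ x, x = l ∨ x = h ∨ x = k → C'.weight τ ω x = -C.weight τ ω x)
    {e e' : (X → Bool) → X → ℤˣ} (he : IsEdgeSign e) (he' : IsEdgeSign e') (n : ℕ) :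
    C'.Strict hC' (C'.weight τ ω) e' n ↔ C.Strict hC (C.weight τ ω) e n := by
  set e₁ : (X → Bool) → X → ℤˣ := fun I x => e (I ∘ Equiv.swap l h) (Equiv.swap l h x) with he₁
  have S : ResCube.IsSlide (C.cube hC) (C'.cube hC') l h k c (fun a => a = i₁ ∨ a = i₂ ∨ a = i₃) i₁
      (C.weight τ ω) (C'.weight τ ω) e e₁ := by
    refine ⟨T.isTriangle hC, T'.isTriangle hC', fun I hI a b ha hb => ⟨fun hab => ?_, fun hab => ?_⟩,
      hsum, hneg _ (by simp), hneg _ (by simp), hneg _ (by simp), fun x h1 h2 h3 => ?_, he,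
      fun _ _ => rfl⟩
    · exact T.rel_slide T' hnext (fun a => (hplain a).1) hx hI ha hb hab
    · have := T'.rel_slide T hnext.symm (fun a => (hplain a).2)
        (fun x hx' => by obtain ⟨h1, h2, h3⟩ := hx x hx'; exact ⟨h1.symm, h2.symm, h3.symm⟩)
        (ResCube.IsSlide.live_slide T.l_ne_k T.h_ne_k hI) ha hb hab
      rwa [ResCube.IsSlide.slide_slide T.l_ne_k T.h_ne_k] at this
    · obtain ⟨e1, e2, -⟩ := hx x (by tauto)
      rw [weight, weight, e1, e2]
  rw [Strict, Strict, S.strictUpTo_iff (hτ.flat hω hC)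
    (hτ'.flat (fun a => by rw [hnext, hω]) hC') n]
  exact ResCube.strictUpTo_iff_of_edgeSign (ResCube.IsSlide.edgeSign_swap he fun _ _ => rfl) he' n

end

end IsTriangleAt

end Code

end LinkSplitting

namespace LinkSplitting

namespace Code

variable {A A' X X' Q : Type*}

/-! ### Relabelling and subdivision -/

/-- `C'` is `C` with the crossings relabelled by `j`, the arcs renamed by `f`, and possibly some of
them subdivided by one more point. -/
structure IsSubdivision (C : Code A X) (C' : Code A' X') (f : A → A') (j : X ≃ X') : Prop where
  inj : Function.Injective f
  upper : ∀ x, C'.upper (j x) = f (C.upper x)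
  lower : ∀ x, C'.lower (j x) = f (C.lower x)
  pos : ∀ x, C'.pos (j x) = C.pos x
  next : ∀ a, C'.next (f a) = f (C.next a) ∨
    (∀ c, f c ≠ C'.next (f a)) ∧ C'.next (C'.next (f a)) = f (C.next a)
  cov : ∀ b, (∃ a, f a = b) ∨ ∃ a, f a = C'.next b

namespace IsSubdivision

variable {C : Code A X} {C' : Code A' X'} {f : A → A'} {j : X ≃ X'}

theorem retraction_next {r : A' → A} (h1 : ∀ a, r (f a) = a)
    (hn : ∀ a, r (C'.next (f a)) = C.next a)
    (h2 : ∀ b, (∀ c, f c ≠ b) → f (r b) = C'.next b) {g : A → Q} (P : A → Prop)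
    (hg : ∀ a, P a → g (C.next a) = g a) {b : A'} (hb : ∀ a, f a = b → P a) :
    g (r (C'.next b)) = g (r b) := by
  by_cases hb' : ∃ a, f a = b
  · obtain ⟨a, rfl⟩ := hb'
    rw [hn, h1, hg a (hb a rfl)]
  · push Not at hb'
    rw [← h2 b hb', h1]

variable (S : IsSubdivision C C' f j)
include S

theorem plain_of_notMem {b : A'} (hb : ∀ c, f c ≠ b) : C'.Plain b := by
  intro x
  obtain ⟨x, rfl⟩ := j.surjective x
  rw [S.upper, S.lower]
  exact ⟨hb _, hb _⟩

theorem plain_iff (a : A) : C'.Plain (f a) ↔ C.Plain a := by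
  rw [Plain, j.symm.forall_congr_left, Plain]
  simp only [j.symm_symm, S.upper, S.lower, ne_eq, S.inj.eq_iff]

/-- A function with the same value before and after plain points is constant along subdivided
arcs. -/
theorem apply_next {g : A' → Q} (hg : ∀ b, C'.Plain b → g b = g (C'.next b)) (a : A) :
    g (C'.next (f a)) = g (f (C.next a)) := by
  rcases S.next a with h | ⟨h, h'⟩
  · rw [h]
  · rw [hg _ (S.plain_of_notMem h), h']

/-- An inverse of `f` up to subdivision. -/
theorem exists_retraction : ∃ r : A' → A, (∀ a, r (f a) = a) ∧
    (∀ a, r (C'.next (f a)) = C.next a) ∧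
    ∀ b, (∀ c, f c ≠ b) → f (r b) = C'.next b := by
  classical
  have : ∀ b, ∃ a, f a = b ∨ (∀ c, f c ≠ b) ∧ f a = C'.next b := by
    intro b
    by_cases hb : ∃ a, f a = b
    · obtain ⟨a, ha⟩ := hb
      exact ⟨a, Or.inl ha⟩
    · obtain ⟨a, ha⟩ := (S.cov b).resolve_left hb
      push Not at hb
      exact ⟨a, Or.inr ⟨hb, ha⟩⟩
  choose r hr using this
  have h1 : ∀ a, r (f a) = a := fun a =>
    S.inj ((hr (f a)).resolve_right fun h => h.1 a rfl)
  have h2 : ∀ b, (∀ c, f c ≠ b) → f (r b) = C'.next b := fun b hb =>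
    ((hr b).resolve_left (hb _)).2
  refine ⟨r, h1, fun a => ?_, h2⟩
  rcases S.next a with h | ⟨h, h'⟩
  · rw [h, h1]
  · exact S.inj (by rw [h2 _ h, h'])

theorem apply_retraction {r : A' → A} (h1 : ∀ a, r (f a) = a)
    (h2 : ∀ b, (∀ c, f c ≠ b) → f (r b) = C'.next b) {g : A' → Q}
    (hg : ∀ b, C'.Plain b → g b = g (C'.next b)) (b : A') : g (f (r b)) = g b := by
  by_cases hb : ∃ a, f a = b
  · obtain ⟨a, rfl⟩ := hb
    rw [h1]
  · push Not at hb
    rw [h2 b hb, ← hg _ (S.plain_of_notMem hb)]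

theorem rel_iff {I : X → Bool} {a b : A} :
    C.rel I a b ↔ C'.rel (I ∘ j.symm) (f a) (f b) := by
  have hI : ∀ x, (I ∘ j.symm) (j x) = I x := fun x => by simp
  constructor
  · intro h
    refine circ_eq_iff.1 (Respects.eq_of_rel (C := C) (I := I)
      (f := fun a => C'.circ (I ∘ j.symm) (f a)) (respects_of_at (fun a ha => ?_) fun x => ?_) h)
    · rw [← S.apply_next (g := C'.circ (I ∘ j.symm)) (fun b hb => (respects_circ _).plain hb) a]
      exact (respects_circ _).plain ((S.plain_iff a).2 ha)
    · have := (respects_circ (C := C') (I ∘ j.symm)).at (j x)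
      rw [RespectsAt, hI, S.pos, S.upper, S.lower,
        S.apply_next (g := C'.circ (I ∘ j.symm)) (fun b hb => (respects_circ _).plain hb),
        S.apply_next (g := C'.circ (I ∘ j.symm)) (fun b hb => (respects_circ _).plain hb)] at this
      exact this
  · intro h
    obtain ⟨r, h1, hn, h2⟩ := S.exists_retraction
    have := Respects.eq_of_rel (C := C') (I := I ∘ j.symm)
      (f := fun b => C.circ I (r b)) (respects_of_at (fun b hb => ?_) fun x => ?_) h
    · rw [h1, h1] at this
      exact circ_eq_iff.1 this
    · refine (retraction_next h1 hn h2 C.Plain (fun a ha => ?_) fun a ha => ?_).symm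
      · exact ((respects_circ I).plain ha).symm
      · rwa [← S.plain_iff, ha]
    · obtain ⟨x, rfl⟩ := j.surjective x
      have := (respects_circ (C := C) I).at x
      rw [RespectsAt, hI, S.pos, S.upper, S.lower]
      simp only [h1, hn]
      exact this

theorem isColoring {τ' : A' → ℤˣ} (hτ' : C'.IsColoring τ') : C.IsColoring (τ' ∘ f) := by
  have hn : ∀ a, τ' (f (C.next a)) = τ' (C'.next (f a)) := fun a =>
    (S.apply_next (fun b hb => (hτ'.plain b hb).symm) a).symm
  refine ⟨fun a ha => ?_, fun x => ?_, fun x => ?_, fun x => ?_⟩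
  · rw [Function.comp, hn, hτ'.plain _ ((S.plain_iff a).2 ha)]; rfl
  · rw [Function.comp, hn, ← S.upper, hτ'.upper, S.upper]; rfl
  · rw [Function.comp, hn, ← S.lower, hτ'.lower, S.lower]; rfl
  · rw [Function.comp, ← S.lower, hτ'.lower_eq, S.upper]; rfl

end IsSubdivision

/-! ### Weights of the components -/

section

variable {R : Type*} [CommRing R]

/-- The function `ω` is given by weights of the components of the link, and the differences of
weights of different components are units. That `a` and `b` lie on different components is expressed
by a union `S` of components that contains one but not the other. -/
structure IsWeighting (C : Code A X) (ω : A → R) : Prop where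
  next : ∀ a, ω (C.next a) = ω a
  unit : ∀ (S : A → Prop), (∀ a, S (C.next a) = S a) → ∀ a b, S a → ¬ S b → IsUnit (ω a - ω b)

variable (R) in
/-- The differential is strict up to `n`, for all weights and signs. -/
def StrictFor [DecidableEq X] [Fintype X] [Finite A] (C : Code A X) (n : ℕ) : Prop :=
  ∀ (h : C.Colorable) (τ : A → ℤˣ) (ω : A → R) (e : (X → Bool) → X → ℤˣ), C.IsColoring τ →
    C.IsWeighting ω → IsEdgeSign e → C.Strict h (C.weight τ ω) e n

namespace IsSubdivision

variable {C : Code A X} {C' : Code A' X'} {f : A → A'} {j : X ≃ X'} (S : IsSubdivision C C' f j)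
include S

theorem isWeighting {ω : A' → R} (hω : C'.IsWeighting ω) : C.IsWeighting (ω ∘ f) := by
  obtain ⟨r, h1, hn, h2⟩ := S.exists_retraction
  refine ⟨fun a => ?_, fun T hT a b ha hb => ?_⟩
  · rw [Function.comp, ← S.apply_next (fun b _ => (hω.next b).symm), hω.next]; rfl
  · exact hω.unit (T ∘ r) (fun b => retraction_next h1 hn h2 (fun _ => True) (fun a _ => hT a)
      fun _ _ => trivial) _ _ (by rwa [Function.comp, h1]) (by rwa [Function.comp, h1])

theorem exists_isWeighting {ω : A → R} (hω : C.IsWeighting ω) :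
    ∃ ω' : A' → R, C'.IsWeighting ω' ∧ ω' ∘ f = ω := by
  obtain ⟨r, h1, hn, h2⟩ := S.exists_retraction
  refine ⟨ω ∘ r, ⟨fun b => ?_, fun T hT a b ha hb => ?_⟩, funext fun a => by
    rw [Function.comp, Function.comp, h1]⟩
  · exact retraction_next h1 hn h2 (fun _ => True) (fun a _ => hω.next a) fun _ _ => trivial
  · have hr := S.apply_retraction h1 h2 (g := T) fun b _ => (hT b).symm
    exact hω.unit (T ∘ f) (fun a => by
      rw [Function.comp, ← S.apply_next (fun b _ => (hT b).symm), hT]; rfl) _ _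
      (by rwa [Function.comp, hr]) (by rwa [Function.comp, hr])

variable [DecidableEq X] [DecidableEq X'] [Fintype X] [Fintype X'] [Finite A] [Finite A']

theorem strictFor_iff (h : C.Colorable) (h' : C'.Colorable) (n : ℕ) :
    C'.StrictFor R n ↔ C.StrictFor R n := by
  have key : ∀ (τ' : A' → ℤˣ) (ω' : A' → R) (e : (X → Bool) → X → ℤˣ)
      (e' : (X' → Bool) → X' → ℤˣ), IsEdgeSign e → IsEdgeSign e' →
      (C'.Strict h' (C'.weight τ' ω') e' n ↔ C.Strict h (C.weight (τ' ∘ f) (ω' ∘ f)) e n) := by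
    intro τ' ω' e e' he he'
    refine ResCube.strictUpTo_iff_of_iso (C := C.cube h) (C' := C'.cube h') j (φ := f)
      (fun I a b => S.rel_iff) (fun I b => ?_) (fun x => ?_) he he' n
    · obtain ⟨r, h1, hn, h2⟩ := S.exists_retraction
      refine ⟨r b, circ_eq_iff.1 ?_⟩
      exact (S.apply_retraction h1 h2 (g := C'.circ (I ∘ j.symm))
        (fun b hb => (respects_circ _).plain hb) b).symm
    · rw [weight, weight, S.upper, S.lower]; rfl
  obtain ⟨τ₀, hτ₀⟩ := h'
  have he : ∀ (e : (X → Bool) → X → ℤˣ), IsEdgeSign e →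
      IsEdgeSign fun (I : X' → Bool) x => e (I ∘ j) (j.symm x) := fun e he =>
    ⟨fun I x => by
      have := flip_comp_equiv I j (j.symm x)
      rw [j.apply_symm_apply] at this
      rw [this, he.symm], fun I x y hxy => by
      have h1 := flip_comp_equiv I j (j.symm x)
      have h2 := flip_comp_equiv I j (j.symm y)
      rw [j.apply_symm_apply] at h1 h2
      rw [h1, h2]
      exact he.square _ _ _ (j.symm.injective.ne hxy)⟩
  have he' : ∀ (e : (X' → Bool) → X' → ℤˣ), IsEdgeSign e →
      IsEdgeSign fun (I : X → Bool) x => e (I ∘ j.symm) (j x) := fun e he =>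
    ⟨fun I x => by
      have := flip_comp_equiv I j.symm (j x)
      rw [j.symm_apply_apply] at this
      rw [this, he.symm], fun I x y hxy => by
      have h1 := flip_comp_equiv I j.symm (j x)
      have h2 := flip_comp_equiv I j.symm (j y)
      rw [j.symm_apply_apply] at h1 h2
      rw [h1, h2]
      exact he.square _ _ _ (j.injective.ne hxy)⟩
  constructor
  · intro H _ τ ω e hτ hω hes
    obtain ⟨ω', hω', rfl⟩ := S.exists_isWeighting hω
    rw [strict_iff_of_coloring hτ (S.isColoring hτ₀), ← key _ _ _ _ hes (he e hes)]
    exact H _ _ _ _ hτ₀ hω' (he e hes)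
  · intro H _ τ' ω' e' hτ' hω' hes'
    rw [key _ _ _ _ (he' e' hes') hes']
    exact H _ _ _ _ (S.isColoring hτ') (S.isWeighting hω') (he' e' hes')

end IsSubdivision

end

end Code

end LinkSplitting

namespace LinkSplitting

/-! ### Planar diagrams have checkerboard colorings -/

/-- The signed Gauss code of a diagram. -/
def gaussCode (D : GaussDiagram) : Code (Fin D.arcs) (Fin D.crossings) where
  next := D.next
  upper := D.upper
  lower := D.lower
  pos := D.pos
  inj := D.passages_injective

section Planar

open Module GaussDiagram

variable (D : GaussDiagram)

/-- The face to the left of a directed arc. -/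
def face (e : Fin D.arcs × Bool) : D.Face := Quot.mk _ e

variable {D} in
theorem face_eq {e f : Fin D.arcs × Bool} (h : D.FaceStep e f) : face D e = face D f :=
  Quot.sound h

instance : Finite D.Face := inferInstanceAs (Finite (Quot _))

instance : Finite D.ShadowComponent := inferInstanceAs (Finite (Quot _))

theorem shadow_next (a : Fin D.arcs) :
    (Quot.mk _ (D.next a) : D.ShadowComponent) = Quot.mk _ a := by
  refine Eq.symm (Quot.sound (Or.inl ?_))
  rfl

theorem shadow_lower (x : Fin D.crossings) :
    (Quot.mk _ (D.lower x) : D.ShadowComponent) = Quot.mk _ (D.upper x) :=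
  Eq.symm (Quot.sound (by exact Or.inr ⟨x, rfl, rfl⟩))

/-- The component of the shadow at a face. -/
def faceShadow : D.Face → D.ShadowComponent :=
  Quot.lift (fun e => Quot.mk _ e.1) fun e f h => by
    cases h <;> simp only [shadow_next, shadow_lower] <;> rfl

/-- The coboundary of a function on the faces: the difference between the two sides of an arc. -/
def faceDifference : (D.Face → ZMod 2) →ₗ[ZMod 2] (Fin D.arcs → ZMod 2) where
  toFun c a := c (face D (a, true)) + c (face D (a, false))
  map_add' c c' := by funext a; simp only [Pi.add_apply]; ring
  map_smul' r c := by funext a; simp only [Pi.smul_apply, smul_eq_mul, RingHom.id_apply]; ring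

/-- Functions on the vertices of the shadow: the points of the code, where the two passages through
a crossing count as one. -/
def vertexFunctions : Submodule (ZMod 2) (Fin D.arcs → ZMod 2) where
  carrier := {h | ∀ x, h (D.lower x) = h (D.upper x)}
  add_mem' := fun h h' x => by simp only [Pi.add_apply, h x, h' x]
  zero_mem' := fun _ => rfl
  smul_mem' := fun r h hh x => by simp only [Pi.smul_apply, hh x]

/-- The pairing of functions on the arcs with coboundaries of functions on the vertices. -/
def vertexPairing : vertexFunctions D →ₗ[ZMod 2] Dual (ZMod 2) (Fin D.arcs → ZMod 2) where
  toFun h :=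
    { toFun := fun f => ∑ a, (f a + f (D.next a)) * h.1 a
      map_add' := fun f g => by
        rw [← Finset.sum_add_distrib]
        exact Finset.sum_congr rfl fun a _ => by simp only [Pi.add_apply]; ring
      map_smul' := fun r f => by
        rw [RingHom.id_apply, smul_eq_mul, Finset.mul_sum]
        exact Finset.sum_congr rfl fun a _ => by simp only [Pi.smul_apply, smul_eq_mul]; ring }
  map_add' h h' := by
    refine LinearMap.ext fun f => ?_
    rw [LinearMap.add_apply]
    simp only [LinearMap.coe_mk, AddHom.coe_mk]
    rw [← Finset.sum_add_distrib]
    exact Finset.sum_congr rfl fun a _ => by simp only [Submodule.coe_add, Pi.add_apply]; ring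
  map_smul' r h := by
    refine LinearMap.ext fun f => ?_
    rw [LinearMap.smul_apply]
    simp only [LinearMap.coe_mk, AddHom.coe_mk, RingHom.id_apply, smul_eq_mul]
    rw [Finset.mul_sum]
    exact Finset.sum_congr rfl fun a _ => by
      simp only [Submodule.coe_smul, Pi.smul_apply, smul_eq_mul]; ring

theorem vertexPairing_apply (h : vertexFunctions D) (f : Fin D.arcs → ZMod 2) :
    vertexPairing D h f = ∑ a, (f a + f (D.next a)) * h.1 a := rfl

theorem zmod_two_add_self (a : ZMod 2) : a + a = 0 := CharTwo.add_self_eq_zero a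

theorem eq_of_add_eq_zero {a b : ZMod 2} (h : a + b = 0) : a = b := by
  rwa [CharTwo.add_eq_zero] at h

/-- The four quadrants at a crossing, each of them seen by two of the directed arcs. -/
theorem face_crossing (c : D.Face → ZMod 2) (x : Fin D.crossings) :
    (c (face D (D.upper x, true)) = c (face D (D.next (D.lower x), true)) ∧
      c (face D (D.lower x, true)) = c (face D (D.upper x, false)) ∧
      c (face D (D.next (D.upper x), false)) = c (face D (D.lower x, false)) ∧
      c (face D (D.next (D.lower x), false)) = c (face D (D.next (D.upper x), true))) ∨
    (c (face D (D.upper x, true)) = c (face D (D.lower x, false)) ∧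
      c (face D (D.lower x, true)) = c (face D (D.next (D.upper x), true)) ∧
      c (face D (D.next (D.upper x), false)) = c (face D (D.next (D.lower x), true)) ∧
      c (face D (D.next (D.lower x), false)) = c (face D (D.upper x, false))) := by
  cases h : D.pos x
  · right
    rw [face_eq (.neg_upper_fwd x h), face_eq (.neg_lower_fwd x h), face_eq (.neg_upper_bwd x h),
      face_eq (.neg_lower_bwd x h)]
    simp
  · left
    rw [face_eq (.pos_upper_fwd x h), face_eq (.pos_lower_fwd x h), face_eq (.pos_upper_bwd x h),
      face_eq (.pos_lower_bwd x h)]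
    simp

theorem face_plain (c : D.Face → ZMod 2) {a : Fin D.arcs} (h : D.IsPlain a) (b : Bool) :
    c (face D (D.next a, b)) = c (face D (a, b)) := by
  cases b
  · rw [face_eq (.plain_bwd a h)]
  · rw [face_eq (.plain_fwd a h)]

/-- The coboundary of a function on the faces sums to zero over the four arcs at a crossing. -/
theorem vertexPairing_faceDifference (h : vertexFunctions D) (c : D.Face → ZMod 2) :
    vertexPairing D h (faceDifference D c) = 0 := by
  rw [vertexPairing_apply]
  set g : Fin D.arcs → ZMod 2 :=
    fun a => (faceDifference D c a + faceDifference D c (D.next a)) * h.1 a with hg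
  have h0 : ∀ a, D.IsPlain a → g a = 0 := fun a ha => by
    simp only [hg, faceDifference, LinearMap.coe_mk, AddHom.coe_mk, face_plain D c ha]
    rw [zmod_two_add_self, zero_mul]
  rw [← Fintype.sum_of_injective (Sum.elim D.upper D.lower) D.passages_injective
    (fun s => g (Sum.elim D.upper D.lower s)) g (fun a ha => h0 a fun x =>
      ⟨fun h => ha ⟨Sum.inl x, h⟩, fun h => ha ⟨Sum.inr x, h⟩⟩) (fun _ => rfl),
    Fintype.sum_sum_type, ← Finset.sum_add_distrib]
  refine Finset.sum_eq_zero fun x _ => ?_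
  simp only [Sum.elim_inl, Sum.elim_inr, hg, h.2 x, ← add_mul, faceDifference, LinearMap.coe_mk,
    AddHom.coe_mk]
  have h2 : (2 : ZMod 2) = 0 := rfl
  rcases face_crossing D c x with ⟨h1, h2', h3, h4⟩ | ⟨h1, h2', h3, h4⟩ <;>
  · rw [h1, h2', h3, h4]
    ring_nf
    simp [h2]

theorem shadow_induction {f : Fin D.arcs → ZMod 2} (hn : ∀ a, f (D.next a) = f a)
    (hl : ∀ x, f (D.lower x) = f (D.upper x)) :
    ∃ g : D.ShadowComponent → ZMod 2, ∀ a, g (Quot.mk _ a) = f a :=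
  ⟨Quot.lift f (by
    rintro a b (rfl | ⟨x, rfl, rfl⟩)
    exacts [(hn a).symm, (hl x).symm]), fun _ => rfl⟩

/-- A function on the faces that has the same value on both sides of every arc is constant on the
components of the shadow. -/
theorem finrank_ker_faceDifference_le :
    finrank (ZMod 2) (LinearMap.ker (faceDifference D)) ≤ Nat.card D.ShadowComponent := by
  classical
  have : Fintype D.ShadowComponent := Fintype.ofFinite _
  have : Fintype D.Face := Fintype.ofFinite _
  rw [Nat.card_eq_fintype_card, ← finrank_fintype_fun_eq_card (ZMod 2)]
  refine le_trans (Submodule.finrank_mono ?_)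
    (LinearMap.finrank_range_le (LinearMap.funLeft (ZMod 2) (ZMod 2) (faceShadow D)))
  intro c hc
  have hc' : ∀ a, c (face D (a, true)) = c (face D (a, false)) := fun a =>
    eq_of_add_eq_zero (congrFun (LinearMap.mem_ker.1 hc) a)
  have hx : ∀ x, c (face D (D.next (D.upper x), true)) = c (face D (D.upper x, true)) ∧
      c (face D (D.next (D.lower x), true)) = c (face D (D.lower x, true)) ∧
      c (face D (D.lower x, true)) = c (face D (D.upper x, true)) := by
    intro x
    have := face_crossing D c x
    simp only [← hc'] at this
    grind
  obtain ⟨g, hg⟩ := shadow_induction D (f := fun a => c (face D (a, true))) (fun a => by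
    rcases (gaussCode D).plain_or a with h | ⟨x, rfl⟩ | ⟨x, rfl⟩
    exacts [face_plain D c h true, (hx x).1, (hx x).2.1]) fun x => (hx x).2.2
  refine ⟨g, funext fun F => ?_⟩
  obtain ⟨⟨a, b⟩, rfl⟩ := Quot.exists_rep F
  refine (hg a).trans ?_
  cases b
  exacts [hc' a, rfl]

/-- A function on the vertices with trivial coboundary is constant on the components of the shadow. -/
theorem finrank_ker_vertexPairing_le :
    finrank (ZMod 2) (LinearMap.ker (vertexPairing D)) ≤ Nat.card D.ShadowComponent := by
  classical
  have : Fintype D.ShadowComponent := Fintype.ofFinite _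
  rw [Nat.card_eq_fintype_card, ← finrank_fintype_fun_eq_card (ZMod 2),
    ← Submodule.finrank_map_subtype_eq]
  refine le_trans (Submodule.finrank_mono ?_) (LinearMap.finrank_range_le
    (LinearMap.funLeft (ZMod 2) (ZMod 2) fun a => (Quot.mk _ a : D.ShadowComponent)))
  rintro _ ⟨h, hh, rfl⟩
  obtain ⟨g, hg⟩ := shadow_induction D (f := h.1) (fun a => by
    have := LinearMap.congr_fun (LinearMap.mem_ker.1 hh) (Pi.single (D.next a) 1)
    rw [vertexPairing_apply, LinearMap.zero_apply] at this
    simp only [add_mul, Finset.sum_add_distrib, Pi.single_apply, D.next.injective.eq_iff, ite_mul,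
      one_mul, zero_mul, Finset.sum_ite_eq', Finset.mem_univ, if_true] at this
    exact eq_of_add_eq_zero this) h.2
  exact ⟨g, funext hg⟩

theorem le_finrank_vertexFunctions :
    D.arcs ≤ finrank (ZMod 2) (vertexFunctions D) + D.crossings := by
  let p : (Fin D.arcs → ZMod 2) →ₗ[ZMod 2] (Fin D.crossings → ZMod 2) :=
    LinearMap.funLeft (ZMod 2) (ZMod 2) D.lower - LinearMap.funLeft (ZMod 2) (ZMod 2) D.upper
  have hp : LinearMap.ker p = vertexFunctions D := by
    ext h
    rw [LinearMap.mem_ker]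
    constructor
    · exact fun h x => sub_eq_zero.1 (congrFun h x)
    · exact fun h => funext fun x => sub_eq_zero.2 (h x)
  have h1 := p.finrank_range_add_finrank_ker
  have h2 := Submodule.finrank_le (LinearMap.range p)
  rw [hp] at h1
  rw [finrank_fin_fun] at h1 h2
  omega

/-- The faces have two colors such that the two sides of every arc have different colors. -/
theorem exists_face_coloring (hD : D.IsPlanar) :
    ∃ c : D.Face → ZMod 2, ∀ a, c (face D (a, true)) + c (face D (a, false)) = 1 := by
  classical
  have : Fintype D.Face := Fintype.ofFinite _
  suffices h : (1 : Fin D.arcs → ZMod 2) ∈ LinearMap.range (faceDifference D) by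
    obtain ⟨c, hc⟩ := h
    exact ⟨c, fun a => congrFun hc a⟩
  have hle : LinearMap.range (vertexPairing D) ≤
      (LinearMap.range (faceDifference D)).dualAnnihilator := by
    rintro _ ⟨h, rfl⟩
    rw [Submodule.mem_dualAnnihilator]
    rintro _ ⟨c, rfl⟩
    exact vertexPairing_faceDifference D h c
  have heq := Submodule.eq_of_le_of_finrank_le hle (by
    have h1 := (faceDifference D).finrank_range_add_finrank_ker
    have h2 := (vertexPairing D).finrank_range_add_finrank_ker
    have h3 := Subspace.finrank_add_finrank_dualAnnihilator_eq (LinearMap.range (faceDifference D))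
    have h4 := finrank_ker_faceDifference_le D
    have h5 := finrank_ker_vertexPairing_le D
    have h6 := le_finrank_vertexFunctions D
    rw [IsPlanar, Nat.card_eq_fintype_card] at hD
    rw [finrank_fintype_fun_eq_card] at h1
    rw [finrank_fin_fun] at h3
    omega)
  rw [← Subspace.forall_mem_dualAnnihilator_apply_eq_zero_iff, ← heq]
  rintro _ ⟨h, rfl⟩
  rw [vertexPairing_apply]
  exact Finset.sum_eq_zero fun a _ => by
    rw [Pi.one_apply, Pi.one_apply, zmod_two_add_self, zero_mul]

/-- A planar diagram has a checkerboard coloring. Over the field with two elements, the coboundaries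
of functions on the faces are orthogonal to those of functions on the vertices, and by Euler's formula
they form the orthogonal complement; so the constant function `1` on the arcs is one of them. -/
theorem colorable_of_isPlanar (hD : D.IsPlanar) : (gaussCode D).Colorable := by
  obtain ⟨c, hc⟩ := exists_face_coloring D hD
  have hf : ∀ a, c (face D (a, false)) = 1 + c (face D (a, true)) := fun a => by
    rw [← hc a]
    ring_nf
    simp [show (2 : ZMod 2) = 0 from rfl]
  have hx : ∀ x, c (face D (D.next (D.upper x), true)) = 1 + c (face D (D.upper x, true)) ∧
      c (face D (D.next (D.lower x), true)) = 1 + c (face D (D.lower x, true)) ∧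
      c (face D (D.lower x, true)) = 1 + c (face D (D.upper x, true)) := by
    intro x
    have := face_crossing D c x
    simp only [hf] at this
    grind
  let σ : ZMod 2 → ℤˣ := fun t => if t = 0 then 1 else -1
  have hσ : ∀ t, σ (1 + t) = -σ t := by decide
  refine ⟨fun a => σ (c (face D (a, true))), ⟨fun a ha => ?_, fun x => ?_, fun x => ?_, fun x => ?_⟩⟩
  · exact congrArg σ (face_plain D c ha true)
  · exact (congrArg σ (hx x).1).trans (hσ _)
  · exact (congrArg σ (hx x).2.1).trans (hσ _)
  · exact (congrArg σ (hx x).2.2).trans (hσ _)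

end Planar

end LinkSplitting

namespace LinkSplitting

/-! ### Edge signs from an order of the crossings -/

/-- The usual signs on the edges of the cube, for an order of the crossings. -/
def orderSign {X : Type*} [Fintype X] (f : X → ℕ) (I : X → Bool) (x : X) : ℤˣ :=
  (-1) ^ (Finset.univ.filter fun k => f k < f x ∧ I k = true).card

theorem isEdgeSign_orderSign {X : Type*} [Fintype X] [DecidableEq X] {f : X → ℕ}
    (hf : Function.Injective f) : IsEdgeSign (orderSign f) := by
  have hprod : ∀ I x, orderSign f I x = ∏ k, if f k < f x ∧ I k = true then (-1 : ℤˣ) else 1 := by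
    intro I x
    rw [orderSign, ← Finset.prod_filter, Finset.prod_const]
  have key : ∀ I x y, orderSign f (flip I x) y =
      orderSign f I y * if f x < f y then -1 else 1 := by
    intro I x y
    rw [hprod, hprod, ← Finset.mul_prod_erase _ _ (Finset.mem_univ x),
      ← Finset.mul_prod_erase _ (fun k => if f k < f y ∧ I k = true then (-1 : ℤˣ) else 1)
        (Finset.mem_univ x), flip_self,
      Finset.prod_congr rfl fun k hk => by rw [flip_of_ne _ (Finset.ne_of_mem_erase hk)]]
    by_cases h : f x < f y <;> cases I x <;> simp [h, mul_comm]
  refine ⟨fun I x => ?_, fun I x y hxy => ?_⟩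
  · rw [key, if_neg (lt_irrefl _), mul_one]
  · rw [key, key]
    rcases lt_or_gt_of_ne (hf.ne hxy) with h | h
    · rw [if_pos h, if_neg h.le.not_gt]; simp [mul_comm]
    · rw [if_pos h, if_neg h.le.not_gt]; simp [mul_comm]

theorem exists_isEdgeSign (X : Type*) [Fintype X] [DecidableEq X] :
    ∃ e : (X → Bool) → X → ℤˣ, IsEdgeSign e :=
  ⟨_, isEdgeSign_orderSign (f := fun x => (Fintype.equivFin X x : ℕ)) fun _ _ h =>
    (Fintype.equivFin X).injective (Fin.ext h)⟩

namespace Code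

/-! ### Reidemeister moves and strictness for all weights -/

section

variable {A A' X X' R : Type*} [Finite A] [Fintype X] [DecidableEq X] [Fintype X'] [DecidableEq X']
  [CommRing R]

theorem strictFor_iff {C : Code A X} {C' : Code A X'} (h : C.Colorable) (h' : C'.Colorable)
    (hnext : C'.next = C.next) (n : ℕ)
    (key : ∀ (τ τ' : A → ℤˣ) (ω : A → R) (e : (X → Bool) → X → ℤˣ) (e' : (X' → Bool) → X' → ℤˣ),
      C.IsColoring τ → C'.IsColoring τ' → (∀ a, ω (C.next a) = ω a) → IsEdgeSign e →
      IsEdgeSign e' → (C'.Strict h' (C'.weight τ' ω) e' n ↔ C.Strict h (C.weight τ ω) e n)) :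
    C'.StrictFor R n ↔ C.StrictFor R n := by
  have hω : ∀ ω : A → R, C'.IsWeighting ω ↔ C.IsWeighting ω := fun ω =>
    ⟨fun hω => ⟨fun a => by rw [← hnext, hω.next], fun S hS => hω.unit S fun a => by rw [hnext, hS]⟩,
      fun hω => ⟨fun a => by rw [hnext, hω.next],
        fun S hS => hω.unit S fun a => by rw [← hnext, hS]⟩⟩
  obtain ⟨τ₀, hτ₀⟩ := h
  obtain ⟨τ₁, hτ₁⟩ := h'
  obtain ⟨e₀, he₀⟩ := exists_isEdgeSign X
  obtain ⟨e₁, he₁⟩ := exists_isEdgeSign X'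
  constructor
  · intro H _ τ ω e hτ hw he
    exact (key τ τ₁ ω e e₁ hτ hτ₁ hw.next he he₁).1 (H _ _ _ _ hτ₁ ((hω ω).2 hw) he₁)
  · intro H _ τ' ω e' hτ' hw he'
    exact (key τ₀ τ' ω e₀ e' hτ₀ hτ' ((hω ω).1 hw).next he₀ he').2
      (H _ _ _ _ hτ₀ ((hω ω).1 hw) he₀)

end

section

variable {A A' X X' R : Type*}

/-- The code `C'` with arcs and crossings renamed. -/
def comap (C' : Code A' X') (f : A ≃ A') (j : X ≃ X') : Code A X where
  next := f.trans (C'.next.trans f.symm)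
  upper x := f.symm (C'.upper (j x))
  lower x := f.symm (C'.lower (j x))
  pos x := C'.pos (j x)
  inj := by
    have : Sum.elim (fun x => f.symm (C'.upper (j x))) (fun x => f.symm (C'.lower (j x))) =
        f.symm ∘ Sum.elim C'.upper C'.lower ∘ Sum.map j j := by
      funext s
      rcases s with s | s <;> rfl
    rw [this]
    exact f.symm.injective.comp (C'.inj.comp (Sum.map_injective.2 ⟨j.injective, j.injective⟩))

theorem isSubdivision_comap (C' : Code A' X') (f : A ≃ A') (j : X ≃ X') :
    IsSubdivision (C'.comap f j) C' f j where
  inj := f.injective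
  upper _ := (f.apply_symm_apply _).symm
  lower _ := (f.apply_symm_apply _).symm
  pos _ := rfl
  next _ := Or.inl (f.apply_symm_apply _).symm
  cov b := Or.inl (f.surjective b)

/-- Invariance under the third Reidemeister move, at the crossings `x` (top over middle), `y` (top
over bottom) and `z` (middle over bottom). The triangle is a circle in the resolutions with the digits
`κ`, `!κ`, `κ`. -/
theorem strictFor_iff_of_triangle [Finite A] [Fintype X] [DecidableEq X] [CommRing R]
    {C C' : Code A X} (h : C.Colorable) (h' : C'.Colorable)
    {x y z : X} (hxy : x ≠ y) (hxz : x ≠ z) (hyz : y ≠ z) {t m b : A} {ε₁ ε₂ ε₃ κ : Bool}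
    (ux : C.upper x = C.stub t (!ε₁)) (uy : C.upper y = C.stub t ε₁)
    (lx : C.lower x = C.stub m (!ε₂)) (uz : C.upper z = C.stub m ε₂)
    (ly : C.lower y = C.stub b (!ε₃)) (lz : C.lower z = C.stub b ε₃)
    (hx : ε₂ = ε₁ ↔ κ = C.pos x) (hy : ε₃ = (!ε₁) ↔ (!κ) = C.pos y)
    (hz : (!ε₃) = (!ε₂) ↔ κ = C.pos z)
    (hnext : C'.next = C.next) (hpos : C'.pos = C.pos)
    (ux' : C'.upper x = C.upper y) (uy' : C'.upper y = C.upper x)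
    (lx' : C'.lower x = C.upper z) (uz' : C'.upper z = C.lower x)
    (ly' : C'.lower y = C.lower z) (lz' : C'.lower z = C.lower y)
    (hne : ∀ v, v ≠ x → v ≠ y → v ≠ z → C'.upper v = C.upper v ∧ C'.lower v = C.lower v) (n : ℕ) :
    C'.StrictFor R n ↔ C.StrictFor R n := by
  classical
  have hplain : ∀ a, C.Plain a ↔ C'.Plain a := by
    intro a
    constructor
    · intro ha v
      by_cases h1 : v = x
      · rw [h1, ux', lx']; exact ⟨(ha y).1, (ha z).1⟩
      by_cases h2 : v = y
      · rw [h2, uy', ly']; exact ⟨(ha x).1, (ha z).2⟩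
      by_cases h3 : v = z
      · rw [h3, uz', lz']; exact ⟨(ha x).2, (ha y).2⟩
      rw [(hne v h1 h2 h3).1, (hne v h1 h2 h3).2]; exact ha v
    · intro ha v
      by_cases h1 : v = x
      · rw [h1, ← uy', ← uz']; exact ⟨(ha y).1, (ha z).1⟩
      by_cases h2 : v = y
      · rw [h2, ← ux', ← lz']; exact ⟨(ha x).1, (ha z).2⟩
      by_cases h3 : v = z
      · rw [h3, ← lx', ← ly']; exact ⟨(ha x).2, (ha y).2⟩
      rw [← (hne v h1 h2 h3).1, ← (hne v h1 h2 h3).2]; exact ha v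
  have hst : C'.stub = C.stub := by
    funext a d
    rw [stub, stub, hnext]
  have it : ∀ d, C.stub (C.stub t (!d)) d = C.next t ∧ C.stub (C.stub t d) (!d) = C.next t := by
    intro d; cases d <;> simp [stub]
  have im : ∀ d, C.stub (C.stub m (!d)) d = C.next m ∧ C.stub (C.stub m d) (!d) = C.next m := by
    intro d; cases d <;> simp [stub]
  have ib : ∀ d, C.stub (C.stub b (!d)) d = C.next b ∧ C.stub (C.stub b d) (!d) = C.next b := by
    intro d; cases d <;> simp [stub]
  have cx : C.Corner x κ (C.next t) (C.next m) (C.stub (C.upper x) (!ε₁)) (C.stub (C.lower x) (!ε₂)) :=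
    ⟨_, _, ε₁, ε₂, Or.inl ⟨rfl, rfl⟩, hx, by rw [ux, (it ε₁).1], by rw [lx, (im ε₂).1], rfl, rfl⟩
  have cy : C.Corner y (!κ) (C.next t) (C.next b) (C.stub (C.upper y) ε₁) (C.stub (C.lower y) (!ε₃)) :=
    ⟨_, _, !ε₁, ε₃, Or.inl ⟨rfl, rfl⟩, hy, by rw [uy, (it ε₁).2], by rw [ly, (ib ε₃).1],
      by rw [Bool.not_not], rfl⟩
  have cz : C.Corner z κ (C.next m) (C.next b) (C.stub (C.upper z) ε₂) (C.stub (C.lower z) ε₃) :=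
    ⟨_, _, !ε₂, !ε₃, Or.inl ⟨rfl, rfl⟩, hz, by rw [uz, (im ε₂).2], by rw [lz, (ib ε₃).2],
      by rw [Bool.not_not], by rw [Bool.not_not]⟩
  have cx' : C'.Corner x κ (C.next t) (C.next m) (C.stub (C.upper y) ε₁) (C.stub (C.upper z) ε₂) :=
    ⟨C.upper y, C.upper z, !ε₁, !ε₂, Or.inl ⟨ux'.symm, lx'.symm⟩, by rw [hpos, ← hx]; simp,
      by rw [hst, uy, (it ε₁).2], by rw [hst, uz, (im ε₂).2], by rw [hst, Bool.not_not],
      by rw [hst, Bool.not_not]⟩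
  have cy' : C'.Corner y (!κ) (C.next t) (C.next b) (C.stub (C.upper x) (!ε₁))
      (C.stub (C.lower z) ε₃) :=
    ⟨C.upper x, C.lower z, ε₁, !ε₃, Or.inl ⟨uy'.symm, ly'.symm⟩, by
        rw [hpos, ← hy]; cases ε₁ <;> cases ε₃ <;> simp,
      by rw [hst, ux, (it ε₁).1], by rw [hst, lz, (ib ε₃).2], by rw [hst],
      by rw [hst, Bool.not_not]⟩
  have cz' : C'.Corner z κ (C.next m) (C.next b) (C.stub (C.lower x) (!ε₂))
      (C.stub (C.lower y) (!ε₃)) :=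
    ⟨C.lower x, C.lower y, ε₂, ε₃, Or.inl ⟨uz'.symm, lz'.symm⟩, by rw [hpos, ← hz]; simp,
      by rw [hst, lx, (im ε₂).1], by rw [hst, ly, (ib ε₃).1], by rw [hst], by rw [hst]⟩
  -- the six points on the triangle are different
  obtain ⟨n1, n2, n3, n4, n5, n6, n7, n8, n9, i12, i13, i23⟩ : t ≠ C.next t ∧ m ≠ C.next m ∧ b ≠ C.next b ∧
      t ≠ C.next m ∧ t ≠ C.next b ∧ m ≠ C.next t ∧ m ≠ C.next b ∧ b ≠ C.next t ∧ b ≠ C.next m ∧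
      C.next t ≠ C.next m ∧ C.next t ≠ C.next b ∧ C.next m ≠ C.next b := by
    have e1 := C.upper_inj.not.2 hxy
    have e2 := C.upper_inj.not.2 hxz
    have e3 := C.upper_inj.not.2 hyz
    have e4 := C.lower_inj.not.2 hxy
    have e5 := C.lower_inj.not.2 hxz
    have e6 := C.lower_inj.not.2 hyz
    have f := C.upper_ne_lower
    have f1 := f x x
    have f2 := f x y
    have f3 := f x z
    have f4 := f y x
    have f5 := f y y
    have f6 := f y z
    have f7 := f z x
    have f8 := f z y
    have f9 := f z z
    rw [ux, uy] at e1
    rw [ux, uz] at e2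
    rw [uy, uz] at e3
    rw [lx, ly] at e4
    rw [lx, lz] at e5
    rw [ly, lz] at e6
    rw [ux, lx] at f1
    rw [ux, ly] at f2
    rw [ux, lz] at f3
    rw [uy, lx] at f4
    rw [uy, ly] at f5
    rw [uy, lz] at f6
    rw [uz, lx] at f7
    rw [uz, ly] at f8
    rw [uz, lz] at f9
    clear! κ
    cases ε₁ <;> cases ε₂ <;> cases ε₃ <;>
    simp only [stub, Bool.not_true, Bool.not_false, if_true, Bool.false_eq_true, if_false]
      at e1 e2 e3 e4 e5 e6 f1 f2 f3 f4 f5 f6 f7 f8 f9 <;>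
    simp only [*, Ne.symm e1, Ne.symm e2, Ne.symm e3, Ne.symm e4, Ne.symm e5, Ne.symm e6,
      Ne.symm f1, Ne.symm f2, Ne.symm f3, Ne.symm f4, Ne.symm f5, Ne.symm f6, Ne.symm f7,
      Ne.symm f8, Ne.symm f9, ne_eq, not_false_eq_true, and_self]
  have out : ∀ p, (p = t ∨ p = m ∨ p = b) → ∀ d, C.stub (C.stub p d) d ≠ C.next t ∧
      C.stub (C.stub p d) d ≠ C.next m ∧ C.stub (C.stub p d) d ≠ C.next b := by
    intro p hp d
    cases d
    · simp only [stub, Bool.false_eq_true, if_false]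
      rcases hp with rfl | rfl | rfl
      exacts [⟨n1, n4, n5⟩, ⟨n6, n2, n7⟩, ⟨n8, n9, n3⟩]
    · simp only [stub, if_true, ne_eq, C.next.injective.eq_iff]
      rcases hp with rfl | rfl | rfl
      exacts [⟨n1.symm, n6.symm, n8.symm⟩, ⟨n4.symm, n2.symm, n9.symm⟩,
        ⟨n5.symm, n7.symm, n3.symm⟩]
  have o1 : ∀ a, (a = C.stub (C.upper x) (!ε₁) ∨ a = C.stub (C.lower x) (!ε₂) ∨
      a = C.stub (C.upper y) ε₁ ∨ a = C.stub (C.lower y) (!ε₃) ∨ a = C.stub (C.upper z) ε₂ ∨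
      a = C.stub (C.lower z) ε₃) → a ≠ C.next t ∧ a ≠ C.next m ∧ a ≠ C.next b := by
    rw [ux, uy, uz, lx, ly, lz]
    rintro a (rfl | rfl | rfl | rfl | rfl | rfl)
    exacts [out t (by simp) _, out m (by simp) _, out t (by simp) _, out b (by simp) _,
      out m (by simp) _, out b (by simp) _]
  have hpts : ∀ a, ((a = C.next t ∨ a = C.next m ∨ a = C.next b) ∨
      (C.next a = C.next t ∨ C.next a = C.next m ∨ C.next a = C.next b)) →
      a = C.upper x ∨ a = C.upper y ∨ a = C.lower x ∨ a = C.upper z ∨ a = C.lower y ∨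
        a = C.lower z := by
    intro a ha
    simp only [C.next.injective.eq_iff] at ha
    rw [ux, uy, uz, lx, ly, lz]
    have hs : ∀ p ε, (a = C.next p ∨ a = p) → a = C.stub p (!ε) ∨ a = C.stub p ε := by
      rintro p (_ | _) (h | h)
      exacts [Or.inl h, Or.inr h, Or.inr h, Or.inl h]
    rcases ha with (h | h | h) | (h | h | h)
    · rcases hs t ε₁ (Or.inl h) with h | h <;> simp [h]
    · rcases hs m ε₂ (Or.inl h) with h | h <;> simp [h]
    · rcases hs b ε₃ (Or.inl h) with h | h <;> simp [h]
    · rcases hs t ε₁ (Or.inr h) with h | h <;> simp [h]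
    · rcases hs m ε₂ (Or.inr h) with h | h <;> simp [h]
    · rcases hs b ε₃ (Or.inr h) with h | h <;> simp [h]
  have near : ∀ a, ((a = C.next t ∨ a = C.next m ∨ a = C.next b) ∨
      (C.next a = C.next t ∨ C.next a = C.next m ∨ C.next a = C.next b)) →
      ∃ v, (v = x ∨ v = y ∨ v = z) ∧ (a = C.upper v ∨ a = C.lower v) := by
    intro a ha
    rcases hpts a ha with h | h | h | h | h | h
    exacts [⟨x, by simp, Or.inl h⟩, ⟨y, by simp, Or.inl h⟩, ⟨x, by simp, Or.inr h⟩,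
      ⟨z, by simp, Or.inl h⟩, ⟨y, by simp, Or.inr h⟩, ⟨z, by simp, Or.inr h⟩]
  have near' : ∀ a, ((a = C.next t ∨ a = C.next m ∨ a = C.next b) ∨
      (C.next a = C.next t ∨ C.next a = C.next m ∨ C.next a = C.next b)) →
      ∃ v, (v = x ∨ v = y ∨ v = z) ∧ (a = C'.upper v ∨ a = C'.lower v) := by
    intro a ha
    rcases hpts a ha with h | h | h | h | h | h
    exacts [⟨y, by simp, Or.inl (h.trans uy'.symm)⟩, ⟨x, by simp, Or.inl (h.trans ux'.symm)⟩,
      ⟨z, by simp, Or.inl (h.trans uz'.symm)⟩, ⟨x, by simp, Or.inr (h.trans lx'.symm)⟩,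
      ⟨z, by simp, Or.inr (h.trans lz'.symm)⟩, ⟨y, by simp, Or.inr (h.trans ly'.symm)⟩]
  have hsame : ∀ v, ¬ (v = x ∨ v = y ∨ v = z) →
      C'.upper v = C.upper v ∧ C'.lower v = C.lower v ∧ C'.pos v = C.pos v := fun v hv => by
    push Not at hv
    have := hne v hv.1 hv.2.1 hv.2.2
    exact ⟨this.1, this.2, by rw [hpos]⟩
  refine strictFor_iff h h' hnext n fun τ τ' ω e e' hτ hτ' hω he he' => ?_
  have hflip : ∀ (p : A) (ε : Bool), ¬ C.Plain p → τ (C.stub p (!ε)) = -τ (C.stub p ε) := by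
    intro p ε hp
    have := hτ.next_eq hp
    cases ε <;> simp [stub, this]
  have hωs : ∀ (p : A) (ε : Bool), ω (C.stub p (!ε)) = ω (C.stub p ε) := by
    intro p ε
    cases ε <;> simp [stub, hω]
  have hnp : ∀ {a : A}, (a = t ∨ a = m ∨ a = b) → ¬ C.Plain a := fun {a} ha hp => by
    obtain ⟨v, -, rfl | rfl⟩ := near a (by simp only [C.next.injective.eq_iff]; exact Or.inr ha)
    exacts [(hp v).1 rfl, (hp v).2 rfl]
  have t1 : τ (C.upper x) = -τ (C.upper y) := by rw [ux, uy]; exact hflip t ε₁ (hnp (by simp))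
  have t2 : τ (C.lower x) = -τ (C.upper z) := by rw [lx, uz]; exact hflip m ε₂ (hnp (by simp))
  have t3 : τ (C.lower y) = -τ (C.lower z) := by rw [ly, lz]; exact hflip b ε₃ (hnp (by simp))
  have w1 : ω (C.upper x) = ω (C.upper y) := by rw [ux, uy, hωs]
  have w2 : ω (C.lower x) = ω (C.upper z) := by rw [lx, uz, hωs]
  have w3 : ω (C.lower y) = ω (C.lower z) := by rw [ly, lz, hωs]
  have hτC' : C'.IsColoring τ := by
    have hall : ∀ v, τ (C'.next (C'.upper v)) = -τ (C'.upper v) ∧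
        τ (C'.next (C'.lower v)) = -τ (C'.lower v) := by
      intro v
      rw [hnext]
      refine ⟨hτ.next_eq fun hp => ?_, hτ.next_eq fun hp => ?_⟩
      exacts [((hplain _).1 hp v).1 rfl, ((hplain _).1 hp v).2 rfl]
    refine ⟨fun a ha => by rw [hnext, hτ.plain a ((hplain a).2 ha)], fun v => (hall v).1,
      fun v => (hall v).2, fun v => ?_⟩
    have s1 := hτ.lower_eq x
    have s2 := hτ.lower_eq y
    have s3 := hτ.lower_eq z
    by_cases h1 : v = x
    · rw [h1, ux', lx', ← neg_inj, ← t2, s1, t1]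
    by_cases h2 : v = y
    · rw [h2, uy', ly', ← neg_inj, ← t3, s2, t1, neg_neg]
    by_cases h3 : v = z
    · rw [h3, uz', lz', t3, s3, t2]
    rw [(hne v h1 h2 h3).1, (hne v h1 h2 h3).2, hτ.lower_eq]
  have hsum : C.weight τ ω x + C.weight τ ω y + C.weight τ ω z = 0 := by
    have s1 := hτ.lower_eq x
    have s2 := hτ.lower_eq y
    have s3 := hτ.lower_eq z
    have q : τ (C.upper z) = -τ (C.upper y) := by rw [← neg_inj, ← t2, s1, t1]
    simp only [weight, s1, s2, s3, q, t1, w1, w2, w3]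
    push_cast
    ring
  have hneg : ∀ v, v = x ∨ v = y ∨ v = z → C'.weight τ ω v = -C.weight τ ω v := by
    rintro v (rfl | rfl | rfl)
    · rw [weight, weight, ux', lx', t1, t2, w1, w2]; push_cast; ring
    · rw [weight, weight, uy', ly', t1, t3, w1, w3]; push_cast; ring
    · rw [weight, weight, uz', lz', t2, t3, w2, w3]; push_cast; ring
  rw [strict_iff_of_coloring hτ' hτC' ω h' e' n]
  cases κ
  · have T : C.IsTriangleAt y x z false (C.next t) (C.next b) (C.next m) (C.stub (C.upper y) ε₁)
        (C.stub (C.lower y) (!ε₃)) (C.stub (C.upper x) (!ε₁)) (C.stub (C.lower x) (!ε₂))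
        (C.stub (C.lower z) ε₃) (C.stub (C.upper z) ε₂) :=
      ⟨hxy.symm, hyz, hxz, cy, cx, cz.symm, i13, i12, i23.symm,
        fun a ha => by clear * - ha o1; have := o1 a (by tauto); tauto, fun a ha => by
          obtain ⟨v, hv, h⟩ := near a (by clear * - ha; tauto)
          exact ⟨v, by clear * - hv; tauto, h⟩⟩
    have T' : C'.IsTriangleAt y x z false (C.next t) (C.next b) (C.next m)
        (C.stub (C.upper x) (!ε₁)) (C.stub (C.lower z) ε₃) (C.stub (C.upper y) ε₁)
        (C.stub (C.upper z) ε₂) (C.stub (C.lower y) (!ε₃)) (C.stub (C.lower x) (!ε₂)) :=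
      ⟨hxy.symm, hyz, hxz, cy', cx', cz'.symm, i13, i12, i23.symm,
        fun a ha => by clear * - ha o1; have := o1 a (by tauto); tauto, fun a ha => by
          rw [hnext] at ha
          obtain ⟨v, hv, h⟩ := near' a (by clear * - ha; tauto)
          exact ⟨v, by clear * - hv; tauto, h⟩⟩
    exact T.strict_iff T' hnext hplain (fun v hv => hsame v (by clear * - hv; tauto)) h h' hτ hτC' hω
      (by rw [← hsum]; ring) (fun v hv => hneg v (by clear * - hv; tauto)) he he' n
  · have T : C.IsTriangleAt x y z true (C.next t) (C.next m) (C.next b)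
        (C.stub (C.upper x) (!ε₁)) (C.stub (C.lower x) (!ε₂)) (C.stub (C.upper y) ε₁)
        (C.stub (C.lower y) (!ε₃)) (C.stub (C.upper z) ε₂) (C.stub (C.lower z) ε₃) :=
      ⟨hxy, hxz, hyz, cx, cy, cz, i12, i13, i23, o1, near⟩
    have T' : C'.IsTriangleAt x y z true (C.next t) (C.next m) (C.next b)
        (C.stub (C.upper y) ε₁) (C.stub (C.upper z) ε₂) (C.stub (C.upper x) (!ε₁))
        (C.stub (C.lower z) ε₃) (C.stub (C.lower x) (!ε₂)) (C.stub (C.lower y) (!ε₃)) :=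
      ⟨hxy, hxz, hyz, cx', cy', cz', i12, i13, i23,
        fun a ha => o1 a (by clear * - ha; tauto), fun a ha => near' a (by rwa [hnext] at ha)⟩
    exact T.strict_iff T' hnext hplain hsame h h' hτ hτC' hω hsum hneg he he' n

end

end Code

end LinkSplitting

namespace LinkSplitting

open GaussDiagram

/-! ### Invariance under the moves between planar diagrams -/

section

variable {D D' : GaussDiagram} {R : Type*} [CommRing R]

theorem isExtension_of_extension {ι : Type} (f : Extension ι D D') :
    Code.IsExtension (gaussCode D) ((gaussCode D').comap f.arc f.cr) where
  next := Equiv.ext fun a => f.arc.symm_apply_eq.2 (f.next_arc a)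
  upper x := f.arc.symm_apply_eq.2 (f.upper_cr x)
  lower x := f.arc.symm_apply_eq.2 (f.lower_cr x)
  pos := f.pos_cr

theorem colorable_comap {A X : Type*} (h' : (gaussCode D').Colorable) (f : A ≃ Fin D'.arcs)
    (j : X ≃ Fin D'.crossings) : ((gaussCode D').comap f j).Colorable :=
  h'.elim fun _ hτ => ⟨_, ((gaussCode D').isSubdivision_comap f j).isColoring hτ⟩

theorem strictFor_iff_of_relabel (h : (gaussCode D).Colorable) (h' : (gaussCode D').Colorable)
    (hm : Relabel D D') (n : ℕ) : (gaussCode D').StrictFor R n ↔ (gaussCode D).StrictFor R n := by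
  obtain ⟨f⟩ := hm
  have S : Code.IsSubdivision (gaussCode D) (gaussCode D') f.arc
      ((Equiv.sumEmpty _ _).symm.trans f.cr) :=
    ⟨f.arc.injective, f.upper_cr, f.lower_cr, f.pos_cr, fun a => Or.inl (f.next_arc a),
      fun b => Or.inl (f.arc.surjective b)⟩
  exact S.strictFor_iff h h' n

theorem strictFor_iff_of_subdivision (h : (gaussCode D).Colorable) (h' : (gaussCode D').Colorable)
    (hm : Subdivision D D') (n : ℕ) :
    (gaussCode D').StrictFor R n ↔ (gaussCode D).StrictFor R n := by
  obtain ⟨arc, cr, a, hn, hx⟩ := hm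
  have hnone : D'.next (arc none) = arc (some a) := by rw [hn]; simp
  have S : Code.IsSubdivision (gaussCode D) (gaussCode D') (fun b => arc (some b)) cr := by
    refine ⟨fun b c h => Option.some_injective _ (arc.injective h), fun x => (hx x).1,
      fun x => (hx x).2.1, fun x => (hx x).2.2, fun b => ?_, fun b => ?_⟩
    · by_cases hb : D.next b = a
      · right
        have h1 : D'.next (arc (some b)) = arc none := by rw [hn, Option.map_some, hb]; simp
        refine ⟨fun c hc => ?_, ?_⟩
        · have := arc.injective (hc.trans h1)
          exact Option.some_ne_none _ this
        · change D'.next (D'.next (arc (some b))) = arc (some (D.next b))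
          rw [h1, hnone, hb]
      · left
        change D'.next (arc (some b)) = arc (some (D.next b))
        rw [hn, Option.map_some, Equiv.swap_apply_of_ne_of_ne (Option.some_ne_none _)
          (fun h => hb (Option.some_injective _ h))]
    · obtain ⟨_ | b, rfl⟩ := arc.surjective b
      exacts [Or.inr ⟨a, hnone.symm⟩, Or.inl ⟨b, rfl⟩]
  exact S.strictFor_iff h h' n

theorem strictFor_iff_of_R1 (h : (gaussCode D).Colorable) (h' : (gaussCode D').Colorable)
    (hm : R1 D D') (n : ℕ) : (gaussCode D').StrictFor R n ↔ (gaussCode D).StrictFor R n := by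
  obtain ⟨f, p, hp⟩ := hm
  have h₁ := colorable_comap h' f.arc f.cr
  rw [((gaussCode D').isSubdivision_comap f.arc f.cr).strictFor_iff h₁ h' n]
  have E := isExtension_of_extension f
  refine Code.strictFor_iff h h₁ E.next n fun τ τ' ω e e' hτ hτ' hω he he' =>
    E.strict_iff_of_kink (p := p) ?_ h h₁ hτ hτ' hω he he' n
  rcases hp with hp | hp
  · exact Or.inl ⟨f.arc.symm_apply_eq.2 hp.1, f.arc.symm_apply_eq.2 hp.2⟩
  · exact Or.inr ⟨f.arc.symm_apply_eq.2 hp.1, f.arc.symm_apply_eq.2 hp.2⟩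

theorem strictFor_iff_of_R2 (h : (gaussCode D).Colorable) (h' : (gaussCode D').Colorable)
    (hm : R2 D D') (n : ℕ) : (gaussCode D').StrictFor R n ↔ (gaussCode D).StrictFor R n := by
  obtain ⟨f, p, q, hpos, hux, huy, hl⟩ := hm
  have h₁ := colorable_comap h' f.arc f.cr
  rw [((gaussCode D').isSubdivision_comap f.arc f.cr).strictFor_iff h₁ h' n]
  have E := isExtension_of_extension f
  set C' := (gaussCode D').comap f.arc f.cr with hC'
  set C := gaussCode D with hC
  have ux : C'.upper (Sum.inr false) = p := f.arc.symm_apply_eq.2 hux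
  have uy : C'.upper (Sum.inr true) = C.next p := f.arc.symm_apply_eq.2 huy
  have pos : C'.pos (Sum.inr false) ≠ C'.pos (Sum.inr true) := hpos
  have hl' : (C'.lower (Sum.inr false) = q ∧ C'.lower (Sum.inr true) = C.next q) ∨
      (C'.lower (Sum.inr true) = q ∧ C'.lower (Sum.inr false) = C.next q) := by
    rcases hl with hl | hl
    · exact Or.inl ⟨f.arc.symm_apply_eq.2 hl.1, f.arc.symm_apply_eq.2 hl.2⟩
    · exact Or.inr ⟨f.arc.symm_apply_eq.2 hl.1, f.arc.symm_apply_eq.2 hl.2⟩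
  have n1 : p ≠ C.next p := by
    rw [← ux, ← uy.trans (congrArg C.next ux.symm)]
    exact C'.upper_inj.not.2 (by simp)
  have n2 : q ≠ C.next q := by
    have := C'.lower_inj.not.2 (show (Sum.inr false : Fin D.crossings ⊕ Bool) ≠ Sum.inr true by simp)
    rcases hl' with ⟨h1, h2⟩ | ⟨h1, h2⟩ <;> rw [h1, h2] at this
    exacts [this, Ne.symm this]
  have hul : ∀ i j, C'.upper (Sum.inr i) ≠ C'.lower (Sum.inr j) := fun i j =>
    C'.upper_ne_lower _ _
  have n3 : p ≠ C.next q ∧ C.next p ≠ q ∧ p ≠ q := by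
    have h1 := hul false false
    have h2 := hul false true
    have h3 := hul true false
    have h4 := hul true true
    rcases hl' with ⟨h5, h6⟩ | ⟨h5, h6⟩ <;> simp only [ux, uy, h5, h6] at h1 h2 h3 h4
    exacts [⟨h2, h3, h1⟩, ⟨h1, h4, h2⟩]
  have hN : ∀ a, (a = C.next p ∨ a = C.next q) ∨ (a = p ∨ a = q) ↔
      ∃ i, a = C'.upper (Sum.inr i) ∨ a = C'.lower (Sum.inr i) := by
    intro a
    rw [Bool.exists_bool, ux, uy]
    rcases hl' with ⟨h5, h6⟩ | ⟨h5, h6⟩ <;> rw [h5, h6] <;> tauto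
  have key : ∃ (κ : Bool) (o o' : Fin D.arcs),
      C'.Corner (Sum.inr false) κ (C.next p) (C.next q) p o ∧
      C'.Corner (Sum.inr true) (!κ) (C.next p) (C.next q) (C.next (C.next p)) o' ∧
      ((o = q ∧ o' = C.next (C.next q)) ∨ (o' = q ∧ o = C.next (C.next q))) := by
    rcases hl' with ⟨h5, h6⟩ | ⟨h5, h6⟩
    · refine ⟨C'.pos (Sum.inr false), _, _,
        ⟨p, q, true, true, Or.inl ⟨ux.symm, h5.symm⟩, by simp, ?_, ?_, rfl, rfl⟩,
        ⟨C.next p, C.next q, false, false, Or.inl ⟨uy.symm, h6.symm⟩, ?_, rfl, rfl, ?_, rfl⟩,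
        Or.inl ⟨rfl, ?_⟩⟩
      · simp [Code.stub, E.next]
      · simp [Code.stub, E.next]
      · revert pos
        cases C'.pos (Sum.inr false) <;> cases C'.pos (Sum.inr true) <;> simp
      · simp [Code.stub, E.next]
      · simp [Code.stub, E.next]
    · refine ⟨!C'.pos (Sum.inr false), _, _,
        ⟨p, C.next q, true, false, Or.inl ⟨ux.symm, h6.symm⟩, by simp, ?_, rfl, rfl, rfl⟩,
        ⟨C.next p, q, false, true, Or.inl ⟨uy.symm, h5.symm⟩, ?_, rfl, ?_, ?_, rfl⟩,
        Or.inr ⟨rfl, ?_⟩⟩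
      · simp [Code.stub, E.next]
      · revert pos
        cases C'.pos (Sum.inr false) <;> cases C'.pos (Sum.inr true) <;> simp
      · simp [Code.stub, E.next]
      · simp [Code.stub, E.next]
      · simp [Code.stub, E.next]
  obtain ⟨κ, o, o', hx, hy, ho⟩ := key
  exact Code.strictFor_iff h h₁ E.next n fun τ τ' ω e e' hτ hτ' hω he he' =>
    E.strict_iff_of_bigon hN n1 n3.1 n3.2.1.symm n2 n3.2.2 hx hy ho h h₁ hτ hτ' hω he he' n

/-- A step along the boundary of a region, from the arc `next t` between `t` and `next t` to the arc
`next m`: if only the crossing `x` has its upper strand at one of the points `t`, `next t` and its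
lower strand at `m` or `next m`, then the arcs are joined in the 0-resolution of `x`. -/
theorem faceStep_upper_lower {t m : Fin D.arcs} {x : Fin D.crossings} {ε ε' i j : Bool}
    (hu : D.upper x = (gaussCode D).stub t (!ε)) (hl : D.lower x = (gaussCode D).stub m (!ε'))
    (ht : t ≠ D.next t) (hm : m ≠ D.next m) (hpt : ¬ D.IsPlain t ∧ ¬ D.IsPlain (D.next t))
    (hT : ∀ v, (D.upper v = t ∨ D.upper v = D.next t) →
      (D.lower v = m ∨ D.lower v = D.next m) → v = x)
    (hT' : ∀ v, (D.lower v = t ∨ D.lower v = D.next t) →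
      ¬ (D.upper v = m ∨ D.upper v = D.next m))
    (h : D.FaceStep (D.next t, i) (D.next m, j)) : ε' = ε ↔ false = D.pos x := by
  have hinj : ∀ a b, D.next a = D.next b → a = b := fun _ _ h => D.next.injective h
  have hu' : D.upper x = if ε then t else D.next t := by rw [hu]; cases ε <;> rfl
  have hl' : D.lower x = if ε' then m else D.next m := by rw [hl]; cases ε' <;> rfl
  clear hu hl
  generalize he : (D.next t, i) = e at h
  generalize hf : (D.next m, j) = f at h
  cases h <;> simp only [Prod.mk.injEq] at he hf <;> grind

/-- As `faceStep_upper_lower`, for a step in the other direction: the arcs are joined in the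
1-resolution. -/
theorem faceStep_lower_upper {t m : Fin D.arcs} {x : Fin D.crossings} {ε ε' i j : Bool}
    (hu : D.upper x = (gaussCode D).stub t (!ε)) (hl : D.lower x = (gaussCode D).stub m (!ε'))
    (ht : t ≠ D.next t) (hm : m ≠ D.next m) (hpm : ¬ D.IsPlain m ∧ ¬ D.IsPlain (D.next m))
    (hT : ∀ v, (D.upper v = t ∨ D.upper v = D.next t) →
      (D.lower v = m ∨ D.lower v = D.next m) → v = x)
    (hT' : ∀ v, (D.lower v = t ∨ D.lower v = D.next t) →
      ¬ (D.upper v = m ∨ D.upper v = D.next m))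
    (h : D.FaceStep (D.next m, j) (D.next t, i)) : ε' = ε ↔ true = D.pos x := by
  have hinj : ∀ a b, D.next a = D.next b → a = b := fun _ _ h => D.next.injective h
  have hu' : D.upper x = if ε then t else D.next t := by rw [hu]; cases ε <;> rfl
  have hl' : D.lower x = if ε' then m else D.next m := by rw [hl]; cases ε' <;> rfl
  clear hu hl
  generalize he : (D.next t, i) = e at h
  generalize hf : (D.next m, j) = f at h
  cases h <;> simp only [Prod.mk.injEq] at he hf <;> grind

end

end LinkSplitting

namespace LinkSplitting

open GaussDiagram

section

variable {D D' : GaussDiagram} {R : Type*} [CommRing R]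

theorem exists_stub_eq {p a b : Fin D.arcs} (h : ({p, D.next p} : Set (Fin D.arcs)) = {a, b}) :
    ∃ ε : Bool, a = (gaussCode D).stub p (!ε) ∧ b = (gaussCode D).stub p ε := by
  rcases Set.pair_eq_pair_iff.1 h with ⟨h1, h2⟩ | ⟨h1, h2⟩
  exacts [⟨true, h1.symm, h2.symm⟩, ⟨false, h2.symm, h1.symm⟩]

theorem swap_eq_of_pair_eq {p a b : Fin D.arcs}
    (h : ({p, D.next p} : Set (Fin D.arcs)) = {a, b}) :
    Equiv.swap p (D.next p) = Equiv.swap a b := by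
  rcases Set.pair_eq_pair_iff.1 h with ⟨h1, h2⟩ | ⟨h1, h2⟩
  · rw [h2, h1]
  · rw [h2, h1, Equiv.swap_comm]

theorem mem_pair_iff {p a b : Fin D.arcs} (h : ({p, D.next p} : Set (Fin D.arcs)) = {a, b})
    (c : Fin D.arcs) : c = p ∨ c = D.next p ↔ c = a ∨ c = b := by
  simpa using Set.ext_iff.1 h c

theorem ne_of_pair_eq {p a b : Fin D.arcs} (h : ({p, D.next p} : Set (Fin D.arcs)) = {a, b})
    (hab : a ≠ b) : p ≠ D.next p := by
  rcases Set.pair_eq_pair_iff.1 h with ⟨h1, h2⟩ | ⟨h1, h2⟩ <;> rw [h2, h1]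
  exacts [hab, hab.symm]

theorem swap_three_apply {A X : Type*} [DecidableEq A] (C : Code A X) {x y z : X} (hxy : x ≠ y)
    (hxz : x ≠ z) (hyz : y ≠ z) {σ : Equiv.Perm A}
    (hσ : σ = Equiv.swap (C.upper x) (C.upper y) * Equiv.swap (C.lower x) (C.upper z) *
      Equiv.swap (C.lower y) (C.lower z)) :
    (σ (C.upper x) = C.upper y ∧ σ (C.upper y) = C.upper x ∧ σ (C.lower x) = C.upper z ∧
      σ (C.upper z) = C.lower x ∧ σ (C.lower y) = C.lower z ∧ σ (C.lower z) = C.lower y) ∧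
    ∀ v, v ≠ x → v ≠ y → v ≠ z → σ (C.upper v) = C.upper v ∧ σ (C.lower v) = C.lower v := by
  have ul := C.upper_ne_lower
  have lu : ∀ v w, C.lower v ≠ C.upper w := fun v w => (ul w v).symm
  refine ⟨⟨?_, ?_, ?_, ?_, ?_, ?_⟩, fun v h1 h2 h3 => ⟨?_, ?_⟩⟩ <;>
  simp_all [Equiv.swap_apply_def, C.upper_inj, C.lower_inj, hxy.symm, hxz.symm, hyz.symm]

theorem strictFor_iff_of_R3 (h : (gaussCode D).Colorable) (h' : (gaussCode D').Colorable)
    (hm : R3 D D') (n : ℕ) : (gaussCode D').StrictFor R n ↔ (gaussCode D).StrictFor R n := by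
  obtain ⟨arc, cr, x, y, z, t, m, b, hxy, hxz, hyz, ht, hm, hb, hT, hn, hv⟩ := hm
  have h₁ := colorable_comap h' arc cr
  rw [((gaussCode D').isSubdivision_comap arc cr).strictFor_iff h₁ h' n]
  have uu : ∀ v w, D.upper v = D.upper w ↔ v = w := fun _ _ => (gaussCode D).upper_inj
  have ll : ∀ v w, D.lower v = D.lower w ↔ v = w := fun _ _ => (gaussCode D).lower_inj
  have ul : ∀ v w, D.upper v ≠ D.lower w := (gaussCode D).upper_ne_lower
  have lu : ∀ v w, D.lower v ≠ D.upper w := fun v w => (ul w v).symm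
  have mt := mem_pair_iff ht
  have mm := mem_pair_iff hm
  have mb := mem_pair_iff hb
  have tt := ne_of_pair_eq ht ((uu _ _).not.2 hxy)
  have mn := ne_of_pair_eq hm (lu _ _)
  have bn := ne_of_pair_eq hb ((ll _ _).not.2 hyz)
  have pt : ¬ D.IsPlain t ∧ ¬ D.IsPlain (D.next t) := by
    have h1 := (mt t).1 (Or.inl rfl)
    have h2 := (mt (D.next t)).1 (Or.inr rfl)
    constructor
    · intro hp; rcases h1 with h1 | h1 <;> exact (hp _).1 h1.symm
    · intro hp; rcases h2 with h1 | h1 <;> exact (hp _).1 h1.symm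
  have pm : ¬ D.IsPlain m ∧ ¬ D.IsPlain (D.next m) := by
    have h1 := (mm m).1 (Or.inl rfl)
    have h2 := (mm (D.next m)).1 (Or.inr rfl)
    constructor
    · intro hp; exact h1.elim (fun h1 => (hp _).2 h1.symm) fun h1 => (hp _).1 h1.symm
    · intro hp; exact h2.elim (fun h1 => (hp _).2 h1.symm) fun h1 => (hp _).1 h1.symm
  have pb : ¬ D.IsPlain b ∧ ¬ D.IsPlain (D.next b) := by
    have h1 := (mb b).1 (Or.inl rfl)
    have h2 := (mb (D.next b)).1 (Or.inr rfl)
    constructor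
    · intro hp; rcases h1 with h1 | h1 <;> exact (hp _).2 h1.symm
    · intro hp; rcases h2 with h1 | h1 <;> exact (hp _).2 h1.symm
  rw [swap_eq_of_pair_eq ht, swap_eq_of_pair_eq hm, swap_eq_of_pair_eq hb] at hv
  -- each of the crossings is the only one between two of the strands
  have cx : ∀ v, (D.upper v = t ∨ D.upper v = D.next t) →
      (D.lower v = m ∨ D.lower v = D.next m) → v = x := fun v => by
    rw [mt, mm]; simp only [uu, ll, lu]; tauto
  have cx' : ∀ v, (D.lower v = t ∨ D.lower v = D.next t) →
      ¬ (D.upper v = m ∨ D.upper v = D.next m) := fun v => by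
    rw [mt, mm]; simp only [lu]; tauto
  have cy : ∀ v, (D.upper v = t ∨ D.upper v = D.next t) →
      (D.lower v = b ∨ D.lower v = D.next b) → v = y := fun v => by
    rw [mt, mb]; simp only [uu, ll]; grind
  have cy' : ∀ v, (D.lower v = t ∨ D.lower v = D.next t) →
      ¬ (D.upper v = b ∨ D.upper v = D.next b) := fun v => by
    rw [mt, mb]; simp only [lu]; tauto
  have cz : ∀ v, (D.upper v = m ∨ D.upper v = D.next m) →
      (D.lower v = b ∨ D.lower v = D.next b) → v = z := fun v => by
    rw [mm, mb]; simp only [uu, ul]; tauto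
  have cz' : ∀ v, (D.lower v = m ∨ D.lower v = D.next m) →
      ¬ (D.upper v = b ∨ D.upper v = D.next b) := fun v => by
    rw [mm, mb]; simp only [ul]; tauto
  obtain ⟨ε₁, ux, uy⟩ := exists_stub_eq ht
  obtain ⟨ε₂, lx, uz⟩ := exists_stub_eq hm
  obtain ⟨ε₃, ly, lz⟩ := exists_stub_eq hb
  have uy₁ : D.upper y = (gaussCode D).stub t (!!ε₁) := by rw [Bool.not_not]; exact uy
  have uz₁ : D.upper z = (gaussCode D).stub m (!!ε₂) := by rw [Bool.not_not]; exact uz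
  have lz₁ : D.lower z = (gaussCode D).stub b (!!ε₃) := by rw [Bool.not_not]; exact lz
  obtain ⟨κ, hx, hy, hz⟩ : ∃ κ, (ε₂ = ε₁ ↔ κ = D.pos x) ∧ (ε₃ = (!ε₁) ↔ (!κ) = D.pos y) ∧
      ((!ε₃) = (!ε₂) ↔ κ = D.pos z) := by
    obtain ⟨i, j, k, ⟨s1, s2, s3⟩ | ⟨s1, s2, s3⟩⟩ := hT
    · exact ⟨false, faceStep_upper_lower ux lx tt mn pt cx cx' s1,
        faceStep_lower_upper uy₁ ly tt bn pb cy cy' s3,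
        faceStep_upper_lower uz₁ lz₁ mn bn pm cz cz' s2⟩
    · exact ⟨true, faceStep_lower_upper ux lx tt mn pm cx cx' s3,
        faceStep_upper_lower uy₁ ly tt bn pt cy cy' s1,
        faceStep_lower_upper uz₁ lz₁ mn bn pb cz cz' s2⟩
  have hu' : ∀ v, ((gaussCode D').comap arc cr).upper v =
      (Equiv.swap (D.upper x) (D.upper y) * Equiv.swap (D.lower x) (D.upper z) *
        Equiv.swap (D.lower y) (D.lower z)) (D.upper v) := fun v =>
    arc.symm_apply_eq.2 (hv v).1
  have hl' : ∀ v, ((gaussCode D').comap arc cr).lower v =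
      (Equiv.swap (D.upper x) (D.upper y) * Equiv.swap (D.lower x) (D.upper z) *
        Equiv.swap (D.lower y) (D.lower z)) (D.lower v) := fun v =>
    arc.symm_apply_eq.2 (hv v).2.1
  have hnext : ((gaussCode D').comap arc cr).next = (gaussCode D).next :=
    Equiv.ext fun a => arc.symm_apply_eq.2 (hn a)
  have hpos : ((gaussCode D').comap arc cr).pos = (gaussCode D).pos :=
    funext fun v => (hv v).2.2
  obtain ⟨⟨e1, e2, e3, e4, e5, e6⟩, e7⟩ := swap_three_apply (gaussCode D) hxy hxz hyz rfl
  exact Code.strictFor_iff_of_triangle h h₁ hxy hxz hyz ux uy lx uz ly lz hx hy hz hnext hpos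
    ((hu' x).trans e1) ((hu' y).trans e2) ((hl' x).trans e3) ((hu' z).trans e4)
    ((hl' y).trans e5) ((hl' z).trans e6) (fun v h1 h2 h3 =>
      ⟨(hu' v).trans (e7 v h1 h2 h3).1, (hl' v).trans (e7 v h1 h2 h3).2⟩) n

/-- Strictness for all weights does not depend on the planar diagram of the link. -/
theorem strictFor_iff_of_move (hD : D.IsPlanar) (hD' : D'.IsPlanar) (hm : Move D D') (n : ℕ) :
    (gaussCode D').StrictFor R n ↔ (gaussCode D).StrictFor R n := by
  have h := colorable_of_isPlanar D hD
  have h' := colorable_of_isPlanar D' hD'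
  rcases hm with hm | hm | hm | hm | hm
  · exact strictFor_iff_of_relabel h h' hm n
  · exact strictFor_iff_of_subdivision h h' hm n
  · exact strictFor_iff_of_R1 h h' hm n
  · exact strictFor_iff_of_R2 h h' hm n
  · exact strictFor_iff_of_R3 h h' hm n

/-- Strictness for all weights is an invariant of the link. -/
theorem strictFor_iff_of_link_eq {D D' : LinkDiagram} (h : D.link = D'.link) (n : ℕ) :
    (gaussCode D.toGaussDiagram).StrictFor R n ↔ (gaussCode D'.toGaussDiagram).StrictFor R n := by
  have := congrArg (Quot.lift (fun E : LinkDiagram => (gaussCode E.toGaussDiagram).StrictFor R n)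
    fun E E' hm => (propext (strictFor_iff_of_move E.planar E'.planar hm n)).symm) h
  exact iff_of_eq this

end

end LinkSplitting

namespace LinkSplitting

open GaussDiagram

/-! ### Sign assignments and colorings -/

/-- A sign assignment is the restriction of a checkerboard coloring to the upper strands. -/
theorem exists_coloring_of_isSignAssignment {D : GaussDiagram} {s : Fin D.crossings → ℤˣ}
    (hs : D.IsSignAssignment s) :
    ∃ τ, (gaussCode D).IsColoring τ ∧ ∀ x, τ (D.upper x) = s x := by
  classical
  let σ : Fin D.arcs → ℤˣ :=
    Function.extend (Sum.elim D.upper D.lower) (Sum.elim s fun x => -s x) 1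
  have σu : ∀ x, σ (D.upper x) = s x := fun x =>
    D.passages_injective.extend_apply (Sum.elim s fun x => -s x) 1 (Sum.inl x)
  have σl : ∀ x, σ (D.lower x) = -s x := fun x =>
    D.passages_injective.extend_apply (Sum.elim s fun x => -s x) 1 (Sum.inr x)
  -- the sign of an arc is read off at the first crossing ahead
  let τ : Fin D.arcs → ℤˣ := fun a =>
    if h : ∃ k : ℕ, ¬ D.IsPlain ((D.next ^ k) a) then σ ((D.next ^ Nat.find h) a) else 1
  have τ0 : ∀ a, ¬ D.IsPlain a → τ a = σ a := by
    intro a ha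
    have h : ∃ k : ℕ, ¬ D.IsPlain ((D.next ^ k) a) := ⟨0, ha⟩
    have h0 : Nat.find h = 0 := by rw [Nat.find_eq_zero]; exact ha
    simp only [τ, dif_pos h, h0, pow_zero, Equiv.Perm.one_apply]
  have shift : ∀ (a : Fin D.arcs) (k : ℕ), (D.next ^ k) (D.next a) = (D.next ^ (k + 1)) a :=
    fun a k => by rw [pow_succ, Equiv.Perm.mul_apply]
  have τp : ∀ a, D.IsPlain a → τ (D.next a) = τ a := by
    intro a ha
    by_cases h : ∃ k : ℕ, ¬ D.IsPlain ((D.next ^ k) a)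
    · have h' : ∃ k : ℕ, ¬ D.IsPlain ((D.next ^ k) (D.next a)) := by
        obtain ⟨_ | k, hk⟩ := h
        · exact absurd ha hk
        · exact ⟨k, by rwa [shift]⟩
      have h0 : Nat.find h = Nat.find h' + 1 := by
        rw [Nat.find_eq_iff]
        refine ⟨by rw [← shift]; exact Nat.find_spec h', fun n hn => ?_⟩
        rcases n with _ | n
        · rw [not_not]; exact ha
        · rw [← shift]; exact Nat.find_min h' (Nat.lt_of_succ_lt_succ hn)
      simp only [τ, dif_pos h, dif_pos h', h0, shift]
    · have h' : ¬ ∃ k : ℕ, ¬ D.IsPlain ((D.next ^ k) (D.next a)) := by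
        rintro ⟨k, hk⟩
        exact h ⟨k + 1, by rwa [← shift]⟩
      simp only [τ, dif_neg h, dif_neg h']
  have edge : ∀ a, ¬ D.IsPlain a → ∃ b, D.IsEdge a b ∧ ¬ D.IsPlain b ∧ τ (D.next a) = σ b := by
    intro a ha
    have h : ∃ k : ℕ, ¬ D.IsPlain ((D.next ^ k) (D.next a)) := by
      refine ⟨orderOf D.next - 1, ?_⟩
      rw [shift, Nat.sub_add_cancel (orderOf_pos D.next), pow_orderOf_eq_one]
      exact ha
    refine ⟨(D.next ^ Nat.find h) (D.next a), ⟨Nat.find h, (shift _ _).symm, fun j hj => ?_⟩,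
      Nat.find_spec h, by simp only [τ, dif_pos h]⟩
    rw [← shift]
    exact not_not.1 (Nat.find_min h hj)
  have pu : ∀ x, ¬ D.IsPlain (D.upper x) := fun x h => (h x).1 rfl
  have pl : ∀ x, ¬ D.IsPlain (D.lower x) := fun x h => (h x).2 rfl
  have sq : ∀ {a b : ℤˣ}, a * b = -1 → b = -a := by decide
  have sq' : ∀ {a b : ℤˣ}, a * b = 1 → b = a := by decide
  refine ⟨τ, ⟨τp, fun x => ?_, fun x => ?_, fun x => ?_⟩, fun x => by rw [τ0 _ (pu x), σu]⟩
  · change τ (D.next (D.upper x)) = -τ (D.upper x)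
    rw [τ0 _ (pu x), σu]
    obtain ⟨b, hb, hb', h⟩ := edge _ (pu x)
    rw [h]
    rcases (gaussCode D).plain_or b with h' | ⟨y, rfl⟩ | ⟨y, rfl⟩
    · exact absurd h' hb'
    · exact (σu y).trans (sq ((hs x y).1 hb))
    · exact (σl y).trans (congrArg _ (sq' ((hs x y).2.2.1 hb)))
  · change τ (D.next (D.lower x)) = -τ (D.lower x)
    rw [τ0 _ (pl x), σl, neg_neg]
    obtain ⟨b, hb, hb', h⟩ := edge _ (pl x)
    rw [h]
    rcases (gaussCode D).plain_or b with h' | ⟨y, rfl⟩ | ⟨y, rfl⟩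
    · exact absurd h' hb'
    · exact (σu y).trans (sq' ((hs x y).2.2.2 hb))
    · exact (σl y).trans (by rw [sq ((hs x y).2.1 hb), neg_neg])
  · change τ (D.lower x) = -τ (D.upper x)
    rw [τ0 _ (pl x), τ0 _ (pu x), σu, σl]

/-! ### The complex of a diagram and the complex of its cube -/

section

variable {D : GaussDiagram}

theorem circle_eq_iff {I : Fin D.crossings → Bool} {a b : Fin D.arcs} :
    D.circle I a = D.circle I b ↔ (gaussCode D).rel I a b := by
  constructor
  · intro h
    have hr := Code.respects_circ (C := gaussCode D) I
    have key : ∀ a b, D.Joined I a b → (gaussCode D).circ I a = (gaussCode D).circ I b := by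
      intro a b h
      cases h with
      | plain _ h => exact hr.plain h
      | oriented_upper x h => exact ((hr.at x).2 h).1
      | oriented_lower x h => exact ((hr.at x).2 h).2
      | unoriented_in x h => exact ((hr.at x).1 h).1
      | unoriented_out x h => exact ((hr.at x).1 h).2
    exact Code.circ_eq_iff.1 (congrArg (Quot.lift ((gaussCode D).circ I) key) h)
  · intro h
    refine Code.Respects.eq_of_rel (f := D.circle I) (Code.respects_of_at (C := gaussCode D) (I := I)
      (fun a ha => Quot.sound (.plain a ha)) fun x => ⟨fun hx => ?_, fun hx => ?_⟩) h
    · exact ⟨Quot.sound (.unoriented_in x hx), Quot.sound (.unoriented_out x hx)⟩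
    · exact ⟨Quot.sound (.oriented_upper x hx), Quot.sound (.oriented_lower x hx)⟩

/-- The monomials of the cube are those of the diagram. -/
def genEquiv (h : (gaussCode D).Colorable) : ((gaussCode D).cube h).Gen ≃ D.Generator where
  toFun γ := ⟨γ.res, Quot.lift γ.label fun a b hab =>
    γ.compat a b (circle_eq_iff.1 (Quot.sound hab))⟩
  invFun δ := ⟨δ.1, δ.label, fun a b hab => congrArg δ.2 (circle_eq_iff.2 hab)⟩
  left_inv γ := rfl
  right_inv δ := by
    refine Sigma.ext rfl (heq_of_eq (funext fun c => ?_))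
    obtain ⟨a, rfl⟩ := Quot.exists_rep c
    rfl

variable {R : Type*} [CommRing R]

open Classical in
/-- The matrix entries of a saddle are `0` or `1`, and `1` exactly for the pairs of monomials described
by `ResCube.Saddle`. -/
theorem saddleCoeff_eq (h : (gaussCode D).Colorable) (x : Fin D.crossings)
    (γ γ' : ((gaussCode D).cube h).Gen) :
    saddleCoeff R D x (genEquiv h γ) (genEquiv h γ') =
      if ((gaussCode D).cube h).Saddle γ.res x γ.label γ'.label then 1 else 0 := by
  let r := (gaussCode D).rel γ.res
  have hS : ((gaussCode D).cube h).Saddle γ.res x γ.label γ'.label ↔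
      (∀ a, ¬ r a (D.upper x) → ¬ r a (D.next (D.upper x)) → γ.label a = γ'.label a) ∧
        (¬ r (D.upper x) (D.next (D.upper x)) →
          (γ.label (D.upper x) && γ.label (D.next (D.upper x))) = false ∧
          γ'.label (D.upper x) = (γ.label (D.upper x) || γ.label (D.next (D.upper x)))) ∧
        (r (D.upper x) (D.next (D.upper x)) →
          (γ'.label (D.upper x) || γ'.label (D.next (D.upper x))) = true ∧
          γ.label (D.upper x) = (γ'.label (D.upper x) && γ'.label (D.next (D.upper x)))) :=
    Iff.rfl
  have hc : ∀ a b, D.circle γ.res a = D.circle γ.res b ↔ r a b := fun a b => circle_eq_iff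
  trans if ∀ a, D.circle γ.res a ≠ D.circle γ.res (D.upper x) →
        D.circle γ.res a ≠ D.circle γ.res (D.next (D.upper x)) → γ.label a = γ'.label a then
      if D.circle γ.res (D.upper x) ≠ D.circle γ.res (D.next (D.upper x)) then
        mulCoeff R (γ.label (D.upper x)) (γ.label (D.next (D.upper x))) (γ'.label (D.upper x))
      else comulCoeff R (γ.label (D.upper x)) (γ'.label (D.upper x))
        (γ'.label (D.next (D.upper x)))
    else 0
  · rfl
  simp only [ne_eq, hc, hS]
  by_cases h1 : ∀ a, ¬ r a (D.upper x) → ¬ r a (D.next (D.upper x)) → γ.label a = γ'.label a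
  · have h1' := eq_true h1
    by_cases h2 : r (D.upper x) (D.next (D.upper x))
    · simp only [h1', h2, not_true_eq_false, if_false, if_true, true_and, IsEmpty.forall_iff,
        forall_const]
      cases γ.label (D.upper x) <;> cases γ'.label (D.upper x) <;>
        cases γ'.label (D.next (D.upper x)) <;> simp [comulCoeff]
    · simp only [h1', h2, not_false_eq_true, if_true, true_and, IsEmpty.forall_iff,
        forall_const, and_true]
      cases γ.label (D.upper x) <;> cases γ.label (D.next (D.upper x)) <;>
        cases γ'.label (D.upper x) <;> simp [mulCoeff]
  · rw [if_neg h1, if_neg fun h => h1 h.1]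

/-- The differential of the diagram is that of its cube, with the coefficients `Code.weight` of the
reversed saddles. -/
theorem diffCoeff_eq (h : (gaussCode D).Colorable) (w : D.Component → R)
    {s : Fin D.crossings → ℤˣ} {τ : Fin D.arcs → ℤˣ} (hτ : (gaussCode D).IsColoring τ)
    (hs : ∀ x, τ (D.upper x) = s x) (γ γ' : ((gaussCode D).cube h).Gen) :
    D.diffCoeff w s (genEquiv h γ) (genEquiv h γ') =
      ((gaussCode D).cube h).mat ((gaussCode D).weight τ fun a => w (D.comp a))
        (orderSign fun k => (k : ℕ)) γ' γ := by
  classical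
  rw [diffCoeff, ← Finset.sum_add_distrib, ResCube.mat_apply]
  refine Finset.sum_congr rfl fun x _ => ?_
  simp only [saddleCoeff_eq]
  have hres : ∀ γ, (genEquiv h γ).1 = γ.res := fun _ => rfl
  have he : ∀ I, D.edgeSign I x = orderSign (fun k : Fin D.crossings => (k : ℕ)) I x :=
    fun I => rfl
  have hu : (gaussCode D).weight τ (fun a => w (D.comp a)) x =
      ((s x : ℤ) : R) * (w (D.comp (D.upper x)) - w (D.comp (D.lower x))) := by
    have h1 : τ (D.lower x) = -s x := (hτ.lower_eq x).trans (congrArg _ (hs x))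
    rw [Code.weight]
    change ((τ (D.upper x) : ℤ) : R) * _ + ((τ (D.lower x) : ℤ) : R) * _ = _
    rw [hs, h1]
    push_cast
    change _ * w (D.comp (D.upper x)) + _ * w (D.comp (D.lower x)) = _
    ring
  simp only [hres, he]
  by_cases hx : γ'.res = flip γ.res x
  · have hself : γ'.res x = !γ.res x := by rw [hx, flip_self]
    have hsym : orderSign (fun k : Fin D.crossings => (k : ℕ)) γ'.res x =
        orderSign (fun k : Fin D.crossings => (k : ℕ)) γ.res x := by
      rw [hx, (isEdgeSign_orderSign Fin.val_injective).symm]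
    cases hg : γ.res x
    · have h1 : γ'.res = Function.update γ.res x true := by
        rw [hx, flip, hg]; rfl
      rw [if_pos (show false = false ∧ γ'.res = Function.update γ.res x true from ⟨rfl, h1⟩),
        if_neg (show ¬ (false = true ∧ γ'.res = Function.update γ.res x false) by simp), add_zero,
        ResCube.cf, hself, hg]
      by_cases hsd : ((gaussCode D).cube h).Saddle γ.res x γ.label γ'.label <;> simp [hsd, hx]
    · have h1 : γ'.res = Function.update γ.res x false := by
        rw [hx, flip, hg]; rfl
      rw [if_neg (show ¬ (true = false ∧ γ'.res = Function.update γ.res x true) by simp),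
        if_pos (show true = true ∧ γ'.res = Function.update γ.res x false from ⟨rfl, h1⟩),
        zero_add, ResCube.cf, hself, hg, hu, hsym]
      by_cases hsd : ((gaussCode D).cube h).Saddle γ.res x γ.label γ'.label
      · simp only [hsd, hx, if_true, and_self, Bool.not_true, Bool.false_eq_true, if_false]
        push_cast
        ring
      · simp [hsd, hx]
  · rw [if_neg, if_neg, if_neg, add_zero]
    · exact fun h => hx h.1
    · rintro ⟨h1, h2⟩
      exact hx (by rw [h2, flip, h1]; rfl)
    · rintro ⟨h1, h2⟩
      exact hx (by rw [h2, flip, h1]; rfl)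

theorem sum_sgn_eq {B : Type*} [Finite B] (l : B → Bool) :
    ∑ᶠ c, ResCube.sgn (l c) = (Nat.card B : ℤ) - 2 * (Nat.card {c // l c = true} : ℤ) := by
  classical
  have := Fintype.ofFinite B
  have h1 : ∀ c, ResCube.sgn (l c) = 1 - 2 * if l c = true then 1 else 0 := fun c => by
    cases l c <;> simp [ResCube.sgn]
  rw [finsum_eq_sum_of_fintype, Finset.sum_congr rfl fun c _ => h1 c, Finset.sum_sub_distrib,
    ← Finset.mul_sum, Finset.sum_boole, Nat.card_eq_fintype_card, Nat.card_eq_fintype_card,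
    Fintype.card_subtype]
  simp

/-- The quantum grading is the level, up to a constant. -/
theorem qGrading_eq (h : (gaussCode D).Colorable) (γ : ((gaussCode D).cube h).Gen) :
    D.qGrading (genEquiv h γ) = ((gaussCode D).cube h).level 1 γ + (D.numPos - 2 * D.numNeg) := by
  let C := (gaussCode D).cube h
  have hwt : C.wt 1 γ = ∑ᶠ c : D.Circle γ.res, ResCube.sgn ((genEquiv h γ).2 c) := by
    let f : Quotient (C.setoid γ.res) → D.Circle γ.res :=
      Quotient.lift (D.circle γ.res) fun a b hab => circle_eq_iff.2 hab
    have hf : Function.Bijective f := by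
      constructor
      · intro c c'
        refine Quotient.inductionOn₂ c c' fun a b h => ?_
        exact Quotient.sound (circle_eq_iff.1 h)
      · intro c
        obtain ⟨a, rfl⟩ := Quot.exists_rep c
        exact ⟨Quotient.mk _ a, rfl⟩
    rw [ResCube.wt, classSum]
    refine finsum_eq_of_bijective f hf fun c => ?_
    rw [Pi.one_apply, one_mul]
    conv_rhs => rw [← Quotient.out_eq c]
    rfl
  have hones : ResCube.ones (fun x => (1 : Fin D.arcs → ℤ) (C.o x)) γ.res =
      ((Finset.univ.filter fun x => γ.res x = true).card : ℤ) := by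
    simp [ResCube.ones]
  rw [ResCube.level]
  change _ = ResCube.ones (fun x => (1 : Fin D.arcs → ℤ) (C.o x)) γ.res + C.wt 1 γ + _
  have hsgn := sum_sgn_eq fun c : D.Circle γ.res => (genEquiv h γ).2 c
  rw [hwt, hones]
  refine Eq.trans ?_ (congrArg (fun z : ℤ => _ + z + _) hsgn.symm)
  rw [qGrading, homGrading, intGrading]
  have key : ∀ a b c e f : ℤ,
      a - f - (2 * b - c - (e - f)) = a + (c - 2 * b) + (e - 2 * f) := by
    intros; ring
  exact key _ _ _ _ _

theorem strictUpTo_diff_iff (h : (gaussCode D).Colorable) (w : D.Component → R)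
    {s : Fin D.crossings → ℤˣ} {τ : Fin D.arcs → ℤˣ} (hτ : (gaussCode D).IsColoring τ)
    (hs : ∀ x, τ (D.upper x) = s x) (n : ℕ) :
    (gaussCode D).Strict h ((gaussCode D).weight τ fun a => w (D.comp a))
      (orderSign fun k => (k : ℕ)) n ↔
      StrictUpTo (D.diff w s) (levelFiltration R D.qGrading) n :=
  strictUpTo_iff_of_equiv (genEquiv h) 1 (fun γ γ' => by
    rw [Matrix.of_apply, diffCoeff_eq h w hτ hs]; simp) _ (qGrading_eq h) n

theorem diff_comp_diff (h : (gaussCode D).Colorable) (w : D.Component → R)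
    {s : Fin D.crossings → ℤˣ} {τ : Fin D.arcs → ℤˣ} (hτ : (gaussCode D).IsColoring τ)
    (hs : ∀ x, τ (D.upper x) = s x) : D.diff w s ∘ₗ D.diff w s = 0 := by
  classical
  have hM : (Matrix.of fun γ' γ => D.diffCoeff w s γ γ') =
      (((gaussCode D).cube h).mat ((gaussCode D).weight τ fun a => w (D.comp a))
        (orderSign fun k => (k : ℕ))).submatrix (genEquiv h).symm (genEquiv h).symm := by
    ext γ' γ
    rw [Matrix.submatrix_apply, Matrix.of_apply, ← diffCoeff_eq h w hτ hs,
      Equiv.apply_symm_apply, Equiv.apply_symm_apply]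
  have hω : ∀ a, w (D.comp (D.next a)) = w (D.comp a) := fun a =>
    congrArg w (Eq.symm (Quot.sound rfl))
  rw [diff, ← Matrix.mulVecLin_mul, hM, Matrix.submatrix_mul_equiv,
    ResCube.mat_mul_mat _ (isEdgeSign_orderSign Fin.val_injective) (hτ.flat hω h)]
  ext
  simp

/-! ### The bound on the last unstable page -/

/-- Strictness up to `n` bounds the last unstable page by `n`. -/
theorem lastUnstablePage_le {w : D.Component → R} {s : Fin D.crossings → ℤˣ} {n : ℕ}
    (hn : StrictUpTo (D.diff w s) (levelFiltration R D.qGrading) n) :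
    D.lastUnstablePage w s ≤ n := by
  refine iSup₂_le fun k hk => ?_
  by_contra hlt
  rw [not_le, Nat.cast_lt] at hlt
  refine hk.2 (collapsesOnPage_of_strictUpTo _ _ _ (Nat.card D.Component)
    (levelFiltration_mono D.qGrading) (fun p => ?_) n k hlt hn)
  ext v
  refine forall_congr' fun γ => ?_
  rw [lt_sub_iff_add_lt]

/-- Components are described without quotients: by the sets of arcs that are invariant under `next`. -/
theorem comp_eq_iff {a b : Fin D.arcs} : D.comp a = D.comp b ↔
    ∀ S : Fin D.arcs → Prop, (∀ a, S (D.next a) = S a) → S a = S b := by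
  constructor
  · intro h S hS
    exact congrArg (Quot.lift S (by rintro a b rfl; exact (hS a).symm)) h
  · intro h
    have := h (fun c => D.comp a = D.comp c) fun c => by
      rw [show D.comp (D.next c) = D.comp c from Eq.symm (Quot.sound rfl)]
    rw [← this]

theorem isWeighting_comp {w : D.Component → R} (hw : ∀ c d, c ≠ d → IsUnit (w c - w d)) :
    (gaussCode D).IsWeighting fun a => w (D.comp a) where
  next a := congrArg w (Eq.symm (Quot.sound rfl))
  unit S hS a b ha hb := hw _ _ fun h => hb (by rwa [← comp_eq_iff.1 h S hS])

/-- In a diagram without crossings between different components, the deformation is trivial. -/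
theorem strictFor_zero (hD : ∀ x, ¬ D.IsMixed x) : (gaussCode D).StrictFor R 0 := by
  intro h τ ω e hτ hω he
  refine Code.strict_zero h (fun x => ?_) e
  have h1 : ω (D.upper x) = ω (D.lower x) := by
    have := comp_eq_iff.1 (not_not.1 (hD x)) (fun a => ω (D.upper x) = ω a) fun a => by
      rw [show ω (D.next a) = ω a from hω.next a]
    rw [← this]
  rw [Code.weight, hτ.lower_eq]
  change _ * ω (D.upper x) + _ * ω (D.lower x) = 0
  rw [h1]
  push_cast
  ring

/-- Changing a crossing between different components costs at most one page. -/
theorem strictFor_of_change (S : Finset (Fin D.crossings)) (hS : ∀ x ∈ S, D.IsMixed x)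
    (hs : (gaussCode (D.change S)).StrictFor R 0) : (gaussCode D).StrictFor R S.card := by
  intro h τ ω e hτ hω he
  let C' : Code (Fin D.arcs) (Fin D.crossings) := gaussCode (D.change S)
  have hch : Code.IsChange (gaussCode D) C' S :=
    ⟨rfl, fun x hx => D.change_mem S hx, fun x hx => D.change_notMem S hx⟩
  have hτ' := hch.isColoring hτ
  have h' : C'.Colorable := ⟨τ, hτ'⟩
  have hω' : C'.IsWeighting ω := ⟨hω.next, hω.unit⟩
  have := hs h' τ ω e hτ' hω' he
  change C'.Strict h' (C'.weight τ ω) e 0 at this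
  rw [hch.weight_eq] at this
  rw [← zero_add S.card]
  refine hch.strict h h' (fun x hx => ?_) he he this
  have h1 : (gaussCode D).weight τ ω x =
      ((τ (D.upper x) : ℤ) : R) * (ω (D.upper x) - ω (D.lower x)) := by
    have h2 : τ (D.lower x) = -τ (D.upper x) := hτ.lower_eq x
    rw [Code.weight]
    change ((τ (D.upper x) : ℤ) : R) * ω (D.upper x) + ((τ (D.lower x) : ℤ) : R) * ω (D.lower x) = _
    rw [h2]
    push_cast
    ring
  rw [h1]
  refine IsUnit.mul ((Units.isUnit (τ (D.upper x))).map (Int.castRingHom R)) ?_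
  refine hω.unit (fun c => D.comp (D.upper x) = D.comp c) (fun a => ?_) _ _ rfl (hS x hx)
  rw [show D.comp ((gaussCode D).next a) = D.comp a from Eq.symm (Quot.sound rfl)]

end

end LinkSplitting

theorem theorem2 {R : Type*} [CommRing R] (L : Link) (D : LinkDiagram) (hD : D.link = L)
    (w : D.Component → R) (hw : ∀ c d : D.Component, c ≠ d → IsUnit (w c - w d))
    (s : Fin D.crossings → ℤˣ) (hs : D.IsSignAssignment s) :
    D.diff w s ∘ₗ D.diff w s = 0 ∧
      D.lastUnstablePage w s ≠ ⊤ ∧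
      D.lastUnstablePage w s ≤ L.splittingNumber := by
  have h := LinkSplitting.colorable_of_isPlanar D.toGaussDiagram D.planar
  obtain ⟨τ, hτ, hτs⟩ := LinkSplitting.exists_coloring_of_isSignAssignment hs
  refine ⟨LinkSplitting.diff_comp_diff h w hτ hτs, ?_, le_sInf ?_⟩
  · obtain ⟨n, hn⟩ := LinkSplitting.exists_strictUpTo D.qGrading (D.diff w s)
    exact ne_top_of_le_ne_top (ENat.natCast_ne_top n) (LinkSplitting.lastUnstablePage_le hn)
  · rintro _ ⟨D₂, hD₂, S, hS, ⟨D₃, hD₃, hmix⟩, rfl⟩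
    have h1 := (LinkSplitting.strictFor_iff_of_link_eq hD₃ 0).1
      (LinkSplitting.strictFor_zero (R := R) hmix)
    have h2 := (LinkSplitting.strictFor_iff_of_link_eq (hD₂.trans hD.symm) S.card).1
      (LinkSplitting.strictFor_of_change S hS h1)
    exact LinkSplitting.lastUnstablePage_le ((LinkSplitting.strictUpTo_diff_iff h w hτ hτs _).1
      (h2 h τ _ _ hτ (LinkSplitting.isWeighting_comp hw)
        (LinkSplitting.isEdgeSign_orderSign Fin.val_injective)))
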